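/- **Task graphs and chunkings.** A *task graph* is a finite simple directed acyclic graph $G=(V,E)$, $V=\{0,\dots,|V|-1\}$, with edge costs $c(e)\ge 0$, a start $s$ and an end $t$ reachable from $s$. A *chunking* $C$ divides every edge $e=(u,v)$ into an ordered list of $l_e\ge 1$ pieces with costs $x_1,\dots,x_{l_e}\ge 0$, $\sum_i x_i=c(e)$. The edge is *chunked* if $l_e\ge 2$; it then uses $l_e$ chunks, and an edge with $l_e=1$ is unchanged and uses none. In the *chunked graph* each chunked edge $(u,v)$ is replaced by a path $u=u_1,u_2,\dots,u_{l_e},v$ whose edges have costs $x_1,\dots,x_{l_e}$, and each of $u_2,\dots,u_{l_e}$ also keeps the edges $(u,w)$ of $G$ with $w\ne v$, at cost $c(u,w)$ and leading to $w$. **Agents.** Let $c(y\to t)$ be the shortest-path cost from $y$ to $t$ in the chunked graph. An agent with bias $b>1$ at a vertex $x$ of the chunked graph follows an edge $(x,y)$ that minimizes the perceived cost $b\,c(x,y)+c(y\to t)$. If several edges are tied and exactly one of them is a chunk of a chunked edge, the agent follows that one; otherwise it follows the tied edge that leads (directly, or as a chunk of an edge with that endpoint) to the first vertex in the ordering of $V$.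 The agent *takes* an $s$–$t$ path $P$ of $G$ if, in the chunked graph, it walks from $s$ to $t$ along exactly the pieces of the edges of $P$, in order. **Optimality.** Let $1<b_1<b_2$ and let $k\ge 2$ be a global budget. Consider all triples $(C,P,Q)$ where $C$ is a chunking of $G$ that uses at most $k$ chunks in total and under which the agent with bias $b_1$ takes $P$ and the agent with bias $b_2$ takes $Q$. A chunking $C$ is *optimal* if it belongs to such a triple whose total cost $c(P)+c(Q)$ is minimal among all such triples. **Theorem.** There are a constant $A$ and a program for a real random access machine (unit-cost exact $+,-,\times,\div$ and comparison of real numbers; unit-cost addition, truncated subtraction and comparison of natural numbers; unit-cost indirectly addressed arrays, initially zero outside the input) such that, for every task graph $G=(V,E)$, all $1<b_1<b_2$ and every $k\ge 2$, the program, given $G$ as a list of edges with costs together with $s,t,b_1,b_2,k$, halts with an optimal chunking of $G$ in its memory after at most $$A\left(|E|^2k^3\log k+|V|\right)$$ steps. -/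

import Mathlib

namespace PresentBias

/-! ### Task graphs -/

/-- A task graph with vertices `Fin n` and edges `Fin m`: a finite simple directed acyclic graph
with nonnegative edge costs, a start `source` and an end `sink` that can be reached from it. -/
structure TaskGraph (n m : ℕ) where
  tail : Fin m → Fin n
  head : Fin m → Fin n
  cost : Fin m → ℝ
  source : Fin n
  sink : Fin n
  simple : ∀ e f, tail e = tail f → head e = head f → e = f
  cost_nonneg : ∀ e, 0 ≤ cost e
  acyclic : ∀ v, ¬ Relation.TransGen (fun u w => ∃ e, tail e = u ∧ head e = w) v v
  reachable : Relation.ReflTransGen (fun u w => ∃ e, tail e = u ∧ head e = w) source sink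

/-- For each edge, the costs of the pieces into which it is divided, in order.
An edge with exactly one piece is left as it is; with two or more pieces it is chunked. -/
abbrev Chunking (m : ℕ) := Fin m → List ℝ

/-- The vertices of a chunked graph: the vertices of the task graph, and for a chunked edge `e`
the vertex `mid e i` reached after completing the first `i` of its chunks. -/
inductive Node (n m : ℕ) where
  | task (v : Fin n)
  | mid (e : Fin m) (i : ℕ)

namespace TaskGraph

variable {n m : ℕ} (G : TaskGraph n m) (C : Chunking m)

/-- The pieces of every edge have nonnegative costs that sum to the cost of the edge. -/
def IsChunking : Prop :=
  ∀ e, C e ≠ [] ∧ (∀ x ∈ C e, 0 ≤ x) ∧ (C e).sum = G.cost e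

/-- The vertex of the chunked graph at which the first `i` pieces of `e` are done. -/
def node (e : Fin m) (i : ℕ) : Node n m :=
  if i = 0 then .task (G.tail e)
  else if i < (C e).length then .mid e i
  else .task (G.head e)

/-- The arcs of the chunked graph. `G.Arc C x e w y` is an arc from `x` to `y` of cost `w`;
`e` is the edge of the task graph that it belongs to. Every piece of an edge is an arc, and each
vertex inside a chunked edge `e` keeps the edges that the tail of `e` has, other than `e`,
to vertices of the task graph. -/
inductive Arc : Node n m → Fin m → ℝ → Node n m → Prop
  | piece (e : Fin m) (i : ℕ) (h : i < (C e).length) :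
      Arc (G.node C e i) e (C e)[i] (G.node C e (i + 1))
  | leave (e : Fin m) (i : ℕ) (h0 : 0 < i) (h : i < (C e).length)
      (f : Fin m) (hne : f ≠ e) (ht : G.tail f = G.tail e) :
      Arc (.mid e i) f (G.cost f) (.task (G.head f))

/-- `G.RouteCost C x d`: there is a walk of total cost `d` from `x` to the sink. -/
inductive RouteCost : Node n m → ℝ → Prop
  | nil : RouteCost (.task G.sink) 0
  | cons {x y : Node n m} {e : Fin m} {w d : ℝ} (h : G.Arc C x e w y) (hd : RouteCost y d) :
      RouteCost x (w + d)

/-- The cost of the shortest path from `x` to the sink in the chunked graph (`⊤` if none). -/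
noncomputable def dist (x : Node n m) : EReal :=
  sInf {r : EReal | ∃ d : ℝ, G.RouteCost C x d ∧ r = (d : EReal)}

/-- The cost that an agent with bias `b` perceives in starting with an arc of cost `w` to `y`. -/
noncomputable def perceived (b w : ℝ) (y : Node n m) : EReal :=
  ((b * w : ℝ) : EReal) + G.dist C y

/-- Some arc out of `x` that belongs to `e` has minimal perceived cost among all arcs out of `x`. -/
def Best (b : ℝ) (x : Node n m) (e : Fin m) : Prop :=
  ∃ w y, G.Arc C x e w y ∧
    ∀ f w' y', G.Arc C x f w' y' → G.perceived C b w y ≤ G.perceived C b w' y'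

/-- The arc out of `x` that belongs to `e` is a chunk of a chunked edge. -/
def IsChunkArc (x : Node n m) (e : Fin m) : Prop :=
  2 ≤ (C e).length ∧ ∃ i < (C e).length, x = G.node C e i

/-- At `x` the agent with bias `b` continues along the arc of `e`: it has minimal perceived cost,
and a tie is broken in favor of a chunk if exactly one of the tied arcs is a chunk, and otherwise
in favor of the arc towards the first vertex in the ordering of the vertices. -/
def Chooses (b : ℝ) (x : Node n m) (e : Fin m) : Prop :=
  G.Best C b x e ∧
    (((∃! f, G.Best C b x f ∧ G.IsChunkArc C x f) ∧ G.IsChunkArc C x e) ∨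
      ((¬ ∃! f, G.Best C b x f ∧ G.IsChunkArc C x f) ∧
        ∀ f, G.Best C b x f → G.head e ≤ G.head f))

/-- `P` is the list of edges of a path from `u` to the sink in the task graph. -/
def IsPath : Fin n → List (Fin m) → Prop
  | u, [] => u = G.sink
  | u, e :: P => G.tail e = u ∧ IsPath (G.head e) P

def pathCost (P : List (Fin m)) : ℝ := (P.map G.cost).sum

/-- The agent with bias `b` takes the path `P` from the source to the sink: in the chunked graph
it starts each edge of `P` and completes all its pieces. -/
def Takes (b : ℝ) (P : List (Fin m)) : Prop :=
  G.IsPath G.source P ∧ ∀ e ∈ P, ∀ i < (C e).length, G.Chooses C b (G.node C e i) e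

/-- The total number of chunks; an edge that is left in one piece uses none. -/
def chunksUsed (C : Chunking m) : ℕ :=
  ∑ e, if (C e).length = 1 then 0 else (C e).length

/-- `C` is a chunking with at most `k` chunks altogether, under which the agent with bias `b₁`
takes `P` and the agent with bias `b₂` takes `Q`. -/
def Achieves (b₁ b₂ : ℝ) (k : ℕ) (P Q : List (Fin m)) : Prop :=
  G.IsChunking C ∧ chunksUsed C ≤ k ∧ G.Takes C b₁ P ∧ G.Takes C b₂ Q

/-- `C` minimizes the sum of the costs of the paths that the two agents take,
under a global budget of `k` chunks. -/
def IsOptimal (b₁ b₂ : ℝ) (k : ℕ) : Prop :=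
  ∃ P Q, G.Achieves C b₁ b₂ k P Q ∧
    ∀ (C' : Chunking m) (P' Q' : List (Fin m)), G.Achieves C' b₁ b₂ k P' Q' →
      G.pathCost P + G.pathCost Q ≤ G.pathCost P' + G.pathCost Q'

end TaskGraph

/-! ### Programs for a real random access machine -/

/-- Memory: registers and arrays, holding natural numbers and real numbers. -/
structure Mem where
  nreg : ℕ → ℕ
  rreg : ℕ → ℝ
  narr : ℕ → ℕ → ℕ
  rarr : ℕ → ℕ → ℝ

/-- Natural number expressions. -/
inductive NExp where
  | lit (c : ℕ)
  | reg (r : ℕ)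
  | get (a : ℕ) (i : NExp)
  | add (x y : NExp)
  | sub (x y : NExp)

/-- Real number expressions: exact arithmetic on registers and array entries. -/
inductive RExp where
  | lit (c : ℕ)
  | reg (r : ℕ)
  | get (a : ℕ) (i : NExp)
  | add (x y : RExp)
  | sub (x y : RExp)
  | mul (x y : RExp)
  | div (x y : RExp)

/-- Tests. -/
inductive BExp where
  | nle (x y : NExp)
  | rle (x y : RExp)
  | neg (p : BExp)
  | conj (p q : BExp)

def NExp.eval (σ : Mem) : NExp → ℕ
  | .lit c => c
  | .reg r => σ.nreg r
  | .get a i => σ.narr a (i.eval σ)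
  | .add x y => x.eval σ + y.eval σ
  | .sub x y => x.eval σ - y.eval σ

noncomputable def RExp.eval (σ : Mem) : RExp → ℝ
  | .lit c => (c : ℝ)
  | .reg r => σ.rreg r
  | .get a i => σ.rarr a (i.eval σ)
  | .add x y => x.eval σ + y.eval σ
  | .sub x y => x.eval σ - y.eval σ
  | .mul x y => x.eval σ * y.eval σ
  | .div x y => x.eval σ / y.eval σ

def BExp.eval (σ : Mem) : BExp → Prop
  | .nle x y => x.eval σ ≤ y.eval σ
  | .rle x y => x.eval σ ≤ y.eval σ
  | .neg p => ¬ p.eval σ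
  | .conj p q => p.eval σ ∧ q.eval σ

/-- Number of elementary operations needed to evaluate an expression. -/
def NExp.size : NExp → ℕ
  | .lit _ => 1
  | .reg _ => 1
  | .get _ i => i.size + 1
  | .add x y => x.size + y.size + 1
  | .sub x y => x.size + y.size + 1

def RExp.size : RExp → ℕ
  | .lit _ => 1
  | .reg _ => 1
  | .get _ i => i.size + 1
  | .add x y => x.size + y.size + 1
  | .sub x y => x.size + y.size + 1
  | .mul x y => x.size + y.size + 1
  | .div x y => x.size + y.size + 1

def BExp.size : BExp → ℕ
  | .nle x y => x.size + y.size + 1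
  | .rle x y => x.size + y.size + 1
  | .neg p => p.size + 1
  | .conj p q => p.size + q.size + 1

/-- Programs: assignments to registers and array entries, sequencing, branching, loops.
Names of registers and arrays are fixed in the program; array indices are computed. -/
inductive Cmd where
  | nset (r : ℕ) (x : NExp)
  | rset (r : ℕ) (x : RExp)
  | nput (a : ℕ) (i x : NExp)
  | rput (a : ℕ) (i : NExp) (x : RExp)
  | seq (c d : Cmd)
  | ite (p : BExp) (c d : Cmd)
  | loop (p : BExp) (c : Cmd)

namespace Mem

def setN (σ : Mem) (r v : ℕ) : Mem :=
  { σ with nreg := Function.update σ.nreg r v }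

def setR (σ : Mem) (r : ℕ) (v : ℝ) : Mem :=
  { σ with rreg := Function.update σ.rreg r v }

def putN (σ : Mem) (a i v : ℕ) : Mem :=
  { σ with narr := Function.update σ.narr a (Function.update (σ.narr a) i v) }

def putR (σ : Mem) (a i : ℕ) (v : ℝ) : Mem :=
  { σ with rarr := Function.update σ.rarr a (Function.update (σ.rarr a) i v) }

end Mem

/-- `Exec c σ τ T`: started in memory `σ`, the program `c` halts with memory `τ`
after `T` elementary steps. -/
inductive Exec : Cmd → Mem → Mem → ℕ → Prop
  | nset (r : ℕ) (x : NExp) (σ : Mem) :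
      Exec (.nset r x) σ (σ.setN r (x.eval σ)) (x.size + 1)
  | rset (r : ℕ) (x : RExp) (σ : Mem) :
      Exec (.rset r x) σ (σ.setR r (x.eval σ)) (x.size + 1)
  | nput (a : ℕ) (i x : NExp) (σ : Mem) :
      Exec (.nput a i x) σ (σ.putN a (i.eval σ) (x.eval σ)) (i.size + x.size + 1)
  | rput (a : ℕ) (i : NExp) (x : RExp) (σ : Mem) :
      Exec (.rput a i x) σ (σ.putR a (i.eval σ) (x.eval σ)) (i.size + x.size + 1)
  | seq {c d : Cmd} {σ τ ρ : Mem} {S T : ℕ} (h : Exec c σ τ S) (h' : Exec d τ ρ T) :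
      Exec (.seq c d) σ ρ (S + T)
  | ite_true {p : BExp} {c d : Cmd} {σ τ : Mem} {T : ℕ} (hp : p.eval σ) (h : Exec c σ τ T) :
      Exec (.ite p c d) σ τ (p.size + T + 1)
  | ite_false {p : BExp} {c d : Cmd} {σ τ : Mem} {T : ℕ} (hp : ¬ p.eval σ) (h : Exec d σ τ T) :
      Exec (.ite p c d) σ τ (p.size + T + 1)
  | loop_false {p : BExp} {c : Cmd} {σ : Mem} (hp : ¬ p.eval σ) :
      Exec (.loop p c) σ σ (p.size + 1)
  | loop_true {p : BExp} {c : Cmd} {σ τ ρ : Mem} {S T : ℕ} (hp : p.eval σ)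
      (h : Exec c σ τ S) (h' : Exec (.loop p c) τ ρ T) :
      Exec (.loop p c) σ ρ (p.size + S + T + 1)

/-- The initial memory: registers hold `n`, `m`, the source, the sink and the budget `k`, and the
two biases; arrays hold the tails, heads and costs of the edges. All other memory is zero. -/
noncomputable def input {n m : ℕ} (G : TaskGraph n m) (b₁ b₂ : ℝ) (k : ℕ) : Mem where
  nreg r :=
    if r = 0 then n else if r = 1 then m else if r = 2 then (G.source : ℕ)
    else if r = 3 then (G.sink : ℕ) else if r = 4 then k else 0
  rreg r := if r = 0 then b₁ else if r = 1 then b₂ else 0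
  narr a i :=
    if h : i < m then
      if a = 0 then (G.tail ⟨i, h⟩ : ℕ) else if a = 1 then (G.head ⟨i, h⟩ : ℕ) else 0
    else 0
  rarr a i := if h : i < m then if a = 0 then G.cost ⟨i, h⟩ else 0 else 0

/-- The chunking written in the memory: natural number arrays 2 and 3 hold, for each edge, the
number of its pieces and the position of the first of them in the real number array 1. -/
def output (m : ℕ) (σ : Mem) : Chunking m := fun e =>
  (List.range (σ.narr 2 e)).map fun i => σ.rarr 1 (σ.narr 3 e + i)

end PresentBias

namespace PresentBias

/-! ### Verification of programs -/

-- Dividing edges never changes the distance from a vertex of the task graph to the sink, since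
-- leaving an edge halfway only adds cost. A vertex inside a chunked edge `e` has the smaller of two
-- distances: that of finishing `e`, and that of leaving for another edge with the same tail
-- (`IsDist.dist_eq`). So what an agent does at a vertex `u`, and inside the edges out of `u`,
-- depends only on how the edges out of `u` are divided. The cost of a path does not depend on the
-- pieces at all. Hence for each edge, and for each pair of edges with a common tail, only one
-- number matters: the least number of chunks for which the agents can be made to take them
-- (`soloSet`, `pairSet`). The rest is dynamic programming over two vertices and a remaining budget.
--
-- Infinite distances are represented by a real number `B` that exceeds every finite perceived cost,
-- and the choices of an agent become inequalities between real numbers (`IsDist.travels_iff`).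
--
-- One edge: an agent completes an edge that it has started if no later piece is perceived as worse
-- than the best alternative. Reasoning backwards from the last piece, there is a largest remaining
-- cost that can be completed in a given number of pieces. It satisfies the recursion `thr`, and
-- cutting the edge at these values is as good as any other division (`rest_le_reach`,
-- `value_le_of_rest`). Only the cost of the first piece is then free, within an interval whose
-- upper end `maxFirst` does not depend on the number of pieces.
--
-- Two edges with one tail: if both agents use the same edge, chunks on other edges are useless. If
-- they use different edges `e` and `e'`, then none, one or both of them are chunked (`PairPlan`).
-- If only `e'` is chunked, its first piece should be as large as possible, to repel the agent on
-- `e`. If that agent is still indifferent, the tie rule favors the single tied chunk, and the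
-- remedy is a second tied chunk on a third edge, after which the order of the vertices decides
-- (`whole_le_of_travels`, `exists_oneSplit`). If both edges are chunked, the first pieces range
-- over a rectangle on which both perceived costs are strictly increasing. A solution then exists
-- only if one of two corners, or one explicitly computed interior candidate, is a solution
-- (`BothSplit.candidate`). Thus each pair of numbers of pieces is decided in constant time.
--
-- Dynamic programming: vertices are numbered such that edges lead to smaller numbers, and the agent
-- with the larger number moves, or both move if they are at the same vertex. That vertex is never
-- visited again, so its chunks are counted once. A table closed under these moves bounds every
-- achievable cost from below (`Layout.le_of_travels`). Conversely, following the stored edges back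
-- from the source produces a chunking whose cost is the entry for the source (`Trace.step`,
-- `Layout.optimal_of_trace`).
--
-- Running time: only the tails of edges and the sink need numbers of their own, so `m + 2` numbers
-- suffice, and `n` enters only through the initialization of the distances. There are at most `m²`
-- pairs of edges, each searched in about `k²` steps, and about `m²` moves of a single agent, each
-- with `k + 1` budgets. The total is of order `m² k² + n` if there is an edge. This is within the
-- claimed bound because `k ≥ 2` bounds `log k` away from zero.
--
-- Programs are verified by the total-correctness statement `Runs`, which carries a time bound.
-- Every verified command comes with a frame `Keep` computed from the program text, so that
-- specifications mention only what changes.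

infixr:60 " ;; " => Cmd.seq

namespace NExp

@[simp] theorem eval_lit (σ : Mem) (c : ℕ) : (lit c).eval σ = c := rfl
@[simp] theorem eval_reg (σ : Mem) (r : ℕ) : (reg r).eval σ = σ.nreg r := rfl
@[simp] theorem eval_get (σ : Mem) (a : ℕ) (i : NExp) : (get a i).eval σ = σ.narr a (i.eval σ) := rfl
@[simp] theorem eval_add (σ : Mem) (x y : NExp) : (add x y).eval σ = x.eval σ + y.eval σ := rfl
@[simp] theorem eval_sub (σ : Mem) (x y : NExp) : (sub x y).eval σ = x.eval σ - y.eval σ := rfl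

end NExp

namespace RExp

@[simp] theorem eval_lit (σ : Mem) (c : ℕ) : (lit c).eval σ = c := rfl
@[simp] theorem eval_reg (σ : Mem) (r : ℕ) : (reg r).eval σ = σ.rreg r := rfl
@[simp] theorem eval_get (σ : Mem) (a : ℕ) (i : NExp) : (get a i).eval σ = σ.rarr a (i.eval σ) := rfl
@[simp] theorem eval_add (σ : Mem) (x y : RExp) : (add x y).eval σ = x.eval σ + y.eval σ := rfl
@[simp] theorem eval_sub (σ : Mem) (x y : RExp) : (sub x y).eval σ = x.eval σ - y.eval σ := rfl
@[simp] theorem eval_mul (σ : Mem) (x y : RExp) : (mul x y).eval σ = x.eval σ * y.eval σ := rfl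
@[simp] theorem eval_div (σ : Mem) (x y : RExp) : (div x y).eval σ = x.eval σ / y.eval σ := rfl

end RExp

namespace BExp

def disj (p q : BExp) : BExp := neg (conj (neg p) (neg q))
def nlt (x y : NExp) : BExp := neg (nle y x)
def neq (x y : NExp) : BExp := conj (nle x y) (nle y x)
def rlt (x y : RExp) : BExp := neg (rle y x)
def req (x y : RExp) : BExp := conj (rle x y) (rle y x)

@[simp] theorem eval_nle (σ : Mem) (x y : NExp) : (nle x y).eval σ ↔ x.eval σ ≤ y.eval σ := Iff.rfl
@[simp] theorem eval_rle (σ : Mem) (x y : RExp) : (rle x y).eval σ ↔ x.eval σ ≤ y.eval σ := Iff.rfl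
@[simp] theorem eval_neg (σ : Mem) (p : BExp) : (neg p).eval σ ↔ ¬ p.eval σ := Iff.rfl
@[simp] theorem eval_conj (σ : Mem) (p q : BExp) : (conj p q).eval σ ↔ p.eval σ ∧ q.eval σ := Iff.rfl
@[simp] theorem eval_disj (σ : Mem) (p q : BExp) : (disj p q).eval σ ↔ p.eval σ ∨ q.eval σ := by
  simp only [disj, eval_neg, eval_conj]; tauto
@[simp] theorem eval_nlt (σ : Mem) (x y : NExp) : (nlt x y).eval σ ↔ x.eval σ < y.eval σ := by
  simp [nlt]
@[simp] theorem eval_neq (σ : Mem) (x y : NExp) : (neq x y).eval σ ↔ x.eval σ = y.eval σ := by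
  simp [neq, le_antisymm_iff]
@[simp] theorem eval_rlt (σ : Mem) (x y : RExp) : (rlt x y).eval σ ↔ x.eval σ < y.eval σ := by
  simp [rlt]
@[simp] theorem eval_req (σ : Mem) (x y : RExp) : (req x y).eval σ ↔ x.eval σ = y.eval σ := by
  simp [req, le_antisymm_iff]

end BExp

/-! ### Reading memory after a write. -/

namespace Mem

variable (σ : Mem) (r r' a a' i i' v : ℕ) (w : ℝ)

@[simp] theorem setN_nreg : (σ.setN r v).nreg r' = if r' = r then v else σ.nreg r' := by
  simp [setN, Function.update_apply]
@[simp] theorem setN_rreg : (σ.setN r v).rreg = σ.rreg := rfl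
@[simp] theorem setN_narr : (σ.setN r v).narr = σ.narr := rfl
@[simp] theorem setN_rarr : (σ.setN r v).rarr = σ.rarr := rfl
@[simp] theorem setR_rreg : (σ.setR r w).rreg r' = if r' = r then w else σ.rreg r' := by
  simp [setR, Function.update_apply]
@[simp] theorem setR_nreg : (σ.setR r w).nreg = σ.nreg := rfl
@[simp] theorem setR_narr : (σ.setR r w).narr = σ.narr := rfl
@[simp] theorem setR_rarr : (σ.setR r w).rarr = σ.rarr := rfl
@[simp] theorem putN_nreg : (σ.putN a i v).nreg = σ.nreg := rfl
@[simp] theorem putN_rreg : (σ.putN a i v).rreg = σ.rreg := rfl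
@[simp] theorem putN_rarr : (σ.putN a i v).rarr = σ.rarr := rfl
theorem putN_narr : (σ.putN a i v).narr a' =
    if a' = a then Function.update (σ.narr a) i v else σ.narr a' := by
  simp [putN, Function.update_apply]
@[simp] theorem putN_narr_apply : (σ.putN a i v).narr a' i' =
    if a' = a ∧ i' = i then v else σ.narr a' i' := by
  simp only [putN_narr]
  split_ifs with h h1 h1
  · simp [h1.2]
  · rw [Function.update_of_ne (fun h2 => h1 ⟨h, h2⟩), h]
  · exact absurd h1.1 h
  · rfl
@[simp] theorem putR_nreg : (σ.putR a i w).nreg = σ.nreg := rfl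
@[simp] theorem putR_rreg : (σ.putR a i w).rreg = σ.rreg := rfl
@[simp] theorem putR_narr : (σ.putR a i w).narr = σ.narr := rfl
theorem putR_rarr : (σ.putR a i w).rarr a' =
    if a' = a then Function.update (σ.rarr a) i w else σ.rarr a' := by
  simp [putR, Function.update_apply]
@[simp] theorem putR_rarr_apply : (σ.putR a i w).rarr a' i' =
    if a' = a ∧ i' = i then w else σ.rarr a' i' := by
  simp only [putR_rarr]
  split_ifs with h h1 h1
  · simp [h1.2]
  · rw [Function.update_of_ne (fun h2 => h1 ⟨h, h2⟩), h]
  · exact absurd h1.1 h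
  · rfl

end Mem

namespace Cmd

/-- The program contains no loop. -/
def flat : Cmd → Bool
  | seq c d => c.flat && d.flat
  | ite _ c d => c.flat && d.flat
  | loop _ _ => false
  | _ => true

/-- A bound for the running time of a program without loops. -/
def cost : Cmd → ℕ
  | nset _ x => x.size + 1
  | rset _ x => x.size + 1
  | nput _ i x => i.size + x.size + 1
  | rput _ i x => i.size + x.size + 1
  | seq c d => c.cost + d.cost
  | ite p c d => p.size + (c.cost + d.cost) + 1
  | loop _ _ => 0

open Classical in
/-- The effect of a program without loops. -/
noncomputable def run : Cmd → Mem → Mem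
  | nset r x, σ => σ.setN r (x.eval σ)
  | rset r x, σ => σ.setR r (x.eval σ)
  | nput a i x, σ => σ.putN a (i.eval σ) (x.eval σ)
  | rput a i x, σ => σ.putR a (i.eval σ) (x.eval σ)
  | seq c d, σ => d.run (c.run σ)
  | ite p c d, σ => if p.eval σ then c.run σ else d.run σ
  | loop _ _, σ => σ

/-- The program does not assign to the natural number register `r`. -/
def keepsN (r : ℕ) : Cmd → Bool
  | nset s _ => s != r
  | seq c d => c.keepsN r && d.keepsN r
  | ite _ c d => c.keepsN r && d.keepsN r
  | loop _ c => c.keepsN r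
  | _ => true

/-- The program does not assign to the real register `r`. -/
def keepsR (r : ℕ) : Cmd → Bool
  | rset s _ => s != r
  | seq c d => c.keepsR r && d.keepsR r
  | ite _ c d => c.keepsR r && d.keepsR r
  | loop _ c => c.keepsR r
  | _ => true

/-- The program does not write to the natural number array `r`. -/
def keepsNA (r : ℕ) : Cmd → Bool
  | nput s _ _ => s != r
  | seq c d => c.keepsNA r && d.keepsNA r
  | ite _ c d => c.keepsNA r && d.keepsNA r
  | loop _ c => c.keepsNA r
  | _ => true

/-- The program does not write to the real array `r`. -/
def keepsRA (r : ℕ) : Cmd → Bool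
  | rput s _ _ => s != r
  | seq c d => c.keepsRA r && d.keepsRA r
  | ite _ c d => c.keepsRA r && d.keepsRA r
  | loop _ c => c.keepsRA r
  | _ => true

/-- Register 999 serves no other purpose, so a skipped branch does not disturb any invariant. -/
def skip : Cmd := nset 999 (.lit 0)
def rmin (r : ℕ) (x y : RExp) : Cmd := ite (.rle x y) (rset r x) (rset r y)
def rmax (r : ℕ) (x y : RExp) : Cmd := ite (.rle x y) (rset r y) (rset r x)
def when (p : BExp) (c : Cmd) : Cmd := ite p c skip

/-- `for i < hi do c`. -/
def upTo (i : ℕ) (hi : NExp) (c : Cmd) : Cmd :=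
  nset i (.lit 0) ;; loop (.nlt (.reg i) hi) (c ;; nset i (.add (.reg i) (.lit 1)))

@[simp] theorem run_nset (r : ℕ) (x : NExp) (σ : Mem) : (nset r x).run σ = σ.setN r (x.eval σ) := rfl
@[simp] theorem run_rset (r : ℕ) (x : RExp) (σ : Mem) : (rset r x).run σ = σ.setR r (x.eval σ) := rfl
@[simp] theorem run_nput (a : ℕ) (i x : NExp) (σ : Mem) :
    (nput a i x).run σ = σ.putN a (i.eval σ) (x.eval σ) := rfl
@[simp] theorem run_rput (a : ℕ) (i : NExp) (x : RExp) (σ : Mem) :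
    (rput a i x).run σ = σ.putR a (i.eval σ) (x.eval σ) := rfl
@[simp] theorem run_seq (c d : Cmd) (σ : Mem) : (c ;; d).run σ = d.run (c.run σ) := rfl
open Classical in
@[simp] theorem run_ite (p : BExp) (c d : Cmd) (σ : Mem) :
    (ite p c d).run σ = if p.eval σ then c.run σ else d.run σ := rfl
@[simp] theorem run_rmin (r : ℕ) (x y : RExp) (σ : Mem) :
    (rmin r x y).run σ = σ.setR r (min (x.eval σ) (y.eval σ)) := by
  simp only [rmin, run_ite, BExp.eval_rle, run_rset, min_def]
  split_ifs <;> rfl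
@[simp] theorem run_rmax (r : ℕ) (x y : RExp) (σ : Mem) :
    (rmax r x y).run σ = σ.setR r (max (x.eval σ) (y.eval σ)) := by
  simp only [rmax, run_ite, BExp.eval_rle, run_rset, max_def]
  split_ifs <;> rfl

end Cmd

/-- `τ` agrees with `σ` on all memory that `c` cannot change. -/
structure Keep (c : Cmd) (σ τ : Mem) : Prop where
  n : ∀ r, c.keepsN r = true → τ.nreg r = σ.nreg r
  r : ∀ r, c.keepsR r = true → τ.rreg r = σ.rreg r
  na : ∀ r, c.keepsNA r = true → τ.narr r = σ.narr r
  ra : ∀ r, c.keepsRA r = true → τ.rarr r = σ.rarr r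

theorem Keep.refl (c : Cmd) (σ : Mem) : Keep c σ σ :=
  ⟨fun _ _ => rfl, fun _ _ => rfl, fun _ _ => rfl, fun _ _ => rfl⟩

theorem Keep.trans {c : Cmd} {σ τ ρ : Mem} (h : Keep c σ τ) (h' : Keep c τ ρ) : Keep c σ ρ :=
  ⟨fun r hr => (h'.n r hr).trans (h.n r hr), fun r hr => (h'.r r hr).trans (h.r r hr),
    fun r hr => (h'.na r hr).trans (h.na r hr), fun r hr => (h'.ra r hr).trans (h.ra r hr)⟩

theorem Keep.mono {c d : Cmd} {σ τ : Mem} (h : Keep c σ τ)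
    (hn : ∀ r, d.keepsN r = true → c.keepsN r = true)
    (hr : ∀ r, d.keepsR r = true → c.keepsR r = true)
    (hna : ∀ r, d.keepsNA r = true → c.keepsNA r = true)
    (hra : ∀ r, d.keepsRA r = true → c.keepsRA r = true) : Keep d σ τ :=
  ⟨fun r h' => h.n r (hn r h'), fun r h' => h.r r (hr r h'),
    fun r h' => h.na r (hna r h'), fun r h' => h.ra r (hra r h')⟩

theorem Keep.seq_left {c d : Cmd} {σ τ : Mem} (h : Keep c σ τ) : Keep (c ;; d) σ τ :=
  h.mono (by simp +contextual [Cmd.keepsN]) (by simp +contextual [Cmd.keepsR])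
    (by simp +contextual [Cmd.keepsNA]) (by simp +contextual [Cmd.keepsRA])

theorem Keep.seq_right {c d : Cmd} {σ τ : Mem} (h : Keep d σ τ) : Keep (c ;; d) σ τ :=
  h.mono (by simp +contextual [Cmd.keepsN]) (by simp +contextual [Cmd.keepsR])
    (by simp +contextual [Cmd.keepsNA]) (by simp +contextual [Cmd.keepsRA])

/-- The frame rule. The conditions `keepsN`, `keepsR`, `keepsNA` and `keepsRA` are Boolean functions
of the program text, so for a concrete program and a concrete register or array they are proved by
`rfl`. -/
theorem Exec.keep {c : Cmd} {σ τ : Mem} {T : ℕ} (h : Exec c σ τ T) : Keep c σ τ := by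
  induction h with
  | nset r x σ =>
    refine ⟨fun s hs => ?_, fun _ _ => rfl, fun _ _ => rfl, fun _ _ => rfl⟩
    simp only [Cmd.keepsN, bne_iff_ne, ne_eq] at hs
    simp [Ne.symm hs]
  | rset r x σ =>
    refine ⟨fun _ _ => rfl, fun s hs => ?_, fun _ _ => rfl, fun _ _ => rfl⟩
    simp only [Cmd.keepsR, bne_iff_ne, ne_eq] at hs
    simp [Ne.symm hs]
  | nput a i x σ =>
    refine ⟨fun _ _ => rfl, fun _ _ => rfl, fun s hs => ?_, fun _ _ => rfl⟩
    simp only [Cmd.keepsNA, bne_iff_ne, ne_eq] at hs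
    simp [Mem.putN_narr, Ne.symm hs]
  | rput a i x σ =>
    refine ⟨fun _ _ => rfl, fun _ _ => rfl, fun _ _ => rfl, fun s hs => ?_⟩
    simp only [Cmd.keepsRA, bne_iff_ne, ne_eq] at hs
    simp [Mem.putR_rarr, Ne.symm hs]
  | seq _ _ ih ih' => exact ih.seq_left.trans ih'.seq_right
  | ite_true _ _ ih =>
    exact ih.mono (by simp +contextual [Cmd.keepsN]) (by simp +contextual [Cmd.keepsR])
      (by simp +contextual [Cmd.keepsNA]) (by simp +contextual [Cmd.keepsRA])
  | ite_false _ _ ih =>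
    exact ih.mono (by simp +contextual [Cmd.keepsN]) (by simp +contextual [Cmd.keepsR])
      (by simp +contextual [Cmd.keepsNA]) (by simp +contextual [Cmd.keepsRA])
  | loop_false _ => exact Keep.refl _ _
  | loop_true _ _ _ ih ih' => exact Keep.trans ⟨ih.n, ih.r, ih.na, ih.ra⟩ ih'

/-- Started in `σ`, the program `c` halts within `t` steps in a memory satisfying `Q`. -/
def Runs (c : Cmd) (σ : Mem) (t : ℕ) (Q : Mem → Prop) : Prop :=
  ∃ τ T, Exec c σ τ T ∧ T ≤ t ∧ Q τ

namespace Runs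

variable {c d : Cmd} {σ : Mem} {s t : ℕ} {Q R : Mem → Prop}

/-- Weakening the postcondition provides the frame `Keep c σ τ` for free; this is how facts about
untouched memory are carried from one command to the next. -/
theorem mono (h : Runs c σ s Q) (hst : s ≤ t) (hQ : ∀ τ, Keep c σ τ → Q τ → R τ) : Runs c σ t R := by
  obtain ⟨τ, T, hE, hT, hq⟩ := h
  exact ⟨τ, T, hE, hT.trans hst, hQ τ hE.keep hq⟩

theorem le (h : Runs c σ s Q) (hst : s ≤ t) : Runs c σ t Q := h.mono hst fun _ _ => id

theorem imp (h : Runs c σ t Q) (hQ : ∀ τ, Keep c σ τ → Q τ → R τ) : Runs c σ t R :=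
  h.mono le_rfl hQ

theorem seq (h : Runs c σ s fun τ => Runs d τ t Q) : Runs (c ;; d) σ (s + t) Q := by
  obtain ⟨τ, T, hE, hT, ρ, T', hE', hT', hq⟩ := h
  exact ⟨ρ, T + T', hE.seq hE', by omega, hq⟩

theorem seq' (h : Runs c σ s R) (h' : ∀ τ, Keep c σ τ → R τ → Runs d τ t Q) :
    Runs (c ;; d) σ (s + t) Q :=
  (h.imp h').seq

theorem ite {p : BExp} (h : p.eval σ → Runs c σ s Q) (h' : ¬ p.eval σ → Runs d σ t Q) :
    Runs (.ite p c d) σ (p.size + max s t + 1) Q := by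
  by_cases hp : p.eval σ
  · obtain ⟨τ, T, hE, hT, hq⟩ := h hp
    exact ⟨τ, _, hE.ite_true hp, by have := le_max_left s t; omega, hq⟩
  · obtain ⟨τ, T, hE, hT, hq⟩ := h' hp
    exact ⟨τ, _, hE.ite_false hp, by have := le_max_right s t; omega, hq⟩

/-- A program without loops is a function on memories that `simp` can unfold. Charging a branch with
the sum of both alternatives makes the time bound a number that depends only on the program and can
be computed. -/
theorem exec_flat (hf : c.flat = true) : ∃ T, Exec c σ (c.run σ) T ∧ T ≤ c.cost := by
  induction c generalizing σ with
  | nset r x => exact ⟨_, .nset r x σ, le_rfl⟩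
  | rset r x => exact ⟨_, .rset r x σ, le_rfl⟩
  | nput a i x => exact ⟨_, .nput a i x σ, le_rfl⟩
  | rput a i x => exact ⟨_, .rput a i x σ, le_rfl⟩
  | seq c d ihc ihd =>
    simp only [Cmd.flat, Bool.and_eq_true] at hf
    obtain ⟨T, h, hT⟩ := ihc (σ := σ) hf.1
    obtain ⟨T', h', hT'⟩ := ihd (σ := c.run σ) hf.2
    exact ⟨_, h.seq h', by simp only [Cmd.cost]; omega⟩
  | ite p c d ihc ihd =>
    simp only [Cmd.flat, Bool.and_eq_true] at hf
    obtain ⟨T, h, hT⟩ := ihc (σ := σ) hf.1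
    obtain ⟨T', h', hT'⟩ := ihd (σ := σ) hf.2
    by_cases hp : p.eval σ
    · exact ⟨_, by rw [Cmd.run_ite, if_pos hp]; exact h.ite_true hp, by simp only [Cmd.cost]; omega⟩
    · exact ⟨_, by rw [Cmd.run_ite, if_neg hp]; exact h'.ite_false hp, by simp only [Cmd.cost]; omega⟩
  | loop p c => simp [Cmd.flat] at hf

theorem flat (hf : c.flat = true) (ht : c.cost ≤ t) (hQ : Keep c σ (c.run σ) → Q (c.run σ)) :
    Runs c σ t Q := by
  obtain ⟨T, h, hT⟩ := exec_flat (σ := σ) hf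
  exact ⟨_, T, h, hT.trans ht, hQ h.keep⟩

theorem skip (h : Q (σ.setN 999 0)) : Runs .skip σ 2 Q := ⟨_, _, .nset _ _ _, le_rfl, h⟩

/-- A loop that counts up, with invariant `J`. -/
theorem upTo {i : ℕ} {hi : NExp} {J : ℕ → Mem → Prop} {N : ℕ} {t : ℕ → ℕ}
    (hbody : c.keepsN i = true)
    (hN : ∀ τ, Keep (Cmd.upTo i hi c) σ τ → hi.eval τ = N)
    (h0 : J 0 (σ.setN i 0))
    (hstep : ∀ j < N, ∀ τ, Keep (Cmd.upTo i hi c) σ τ → τ.nreg i = j → J j τ →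
      Runs c τ (t j) fun ρ => J (j + 1) (ρ.setN i (j + 1)))
    (hQ : ∀ τ, Keep (Cmd.upTo i hi c) σ τ → J N τ → Q τ) :
    Runs (Cmd.upTo i hi c) σ ((∑ j ∈ Finset.range N, (t j + (hi.size + 8))) + (hi.size + 8)) Q := by
  set C := Cmd.upTo i hi c with hC
  have key : ∀ d j τ, j + d = N → Keep C σ τ → τ.nreg i = j → J j τ →
      Runs (.loop (.nlt (.reg i) hi) (c ;; .nset i (.add (.reg i) (.lit 1)))) τ
        ((∑ j ∈ Finset.Ico j N, (t j + (hi.size + 8))) + (hi.size + 4)) Q := by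
    intro d
    induction d with
    | zero =>
      intro j τ hj hK hi' hJ
      obtain rfl : j = N := by omega
      refine ⟨τ, _, .loop_false ?_, ?_, hQ τ hK hJ⟩
      · simp [hN τ hK, hi']
      · simp only [BExp.nlt, BExp.size, NExp.size]; omega
    | succ d ih =>
      intro j τ hj hK hi' hJ
      obtain ⟨ρ, T, hE, hT, hρ⟩ := hstep j (by omega) τ hK hi' hJ
      have hKρ : Keep C σ ρ := hK.trans (hE.keep.mono (by simp +contextual [hC, Cmd.upTo, Cmd.keepsN])
        (by simp +contextual [hC, Cmd.upTo, Cmd.keepsR])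
        (by simp +contextual [hC, Cmd.upTo, Cmd.keepsNA]) (by simp +contextual [hC, Cmd.upTo, Cmd.keepsRA]))
      have hiρ : ρ.nreg i = j := by rw [hE.keep.n i hbody, hi']
      have hE2 := hE.seq (Exec.nset i (.add (.reg i) (.lit 1)) ρ)
      have hval : (NExp.add (.reg i) (.lit 1)).eval ρ = j + 1 := by simp [hiρ]
      rw [hval] at hE2
      have hK2 : Keep C σ (ρ.setN i (j + 1)) := by
        refine ⟨fun r hr => ?_, hKρ.r, hKρ.na, hKρ.ra⟩
        rw [← hKρ.n r hr]
        have : i ≠ r := by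
          simp only [hC, Cmd.upTo, Cmd.keepsN, Bool.and_eq_true, bne_iff_ne] at hr
          exact hr.1
        simp [Ne.symm this]
      obtain ⟨μ, T', hE', hT', hμ⟩ := ih (j + 1) _ (by omega) hK2 (by simp) hρ
      refine ⟨μ, _, .loop_true (by simp [hN τ hK, hi']; omega) hE2 hE', ?_, hμ⟩
      -- Besides its body, a pass costs `hi.size + 3` for the test, 1 for the loop and 4 for the
      -- increment.
      rw [Finset.sum_eq_sum_Ico_succ_bot (by omega)]
      simp only [BExp.nlt, BExp.size, NExp.size]
      omega
  have hK0 : Keep C σ (σ.setN i 0) := by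
    refine ⟨fun r hr => ?_, fun _ _ => rfl, fun _ _ => rfl, fun _ _ => rfl⟩
    have : i ≠ r := by
      simp only [hC, Cmd.upTo, Cmd.keepsN, Bool.and_eq_true, bne_iff_ne] at hr
      exact hr.1
    simp [Ne.symm this]
  obtain ⟨μ, T', hE', hT', hμ⟩ := key N 0 _ (by omega) hK0 (by simp) h0
  refine ⟨μ, _, Exec.seq (Exec.nset i (.lit 0) σ) hE', ?_, hμ⟩
  rw [← Finset.range_eq_Ico] at hT'
  simp only [NExp.size]
  omega

/-- A loop that counts up, with invariant `J` and a uniform bound for the time of the body. -/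
theorem upTo' {i : ℕ} {hi : NExp} (J : ℕ → Mem → Prop) {N : ℕ} {t : ℕ} {b : ℕ}
    (hbody : c.keepsN i = true)
    (hN : ∀ τ, Keep (Cmd.upTo i hi c) σ τ → hi.eval τ = N)
    (h0 : J 0 (σ.setN i 0))
    (hstep : ∀ j < N, ∀ τ, Keep (Cmd.upTo i hi c) σ τ → τ.nreg i = j → J j τ →
      Runs c τ t fun ρ => J (j + 1) (ρ.setN i (j + 1)))
    (hb : N * (t + (hi.size + 8)) + (hi.size + 8) ≤ b)
    (hQ : ∀ τ, Keep (Cmd.upTo i hi c) σ τ → J N τ → Q τ) :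
    Runs (Cmd.upTo i hi c) σ b Q := by
  refine (upTo (t := fun _ => t) hbody hN h0 hstep hQ).le ?_
  simpa using hb

end Runs

end PresentBias

namespace PresentBias

namespace TaskGraph

variable {n m : ℕ} (G : TaskGraph n m) (C : Chunking m)

/-! ### Shortest-path costs -/

def totalCost : ℝ := ∑ e, G.cost e

theorem cost_le_totalCost (e : Fin m) : G.cost e ≤ G.totalCost :=
  Finset.single_le_sum (f := G.cost) (fun e _ => G.cost_nonneg e) (Finset.mem_univ e)

theorem totalCost_nonneg : 0 ≤ G.totalCost := Finset.sum_nonneg fun e _ => G.cost_nonneg e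

/-- The map `ord` decreases along edges, and `δ` is the cost of a shortest path to the sink,
with the value `B` at vertices from which the sink cannot be reached. The number `B` exceeds all
costs that agents with biases up to `β` perceive. -/
structure IsDist (β B : ℝ) (ord : Fin n → ℕ) (δ : Fin n → ℝ) : Prop where
  one_lt : 1 < β
  big : (β + 2) * G.totalCost < B
  ord_lt : ∀ e, ord (G.head e) < ord (G.tail e)
  le : ∀ v, δ v ≤ B
  sink_le : δ G.sink ≤ 0
  edge : ∀ e, δ (G.tail e) ≤ G.cost e + δ (G.head e)
  attained : ∀ v, (v = G.sink ∧ δ v = 0) ∨ δ v = B ∨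
    ∃ e, G.tail e = v ∧ δ v = G.cost e + δ (G.head e)

/-- The other edges with the same tail. -/
def alts (e : Fin m) : Finset (Fin m) := Finset.univ.filter fun f => f ≠ e ∧ G.tail f = G.tail e

variable {G} in
@[simp] theorem mem_alts {e f : Fin m} : f ∈ G.alts e ↔ f ≠ e ∧ G.tail f = G.tail e := by
  simp [alts]

variable {β B : ℝ} {ord : Fin n → ℕ} {δ : Fin n → ℝ}

/-- The perceived cost of an edge that is not chunked. -/
def whole (δ : Fin n → ℝ) (b : ℝ) (e : Fin m) : ℝ := b * G.cost e + δ (G.head e)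

/-- The least perceived cost of another edge with the same tail, at most `B`. -/
noncomputable def altMin (B : ℝ) (δ : Fin n → ℝ) (b : ℝ) (e : Fin m) : ℝ :=
  (G.alts e).fold min B (G.whole δ b)

variable {G C} in
theorem altMin_le {b : ℝ} {e f : Fin m} (h : f ≠ e) (ht : G.tail f = G.tail e) :
    G.altMin B δ b e ≤ G.whole δ b f :=
  (Finset.fold_min_le _).2 (Or.inr ⟨f, mem_alts.2 ⟨h, ht⟩, le_rfl⟩)

theorem altMin_le_bound (b : ℝ) (e : Fin m) : G.altMin B δ b e ≤ B :=
  (Finset.fold_min_le _).2 (Or.inl le_rfl)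

variable {G} in
theorem le_altMin {b x : ℝ} {e : Fin m} : x ≤ G.altMin B δ b e ↔
    x ≤ B ∧ ∀ f, f ≠ e → G.tail f = G.tail e → x ≤ G.whole δ b f := by
  simp [altMin, Finset.le_fold_min]

variable {G} in
theorem altMin_attained {b : ℝ} {e : Fin m} (h : G.altMin B δ b e < B) :
    ∃ f, f ≠ e ∧ G.tail f = G.tail e ∧ G.whole δ b f = G.altMin B δ b e := by
  have h1 := (Finset.fold_min_le (s := G.alts e) (b := B) (f := G.whole δ b)
    (G.altMin B δ b e)).1 le_rfl
  rcases h1 with h1 | ⟨f, hf, h1⟩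
  · exact absurd h1 (not_le.2 h)
  · rw [mem_alts] at hf
    exact ⟨f, hf.1, hf.2, le_antisymm h1 (altMin_le hf.1 hf.2)⟩

/-! ### The gap between finite distances and the bound `B`. -/

namespace IsDist

variable {G} (D : G.IsDist β B ord δ)
include D

theorem bound_pos : 0 < B := by
  have h1 := D.big
  have h2 := G.totalCost_nonneg
  have h3 := D.one_lt
  nlinarith [mul_nonneg (by linarith : 0 ≤ β + 2) h2]

theorem two_lt : 2 * G.totalCost < B := by
  have h1 := D.big
  have h2 := G.totalCost_nonneg
  have h3 := D.one_lt
  nlinarith [mul_nonneg (by linarith : 0 ≤ β) h2]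

/-- Numbers decrease along a shortest path, so it uses each edge at most once. The induction bounds
the distance by the total cost of the edges whose tail has a number at most `ord v`. As a
consequence a value of `δ` is either at most `totalCost` or equal to `B`, with nothing in between.
-/
theorem live_le (v : Fin n) (h : δ v < B) : δ v ≤ G.totalCost := by
  suffices H : δ v ≤ ∑ e with ord (G.tail e) ≤ ord v, G.cost e from
    H.trans (Finset.sum_le_univ_sum_of_nonneg G.cost_nonneg)
  induction hk : ord v using Nat.strong_induction_on generalizing v with
  | _ k ih =>
    rcases D.attained v with h1 | h1 | ⟨e, he, h1⟩
    · rw [h1.2]; exact Finset.sum_nonneg fun e _ => G.cost_nonneg e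
    · exact absurd h1 h.ne
    · have hlt := D.ord_lt e
      rw [he, hk] at hlt
      have h2 := ih _ hlt (G.head e) (by linarith [G.cost_nonneg e]) rfl
      rw [h1]
      have h3 : (insert e ({f | ord (G.tail f) ≤ ord (G.head e)} : Finset (Fin m))) ⊆
          ({f | ord (G.tail f) ≤ k} : Finset (Fin m)) := by
        intro f hf
        simp only [Finset.mem_insert, Finset.mem_filter, Finset.mem_univ, true_and] at hf ⊢
        rcases hf with rfl | hf
        · rw [he, hk]
        · omega
      refine le_trans ?_ (Finset.sum_le_sum_of_subset_of_nonneg h3 fun f _ _ => G.cost_nonneg f)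
      rw [Finset.sum_insert]
      · linarith
      · simp only [Finset.mem_filter, Finset.mem_univ, true_and, not_le]
        rw [he, hk]; exact hlt

theorem live_tail {e : Fin m} (h : δ (G.head e) < B) : δ (G.tail e) < B := by
  have h1 := D.edge e
  have h2 := D.live_le _ h
  have h3 := G.cost_le_totalCost e
  linarith [D.two_lt]

theorem le_altMin_one (e : Fin m) : δ (G.tail e) ≤ G.altMin B δ 1 e := by
  rw [le_altMin]
  refine ⟨D.le _, fun f _ hf => ?_⟩
  rw [whole, one_mul, ← hf]
  exact D.edge f

omit D in
theorem altMin_mono {b : ℝ} (hb : 1 ≤ b) (e : Fin m) : G.altMin B δ 1 e ≤ G.altMin B δ b e := by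
  rw [le_altMin]
  refine ⟨G.altMin_le_bound _ _, fun f h hf => (altMin_le h hf).trans ?_⟩
  have := G.cost_nonneg f
  simp only [whole]
  nlinarith

end IsDist

/-- The cost that remains of the edge `e` after `i` of its pieces. -/
def rest (e : Fin m) (i : ℕ) : ℝ := ((C e).drop i).sum

/-- The cost of a shortest path from a vertex of the chunked graph, at least `B` if there is none. -/
noncomputable def pot (B : ℝ) (δ : Fin n → ℝ) : Node n m → ℝ
  | .task v => δ v
  | .mid e i => min (rest C e i + δ (G.head e)) (G.altMin B δ 1 e)

theorem rest_succ (e : Fin m) (i : ℕ) (h : i < (C e).length) :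
    rest C e i = (C e)[i] + rest C e (i + 1) := by
  rw [rest, rest, List.drop_eq_getElem_cons h, List.sum_cons]

theorem rest_length (e : Fin m) (i : ℕ) (h : (C e).length ≤ i) : rest C e i = 0 := by
  rw [rest, List.drop_eq_nil_of_le h, List.sum_nil]

namespace IsChunking

variable {G C} (hC : G.IsChunking C)
include hC

theorem rest_zero (e : Fin m) : rest C e 0 = G.cost e := (hC e).2.2

theorem piece_nonneg (e : Fin m) (i : ℕ) (h : i < (C e).length) : 0 ≤ (C e)[i] :=
  (hC e).2.1 _ (List.getElem_mem h)

theorem rest_nonneg (e : Fin m) (i : ℕ) : 0 ≤ rest C e i :=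
  List.sum_nonneg fun x hx => (hC e).2.1 x (List.mem_of_mem_drop hx)

theorem rest_anti (e : Fin m) (i : ℕ) : rest C e (i + 1) ≤ rest C e i := by
  by_cases h : i < (C e).length
  · rw [rest_succ C e i h]; linarith [hC.piece_nonneg e i h]
  · rw [rest_length C e i (by omega), rest_length C e (i + 1) (by omega)]

theorem rest_le (e : Fin m) (i : ℕ) : rest C e i ≤ G.cost e := by
  induction i with
  | zero => exact (hC.rest_zero e).le
  | succ i ih => exact (hC.rest_anti e i).trans ih

theorem length_pos (e : Fin m) : 0 < (C e).length := List.length_pos_iff.2 (hC e).1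

theorem piece_le (e : Fin m) (i : ℕ) (h : i < (C e).length) : (C e)[i] ≤ G.cost e := by
  have := rest_succ C e i h
  linarith [hC.rest_le e i, hC.rest_nonneg e (i + 1)]

end IsChunking

theorem node_zero (e : Fin m) : G.node C e 0 = .task (G.tail e) := by simp [node]

theorem node_mid (e : Fin m) {i : ℕ} (h0 : 0 < i) (h : i < (C e).length) :
    G.node C e i = .mid e i := by simp [node, h0.ne', h]

theorem node_length (e : Fin m) {i : ℕ} (h0 : 0 < i) (h : (C e).length ≤ i) :
    G.node C e i = .task (G.head e) := by simp [node, h0.ne', h]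

variable {G C} in
-- The function `node` is not a constructor, so a case distinction on an arc between concrete
-- vertices would not unify; here the indices appear as equations.
theorem Arc.cases {x y : Node n m} {e : Fin m} {w : ℝ} (h : G.Arc C x e w y) :
    (∃ i, ∃ hi : i < (C e).length, x = G.node C e i ∧ w = (C e)[i] ∧ y = G.node C e (i + 1)) ∨
    (∃ f i, 0 < i ∧ i < (C f).length ∧ e ≠ f ∧ G.tail e = G.tail f ∧ x = .mid f i ∧
      w = G.cost e ∧ y = .task (G.head e)) := by
  cases h with
  | piece _ i h => exact Or.inl ⟨i, h, rfl, rfl, rfl⟩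
  | leave f i h0 h _ hne ht => exact Or.inr ⟨f, i, h0, h, hne, ht, rfl, rfl, rfl⟩

variable {G C} in
theorem pot_node_succ (e : Fin m) (i : ℕ) (h : i < (C e).length) :
    G.pot C B δ (G.node C e (i + 1)) ≤ rest C e (i + 1) + δ (G.head e) := by
  by_cases h1 : i + 1 < (C e).length
  · rw [node_mid G C e (Nat.succ_pos _) h1]
    exact min_le_left _ _
  · rw [node_length G C e (Nat.succ_pos _) (by omega), rest_length C e _ (by omega), zero_add]
    exact le_rfl

namespace IsDist

variable {G C} (D : G.IsDist β B ord δ) (hC : G.IsChunking C)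
include D hC

/-- `pot` is a feasible potential. Before and after a piece it is governed by the same two options:
finishing the edge, which becomes cheaper by exactly the cost of the piece, and leaving it, which
does not become cheaper. Finiteness also passes backwards along arcs, by the gap below `B`. -/
theorem arc_le {x y : Node n m} {e : Fin m} {w : ℝ} (h : G.Arc C x e w y) :
    G.pot C B δ x ≤ w + G.pot C B δ y ∧ (G.pot C B δ y < B → G.pot C B δ x < B) ∧
      0 ≤ w ∧ w ≤ G.cost e := by
  rcases h.cases with ⟨i, hi, rfl, rfl, rfl⟩ | ⟨f, i, h0, h, hne, ht, rfl, rfl, rfl⟩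
  · have hp := hC.piece_nonneg e i hi
    have hM := D.le_altMin_one e
    have hr := rest_succ C e i hi
    -- the potential before the piece is at most both ways to continue
    have hA : G.pot C B δ (G.node C e i) ≤ rest C e i + δ (G.head e) ∧
        G.pot C B δ (G.node C e i) ≤ G.altMin B δ 1 e := by
      rcases Nat.eq_zero_or_pos i with rfl | h0
      · rw [node_zero, hC.rest_zero]
        exact ⟨D.edge e, hM⟩
      · rw [node_mid G C e h0 hi]
        exact ⟨min_le_left _ _, min_le_right _ _⟩
    have hB : G.pot C B δ (G.node C e (i + 1)) =
        rest C e (i + 1) + δ (G.head e) ∨ G.pot C B δ (G.node C e (i + 1)) = G.altMin B δ 1 e := by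
      by_cases h1 : i + 1 < (C e).length
      · rw [node_mid G C e (Nat.succ_pos _) h1]
        exact min_choice _ _
      · rw [node_length G C e (Nat.succ_pos _) (by omega), rest_length C e _ (by omega), zero_add]
        exact Or.inl rfl
    refine ⟨?_, ?_, hp, hC.piece_le e i hi⟩
    · rcases hB with hB | hB <;> rw [hB] <;> linarith [hA.1, hA.2]
    · rcases hB with hB | hB <;> rw [hB] <;> intro hlt
      · have h1 := hC.rest_nonneg e (i + 1)
        have h2 := D.live_le (G.head e) (by linarith)
        have h3 := hC.rest_le e i
        have h4 := G.cost_le_totalCost e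
        linarith [D.two_lt, hA.1]
      · linarith [hA.2]
  · have h1 : G.pot C B δ (.mid f i) ≤ G.cost e + δ (G.head e) := by
      refine (min_le_right _ _).trans ((altMin_le hne ht).trans ?_)
      rw [whole, one_mul]
    refine ⟨h1, fun h2 => ?_, G.cost_nonneg e, le_rfl⟩
    have h3 := D.live_le (G.head e) h2
    have h4 := G.cost_le_totalCost e
    linarith [D.two_lt]

theorem pot_le_of_routeCost {x : Node n m} {d : ℝ} (h : G.RouteCost C x d) :
    G.pot C B δ x ≤ d ∧ G.pot C B δ x < B := by
  induction h with
  | nil => exact ⟨D.sink_le, lt_of_le_of_lt D.sink_le D.bound_pos⟩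
  | cons h hd ih =>
    obtain ⟨h1, h2, -⟩ := D.arc_le hC h
    exact ⟨by linarith, h2 ih.2⟩

omit D hC in
theorem routeCost_rest (e : Fin m) (h : G.RouteCost C (.task (G.head e)) (δ (G.head e))) (i : ℕ)
    (hi : i ≤ (C e).length) (h0 : 0 < (C e).length) :
    G.RouteCost C (G.node C e i) (rest C e i + δ (G.head e)) := by
  induction hd : (C e).length - i generalizing i with
  | zero =>
    rw [node_length G C e (by omega) (by omega), rest_length C e i (by omega), zero_add]
    exact h
  | succ d ih =>
    have hi' : i < (C e).length := by omega
    rw [rest_succ C e i hi', add_assoc]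
    exact .cons (.piece e i hi') (ih (i + 1) (by omega) (by omega))

theorem routeCost_task (v : Fin n) (h : δ v < B) : G.RouteCost C (.task v) (δ v) := by
  induction hk : ord v using Nat.strong_induction_on generalizing v with
  | _ k ih =>
    rcases D.attained v with ⟨rfl, h1⟩ | h1 | ⟨e, he, h1⟩
    · rw [h1]; exact .nil
    · exact absurd h1 h.ne
    · have hlt := D.ord_lt e
      rw [he, hk] at hlt
      have h2 := ih _ hlt (G.head e) (by linarith [G.cost_nonneg e]) rfl
      have h3 := routeCost_rest e h2 0 (Nat.zero_le _) (hC.length_pos e)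
      rwa [node_zero, hC.rest_zero, he, ← h1] at h3

theorem routeCost_pot (e : Fin m) (i : ℕ) (hi : i ≤ (C e).length)
    (h : G.pot C B δ (G.node C e i) < B) :
    G.RouteCost C (G.node C e i) (G.pot C B δ (G.node C e i)) := by
  rcases Nat.eq_zero_or_pos i with rfl | h0
  · rw [node_zero] at h ⊢
    exact D.routeCost_task hC _ h
  · rcases hi.eq_or_lt with rfl | hi'
    · rw [node_length G C e h0 le_rfl] at h ⊢
      exact D.routeCost_task hC _ h
    · rw [node_mid G C e h0 hi'] at h ⊢
      rcases min_choice (rest C e i + δ (G.head e)) (G.altMin B δ 1 e) with h1 | h1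
      · rw [pot, h1] at h ⊢
        have h2 := hC.rest_nonneg e i
        have := routeCost_rest e (D.routeCost_task hC _ (by linarith)) i hi (hC.length_pos e)
        rwa [node_mid G C e h0 hi'] at this
      · rw [pot, h1] at h ⊢
        obtain ⟨f, hf, hft, hfe⟩ := altMin_attained h
        rw [← hfe, whole, one_mul]
        rw [← hfe, whole, one_mul] at h
        exact .cons (.leave e i h0 hi' f hf hft)
          (D.routeCost_task hC _ (by linarith [G.cost_nonneg f]))

open Classical in
-- Summing `arc_le` along a walk shows that no walk is cheaper than the potential, and that there is
-- none at all where the potential reaches `B`. Where it is below `B`, finishing the edge or leaving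
-- it at once gives a walk of exactly this cost. The hypothesis excludes the terms `mid e i` that
-- are not vertices of the chunked graph.
theorem dist_eq {x : Node n m} (hx : (∃ v, x = .task v) ∨
      ∃ e i, i ≤ (C e).length ∧ x = G.node C e i) :
    G.dist C x = if G.pot C B δ x < B then ((G.pot C B δ x : ℝ) : EReal) else ⊤ := by
  have hroute : G.pot C B δ x < B → G.RouteCost C x (G.pot C B δ x) := by
    intro h
    rcases hx with ⟨v, rfl⟩ | ⟨e, i, hi, rfl⟩
    · exact D.routeCost_task hC v h
    · exact D.routeCost_pot hC e i hi h
  split_ifs with h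
  · refine IsLeast.csInf_eq ⟨⟨_, hroute h, rfl⟩, ?_⟩
    rintro r ⟨d, hd, rfl⟩
    exact EReal.coe_le_coe_iff.2 (D.pot_le_of_routeCost hC hd).1
  · rw [dist, sInf_eq_top]
    rintro r ⟨d, hd, -⟩
    exact absurd (D.pot_le_of_routeCost hC hd).2 h

end IsDist

end TaskGraph

end PresentBias

namespace PresentBias

namespace TaskGraph

variable {n m : ℕ} {G : TaskGraph n m} {C : Chunking m}
variable {β B : ℝ} {ord : Fin n → ℕ} {δ : Fin n → ℝ}

/-! ### The choices of an agent in terms of real numbers -/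

variable (G C) in
/-- The perceived cost of starting with piece `i` of the edge `e`. -/
noncomputable def value (B : ℝ) (δ : Fin n → ℝ) (b : ℝ) (e : Fin m) (i : ℕ) : ℝ :=
  b * (rest C e i - rest C e (i + 1)) + G.pot C B δ (G.node C e (i + 1))

variable (G C) in
/-- The agent takes all the pieces of `e`. -/
def Travels (b : ℝ) (e : Fin m) : Prop := ∀ i < (C e).length, G.Chooses C b (G.node C e i) e

theorem value_last {b : ℝ} {e : Fin m} {i : ℕ} (h : (C e).length ≤ i + 1) :
    G.value C B δ b e i = b * rest C e i + δ (G.head e) := by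
  rw [value, node_length G C e (Nat.succ_pos _) h, rest_length C e _ h, sub_zero, pot]

theorem value_mid {b : ℝ} {e : Fin m} {i : ℕ} (h : i + 1 < (C e).length) :
    G.value C B δ b e i = b * (rest C e i - rest C e (i + 1)) +
      min (rest C e (i + 1) + δ (G.head e)) (G.altMin B δ 1 e) := by
  rw [value, node_mid G C e (Nat.succ_pos _) h, pot]

theorem value_le (hC : G.IsChunking C) {b : ℝ} (hb : 1 ≤ b) (e : Fin m) (i : ℕ)
    (hi : i < (C e).length) : G.value C B δ b e i ≤ b * rest C e i + δ (G.head e) := by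
  have h1 := pot_node_succ (G := G) (C := C) (B := B) (δ := δ) e i hi
  have h2 := hC.rest_nonneg e (i + 1)
  rw [value]
  nlinarith

theorem value_le_whole (hC : G.IsChunking C) {b : ℝ} (hb : 1 ≤ b) (e : Fin m) (i : ℕ)
    (hi : i < (C e).length) : G.value C B δ b e i ≤ G.whole δ b e := by
  have h1 := value_le (B := B) (δ := δ) hC hb e i hi
  have h2 := hC.rest_le e i
  rw [whole]
  nlinarith

/-- The edge `e` is picked at its tail, where the perceived costs are `val`
and the edges in `ch` are chunked. -/
def Pick (G : TaskGraph n m) (val : Fin m → ℝ) (ch : Fin m → Prop) (e : Fin m) : Prop :=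
  (∀ f, G.tail f = G.tail e → val e ≤ val f) ∧
  ((ch e ∧ ∀ f, G.tail f = G.tail e → val f = val e → ch f → f = e) ∨
    ((¬ ∃! f, (G.tail f = G.tail e ∧ val f = val e) ∧ ch f) ∧
      ∀ f, G.tail f = G.tail e → val f = val e → G.head e ≤ G.head f))

namespace IsDist

variable (D : G.IsDist β B ord δ) (hC : G.IsChunking C) {b : ℝ} (hb : 1 < b) (hbβ : b ≤ β)
include D

theorem alt_live_le {e : Fin m} (h : G.altMin B δ 1 e < B) : G.altMin B δ 1 e ≤ 2 * G.totalCost := by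
  obtain ⟨f, -, -, hf⟩ := altMin_attained h
  rw [← hf, whole, one_mul] at h ⊢
  have h1 := D.live_le (G.head f) (by linarith [G.cost_nonneg f])
  linarith [G.cost_le_totalCost f]

include hb hbβ in
theorem whole_lt {e : Fin m} (h : δ (G.head e) < B) : G.whole δ b e < B := by
  have h1 := D.live_le _ h
  have h2 := G.cost_le_totalCost e
  have h3 := D.big
  have h4 := G.totalCost_nonneg
  rw [whole]
  nlinarith [mul_le_mul hbβ h2 (G.cost_nonneg e) (by linarith)]

include hb in
omit D in
theorem le_whole {e : Fin m} (h : B ≤ δ (G.head e)) : B ≤ G.whole δ b e := by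
  have := G.cost_nonneg e
  rw [whole]
  nlinarith

include hC hb hbβ

open Classical in
-- This is where the constant `β + 2` in `IsDist.big` comes from: an arc costs at most `totalCost`
-- and is weighted by at most `β`, and a finite distance is at most `2 * totalCost`. So a finite
-- perceived cost stays below `B`.
theorem perceived_eq {x y : Node n m} {e : Fin m} {w : ℝ} (h : G.Arc C x e w y) :
    G.perceived C b w y = if b * w + G.pot C B δ y < B
      then ((b * w + G.pot C B δ y : ℝ) : EReal) else ⊤ := by
  obtain ⟨-, -, hw, hw'⟩ := D.arc_le hC h
  have hy : ((∃ v, y = .task v) ∨ ∃ e i, i ≤ (C e).length ∧ y = G.node C e i) ∧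
      (G.pot C B δ y < B → G.pot C B δ y ≤ 2 * G.totalCost) := by
    rcases h.cases with ⟨i, hi, -, -, rfl⟩ | ⟨-, -, -, -, -, -, -, -, rfl⟩
    · refine ⟨Or.inr ⟨e, i + 1, hi, rfl⟩, fun hlt => ?_⟩
      by_cases h1 : i + 1 < (C e).length
      · rw [node_mid G C e (Nat.succ_pos _) h1, pot] at hlt ⊢
        rcases min_choice (rest C e (i + 1) + δ (G.head e)) (G.altMin B δ 1 e) with h2 | h2
        · rw [h2] at hlt ⊢
          have h3 := D.live_le (G.head e) (by linarith [hC.rest_nonneg e (i + 1)])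
          linarith [hC.rest_le e (i + 1), G.cost_le_totalCost e]
        · rw [h2] at hlt ⊢
          exact D.alt_live_le hlt
      · rw [node_length G C e (Nat.succ_pos _) (by omega), pot] at hlt ⊢
        linarith [D.live_le _ hlt, G.totalCost_nonneg]
    · refine ⟨Or.inl ⟨_, rfl⟩, fun hlt => ?_⟩
      rw [pot] at hlt ⊢
      linarith [D.live_le _ hlt, G.totalCost_nonneg]
  rw [perceived, D.dist_eq hC hy.1]
  have hbw : 0 ≤ b * w := by positivity
  have h4 : b * w ≤ β * G.totalCost :=
    mul_le_mul hbβ (hw'.trans (G.cost_le_totalCost e)) hw (by linarith)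
  by_cases h1 : G.pot C B δ y < B
  · have h2 : b * w + G.pot C B δ y < B := by linarith [hy.2 h1, D.big]
    rw [if_pos h1, if_pos h2, EReal.coe_add]
  · rw [if_neg h1, if_neg (by linarith), EReal.coe_add_top]

theorem perceived_le_iff {x y z : Node n m} {e f : Fin m} {w v : ℝ} (h : G.Arc C x e w y)
    (h' : G.Arc C x f v z) : G.perceived C b w y ≤ G.perceived C b v z ↔
      b * w + G.pot C B δ y ≤ b * v + G.pot C B δ z ∨ B ≤ b * v + G.pot C B δ z := by
  rw [D.perceived_eq hC hb hbβ h, D.perceived_eq hC hb hbβ h']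
  by_cases h2 : b * v + G.pot C B δ z < B
  · rw [if_pos h2]
    split_ifs with h1
    · rw [EReal.coe_le_coe_iff]; constructor
      · exact Or.inl
      · rintro (h3 | h3)
        · exact h3
        · linarith
    · constructor
      · intro h3; exact absurd (top_le_iff.1 h3) (EReal.coe_ne_top _)
      · rintro (h3 | h3) <;> linarith
  · rw [if_neg h2]
    simp only [le_top, true_iff]
    exact Or.inr (not_lt.1 h2)

/-- If one arc has perceived cost below `B`, so has every minimal arc, and it makes no difference
that costs of `B` or more stand for `⊤`. -/
theorem best_iff {x : Node n m} {e : Fin m}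
    (h0 : ∃ f v z, G.Arc C x f v z ∧ b * v + G.pot C B δ z < B) :
    G.Best C b x e ↔ ∃ w y, G.Arc C x e w y ∧
      ∀ f v z, G.Arc C x f v z → b * w + G.pot C B δ y ≤ b * v + G.pot C B δ z := by
  constructor
  · rintro ⟨w, y, ha, h⟩
    refine ⟨w, y, ha, ?_⟩
    obtain ⟨f, v, z, hf, hlt⟩ := h0
    have h1 := (D.perceived_le_iff hC hb hbβ ha hf).1 (h f v z hf)
    have h2 : b * w + G.pot C B δ y < B := by rcases h1 with h1 | h1 <;> linarith
    intro g v' z' hg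
    rcases (D.perceived_le_iff hC hb hbβ ha hg).1 (h g v' z' hg) with h3 | h3 <;> linarith
  · rintro ⟨w, y, ha, h⟩
    exact ⟨w, y, ha, fun f v z hf => (D.perceived_le_iff hC hb hbβ ha hf).2 (Or.inl (h f v z hf))⟩

end IsDist

theorem node_eq_task {e : Fin m} {i : ℕ} {u : Fin n} (hi : i < (C e).length)
    (h : G.node C e i = .task u) : i = 0 ∧ G.tail e = u := by
  rcases Nat.eq_zero_or_pos i with rfl | h0
  · rw [node_zero] at h
    exact ⟨rfl, by injection h⟩
  · rw [node_mid G C e h0 hi] at h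
    exact absurd h (by simp)

theorem node_eq_mid {e f : Fin m} {i j : ℕ} (hi : i < (C f).length)
    (h : G.node C f i = .mid e j) : f = e ∧ i = j := by
  rcases Nat.eq_zero_or_pos i with rfl | h0
  · rw [node_zero] at h
    exact absurd h (by simp)
  · rw [node_mid G C f h0 hi] at h
    injection h with h1 h2
    exact ⟨h1, h2⟩

theorem arc_task_iff (hC : G.IsChunking C) {u : Fin n} {e : Fin m} {w : ℝ} {y : Node n m} :
    G.Arc C (.task u) e w y ↔
      G.tail e = u ∧ w = rest C e 0 - rest C e 1 ∧ y = G.node C e 1 := by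
  have hl := hC.length_pos e
  have hr := rest_succ C e 0 hl
  constructor
  · intro h
    rcases h.cases with ⟨i, hi, hx, rfl, rfl⟩ | ⟨f, i, -, -, -, -, hx, -⟩
    · obtain ⟨rfl, hu⟩ := node_eq_task hi hx.symm
      exact ⟨hu, by rw [hr]; simp, rfl⟩
    · exact absurd hx (by simp)
  · rintro ⟨rfl, rfl, rfl⟩
    have := Arc.piece (G := G) (C := C) e 0 hl
    rw [node_zero] at this
    rwa [hr, show (C e)[0] + rest C e (0 + 1) - rest C e 1 = (C e)[0] by simp]

theorem isChunkArc_task_iff (hC : G.IsChunking C) {u : Fin n} {e : Fin m} :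
    G.IsChunkArc C (.task u) e ↔ G.tail e = u ∧ 2 ≤ (C e).length := by
  constructor
  · rintro ⟨h, i, hi, hx⟩
    exact ⟨(node_eq_task hi hx.symm).2, h⟩
  · rintro ⟨rfl, h⟩
    exact ⟨h, 0, hC.length_pos e, (node_zero G C e).symm⟩

/-- The sink can be reached from `u` by a nonempty path. -/
def Alive (G : TaskGraph n m) (B : ℝ) (δ : Fin n → ℝ) (u : Fin n) : Prop :=
  ∃ e, G.tail e = u ∧ δ (G.head e) < B

namespace IsDist

variable (D : G.IsDist β B ord δ) (hC : G.IsChunking C) {b : ℝ} (hb : 1 < b) (hbβ : b ≤ β)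
include D hC hb hbβ

theorem best_task_iff {u : Fin n} (hu : Alive G B δ u) {e : Fin m} :
    G.Best C b (.task u) e ↔ G.tail e = u ∧
      ∀ f, G.tail f = u → G.value C B δ b e 0 ≤ G.value C B δ b f 0 := by
  obtain ⟨e₀, he₀, hlt⟩ := hu
  rw [D.best_iff hC hb hbβ (x := .task u) ⟨e₀, _, _, (arc_task_iff hC).2 ⟨he₀, rfl, rfl⟩,
    (value_le_whole (B := B) (δ := δ) hC hb.le e₀ 0 (hC.length_pos _)).trans_lt
      (D.whole_lt hb hbβ hlt)⟩]
  constructor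
  · rintro ⟨w, y, ha, h⟩
    obtain ⟨h1, rfl, rfl⟩ := (arc_task_iff hC).1 ha
    exact ⟨h1, fun f hf => h f _ _ ((arc_task_iff hC).2 ⟨hf, rfl, rfl⟩)⟩
  · rintro ⟨h1, h⟩
    refine ⟨_, _, (arc_task_iff hC).2 ⟨h1, rfl, rfl⟩, fun f v z hf => ?_⟩
    obtain ⟨h2, rfl, rfl⟩ := (arc_task_iff hC).1 hf
    exact h f h2

theorem chooses_task_iff {e : Fin m} (hu : Alive G B δ (G.tail e)) :
    G.Chooses C b (.task (G.tail e)) e ↔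
      Pick G (fun f => G.value C B δ b f 0) (fun f => 2 ≤ (C f).length) e := by
  have hbest : ∀ f, (∀ g, G.tail g = G.tail e → G.value C B δ b e 0 ≤ G.value C B δ b g 0) →
      (G.Best C b (.task (G.tail e)) f ↔
        G.tail f = G.tail e ∧ G.value C B δ b f 0 = G.value C B δ b e 0) := by
    intro f he
    rw [D.best_task_iff hC hb hbβ hu]
    constructor
    · rintro ⟨h1, h2⟩
      exact ⟨h1, le_antisymm (h2 e rfl) (he f h1)⟩
    · rintro ⟨h1, h2⟩
      exact ⟨h1, fun g hg => by rw [h2]; exact he g hg⟩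
  rw [Chooses, Pick, D.best_task_iff hC hb hbβ hu]
  simp only [true_and]
  refine and_congr_right fun he => ?_
  simp only [hbest _ he, isChunkArc_task_iff hC, true_and]
  have hEx : (∃! f, (G.tail f = G.tail e ∧ G.value C B δ b f 0 = G.value C B δ b e 0) ∧
        (G.tail f = G.tail e ∧ 2 ≤ (C f).length)) ↔
      ∃! f, (G.tail f = G.tail e ∧ G.value C B δ b f 0 = G.value C B δ b e 0) ∧
        2 ≤ (C f).length := by
    constructor <;> rintro ⟨f, hf, hu⟩
    · exact ⟨f, ⟨hf.1, hf.2.2⟩, fun g hg => hu g ⟨hg.1, hg.1.1, hg.2⟩⟩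
    · exact ⟨f, ⟨hf.1, hf.1.1, hf.2⟩, fun g hg => hu g ⟨hg.1, hg.2.2⟩⟩
  rw [hEx]
  refine or_congr ?_ ?_
  · constructor
    · rintro ⟨⟨f, hf, hu⟩, h2⟩
      refine ⟨h2, fun g hg hv hl => ?_⟩
      rw [hu g ⟨⟨hg, hv⟩, hl⟩, hu e ⟨⟨rfl, rfl⟩, h2⟩]
    · rintro ⟨h2, h⟩
      exact ⟨⟨e, ⟨⟨rfl, rfl⟩, h2⟩, fun g hg => h g hg.1.1 hg.1.2 hg.2⟩, h2⟩
  · refine and_congr_right fun _ => ?_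
    exact ⟨fun h f h1 h2 => h f ⟨h1, h2⟩, fun h f h1 => h f h1.1 h1.2⟩

/-- Inside a chunked edge the next piece is the only outgoing chunk, so every tie is resolved in
favor of continuing and a weak inequality suffices. -/
theorem chooses_mid_iff {e : Fin m} (hu : Alive G B δ (G.tail e)) {i : ℕ} (h0 : 0 < i)
    (hi : i < (C e).length) :
    G.Chooses C b (G.node C e i) e ↔ G.value C B δ b e i ≤ G.altMin B δ b e := by
  have hpiece := Arc.piece (G := G) (C := C) e i hi
  have hval : b * (C e)[i] + G.pot C B δ (G.node C e (i + 1)) = G.value C B δ b e i := by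
    rw [value, rest_succ C e i hi]; ring
  have hlive : ∃ f v z, G.Arc C (G.node C e i) f v z ∧ b * v + G.pot C B δ z < B := by
    obtain ⟨e₀, he₀, hlt⟩ := hu
    by_cases h : e₀ = e
    · subst h
      refine ⟨_, _, _, hpiece, ?_⟩
      rw [hval]
      exact (value_le_whole (B := B) (δ := δ) hC hb.le e₀ i hi).trans_lt (D.whole_lt hb hbβ hlt)
    · refine ⟨e₀, G.cost e₀, .task (G.head e₀), ?_, D.whole_lt hb hbβ hlt⟩
      rw [node_mid G C e h0 hi]
      exact .leave e i h0 hi e₀ h he₀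
  have harc : ∀ f w y, G.Arc C (G.node C e i) f w y → (f = e ∧ w = (C e)[i] ∧ y = G.node C e (i + 1))
      ∨ (f ≠ e ∧ G.tail f = G.tail e ∧ w = G.cost f ∧ y = .task (G.head f)) := by
    intro f w y h
    rw [node_mid G C e h0 hi] at h
    rcases h.cases with ⟨j, hj, hx, rfl, rfl⟩ | ⟨g, j, -, -, hne, ht, hx, rfl, rfl⟩
    · obtain ⟨rfl, rfl⟩ := node_eq_mid hj hx.symm
      exact Or.inl ⟨rfl, rfl, rfl⟩
    · injection hx with h1 h2
      subst h1
      exact Or.inr ⟨hne, ht, rfl, rfl⟩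
  have hbest : G.Best C b (G.node C e i) e ↔ G.value C B δ b e i ≤ G.altMin B δ b e := by
    rw [D.best_iff hC hb hbβ hlive, le_altMin]
    constructor
    · rintro ⟨w, y, ha, h⟩
      rcases harc _ _ _ ha with ⟨-, rfl, rfl⟩ | ⟨h1, -⟩
      · rw [hval] at h
        obtain ⟨f, v, z, hf, hlt⟩ := hlive
        refine ⟨(h f v z hf).trans hlt.le, fun f hf hft => ?_⟩
        refine h f _ (.task (G.head f)) ?_
        rw [node_mid G C e h0 hi]
        exact .leave e i h0 hi f hf hft
      · exact absurd rfl h1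
    · rintro ⟨-, h⟩
      refine ⟨_, _, hpiece, fun f v z hf => ?_⟩
      rcases harc _ _ _ hf with ⟨rfl, rfl, rfl⟩ | ⟨h1, h2, rfl, rfl⟩
      · exact le_rfl
      · rw [hval]
        exact h f h1 h2
  have hchunk : ∀ f, G.IsChunkArc C (G.node C e i) f ↔ f = e := by
    intro f
    constructor
    · rintro ⟨-, j, hj, hx⟩
      rw [node_mid G C e h0 hi] at hx
      exact (node_eq_mid hj hx.symm).1
    · rintro rfl
      exact ⟨by omega, i, hi, rfl⟩
  rw [Chooses, hbest]
  constructor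
  · exact fun h => h.1
  · intro h
    refine ⟨h, Or.inl ⟨⟨e, ⟨hbest.2 h, (hchunk e).2 rfl⟩, fun f hf => (hchunk f).1 hf.2⟩,
      (hchunk e).2 rfl⟩⟩

/-- Everything about the agents from here on is derived from this description: a competition at the
tail, where the other edges may be chunked too, and one inequality for each later piece, in which
they enter undivided. -/
theorem travels_iff {e : Fin m} (hu : Alive G B δ (G.tail e)) :
    G.Travels C b e ↔ Pick G (fun f => G.value C B δ b f 0) (fun f => 2 ≤ (C f).length) e ∧
      ∀ i, 0 < i → i < (C e).length → G.value C B δ b e i ≤ G.altMin B δ b e := by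
  rw [← D.chooses_task_iff hC hb hbβ hu]
  constructor
  · intro h
    refine ⟨?_, fun i h0 hi => (D.chooses_mid_iff hC hb hbβ hu h0 hi).1 (h i hi)⟩
    have := h 0 (hC.length_pos e)
    rwa [node_zero] at this
  · rintro ⟨h1, h2⟩ i hi
    rcases Nat.eq_zero_or_pos i with rfl | h0
    · rwa [node_zero]
    · exact (D.chooses_mid_iff hC hb hbβ hu h0 hi).2 (h2 i h0 hi)

end IsDist

end TaskGraph

end PresentBias

namespace PresentBias

/-! ### Dividing an edge into few pieces -/

/-- `thr b Λ b' Λ' M d j` is the largest remaining cost that can be divided into `j + 1` pieces such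
that the agents with biases `b` and `b'` complete each of them, if they abandon an edge to a
vertex at distance `d` for perceived costs below `Λ` and `Λ'`, and leaving it costs `M`. -/
noncomputable def thr (b Λ b' Λ' M d : ℝ) : ℕ → ℝ
  | 0 => min ((Λ - d) / b) ((Λ' - d) / b')
  | j + 1 => min (thr b Λ b' Λ' M d j + (Λ - min (thr b Λ b' Λ' M d j + d) M) / b)
      (thr b Λ b' Λ' M d j + (Λ' - min (thr b Λ b' Λ' M d j + d) M) / b')

/-- An additional piece never hurts: the unbiased alternative `M` is at most `Λ` and `Λ'`, so both
agents accept a further piece of cost zero. -/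
theorem thr_mono {b Λ b' Λ' M d : ℝ} (hb : 0 < b) (hb' : 0 < b') (h : M ≤ Λ) (h' : M ≤ Λ') :
    Monotone (thr b Λ b' Λ' M d) := by
  refine monotone_nat_of_le_succ fun j => ?_
  have h1 := min_le_right (thr b Λ b' Λ' M d j + d) M
  have h2 : 0 ≤ (Λ - min (thr b Λ b' Λ' M d j + d) M) / b := div_nonneg (by linarith) hb.le
  have h3 : 0 ≤ (Λ' - min (thr b Λ b' Λ' M d j + d) M) / b' := div_nonneg (by linarith) hb'.le
  rw [thr]
  exact le_min (by linarith) (by linarith)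

/-- The cost remaining after `i` pieces, when an edge of cost `c` is divided into `l` pieces. -/
noncomputable def remain (c x : ℝ) (t : ℕ → ℝ) (l i : ℕ) : ℝ :=
  if i = 0 then c else if i < l then min (c - x) (t (l - 1 - i)) else 0

/-- The pieces of an edge of cost `c` of which the first has cost `x`. -/
noncomputable def pieces (c x : ℝ) (t : ℕ → ℝ) (l : ℕ) : List ℝ :=
  (List.range l).map fun i => remain c x t l i - remain c x t l (i + 1)

@[simp] theorem length_pieces (c x : ℝ) (t : ℕ → ℝ) (l : ℕ) : (pieces c x t l).length = l := by
  simp [pieces]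

theorem sum_drop_pieces {c x : ℝ} {t : ℕ → ℝ} {l i : ℕ} (hl : 0 < l) (hi : i ≤ l) :
    ((pieces c x t l).drop i).sum = remain c x t l i := by
  induction hd : l - i generalizing i with
  | zero =>
    rw [List.drop_eq_nil_of_le (by simp; omega), List.sum_nil, remain, if_neg (by omega),
      if_neg (by omega)]
  | succ d ih =>
    rw [List.drop_eq_getElem_cons (by simp; omega), List.sum_cons, ih (by omega) (by omega)]
    simp [pieces]

theorem remain_anti {c x : ℝ} {t : ℕ → ℝ} {l : ℕ} (hx : 0 ≤ x) (hxc : x ≤ c) (ht0 : 0 ≤ t 0)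
    (ht : Monotone t) {i : ℕ} (hi : i < l) : remain c x t l (i + 1) ≤ remain c x t l i := by
  have hpos : ∀ j, 0 ≤ t j := fun j => ht0.trans (ht (Nat.zero_le j))
  rw [remain, remain, if_neg (Nat.succ_ne_zero i)]
  by_cases h0 : i = 0
  · rw [if_pos h0]
    split_ifs
    · exact (min_le_left _ _).trans (by linarith)
    · linarith
  · rw [if_neg h0, if_pos hi]
    split_ifs
    · exact min_le_min le_rfl (ht (by omega))
    · exact le_min (by linarith) (hpos _)

namespace TaskGraph

variable {n m : ℕ} {G : TaskGraph n m} {C : Chunking m}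
variable {β B : ℝ} {ord : Fin n → ℕ} {δ : Fin n → ℝ}

theorem pieces_isChunking {e : Fin m} {x : ℝ} {t : ℕ → ℝ} {l : ℕ} (hl : 0 < l) (hx : 0 ≤ x)
    (hxc : x ≤ G.cost e) (ht0 : 0 ≤ t 0) (ht : Monotone t) :
    pieces (G.cost e) x t l ≠ [] ∧ (∀ y ∈ pieces (G.cost e) x t l, 0 ≤ y) ∧
      (pieces (G.cost e) x t l).sum = G.cost e := by
  refine ⟨fun h => ?_, fun y hy => ?_, ?_⟩
  · have := congrArg List.length h
    simp at this
    omega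
  · simp only [pieces, List.mem_map, List.mem_range] at hy
    obtain ⟨i, hi, rfl⟩ := hy
    exact sub_nonneg.2 (remain_anti hx hxc ht0 ht hi)
  · have := sum_drop_pieces (c := G.cost e) (x := x) (t := t) hl (Nat.zero_le l)
    rwa [List.drop_zero, remain, if_pos rfl] at this

variable (G) in
/-- The perceived cost of a chunked edge whose first piece has cost `x`. -/
noncomputable def part (B : ℝ) (δ : Fin n → ℝ) (b : ℝ) (e : Fin m) (x : ℝ) : ℝ :=
  b * x + min (G.cost e - x + δ (G.head e)) (G.altMin B δ 1 e)

variable (G) in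
/-- The first piece that leads to the perceived cost `v`. -/
noncomputable def partInv (B : ℝ) (δ : Fin n → ℝ) (b : ℝ) (e : Fin m) (v : ℝ) : ℝ :=
  max ((v - (G.cost e + δ (G.head e))) / (b - 1)) ((v - G.altMin B δ 1 e) / b)

/-- `part` is the minimum of two affine functions of the first piece, with the positive slopes `b -
1` and `b`, and `partInv` is the maximum of their inverses. So the two functions are inverse to each
other. -/
theorem part_le_iff {b : ℝ} (hb : 1 < b) {e : Fin m} {x v : ℝ} :
    v ≤ G.part B δ b e x ↔ G.partInv B δ b e v ≤ x := by
  rw [part, partInv, max_le_iff, div_le_iff₀ (by linarith), div_le_iff₀ (by linarith),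
    ← min_add_add_left, le_min_iff]
  constructor <;> rintro ⟨h1, h2⟩ <;> constructor <;> linarith

theorem part_lt_iff {b : ℝ} (hb : 1 < b) {e : Fin m} {x v : ℝ} :
    v < G.part B δ b e x ↔ G.partInv B δ b e v < x := by
  rw [part, partInv, max_lt_iff, div_lt_iff₀ (by linarith), div_lt_iff₀ (by linarith),
    ← min_add_add_left, lt_min_iff]
  constructor <;> rintro ⟨h1, h2⟩ <;> constructor <;> linarith

theorem part_partInv {b : ℝ} (hb : 1 < b) (e : Fin m) (v : ℝ) :
    G.part B δ b e (G.partInv B δ b e v) = v := by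
  refine le_antisymm ?_ ((part_le_iff hb).2 le_rfl)
  exact not_lt.1 fun h => lt_irrefl _ ((part_lt_iff hb).1 h)

theorem part_strictMono {b : ℝ} (hb : 1 < b) (e : Fin m) : StrictMono (G.part B δ b e) := by
  intro x y hxy
  refine (part_lt_iff hb).2 (lt_of_le_of_lt ((part_le_iff hb).1 le_rfl) hxy)

theorem partInv_part {b : ℝ} (hb : 1 < b) (e : Fin m) (x : ℝ) :
    G.partInv B δ b e (G.part B δ b e x) = x :=
  (part_strictMono hb e).injective (part_partInv hb e _)

variable (G) in
/-- The first head among the other edges with the same tail and the least perceived cost. -/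
noncomputable def altHead (B : ℝ) (δ : Fin n → ℝ) (b : ℝ) (e : Fin m) : ℕ :=
  ({f ∈ G.alts e | G.whole δ b f = G.altMin B δ b e}).fold min n fun f => (G.head f : ℕ)

theorem lt_altHead {b : ℝ} {e : Fin m} {h : Fin n} : (h : ℕ) < G.altHead B δ b e ↔
    ∀ f, f ≠ e → G.tail f = G.tail e → G.whole δ b f = G.altMin B δ b e → h < G.head f := by
  simp only [altHead, Finset.lt_fold_min, h.2, true_and, Finset.mem_filter, mem_alts, and_imp,
    Fin.lt_def]

/-- An agent takes the edge if no edge with this tail is chunked. -/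
def Natural (G : TaskGraph n m) (B : ℝ) (δ : Fin n → ℝ) (b : ℝ) (e : Fin m) : Prop :=
  G.whole δ b e < G.altMin B δ b e ∨
    (G.whole δ b e = G.altMin B δ b e ∧ (G.head e : ℕ) < G.altHead B δ b e)

theorem Natural.le {b : ℝ} {e : Fin m} (h : Natural G B δ b e) :
    G.whole δ b e ≤ G.altMin B δ b e := h.elim le_of_lt fun h => h.1.le

theorem Natural.head_lt {b : ℝ} {e f : Fin m} (h : Natural G B δ b e) (hf : f ≠ e)
    (ht : G.tail f = G.tail e) (hv : G.whole δ b f ≤ G.whole δ b e) : G.head e < G.head f := by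
  have h1 := altMin_le (B := B) (δ := δ) (b := b) hf ht
  rcases h with h | ⟨h, h2⟩
  · linarith
  · exact lt_altHead.1 h2 f hf ht (by linarith)

/-- Two such edges would have equal perceived costs, and the head of each would precede that of the
other. -/
theorem Natural.unique {b : ℝ} {e f : Fin m} (h : Natural G B δ b e) (h' : Natural G B δ b f)
    (ht : G.tail f = G.tail e) : f = e := by
  by_contra hf
  have h1 := h.le.trans (altMin_le hf ht)
  have h2 := h'.le.trans (altMin_le (Ne.symm hf) ht.symm)
  exact lt_asymm (h.head_lt hf ht h2) (h'.head_lt (Ne.symm hf) ht.symm h1)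

variable (G) in
/-- The remaining costs of `e` that two agents complete in a given number of pieces. -/
noncomputable def reach (B : ℝ) (δ : Fin n → ℝ) (b b' : ℝ) (e : Fin m) : ℕ → ℝ :=
  thr b (G.altMin B δ b e) b' (G.altMin B δ b' e) (G.altMin B δ 1 e) (δ (G.head e))

theorem reach_mono {b b' : ℝ} (hb : 1 < b) (hb' : 1 < b') (e : Fin m) :
    Monotone (G.reach B δ b b' e) :=
  thr_mono (by linarith) (by linarith) (IsDist.altMin_mono hb.le e) (IsDist.altMin_mono hb'.le e)

/-- Two agents can be made to take the edge in `l` pieces. -/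
def Feas (G : TaskGraph n m) (B : ℝ) (δ : Fin n → ℝ) (b b' : ℝ) (e : Fin m) (l : ℕ) : Prop :=
  2 ≤ l ∧ 0 ≤ G.reach B δ b b' e 0 ∧ G.cost e ≤ G.reach B δ b b' e (l - 1)

theorem value_zero_of_length_eq (hC : G.IsChunking C) {b : ℝ} {e : Fin m}
    (h : (C e).length = 1) : G.value C B δ b e 0 = G.whole δ b e := by
  rw [value_last (by omega), hC.rest_zero, whole]

theorem value_zero_of_two_le (hC : G.IsChunking C) {b : ℝ} {e : Fin m}
    (h : 2 ≤ (C e).length) :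
    G.value C B δ b e 0 = G.part B δ b e (G.cost e - rest C e 1) := by
  rw [value_mid (by omega), hC.rest_zero, part, zero_add]
  congr 2
  ring

/-- The pieces of an edge that two agents complete are not too large. -/
theorem rest_le_reach {b b' : ℝ} (hb : 1 < b) (hb' : 1 < b') {e : Fin m}
    (j : ℕ) (hj : j < (C e).length)
    (h : ∀ i, (C e).length - 1 - j ≤ i → i < (C e).length →
      G.value C B δ b e i ≤ G.altMin B δ b e ∧ G.value C B δ b' e i ≤ G.altMin B δ b' e) :
    rest C e ((C e).length - 1 - j) ≤ G.reach B δ b b' e j := by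
  induction j with
  | zero =>
    have h1 := h ((C e).length - 1) le_rfl (by omega)
    rw [value_last (by omega), value_last (by omega)] at h1
    rw [reach, thr, le_min_iff, le_div_iff₀ (by linarith), le_div_iff₀ (by linarith)]
    constructor <;> simp only [Nat.sub_zero] <;> linarith
  | succ j ih =>
    have h0 := ih (by omega) fun i h1 h2 => h i (by omega) h2
    set i := (C e).length - 1 - (j + 1) with hi
    rw [show (C e).length - 1 - j = i + 1 by omega] at h0
    have h1 := h i le_rfl (by omega)
    rw [value_mid (by omega), value_mid (by omega)] at h1
    set T := G.reach B δ b b' e j with hT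
    have key : ∀ b'', 1 < b'' → b'' * (rest C e i - rest C e (i + 1)) +
        min (rest C e (i + 1) + δ (G.head e)) (G.altMin B δ 1 e) ≤ G.altMin B δ b'' e →
        rest C e i ≤ T + (G.altMin B δ b'' e - min (T + δ (G.head e)) (G.altMin B δ 1 e)) / b'' := by
      intro b'' hb'' h2
      rw [← sub_le_iff_le_add', le_div_iff₀ (by linarith)]
      -- The minimum grows at most as fast as the remaining cost, while the factor `b'' > 1` rewards
      -- a larger remainder. So replacing the remainder after this piece by its upper bound `T` only
      -- relaxes the constraint.
      have h3 : min (T + δ (G.head e)) (G.altMin B δ 1 e) ≤ (T - rest C e (i + 1)) +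
          min (rest C e (i + 1) + δ (G.head e)) (G.altMin B δ 1 e) := by
        rw [← min_add_add_left]
        exact min_le_min (by linarith) (by linarith)
      nlinarith
    have : G.reach B δ b b' e (j + 1) =
      min (T + (G.altMin B δ b e - min (T + δ (G.head e)) (G.altMin B δ 1 e)) / b)
        (T + (G.altMin B δ b' e - min (T + δ (G.head e)) (G.altMin B δ 1 e)) / b') := rfl
    rw [this]
    exact le_min (key b hb h1.1) (key b' hb' h1.2)

/-- If the costs that remain are bounded by `t`, then an agent completes the pieces of the edge. -/
theorem value_le_of_rest {b : ℝ} (hb : 1 < b) {e : Fin m} {l : ℕ}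
    (hl : (C e).length = l) {x : ℝ} {t : ℕ → ℝ}
    (hr : ∀ i ≤ l, rest C e i = remain (G.cost e) x t l i)
    (ht0 : t 0 ≤ (G.altMin B δ b e - δ (G.head e)) / b)
    (ht : ∀ j, t (j + 1) ≤ t j + (G.altMin B δ b e - min (t j + δ (G.head e)) (G.altMin B δ 1 e)) / b)
    {i : ℕ} (h0 : 0 < i) (hi : i < l) : G.value C B δ b e i ≤ G.altMin B δ b e := by
  have hM := IsDist.altMin_mono (G := G) (B := B) (δ := δ) hb.le e
  have hri := hr i hi.le
  rw [remain, if_neg h0.ne', if_pos hi] at hri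
  rcases (show i + 1 ≤ l from hi).eq_or_lt with h1 | h1
  · rw [value_last (by omega), hri]
    rw [show l - 1 - i = 0 by omega]
    rw [le_div_iff₀ (by linarith)] at ht0
    have := min_le_right (G.cost e - x) (t 0)
    nlinarith
  · have hrs := hr (i + 1) h1.le
    rw [remain, if_neg (Nat.succ_ne_zero i), if_pos h1] at hrs
    obtain ⟨j, hj⟩ : ∃ j, l - 1 - i = j + 1 := ⟨l - 1 - i - 1, by omega⟩
    rw [hj] at hri
    rw [show l - 1 - (i + 1) = j by omega] at hrs
    rw [value_mid (by omega), hri, hrs]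
    -- If the cap `cost e - x` is active after this piece, the piece costs nothing, and its
    -- perceived cost is at most the unbiased alternative. Otherwise the recursive bound `ht`
    -- applies.
    rcases le_total (G.cost e - x) (t j) with h2 | h2
    · rw [min_eq_left h2]
      have h3 := min_le_left (G.cost e - x) (t (j + 1))
      have h4 := min_le_right (G.cost e - x + δ (G.head e)) (G.altMin B δ 1 e)
      nlinarith
    · rw [min_eq_right h2]
      have h3 := (min_le_right (G.cost e - x) (t (j + 1))).trans (ht j)
      rw [← sub_le_iff_le_add', le_div_iff₀ (by linarith)] at h3
      linarith

theorem length_eq_one_or (hC : G.IsChunking C) (e : Fin m) :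
    (C e).length = 1 ∨ 2 ≤ (C e).length := by
  have := hC.length_pos e
  omega

theorem value_zero_le (hC : G.IsChunking C) {b : ℝ} (hb : 1 < b) (e : Fin m) :
    G.value C B δ b e 0 ≤ G.whole δ b e :=
  value_le_whole hC hb.le e 0 (hC.length_pos e)

theorem head_ne {e f : Fin m} (hf : f ≠ e) (ht : G.tail f = G.tail e) : G.head f ≠ G.head e :=
  fun h => hf (G.simple f e ht h)

namespace IsDist

variable (D : G.IsDist β B ord δ) (hC : G.IsChunking C) {b : ℝ} (hb : 1 < b) (hbβ : b ≤ β)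
include D hC hb hbβ

/-- Dividing an edge only lowers the perceived cost of starting it, so an edge that beats its rivals
also beats them undivided. The bound `B`, which is part of `altMin`, is covered by an edge from
which the sink can be reached. -/
theorem value_le_altMin {e : Fin m} (hu : Alive G B δ (G.tail e))
    (h : ∀ f, G.tail f = G.tail e → G.value C B δ b e 0 ≤ G.value C B δ b f 0) :
    G.value C B δ b e 0 ≤ G.altMin B δ b e := by
  rw [le_altMin]
  obtain ⟨f, hf, hlt⟩ := hu
  refine ⟨?_, fun f _ hf => (h f hf).trans (value_zero_le hC hb f)⟩
  exact (h f hf).trans ((value_zero_le hC hb f).trans (D.whole_lt hb hbβ hlt).le)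

/-- An agent that takes an edge which is not chunked also takes it without any chunks. -/
theorem natural_of_travels {e : Fin m} (hu : Alive G B δ (G.tail e)) (h : G.Travels C b e)
    (hl : (C e).length = 1) : Natural G B δ b e := by
  obtain ⟨⟨h1, h2⟩, -⟩ := (D.travels_iff hC hb hbβ hu).1 h
  have h3 := D.value_le_altMin hC hb hbβ hu h1
  rw [value_zero_of_length_eq hC hl] at h3
  rcases h3.lt_or_eq with h3 | h3
  · exact Or.inl h3
  refine Or.inr ⟨h3, lt_altHead.2 fun f hf ht hv => ?_⟩
  rcases h2 with ⟨h2, -⟩ | ⟨-, h2⟩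
  · omega
  · refine lt_of_le_of_ne (h2 f ht (le_antisymm ?_ (h1 f ht))) (head_ne hf ht).symm
    beta_reduce
    rw [value_zero_of_length_eq hC hl, h3, ← hv]
    exact value_zero_le hC hb f

theorem part_le_of_travels {e : Fin m} (hu : Alive G B δ (G.tail e)) (h : G.Travels C b e)
    (hl : 2 ≤ (C e).length) :
    G.part B δ b e (G.cost e - rest C e 1) ≤ G.altMin B δ b e ∧
      ∀ i, i < (C e).length → G.value C B δ b e i ≤ G.altMin B δ b e := by
  obtain ⟨⟨h1, -⟩, h2⟩ := (D.travels_iff hC hb hbβ hu).1 h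
  have h3 := D.value_le_altMin hC hb hbβ hu h1
  refine ⟨by rwa [← value_zero_of_two_le hC hl], fun i hi => ?_⟩
  rcases Nat.eq_zero_or_pos i with rfl | h0
  · exact h3
  · exact h2 i h0 hi

/-- An agent that would take an edge without any chunks does so if there are no chunks. -/
theorem travels_of_natural {e : Fin m} (hu : Alive G B δ (G.tail e)) (h : Natural G B δ b e)
    (hl : ∀ f, G.tail f = G.tail e → (C f).length = 1) : G.Travels C b e := by
  rw [D.travels_iff hC hb hbβ hu]
  have hv : ∀ f, G.tail f = G.tail e → G.value C B δ b f 0 = G.whole δ b f :=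
    fun f hf => value_zero_of_length_eq hC (hl f hf)
  refine ⟨⟨fun f hf => ?_, Or.inr ⟨?_, fun f hf hvf => ?_⟩⟩, fun i h0 hi => ?_⟩
  · beta_reduce
    rw [hv f hf, hv e rfl]
    by_cases hfe : f = e
    · rw [hfe]
    · exact h.le.trans (altMin_le hfe hf)
  · rintro ⟨f, ⟨⟨hf, -⟩, h2⟩, -⟩
    have := hl f hf
    omega
  · by_cases hfe : f = e
    · rw [hfe]
    · beta_reduce at hvf
      rw [hv f hf, hv e rfl] at hvf
      exact (h.head_lt hfe hf hvf.le).le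
  · have := hl e rfl
    omega

omit hC in
-- Every piece, the first included, must be perceived as no worse than `altMin`, so `rest_le_reach`
-- applies at every position: at the last piece, at the start, and after the first piece. The last
-- of these bounds the first piece from below.
theorem feas_of_travels {b' : ℝ} (hb' : 1 < b') (hbβ' : b' ≤ β) (hC : G.IsChunking C) {e : Fin m}
    (hu : Alive G B δ (G.tail e))
    (h : G.Travels C b e) (h' : G.Travels C b' e) (hl : 2 ≤ (C e).length) :
    Feas G B δ b b' e (C e).length ∧
      rest C e 1 ≤ G.reach B δ b b' e ((C e).length - 2) := by
  have h1 := D.part_le_of_travels hC hb hbβ hu h hl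
  have h2 := D.part_le_of_travels hC hb' hbβ' hu h' hl
  have key := fun j hj => rest_le_reach (B := B) (δ := δ) (b := b) (b' := b') hb hb' (e := e)
    j hj fun i _ hi => ⟨h1.2 i hi, h2.2 i hi⟩
  refine ⟨⟨hl, ?_, ?_⟩, ?_⟩
  · exact (hC.rest_nonneg e _).trans (key 0 (by omega))
  · have := key ((C e).length - 1) (by omega)
    rwa [Nat.sub_self, hC.rest_zero] at this
  · have := key ((C e).length - 2) (by omega)
    rwa [show (C e).length - 1 - ((C e).length - 2) = 1 by omega] at this

/-- An edge that is the only chunked edge at its tail is taken if its first piece is small. -/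
theorem travels_of_part_le {e : Fin m} (hu : Alive G B δ (G.tail e)) (h2 : 2 ≤ (C e).length)
    (h : G.part B δ b e (G.cost e - rest C e 1) ≤ G.altMin B δ b e)
    (hmid : ∀ i, 0 < i → i < (C e).length → G.value C B δ b e i ≤ G.altMin B δ b e)
    (hl : ∀ f, f ≠ e → G.tail f = G.tail e → (C f).length = 1) : G.Travels C b e := by
  rw [D.travels_iff hC hb hbβ hu]
  refine ⟨⟨fun f hf => ?_, Or.inl ⟨h2, fun f hf hvf h2f => ?_⟩⟩, hmid⟩
  · by_cases hfe : f = e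
    · rw [hfe]
    · beta_reduce
      rw [value_zero_of_two_le hC h2, value_zero_of_length_eq hC (hl f hfe hf)]
      exact h.trans (altMin_le hfe hf)
  · by_contra hfe
    have := hl f hfe hf
    omega

end IsDist

end TaskGraph

end PresentBias

namespace PresentBias

namespace TaskGraph

variable {n m : ℕ} {G : TaskGraph n m} {C : Chunking m}
variable {β B : ℝ} {ord : Fin n → ℕ} {δ : Fin n → ℝ}

/-! ### Two agents at a vertex -/

/-- The number of chunks on edges out of `u`. -/
def use (G : TaskGraph n m) (C : Chunking m) (u : Fin n) : ℕ :=
  ∑ e with G.tail e = u, if (C e).length = 1 then 0 else (C e).length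

theorem length_le_use {e : Fin m} (he : 2 ≤ (C e).length) : (C e).length ≤ G.use C (G.tail e) := by
  have := Finset.single_le_sum
    (f := fun e => if (C e).length = 1 then 0 else (C e).length) (fun _ _ => Nat.zero_le _)
    (show e ∈ ({f | G.tail f = G.tail e} : Finset (Fin m)) by simp)
  rwa [if_neg (by omega)] at this

theorem length_add_length_le_use {e f : Fin m} (hf : f ≠ e) (ht : G.tail f = G.tail e)
    (he : 2 ≤ (C e).length) (h2 : 2 ≤ (C f).length) :
    (C e).length + (C f).length ≤ G.use C (G.tail e) := by
  have := Finset.sum_le_sum_of_subset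
    (f := fun e => if (C e).length = 1 then 0 else (C e).length)
    (show ({e, f} : Finset (Fin m)) ⊆ ({f | G.tail f = G.tail e} : Finset (Fin m)) by
      intro g hg
      simp only [Finset.mem_insert, Finset.mem_singleton] at hg
      rcases hg with rfl | rfl <;> simp [ht])
  rw [Finset.sum_pair hf.symm, if_neg (by omega), if_neg (by omega)] at this
  exact this

/-- The chunked edge `e` is taken for the perceived cost `p` if another chunked edge `f` has the
perceived cost `q`, and no further edge with the same tail is chunked. -/
def Wins (G : TaskGraph n m) (B : ℝ) (δ : Fin n → ℝ) (b : ℝ) (e f : Fin m) (p q : ℝ) : Prop :=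
  p ≤ G.altMin B δ b e ∧ (p < q ∨ p = q ∧ G.head e < G.head f ∧
    (p < G.altMin B δ b e ∨ (G.head e : ℕ) < G.altHead B δ b e))

/-- The chunked edge `f` with first piece `z` attracts the agent with bias `b` as much as the edge
`e`, but the agent with bias `b'` prefers the chunked edge `e'` with first piece `y`. -/
def Third (G : TaskGraph n m) (B : ℝ) (δ : Fin n → ℝ) (b b' : ℝ) (e e' : Fin m) (y : ℝ)
    (f : Fin m) (z : ℝ) : Prop :=
  f ≠ e ∧ f ≠ e' ∧ G.tail f = G.tail e' ∧ (0 ≤ z ∧ z ≤ G.cost f) ∧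
    G.part B δ b f z = G.whole δ b e ∧ G.head e < G.head f ∧
    Wins G B δ b' e' f (G.part B δ b' e' y) (G.part B δ b' f z)

/-- The largest first piece for which two agents take an edge. -/
noncomputable def maxFirst (G : TaskGraph n m) (B : ℝ) (δ : Fin n → ℝ) (b b' : ℝ) (e : Fin m) : ℝ :=
  min (G.cost e)
    (min (G.partInv B δ b e (G.altMin B δ b e)) (G.partInv B δ b' e (G.altMin B δ b' e)))

theorem part_maxFirst_le {b b' : ℝ} (hb : 1 < b) (hb' : 1 < b') (e : Fin m) :
    G.part B δ b e (G.maxFirst B δ b b' e) ≤ G.altMin B δ b e ∧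
      G.part B δ b' e (G.maxFirst B δ b b' e) ≤ G.altMin B δ b' e := by
  constructor
  · refine ((part_strictMono hb e).monotone ((min_le_right _ _).trans (min_le_left _ _))).trans ?_
    rw [part_partInv hb]
  · refine ((part_strictMono hb' e).monotone ((min_le_right _ _).trans (min_le_right _ _))).trans ?_
    rw [part_partInv hb']

theorem le_maxFirst {b b' : ℝ} (hb : 1 < b) (hb' : 1 < b') {e : Fin m} {x : ℝ}
    (hx : x ≤ G.cost e) (h : G.part B δ b e x ≤ G.altMin B δ b e)
    (h' : G.part B δ b' e x ≤ G.altMin B δ b' e) : x ≤ G.maxFirst B δ b b' e := by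
  refine le_min hx (le_min ?_ ?_)
  · exact not_lt.1 fun h1 => absurd ((part_lt_iff hb).2 h1) (not_lt.2 h)
  · exact not_lt.1 fun h1 => absurd ((part_lt_iff hb').2 h1) (not_lt.2 h')

/-- The final step of the recursion for `reach`, read backwards, says that both agents accept a
first piece that leaves `reach (l - 2)`. So the interval of possible first pieces is nonempty for
every feasible `l`, and its upper end is the same for all `l`. -/
theorem Feas.maxFirst {b b' : ℝ} (hb : 1 < b) (hb' : 1 < b') {e : Fin m} {l : ℕ}
    (h : Feas G B δ b b' e l) : max 0 (G.cost e - G.reach B δ b b' e (l - 2)) ≤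
      G.maxFirst B δ b b' e := by
  obtain ⟨hl, h0, h1⟩ := h
  obtain ⟨j, rfl⟩ : ∃ j, l = j + 2 := ⟨l - 2, by omega⟩
  simp only [Nat.add_sub_cancel, show j + 2 - 1 = j + 1 by omega] at h1 ⊢
  have hpos : 0 ≤ G.reach B δ b b' e j := h0.trans (reach_mono hb hb' e (Nat.zero_le j))
  set T := G.reach B δ b b' e j with hT
  have hs : G.reach B δ b b' e (j + 1) =
      min (T + (G.altMin B δ b e - min (T + δ (G.head e)) (G.altMin B δ 1 e)) / b)
        (T + (G.altMin B δ b' e - min (T + δ (G.head e)) (G.altMin B δ 1 e)) / b') := rfl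
  rw [hs, le_min_iff] at h1
  have key : ∀ b'', 1 < b'' →
      G.cost e ≤ T + (G.altMin B δ b'' e - min (T + δ (G.head e)) (G.altMin B δ 1 e)) / b'' →
      G.part B δ b'' e (max 0 (G.cost e - T)) ≤ G.altMin B δ b'' e := by
    intro b'' hb'' h2
    rw [← sub_le_iff_le_add', le_div_iff₀ (by linarith)] at h2
    rw [part]
    rcases le_total 0 (G.cost e - T) with h3 | h3
    · rw [max_eq_right h3, show G.cost e - (G.cost e - T) = T by ring]
      linarith
    · rw [max_eq_left h3, mul_zero, zero_add]
      exact (min_le_right _ _).trans (IsDist.altMin_mono hb''.le e)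
  refine le_maxFirst hb hb' (max_le (G.cost_nonneg e) (by linarith)) (key b hb h1.1) (key b' hb' h1.2)

/-- The edge is divided into `l` pieces, the first of cost `x`,
such that agents with biases `b` and `b'` complete the pieces after the first. -/
def Splits (G : TaskGraph n m) (B : ℝ) (δ : Fin n → ℝ) (C : Chunking m) (b b' : ℝ) (e : Fin m)
    (l : ℕ) (x : ℝ) : Prop :=
  2 ≤ l ∧ C e = pieces (G.cost e) x (G.reach B δ b b' e) l ∧ 0 ≤ x ∧ x ≤ G.cost e ∧
    0 ≤ G.reach B δ b b' e 0 ∧ G.cost e - x ≤ G.reach B δ b b' e (l - 2)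

theorem Splits.length {b b' : ℝ} {e : Fin m} {l : ℕ} {x : ℝ}
    (h : Splits G B δ C b b' e l x) : (C e).length = l := by rw [h.2.1, length_pieces]

theorem rest_of_pieces {e : Fin m} {l : ℕ} {x : ℝ} {t : ℕ → ℝ} (hl : 2 ≤ l)
    (h : C e = pieces (G.cost e) x t l) {i : ℕ} (hi : i ≤ l) :
    rest C e i = remain (G.cost e) x t l i := by
  rw [rest, h, sum_drop_pieces (by omega) hi]

theorem first_of_pieces {e : Fin m} {l : ℕ} {x : ℝ} {t : ℕ → ℝ} (hl : 2 ≤ l)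
    (h : C e = pieces (G.cost e) x t l) (hx : G.cost e - x ≤ t (l - 2)) :
    G.cost e - rest C e 1 = x := by
  rw [rest_of_pieces hl h (by omega), remain, if_neg one_ne_zero, if_pos (by omega),
    show l - 1 - 1 = l - 2 by omega, min_eq_left hx]
  ring

theorem Splits.first {b b' : ℝ} {e : Fin m} {l : ℕ} {x : ℝ}
    (h : Splits G B δ C b b' e l x) : G.cost e - rest C e 1 = x :=
  first_of_pieces h.1 h.2.1 h.2.2.2.2.2

theorem Splits.value_le {b b' : ℝ} (hb : 1 < b) (hb' : 1 < b') {e : Fin m} {l : ℕ} {x : ℝ}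
    (h : Splits G B δ C b b' e l x) {i : ℕ} (h0 : 0 < i) (hi : i < (C e).length) :
    G.value C B δ b e i ≤ G.altMin B δ b e ∧ G.value C B δ b' e i ≤ G.altMin B δ b' e := by
  have hr : ∀ i ≤ l, rest C e i = remain (G.cost e) x (G.reach B δ b b' e) l i :=
    fun i hi => rest_of_pieces h.1 h.2.1 hi
  rw [h.length] at hi
  constructor
  · exact value_le_of_rest hb h.length hr (min_le_left _ _) (fun j => min_le_left _ _) h0 hi
  · exact value_le_of_rest hb' h.length hr (min_le_right _ _) (fun j => min_le_right _ _) h0 hi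

theorem Feas.splits {b b' : ℝ} (hb : 1 < b) (hb' : 1 < b') {e : Fin m} {l : ℕ}
    (h : Feas G B δ b b' e l)
    (hC : C e = pieces (G.cost e) (G.maxFirst B δ b b' e) (G.reach B δ b b' e) l) :
    Splits G B δ C b b' e l (G.maxFirst B δ b b' e) := by
  have h1 := h.maxFirst hb hb'
  rw [max_le_iff] at h1
  exact ⟨h.1, hC, h1.1, min_le_left _ _, h.2.1, by linarith⟩

theorem Splits.isChunking {b b' : ℝ} (hb : 1 < b) (hb' : 1 < b') {e : Fin m} {l : ℕ} {x : ℝ}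
    (h : Splits G B δ C b b' e l x) :
    C e ≠ [] ∧ (∀ y ∈ C e, 0 ≤ y) ∧ (C e).sum = G.cost e := by
  rw [h.2.1]
  exact pieces_isChunking (by have := h.1; omega) h.2.2.1 h.2.2.2.1 h.2.2.2.2.1 (reach_mono hb hb' e)

theorem first_mem (hC : G.IsChunking C) (e : Fin m) :
    0 ≤ G.cost e - rest C e 1 ∧ G.cost e - rest C e 1 ≤ G.cost e :=
  ⟨by linarith [hC.rest_le e 1], by linarith [hC.rest_nonneg e 1]⟩

namespace IsDist

variable (D : G.IsDist β B ord δ) (hC : G.IsChunking C) {b : ℝ} (hb : 1 < b) (hbβ : b ≤ β)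
include D hC hb hbβ

/-- One edge is taken by two agents if it is the only chunked edge at its tail. -/
theorem travels_of_splits {b' : ℝ} (hb' : 1 < b') (hbβ' : b' ≤ β) {e : Fin m}
    (hu : Alive G B δ (G.tail e)) {l : ℕ} (h : Feas G B δ b b' e l)
    (hp : C e = pieces (G.cost e) (G.maxFirst B δ b b' e) (G.reach B δ b b' e) l)
    (hl : ∀ f, f ≠ e → G.tail f = G.tail e → (C f).length = 1) :
    G.Travels C b e ∧ G.Travels C b' e := by
  have hs := h.splits hb hb' hp
  have h1 := part_maxFirst_le (G := G) (B := B) (δ := δ) hb hb' e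
  have h2 : 2 ≤ (C e).length := by rw [hs.length]; exact h.1
  constructor
  · refine D.travels_of_part_le hC hb hbβ hu h2 (by rw [hs.first]; exact h1.1) ?_ hl
    exact fun i h0 hi => (hs.value_le hb hb' h0 hi).1
  · refine D.travels_of_part_le hC hb' hbβ' hu h2 (by rw [hs.first]; exact h1.2) ?_ hl
    exact fun i h0 hi => (hs.value_le hb hb' h0 hi).2

/-- If `e` and `f` tie, the tied chunk is not unique, so the order of the vertices decides among all
tied edges, including those in one piece. This is the reason for the last clause of `Wins`. Further
chunked edges do no harm here, since their perceived cost is at most that of the whole edge. -/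
theorem wins_of_travels {e f : Fin m} (hu : Alive G B δ (G.tail e)) (h : G.Travels C b e)
    (hf : f ≠ e) (ht : G.tail f = G.tail e) (h2 : 2 ≤ (C e).length) (h2f : 2 ≤ (C f).length) :
    Wins G B δ b e f (G.part B δ b e (G.cost e - rest C e 1))
      (G.part B δ b f (G.cost f - rest C f 1)) := by
  obtain ⟨⟨h1, h3⟩, -⟩ := (D.travels_iff hC hb hbβ hu).1 h
  beta_reduce at h1 h3
  have h4 := D.value_le_altMin hC hb hbβ hu h1
  rw [← value_zero_of_two_le hC h2, ← value_zero_of_two_le hC h2f]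
  refine ⟨h4, ?_⟩
  rcases (h1 f ht).lt_or_eq with h5 | h5
  · exact Or.inl h5
  refine Or.inr ⟨h5, ?_⟩
  rcases h3 with ⟨-, h3⟩ | ⟨-, h3⟩
  · exact absurd (h3 f ht h5.symm h2f) hf
  refine ⟨lt_of_le_of_ne (h3 f ht h5.symm) (head_ne hf ht).symm, ?_⟩
  rcases h4.lt_or_eq with h6 | h6
  · exact Or.inl h6
  · refine Or.inr (lt_altHead.2 fun g hg htg hv => ?_)
    refine lt_of_le_of_ne (h3 g htg (le_antisymm ?_ (h1 g htg))) (head_ne hg htg).symm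
    rw [h6, ← hv]
    exact value_zero_le hC hb g

theorem travels_of_wins {e f : Fin m} (hu : Alive G B δ (G.tail e))
    (hf : f ≠ e) (ht : G.tail f = G.tail e) (h2 : 2 ≤ (C e).length) (h2f : 2 ≤ (C f).length)
    (h : Wins G B δ b e f (G.part B δ b e (G.cost e - rest C e 1))
      (G.part B δ b f (G.cost f - rest C f 1)))
    (hmid : ∀ i, 0 < i → i < (C e).length → G.value C B δ b e i ≤ G.altMin B δ b e)
    (hl : ∀ g, g ≠ e → g ≠ f → G.tail g = G.tail e → (C g).length = 1) : G.Travels C b e := by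
  rw [← value_zero_of_two_le hC h2, ← value_zero_of_two_le hC h2f] at h
  rw [D.travels_iff hC hb hbβ hu]
  obtain ⟨h4, h5⟩ := h
  have hef : G.value C B δ b e 0 ≤ G.value C B δ b f 0 := h5.elim le_of_lt fun h => h.1.le
  have hg : ∀ g, g ≠ e → g ≠ f → G.tail g = G.tail e →
      G.value C B δ b g 0 = G.whole δ b g := fun g h1 h2 h3 =>
    value_zero_of_length_eq hC (hl g h1 h2 h3)
  refine ⟨⟨fun g htg => ?_, ?_⟩, hmid⟩
  · beta_reduce
    by_cases hge : g = e
    · rw [hge]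
    by_cases hgf : g = f
    · rw [hgf]; exact hef
    rw [hg g hge hgf htg]
    exact h4.trans (altMin_le hge htg)
  · beta_reduce
    rcases h5 with h5 | ⟨h5, h6, h7⟩
    · refine Or.inl ⟨h2, fun g htg hv hg2 => ?_⟩
      by_contra hge
      by_cases hgf : g = f
      · rw [hgf] at hv; linarith
      · have := hl g hge hgf htg
        omega
    · refine Or.inr ⟨?_, fun g htg hv => ?_⟩
      · rintro ⟨g, -, hu⟩
        have h8 := hu e ⟨⟨rfl, rfl⟩, h2⟩
        have h9 := hu f ⟨⟨ht, h5.symm⟩, h2f⟩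
        exact hf (h9.trans h8.symm)
      · by_cases hge : g = e
        · rw [hge]
        by_cases hgf : g = f
        · rw [hgf]; exact h6.le
        rw [hg g hge hgf htg] at hv
        have h8 := altMin_le (B := B) (δ := δ) (b := b) hge htg
        rcases h7 with h7 | h7
        · linarith
        · exact (lt_altHead.1 h7 g hge htg (by linarith)).le

/-- An undivided edge can win a tie against a chunk only if there is a second tied chunk, because a
single one would be preferred. This is the origin of third edges: a chunked edge that nobody takes,
but that restores the order of the vertices as the criterion. -/
theorem whole_le_of_travels {e f : Fin m} (hu : Alive G B δ (G.tail e)) (h : G.Travels C b e)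
    (hf : f ≠ e) (ht : G.tail f = G.tail e) (h1 : (C e).length = 1) (h2f : 2 ≤ (C f).length) :
    G.whole δ b e < G.part B δ b f (G.cost f - rest C f 1) ∨
    (G.whole δ b e = G.part B δ b f (G.cost f - rest C f 1) ∧ G.head e < G.head f ∧
      ∃ g, g ≠ e ∧ g ≠ f ∧ G.tail g = G.tail e ∧ 2 ≤ (C g).length ∧
        G.part B δ b g (G.cost g - rest C g 1) = G.whole δ b e ∧ G.head e < G.head g) := by
  obtain ⟨⟨h3, h4⟩, -⟩ := (D.travels_iff hC hb hbβ hu).1 h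
  beta_reduce at h3 h4
  rw [value_zero_of_length_eq hC h1] at h3 h4
  rw [← value_zero_of_two_le hC h2f]
  rcases (h3 f ht).lt_or_eq with h5 | h5
  · exact Or.inl h5
  refine Or.inr ⟨h5, ?_⟩
  rcases h4 with ⟨h4, -⟩ | ⟨h4, h6⟩
  · omega
  refine ⟨lt_of_le_of_ne (h6 f ht h5.symm) (head_ne hf ht).symm, ?_⟩
  by_contra hno
  refine h4 ⟨f, ⟨⟨ht, h5.symm⟩, h2f⟩, fun g hg => ?_⟩
  by_contra hgf
  have hge : g ≠ e := by rintro rfl; have := hg.2; omega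
  refine hno ⟨g, hge, hgf, hg.1.1, hg.2, ?_, ?_⟩
  · rw [← value_zero_of_two_le hC hg.2, hg.1.2]
  · exact lt_of_le_of_ne (h6 g hg.1.1 hg.1.2) (head_ne hge hg.1.1).symm

theorem travels_of_whole_lt {e f : Fin m} (hu : Alive G B δ (G.tail e)) (h : Natural G B δ b e)
    (hf : f ≠ e) (h2f : 2 ≤ (C f).length)
    (hlt : G.whole δ b e < G.part B δ b f (G.cost f - rest C f 1))
    (hl : ∀ g, g ≠ f → G.tail g = G.tail e → (C g).length = 1) : G.Travels C b e := by
  rw [← value_zero_of_two_le hC h2f] at hlt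
  rw [D.travels_iff hC hb hbβ hu]
  have hv : ∀ g, g ≠ f → G.tail g = G.tail e → G.value C B δ b g 0 = G.whole δ b g :=
    fun g h1 h2 => value_zero_of_length_eq hC (hl g h1 h2)
  have he := hv e hf.symm rfl
  refine ⟨⟨fun g htg => ?_, Or.inr ⟨?_, fun g htg hvg => ?_⟩⟩, fun i h0 hi => ?_⟩
  · beta_reduce
    rw [he]
    by_cases hgf : g = f
    · rw [hgf]; exact hlt.le
    by_cases hge : g = e
    · rw [hge, he]
    rw [hv g hgf htg]
    exact h.le.trans (altMin_le hge htg)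
  · rintro ⟨g, ⟨⟨htg, hvg⟩, h2g⟩, -⟩
    beta_reduce at hvg h2g
    by_cases hgf : g = f
    · rw [hgf, he] at hvg; linarith
    · have := hl g hgf htg
      omega
  · beta_reduce at hvg
    by_cases hgf : g = f
    · rw [hgf, he] at hvg; linarith
    by_cases hge : g = e
    · rw [hge]
    rw [he, hv g hgf htg] at hvg
    exact (h.head_lt hge htg hvg.le).le
  · have := hl e hf.symm rfl
    omega

/-- Two tied chunks cancel the preference for chunks, and the undivided edge wins because its head
comes before theirs. -/
theorem travels_of_whole_eq {e f g : Fin m} (hu : Alive G B δ (G.tail e)) (h : Natural G B δ b e)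
    (hf : f ≠ e) (ht : G.tail f = G.tail e) (h2f : 2 ≤ (C f).length)
    (hg : g ≠ e) (htg : G.tail g = G.tail e) (h2g : 2 ≤ (C g).length) (hgf : g ≠ f)
    (hfv : G.whole δ b e = G.part B δ b f (G.cost f - rest C f 1))
    (hgv : G.whole δ b e = G.part B δ b g (G.cost g - rest C g 1))
    (hfh : G.head e < G.head f) (hgh : G.head e < G.head g)
    (hl : ∀ a, a ≠ f → a ≠ g → G.tail a = G.tail e → (C a).length = 1) : G.Travels C b e := by
  rw [← value_zero_of_two_le hC h2f] at hfv
  rw [← value_zero_of_two_le hC h2g] at hgv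
  rw [D.travels_iff hC hb hbβ hu]
  have hv : ∀ a, a ≠ f → a ≠ g → G.tail a = G.tail e → G.value C B δ b a 0 = G.whole δ b a :=
    fun a h1 h2 h3 => value_zero_of_length_eq hC (hl a h1 h2 h3)
  have he := hv e hf.symm hg.symm rfl
  refine ⟨⟨fun a hta => ?_, Or.inr ⟨?_, fun a hta hva => ?_⟩⟩, fun i h0 hi => ?_⟩
  · beta_reduce
    rw [he]
    by_cases haf : a = f
    · rw [haf]; exact hfv.le
    by_cases hag : a = g
    · rw [hag]; exact hgv.le
    by_cases hae : a = e
    · rw [hae, he]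
    rw [hv a haf hag hta]
    exact h.le.trans (altMin_le hae hta)
  · rintro ⟨a, -, hu⟩
    have h8 := hu f ⟨⟨ht, by beta_reduce; rw [he]; exact hfv.symm⟩, h2f⟩
    have h9 := hu g ⟨⟨htg, by beta_reduce; rw [he]; exact hgv.symm⟩, h2g⟩
    exact hgf (h9.trans h8.symm)
  · beta_reduce at hva
    by_cases haf : a = f
    · rw [haf]; exact hfh.le
    by_cases hag : a = g
    · rw [hag]; exact hgh.le
    by_cases hae : a = e
    · rw [hae]
    rw [he, hv a haf hag hta] at hva
    exact (h.head_lt hae hta hva.le).le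
  · have := hl e hf.symm hg.symm rfl
    omega

end IsDist

end TaskGraph

end PresentBias

namespace PresentBias

namespace TaskGraph

variable {n m : ℕ} {G : TaskGraph n m} {C : Chunking m}
variable {β B : ℝ} {ord : Fin n → ℕ} {δ : Fin n → ℝ}

/-! ### Plans for the edges out of one vertex -/

/-- Two agents can be made to take `e` in `l` pieces at the expense of `w` chunks. -/
def SoloPlan (G : TaskGraph n m) (B : ℝ) (δ : Fin n → ℝ) (k : ℕ) (b b' : ℝ) (e : Fin m)
    (l w : ℕ) : Prop :=
  (l = 1 ∧ w = 0 ∧ Natural G B δ b e ∧ Natural G B δ b' e) ∨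
    (Feas G B δ b b' e l ∧ l ≤ k ∧ w = l)

/-- The edges `e` and `e'` are divided into `l` and `l'` pieces, starting with `x` and `y`,
such that the agent with bias `b` takes `e` and the agent with bias `b'` takes `e'`. -/
def BothSplit (G : TaskGraph n m) (B : ℝ) (δ : Fin n → ℝ) (k : ℕ) (b b' : ℝ) (e e' : Fin m)
    (l : ℕ) (x : ℝ) (l' : ℕ) (y : ℝ) : Prop :=
  (2 ≤ l ∧ l ≤ k) ∧ (2 ≤ l' ∧ l' ≤ k) ∧ 0 ≤ G.reach B δ b b e 0 ∧ 0 ≤ G.reach B δ b' b' e' 0 ∧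
  (max 0 (G.cost e - G.reach B δ b b e (l - 2)) ≤ x ∧ x ≤ G.maxFirst B δ b b e) ∧
  (max 0 (G.cost e' - G.reach B δ b' b' e' (l' - 2)) ≤ y ∧ y ≤ G.maxFirst B δ b' b' e') ∧
  Wins G B δ b e e' (G.part B δ b e x) (G.part B δ b e' y) ∧
  Wins G B δ b' e' e (G.part B δ b' e' y) (G.part B δ b' e x)

/-- The agent with bias `b` takes `e`, which is not chunked, and the agent with bias `b'` takes
`e'` in `l` pieces; if `f = g + 1`, then `g` is divided into two pieces, starting with `z`. -/
def OneSplit (G : TaskGraph n m) (B : ℝ) (δ : Fin n → ℝ) (k : ℕ) (b b' : ℝ) (e e' : Fin m)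
    (l f : ℕ) (z : ℝ) (w : ℕ) : Prop :=
  Natural G B δ b e ∧ Feas G B δ b' b' e' l ∧ l ≤ k ∧
  ((f = 0 ∧ w = l ∧ G.whole δ b e < G.part B δ b e' (G.maxFirst B δ b' b' e')) ∨
    ∃ g : Fin m, f = g + 1 ∧ w = l + 2 ∧
      G.whole δ b e = G.part B δ b e' (G.maxFirst B δ b' b' e') ∧ G.head e < G.head e' ∧
      Third G B δ b b' e e' (G.maxFirst B δ b' b' e') g z)

/-- A plan with `w` chunks by which the agent with bias `b` takes `e` and the agent with bias `b'`
takes another edge `e'`. -/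
def PairPlan (G : TaskGraph n m) (B : ℝ) (δ : Fin n → ℝ) (k : ℕ) (b b' : ℝ) (e e' : Fin m)
    (l : ℕ) (x : ℝ) (l' : ℕ) (y : ℝ) (f : ℕ) (z : ℝ) (w : ℕ) : Prop :=
  (l = 1 ∧ l' = 1 ∧ f = 0 ∧ w = 0 ∧ Natural G B δ b e ∧ Natural G B δ b' e') ∨
  (f = 0 ∧ w = l + l' ∧ BothSplit G B δ k b b' e e' l x l' y) ∨
  (l = 1 ∧ y = G.maxFirst B δ b' b' e' ∧ OneSplit G B δ k b b' e e' l' f z w) ∨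
  (l' = 1 ∧ x = G.maxFirst B δ b b e ∧ OneSplit G B δ k b' b e' e l f z w)

/-- How the edge `e` is written for a plan with `l` pieces. -/
def Written (G : TaskGraph n m) (B : ℝ) (δ : Fin n → ℝ) (C : Chunking m) (b b' : ℝ) (e : Fin m)
    (l : ℕ) (x : ℝ) : Prop :=
  (l = 1 → C e = [G.cost e]) ∧ (2 ≤ l → C e = pieces (G.cost e) x (G.reach B δ b b' e) l)

/-- The edge `e` is divided into two pieces, starting with `z`. -/
def Halved (G : TaskGraph n m) (C : Chunking m) (e : Fin m) (z : ℝ) : Prop :=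
  ∃ t : ℕ → ℝ, Monotone t ∧ G.cost e ≤ t 0 ∧ C e = pieces (G.cost e) z t 2

theorem Halved.isChunking {e : Fin m} {z : ℝ} (h : Halved G C e z) (hz : 0 ≤ z ∧ z ≤ G.cost e) :
    (C e ≠ [] ∧ (∀ y ∈ C e, 0 ≤ y) ∧ (C e).sum = G.cost e) ∧ (C e).length = 2 ∧
      G.cost e - rest C e 1 = z := by
  obtain ⟨t, ht, hc, h⟩ := h
  refine ⟨?_, ?_, first_of_pieces le_rfl h (by linarith)⟩
  · rw [h]
    exact pieces_isChunking two_pos hz.1 hz.2 ((G.cost_nonneg e).trans hc) ht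
  · rw [h, length_pieces]

theorem singleton_isChunking {e : Fin m} (h : C e = [G.cost e]) :
    C e ≠ [] ∧ (∀ y ∈ C e, 0 ≤ y) ∧ (C e).sum = G.cost e := by
  rw [h]
  simp [G.cost_nonneg e]

theorem BothSplit.splits {k : ℕ} {b b' : ℝ} {e e' : Fin m} {l l' : ℕ} {x y : ℝ}
    (h : BothSplit G B δ k b b' e e' l x l' y)
    (hw : Written G B δ C b b e l x) (hw' : Written G B δ C b' b' e' l' y) :
    Splits G B δ C b b e l x ∧ Splits G B δ C b' b' e' l' y := by
  obtain ⟨h1, h2, h3, h4, ⟨h5, h6⟩, ⟨h7, h8⟩, -, -⟩ := h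
  rw [max_le_iff] at h5 h7
  exact ⟨⟨h1.1, hw.2 h1.1, h5.1, h6.trans (min_le_left _ _), h3, by linarith⟩,
    ⟨h2.1, hw'.2 h2.1, h7.1, h8.trans (min_le_left _ _), h4, by linarith⟩⟩

theorem use_le_of_forall {u : Fin n} (s : Finset (Fin m)) (w : ℕ)
    (h : ∀ f ∉ s, G.tail f = u → (C f).length = 1)
    (hw : ∑ e ∈ s, (if (C e).length = 1 then 0 else (C e).length) ≤ w) : G.use C u ≤ w := by
  refine le_trans ?_ hw
  rw [use]
  refine le_of_eq_of_le ?_ (Finset.sum_le_sum_of_subset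
    (Finset.inter_subset_left (s₁ := s) (s₂ := ({e | G.tail e = u} : Finset (Fin m)))))
  symm
  refine Finset.sum_subset Finset.inter_subset_right fun f hf hf' => ?_
  rw [if_pos]
  simp only [Finset.mem_filter, Finset.mem_univ, true_and, Finset.mem_inter, not_and] at hf hf'
  exact h f (fun hs => hf' hs hf) hf

namespace IsDist

variable (D : G.IsDist β B ord δ) {b : ℝ} (hb : 1 < b) (hbβ : b ≤ β)
  {b' : ℝ} (hb' : 1 < b') (hbβ' : b' ≤ β) {k : ℕ}
include D hb hbβ hb' hbβ'

/-- Chunks on edges that nobody takes are simply dropped: the plan needs only the chunks of `e`, so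
it is no more expensive than what is used at this vertex. The converse is `travels_of_soloPlan`, in
which the other edges out of the vertex are undivided. -/
theorem exists_soloPlan (hC : G.IsChunking C) {e : Fin m} (hu : Alive G B δ (G.tail e))
    (h : G.Travels C b e) (h' : G.Travels C b' e) (hk : G.use C (G.tail e) ≤ k) :
    ∃ l w, w ≤ G.use C (G.tail e) ∧ SoloPlan G B δ k b b' e l w := by
  rcases length_eq_one_or hC e with h1 | h1
  · exact ⟨1, 0, Nat.zero_le _, Or.inl ⟨rfl, rfl, D.natural_of_travels hC hb hbβ hu h h1,
      D.natural_of_travels hC hb' hbβ' hu h' h1⟩⟩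
  · have h2 := length_le_use (G := G) h1
    exact ⟨_, _, h2, Or.inr ⟨(D.feas_of_travels hb hbβ hb' hbβ' hC hu h h' h1).1, h2.trans hk, rfl⟩⟩

omit D hbβ hbβ' in
theorem soloPlan_isChunking {e : Fin m} {l w : ℕ} (h : SoloPlan G B δ k b b' e l w)
    (hw : Written G B δ C b b' e l (G.maxFirst B δ b b' e)) :
    C e ≠ [] ∧ (∀ y ∈ C e, 0 ≤ y) ∧ (C e).sum = G.cost e := by
  rcases h with ⟨rfl, -⟩ | ⟨h, -⟩
  · exact singleton_isChunking (hw.1 rfl)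
  · exact (h.splits hb hb' (hw.2 h.1)).isChunking hb hb'

theorem travels_of_soloPlan (hC : G.IsChunking C) {e : Fin m} (hu : Alive G B δ (G.tail e))
    {l w : ℕ} (h : SoloPlan G B δ k b b' e l w)
    (hw : Written G B δ C b b' e l (G.maxFirst B δ b b' e))
    (hl : ∀ f, f ≠ e → G.tail f = G.tail e → (C f).length = 1) :
    G.Travels C b e ∧ G.Travels C b' e ∧ G.use C (G.tail e) ≤ w := by
  rcases h with ⟨rfl, rfl, h1, h2⟩ | ⟨h, -, rfl⟩
  · have hl' : ∀ f, G.tail f = G.tail e → (C f).length = 1 := by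
      intro f hf
      by_cases hfe : f = e
      · rw [hfe, hw.1 rfl]; rfl
      · exact hl f hfe hf
    refine ⟨D.travels_of_natural hC hb hbβ hu h1 hl', D.travels_of_natural hC hb' hbβ' hu h2 hl', ?_⟩
    exact use_le_of_forall ∅ 0 (fun f _ hf => hl' f hf) (by simp)
  · have h1 := D.travels_of_splits hC hb hbβ hb' hbβ' hu h (hw.2 h.1) hl
    refine ⟨h1.1, h1.2, use_le_of_forall {e} w (fun f hf ht => hl f (by simpa using hf) ht) ?_⟩
    rw [Finset.sum_singleton, hw.2 h.1, length_pieces]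
    split_ifs <;> omega

omit D hbβ hbβ' in
theorem pairPlan_isChunking {e e' : Fin m} {l l' f w : ℕ} {x y z : ℝ}
    (h : PairPlan G B δ k b b' e e' l x l' y f z w)
    (hw : Written G B δ C b b e l x) (hw' : Written G B δ C b' b' e' l' y)
    (hf : ∀ g : Fin m, f = g + 1 → Halved G C g z) :
    (C e ≠ [] ∧ (∀ y ∈ C e, 0 ≤ y) ∧ (C e).sum = G.cost e) ∧
    (C e' ≠ [] ∧ (∀ y ∈ C e', 0 ≤ y) ∧ (C e').sum = G.cost e') ∧
    ∀ g : Fin m, f = g + 1 → (C g ≠ [] ∧ (∀ y ∈ C g, 0 ≤ y) ∧ (C g).sum = G.cost g) := by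
  rcases h with ⟨rfl, rfl, rfl, -⟩ | ⟨rfl, -, h⟩ | ⟨rfl, rfl, h, h1, -, h2⟩ | ⟨rfl, rfl, h, h1, -, h2⟩
  · exact ⟨singleton_isChunking (hw.1 rfl), singleton_isChunking (hw'.1 rfl), by simp⟩
  · obtain ⟨h1, h2⟩ := h.splits hw hw'
    exact ⟨h1.isChunking hb hb, h2.isChunking hb' hb', by simp⟩
  · refine ⟨singleton_isChunking (hw.1 rfl),
      (h1.splits hb' hb' (hw'.2 h1.1)).isChunking hb' hb', fun g hg => ?_⟩
    rcases h2 with ⟨rfl, -⟩ | ⟨g', rfl, -, -, -, h3⟩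
    · omega
    · obtain rfl : g' = g := Fin.ext (by omega)
      exact ((hf _ rfl).isChunking h3.2.2.2.1).1
  · refine ⟨(h1.splits hb hb (hw.2 h1.1)).isChunking hb hb,
      singleton_isChunking (hw'.1 rfl), fun g hg => ?_⟩
    rcases h2 with ⟨rfl, -⟩ | ⟨g', rfl, -, -, -, h3⟩
    · omega
    · obtain rfl : g' = g := Fin.ext (by omega)
      exact ((hf _ rfl).isChunking h3.2.2.2.1).1

theorem travels_of_oneSplit (hC : G.IsChunking C) {e e' : Fin m} (hne : e' ≠ e)
    (ht : G.tail e' = G.tail e) (hu : Alive G B δ (G.tail e)) {l f w : ℕ} {z : ℝ}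
    (h : OneSplit G B δ k b b' e e' l f z w) (hw : C e = [G.cost e])
    (hw' : Written G B δ C b' b' e' l (G.maxFirst B δ b' b' e'))
    (hf : ∀ g : Fin m, f = g + 1 → Halved G C g z)
    (hl : ∀ g : Fin m, g ≠ e → g ≠ e' → f ≠ g + 1 → G.tail g = G.tail e → (C g).length = 1) :
    G.Travels C b e ∧ G.Travels C b' e' ∧ G.use C (G.tail e) ≤ w := by
  have hw1 : (C e).length = 1 := by rw [hw]; rfl
  obtain ⟨hN, hF, -, h2⟩ := h
  have hs := hF.splits hb' hb' (hw'.2 hF.1)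
  have h2e' : 2 ≤ (C e').length := by rw [hs.length]; exact hF.1
  have hmax := part_maxFirst_le (G := G) (B := B) (δ := δ) hb' hb' e'
  have hu' : Alive G B δ (G.tail e') := ht ▸ hu
  rcases h2 with ⟨rfl, rfl, h3⟩ | ⟨g, rfl, rfl, h3, h4, h5⟩
  · have hl' : ∀ g, g ≠ e' → G.tail g = G.tail e → (C g).length = 1 := by
      intro g hg htg
      by_cases hge : g = e
      · rw [hge]; exact hw1
      · exact hl g hge hg (by omega) htg
    refine ⟨?_, ?_, ?_⟩
    · exact D.travels_of_whole_lt hC hb hbβ hu hN hne h2e' (by rwa [hs.first]) hl'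
    · exact D.travels_of_part_le hC hb' hbβ' hu' h2e' (by rw [hs.first]; exact hmax.1)
        (fun i h0 hi => (hs.value_le hb' hb' h0 hi).1) (fun g hg htg => hl' g hg (htg.trans ht))
    · refine use_le_of_forall {e'} w (fun f hf ht => hl' f (by simpa using hf) ht) ?_
      rw [Finset.sum_singleton, hs.length]
      split_ifs <;> omega
  · obtain ⟨h6, h7, h8, h9, h10, h11, h12⟩ := h5
    obtain ⟨-, hg2, hgz⟩ := (hf g rfl).isChunking h9
    have hl' : ∀ a, a ≠ e' → a ≠ g → G.tail a = G.tail e → (C a).length = 1 := by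
      intro a h1 h2 h3
      by_cases hae : a = e
      · rw [hae]; exact hw1
      · exact hl a hae h1 (fun h => h2 (Fin.ext (by omega))) h3
    refine ⟨?_, ?_, ?_⟩
    · exact D.travels_of_whole_eq hC hb hbβ hu hN hne ht h2e' h6 (h8.trans ht) hg2.ge h7
        (by rw [hs.first]; exact h3) (by rw [hgz]; exact h10.symm) h4 h11 hl'
    · refine D.travels_of_wins hC hb' hbβ' hu' h7 h8 h2e' hg2.ge (by rw [hs.first, hgz]; exact h12)
        (fun i h0 hi => (hs.value_le hb' hb' h0 hi).1) (fun a h1 h2 h3 => hl' a h1 h2 (h3.trans ht))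
    · refine use_le_of_forall {e', g} (l + 2) (fun f hf ht => ?_) ?_
      · simp only [Finset.mem_insert, Finset.mem_singleton, not_or] at hf
        exact hl' f hf.1 hf.2 ht
      · rw [Finset.sum_pair h7.symm, hs.length, hg2]
        split_ifs <;> omega

theorem travels_of_pairPlan (hC : G.IsChunking C) {e e' : Fin m} (hne : e' ≠ e)
    (ht : G.tail e' = G.tail e) (hu : Alive G B δ (G.tail e)) {l l' f w : ℕ} {x y z : ℝ}
    (h : PairPlan G B δ k b b' e e' l x l' y f z w)
    (hw : Written G B δ C b b e l x) (hw' : Written G B δ C b' b' e' l' y)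
    (hf : ∀ g : Fin m, f = g + 1 → Halved G C g z)
    (hl : ∀ g : Fin m, g ≠ e → g ≠ e' → f ≠ g + 1 → G.tail g = G.tail e → (C g).length = 1) :
    G.Travels C b e ∧ G.Travels C b' e' ∧ G.use C (G.tail e) ≤ w := by
  have hu' : Alive G B δ (G.tail e') := ht ▸ hu
  rcases h with ⟨rfl, rfl, rfl, rfl, h1, h2⟩ | ⟨rfl, rfl, h⟩ | ⟨rfl, rfl, h⟩ | ⟨rfl, rfl, h⟩
  · have hl' : ∀ g, G.tail g = G.tail e → (C g).length = 1 := by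
      intro g hg
      by_cases hge : g = e
      · rw [hge, hw.1 rfl]; rfl
      by_cases hge' : g = e'
      · rw [hge', hw'.1 rfl]; rfl
      exact hl g hge hge' (by omega) hg
    refine ⟨D.travels_of_natural hC hb hbβ hu h1 hl', D.travels_of_natural hC hb' hbβ' hu' h2
      fun g hg => hl' g (hg.trans ht), ?_⟩
    exact use_le_of_forall ∅ 0 (fun f _ hf => hl' f hf) (by simp)
  · obtain ⟨h1, h2⟩ := h.splits hw hw'
    obtain ⟨h3, h4, -, -, -, -, h5, h6⟩ := h
    have h7 : 2 ≤ (C e).length := by rw [h1.length]; exact h3.1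
    have h8 : 2 ≤ (C e').length := by rw [h2.length]; exact h4.1
    refine ⟨?_, ?_, ?_⟩
    · exact D.travels_of_wins hC hb hbβ hu hne ht h7 h8 (by rw [h1.first, h2.first]; exact h5)
        (fun i h0 hi => (h1.value_le hb hb h0 hi).1) (fun a h1 h2 h3 => hl a h1 h2 (by omega) h3)
    · exact D.travels_of_wins hC hb' hbβ' hu' hne.symm ht.symm h8 h7
        (by rw [h1.first, h2.first]; exact h6)
        (fun i h0 hi => (h2.value_le hb' hb' h0 hi).1)
        (fun a h1 h2 h3 => hl a h2 h1 (by omega) (h3.trans ht))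
    · refine use_le_of_forall {e, e'} (l + l') (fun f hf ht => ?_) ?_
      · simp only [Finset.mem_insert, Finset.mem_singleton, not_or] at hf
        exact hl f hf.1 hf.2 (by omega) ht
      · rw [Finset.sum_pair hne.symm, h1.length, h2.length]
        split_ifs <;> omega
  · exact D.travels_of_oneSplit hb hbβ hb' hbβ' hC hne ht hu h (hw.1 rfl) hw' hf hl
  · have := D.travels_of_oneSplit hb' hbβ' hb hbβ hC hne.symm ht.symm hu' h (hw'.1 rfl) hw hf
      fun g h1 h2 h3 h4 => hl g h2 h1 h3 (h4.trans ht)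
    rw [ht] at this
    exact ⟨this.2.1, this.1, this.2.2⟩

/-- Enlarging the first piece of `e'` to `maxFirst` is harmless for the agent that takes `e'` and
makes this edge less attractive for the agent that takes `e`. After that the latter is no longer
indifferent, unless the first piece was already maximal. In that case the given chunking must
contain a third tied chunk, and dividing that edge into two pieces with the same first piece is
enough. -/
theorem exists_oneSplit (hC : G.IsChunking C) {e e' : Fin m} (hne : e' ≠ e)
    (ht : G.tail e' = G.tail e) (hu : Alive G B δ (G.tail e))
    (h : G.Travels C b e) (h' : G.Travels C b' e') (h1 : (C e).length = 1)
    (h2 : 2 ≤ (C e').length) (hk : G.use C (G.tail e) ≤ k) :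
    ∃ l f z w, w ≤ G.use C (G.tail e) ∧ OneSplit G B δ k b b' e e' l f z w := by
  have hu' : Alive G B δ (G.tail e') := ht ▸ hu
  have hN := D.natural_of_travels hC hb hbβ hu h h1
  have hF := (D.feas_of_travels hb' hbβ' hb' hbβ' hC hu' h' h' h2).1
  have hle := length_le_use (G := G) h2
  rw [ht] at hle
  have h3 := (D.part_le_of_travels hC hb' hbβ' hu' h' h2).1
  have h4 := le_maxFirst hb' hb' (first_mem hC e').2 h3 h3
  rcases D.whole_le_of_travels hC hb hbβ hu h hne ht h1 h2 with h5 | ⟨h5, h6, g, hg⟩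
  · exact ⟨_, 0, 0, _, hle, hN, hF, hle.trans hk, Or.inl ⟨rfl, rfl,
      h5.trans_le ((part_strictMono hb e').monotone h4)⟩⟩
  · rcases h4.lt_or_eq with h4 | h4
    · exact ⟨_, 0, 0, _, hle, hN, hF, hle.trans hk, Or.inl ⟨rfl, rfl,
        h5.trans_lt (part_strictMono hb e' h4)⟩⟩
    · obtain ⟨h7, h8, h9, h10, h11, h12⟩ := hg
      have h13 := length_add_length_le_use (G := G) (C := C) h8 (h9.trans ht.symm) h2 h10
      rw [ht] at h13
      refine ⟨_, g + 1, G.cost g - rest C g 1, (C e').length + 2, by omega, hN, hF, hle.trans hk,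
        Or.inr ⟨g, rfl, rfl, by rw [← h4]; exact h5, h6, h7, h8, h9.trans ht.symm, first_mem hC g,
          h11, h12, ?_⟩⟩
      rw [← h4]
      exact D.wins_of_travels hC hb' hbβ' hu' h' h8 (h9.trans ht.symm) h2 h10

/-- The cases are distinguished by which of the two edges are chunked. If both are, the first pieces
are kept, and their bounds follow from the feasibility of each edge for its own agent alone; all
other edges can be left undivided. -/
theorem exists_pairPlan (hC : G.IsChunking C) {e e' : Fin m} (hne : e' ≠ e)
    (ht : G.tail e' = G.tail e) (hu : Alive G B δ (G.tail e))
    (h : G.Travels C b e) (h' : G.Travels C b' e') (hk : G.use C (G.tail e) ≤ k) :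
    ∃ l x l' y f z w, w ≤ G.use C (G.tail e) ∧ PairPlan G B δ k b b' e e' l x l' y f z w := by
  have hu' : Alive G B δ (G.tail e') := ht ▸ hu
  rcases length_eq_one_or hC e with h1 | h1 <;> rcases length_eq_one_or hC e' with h2 | h2
  · exact ⟨1, 0, 1, 0, 0, 0, 0, Nat.zero_le _, Or.inl ⟨rfl, rfl, rfl, rfl,
      D.natural_of_travels hC hb hbβ hu h h1, D.natural_of_travels hC hb' hbβ' hu' h' h2⟩⟩
  · obtain ⟨l, f, z, w, hw, hp⟩ := D.exists_oneSplit hb hbβ hb' hbβ' hC hne ht hu h h' h1 h2 hk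
    exact ⟨1, 0, l, _, f, z, w, hw, Or.inr (Or.inr (Or.inl ⟨rfl, rfl, hp⟩))⟩
  · obtain ⟨l, f, z, w, hw, hp⟩ := D.exists_oneSplit (k := k) hb' hbβ' hb hbβ hC hne.symm ht.symm hu' h' h h2 h1
      (by rwa [ht])
    rw [ht] at hw
    exact ⟨l, _, 1, 0, f, z, w, hw, Or.inr (Or.inr (Or.inr ⟨rfl, rfl, hp⟩))⟩
  · have h3 := length_add_length_le_use (G := G) (C := C) hne ht h1 h2
    obtain ⟨h4, h5⟩ := D.feas_of_travels hb hbβ hb hbβ hC hu h h h1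
    obtain ⟨h4', h5'⟩ := D.feas_of_travels hb' hbβ' hb' hbβ' hC hu' h' h' h2
    have h6 := (D.part_le_of_travels hC hb hbβ hu h h1).1
    have h6' := (D.part_le_of_travels hC hb' hbβ' hu' h' h2).1
    refine ⟨_, G.cost e - rest C e 1, _, G.cost e' - rest C e' 1, 0, 0, _, h3,
      Or.inr (Or.inl ⟨rfl, rfl, ⟨h1, by omega⟩, ⟨h2, by omega⟩, h4.2.1, h4'.2.1, ⟨?_, ?_⟩, ⟨?_, ?_⟩,
        ?_, ?_⟩)⟩
    · exact max_le (first_mem hC e).1 (by linarith)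
    · exact le_maxFirst hb hb (first_mem hC e).2 h6 h6
    · exact max_le (first_mem hC e').1 (by linarith)
    · exact le_maxFirst hb' hb' (first_mem hC e').2 h6' h6'
    · exact D.wins_of_travels hC hb hbβ hu h hne ht h1 h2
    · exact D.wins_of_travels hC hb' hbβ' hu' h' hne.symm ht.symm h2 h1

end IsDist

/-! ### Three candidates for a pair of first pieces -/

/-- `M` is the least unbiased cost, truncated at `B`, over the edges with this tail other than both
`e` and `e'`. It is common to both alternatives, which makes the perceived costs of `e` and `e'`
comparable. -/
theorem exists_altMin_pair {e e' : Fin m} (hne : e' ≠ e) (ht : G.tail e' = G.tail e) :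
    ∃ M, G.altMin B δ 1 e = min (G.cost e' + δ (G.head e')) M ∧
      G.altMin B δ 1 e' = min (G.cost e + δ (G.head e)) M := by
  refine ⟨((G.alts e).erase e').fold min B (G.whole δ 1), ?_, ?_⟩ <;>
    refine eq_of_forall_le_iff fun x => ?_ <;>
    rw [le_altMin, le_min_iff, Finset.le_fold_min] <;>
    simp only [Finset.mem_erase, mem_alts, and_imp]
  · constructor
    · rintro ⟨h1, h2⟩
      refine ⟨?_, h1, fun f _ hf htf => h2 f hf htf⟩
      have := h2 e' hne ht
      rwa [whole, one_mul] at this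
    · rintro ⟨h1, h2, h3⟩
      refine ⟨h2, fun f hf htf => ?_⟩
      by_cases hfe : f = e'
      · rw [hfe, whole, one_mul]; exact h1
      · exact h3 f hfe hf htf
  · constructor
    · rintro ⟨h1, h2⟩
      refine ⟨?_, h1, fun f hf' _ htf => h2 f hf' (htf.trans ht.symm)⟩
      have := h2 e hne.symm ht.symm
      rwa [whole, one_mul] at this
    · rintro ⟨h1, h2, h3⟩
      refine ⟨h2, fun f hf htf => ?_⟩
      by_cases hfe : f = e
      · rw [hfe, whole, one_mul]; exact h1
      · exact h3 f hf hfe (htf.trans ht)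

/-- The first piece of `e` in the third candidate. -/
noncomputable def midFirst (G : TaskGraph n m) (B : ℝ) (δ : Fin n → ℝ) (b b' : ℝ) (e e' : Fin m)
    (X X' Y Y' : ℝ) : ℝ :=
  (max X (max (G.cost e + δ (G.head e) - G.altMin B δ 1 e')
      (G.partInv B δ b' e (G.part B δ b' e' Y))) +
    min X' (G.partInv B δ b e (G.part B δ b e' Y'))) / 2

/-- The first piece of `e'` in the third candidate. -/
noncomputable def midSecond (G : TaskGraph n m) (B : ℝ) (δ : Fin n → ℝ) (b b' : ℝ) (e e' : Fin m)
    (Y Y' x : ℝ) : ℝ :=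
  (max Y (G.partInv B δ b e' (G.part B δ b e x)) +
    min Y' (G.partInv B δ b' e' (G.part B δ b' e x))) / 2

/-- For a fixed first piece `x` of `e`, the first agent asks for `y` above a threshold and the
second for `y` below another one. Both, together with the bounds `Y` and `Y'`, can be met exactly if
`x` satisfies a few one-sided bounds, so the suitable `x` form an interval. The ends of this
interval are those in `midFirst`, and its midpoint is suitable whenever some `x` is; then the
midpoint of the interval for `y` works as well. -/
theorem strict_candidate {b b' : ℝ} (hb : 1 < b) (hbb : b < b') {e e' : Fin m} (hne : e' ≠ e)
    (ht : G.tail e' = G.tail e) {X X' Y Y' x y : ℝ} (hX0 : 0 ≤ X)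
    (hX : X ≤ x) (hX' : x ≤ X') (hY : Y ≤ y) (hY' : y ≤ Y')
    (h1 : G.part B δ b e x < G.part B δ b e' y) (h2 : G.part B δ b' e' y < G.part B δ b' e x) :
    ∃ x' y', x' = G.midFirst B δ b b' e e' X X' Y Y' ∧ y' = G.midSecond B δ b b' e e' Y Y' x' ∧
      X ≤ x' ∧ x' ≤ X' ∧ Y ≤ y' ∧ y' ≤ Y' ∧
      G.part B δ b e x' < G.part B δ b e' y' ∧ G.part B δ b' e' y' < G.part B δ b' e x' := by
  have hb' : 1 < b' := hb.trans hbb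
  obtain ⟨M, hM, hM'⟩ := exists_altMin_pair (G := G) (B := B) (δ := δ) hne ht
  -- the difference of the perceived costs for the two agents
  have hdiff : ∀ f x, G.part B δ b' f x = G.part B δ b f x + (b' - b) * x := by
    intro f x; simp only [part]; ring
  -- The second agent perceives a first piece `z` as more costly than the first agent does, by `(b'
  -- - b) * z` on either edge. Opposite strict preferences therefore force the first piece of `e` to
  -- be the larger one.
  have hyx : y < x := by
    rw [hdiff, hdiff e] at h2
    nlinarith
  have h3 : G.part B δ b e x < G.part B δ b e' x := h1.trans (part_strictMono hb e' hyx)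
  -- With equal first pieces `e` looks cheaper than `e'`, so the comparison is one between the two
  -- minima in `part`. By the common `M` it amounts to these two inequalities, the second of which
  -- is a lower bound for `x`.
  have h4 : G.cost e + δ (G.head e) < G.cost e' + δ (G.head e') ∧
      G.cost e + δ (G.head e) - G.altMin B δ 1 e' < x := by
    have hx0 : 0 ≤ x := hX0.trans hX
    rw [part, part, add_lt_add_iff_left, lt_min_iff, min_lt_iff, min_lt_iff, hM, hM'] at h3
    rw [hM']
    rcases le_total (G.cost e + δ (G.head e)) M with h5 | h5 <;>
      rcases le_total (G.cost e' + δ (G.head e')) M with h6 | h6 <;>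
      simp only [min_eq_left h5, min_eq_right h5, min_eq_left h6, min_eq_right h6] at h3 ⊢ <;>
      rcases h3 with ⟨h7 | h7, h8 | h8⟩ <;> constructor <;> linarith
  obtain ⟨x', hx'⟩ : ∃ x', x' = G.midFirst B δ b b' e e' X X' Y Y' := ⟨_, rfl⟩
  have h5 : G.partInv B δ b' e (G.part B δ b' e' Y) < x :=
    (part_lt_iff hb').1 (((part_strictMono hb' e').monotone hY).trans_lt h2)
  have h6 : x < G.partInv B δ b e (G.part B δ b e' Y') := by
    rw [← (part_strictMono (G := G) (B := B) (δ := δ) hb e).lt_iff_lt, part_partInv hb]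
    exact h1.trans_le ((part_strictMono hb e').monotone hY')
  -- the midpoint satisfies the same bounds as `x`
  have hmid : ∀ lo hi x : ℝ, lo ≤ x → x ≤ hi → lo ≤ (lo + hi) / 2 ∧ (lo + hi) / 2 ≤ hi ∧
      (∀ a, a ≤ lo → a < x → a < (lo + hi) / 2) ∧ ∀ a, hi ≤ a → x < a → (lo + hi) / 2 < a := by
    intro lo hi x hl hh
    refine ⟨by linarith, by linarith, fun a h1 h2 => ?_, fun a h1 h2 => ?_⟩
    · rcases h1.lt_or_eq with h | h <;> linarith
    · rcases h1.lt_or_eq with h | h <;> linarith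
  obtain ⟨m1, m2, m3, m4⟩ := hmid _ _ x (max_le hX (max_le h4.2.le h5.le)) (le_min hX' h6.le)
  rw [← midFirst, ← hx'] at m1 m2 m3 m4
  have hXx' : X ≤ x' := (le_max_left _ _).trans m1
  have hx'X : x' ≤ X' := m2.trans (min_le_left _ _)
  have h7 : G.cost e + δ (G.head e) - G.altMin B δ 1 e' < x' :=
    m3 _ ((le_max_left _ _).trans (le_max_right _ _)) h4.2
  have h8 : G.partInv B δ b' e (G.part B δ b' e' Y) < x' :=
    m3 _ ((le_max_right _ _).trans (le_max_right _ _)) h5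
  have h9 : x' < G.partInv B δ b e (G.part B δ b e' Y') := m4 _ (min_le_right _ _) h6
  have h10 : G.part B δ b e x' < G.part B δ b e' x' := by
    rw [part, part, add_lt_add_iff_left, lt_min_iff, min_lt_iff, min_lt_iff]
    constructor <;> left <;> linarith [h4.1]
  -- The first agent strictly prefers `e` if `y > lo`, and the second strictly prefers `e'` if `y <
  -- hi`.
  set lo := G.partInv B δ b e' (G.part B δ b e x') with hlo
  set hi := G.partInv B δ b' e' (G.part B δ b' e x') with hhi
  -- At `y = lo` the first agent is indifferent. Since `lo < x'`, the second agent then strictly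
  -- prefers `e'`, so `lo` lies below `hi`.
  have h11 : lo < hi := by
    have h12 : lo < x' := (part_lt_iff hb).1 h10
    have h13 : G.part B δ b e' lo = G.part B δ b e x' := part_partInv hb e' _
    rw [← (part_strictMono (G := G) (B := B) (δ := δ) hb' e').lt_iff_lt, hhi, part_partInv hb',
      hdiff, hdiff e, h13]
    nlinarith
  have h12 : lo < Y' := by
    refine (part_lt_iff hb).1 ?_
    have := part_strictMono (G := G) (B := B) (δ := δ) hb e h9
    rwa [part_partInv hb] at this
  have h13 : Y < hi := by
    rw [← (part_strictMono (G := G) (B := B) (δ := δ) hb' e').lt_iff_lt, hhi, part_partInv hb']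
    exact (part_lt_iff hb').2 h8
  refine ⟨x', _, hx', rfl, hXx', hx'X, ?_⟩
  rw [midSecond, ← hlo, ← hhi]
  have hYY : Y ≤ Y' := hY.trans hY'
  have h14 : max Y lo ≤ min Y' hi := max_le (le_min hYY h13.le) (le_min h12.le h11.le)
  have h15 : lo < (max Y lo + min Y' hi) / 2 := by
    have := le_max_right Y lo
    have := lt_min h12 h11
    linarith
  have h16 : (max Y lo + min Y' hi) / 2 < hi := by
    have := min_le_right Y' hi
    have := max_lt h13 h11
    linarith
  refine ⟨by linarith [le_max_left Y lo], by linarith [min_le_left Y' hi], ?_, ?_⟩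
  · exact (part_lt_iff hb).2 h15
  · have := part_strictMono (G := G) (B := B) (δ := δ) hb' e' h16
    rwa [hhi, part_partInv hb'] at this

/-- If one agent is indifferent, a small change of `x` or `y` in the right direction makes its
preference strict while keeping the strict preference of the other. This fails only at a corner: `y
= Y` and `x = X'` if the second agent is indifferent, `x = X` and `y = Y'` if the first one is. All
other solutions lead to a strict one and thus to the midpoint candidate. -/
theorem BothSplit.candidate {k : ℕ} {b b' : ℝ} (hb : 1 < b) (hbb : b < b') {e e' : Fin m}
    (hne : e' ≠ e) (ht : G.tail e' = G.tail e) {l l' : ℕ} {x y X X' Y Y' : ℝ}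
    (h : BothSplit G B δ k b b' e e' l x l' y)
    (hX : X = max 0 (G.cost e - G.reach B δ b b e (l - 2))) (hX' : X' = G.maxFirst B δ b b e)
    (hY : Y = max 0 (G.cost e' - G.reach B δ b' b' e' (l' - 2)))
    (hY' : Y' = G.maxFirst B δ b' b' e') :
    BothSplit G B δ k b b' e e' l X l' Y' ∨ BothSplit G B δ k b b' e e' l X' l' Y ∨
      ∃ x y, x = G.midFirst B δ b b' e e' X X' Y Y' ∧ y = G.midSecond B δ b b' e e' Y Y' x ∧
        BothSplit G B δ k b b' e e' l x l' y := by
  have hb' : 1 < b' := hb.trans hbb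
  obtain ⟨h1, h2, h3, h4, ⟨h5, h6⟩, ⟨h7, h8⟩, ⟨h9, h10⟩, ⟨h11, h12⟩⟩ := h
  have mP := fun {b} (hb : 1 < b) f => part_strictMono (G := G) (B := B) (δ := δ) (b := b) hb f
  have strict : ∀ x y, X ≤ x → x ≤ X' → Y ≤ y → y ≤ Y' →
      G.part B δ b e x < G.part B δ b e' y → G.part B δ b' e' y < G.part B δ b' e x →
      ∃ x y, x = G.midFirst B δ b b' e e' X X' Y Y' ∧ y = G.midSecond B δ b b' e e' Y Y' x ∧
        BothSplit G B δ k b b' e e' l x l' y := by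
    intro x y a1 a2 a3 a4 a5 a6
    obtain ⟨x', y', e1, e2, c1, c2, c3, c4, c5, c6⟩ :=
      strict_candidate hb hbb hne ht (hX ▸ le_max_left _ _) a1 a2 a3 a4 a5 a6
    refine ⟨x', y', e1, e2, h1, h2, h3, h4, ⟨hX ▸ c1, hX' ▸ c2⟩, ⟨hY ▸ c3, hY' ▸ c4⟩,
      ⟨?_, Or.inl c5⟩, ⟨?_, Or.inl c6⟩⟩
    · exact ((mP hb e).monotone (hX' ▸ c2)).trans (part_maxFirst_le hb hb e).1
    · exact ((mP hb' e').monotone (hY' ▸ c4)).trans (part_maxFirst_le hb' hb' e').1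
  rw [← hX] at h5
  rw [← hX'] at h6
  rw [← hY] at h7
  rw [← hY'] at h8
  rcases h10 with h10 | ⟨h10, h13, h14⟩
  · rcases h12 with h12 | ⟨h12, h13, h14⟩
    · exact Or.inr (Or.inr (strict x y h5 h6 h7 h8 h10 h12))
    · -- the second agent is indifferent
      rcases h7.lt_or_eq with h15 | h15
      · obtain ⟨y', hy1, hy2⟩ := exists_between (max_lt h15 ((part_lt_iff hb).1 h10))
        rw [max_lt_iff] at hy1
        exact Or.inr (Or.inr (strict x y' h5 h6 hy1.1.le (hy2.le.trans h8) ((part_lt_iff hb).2 hy1.2)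
          (h12 ▸ mP hb' e' hy2)))
      rcases h6.lt_or_eq with h16 | h16
      · obtain ⟨x', hx1, hx2⟩ := exists_between (lt_min h16
          ((mP hb e).lt_iff_lt.1 (h10.trans_eq (part_partInv hb e _).symm)))
        rw [lt_min_iff] at hx2
        refine Or.inr (Or.inr (strict x' y (h5.trans hx1.le) hx2.1.le h7 h8 ?_ ?_))
        · have := mP hb e hx2.2
          rwa [part_partInv hb] at this
        · rw [h12]; exact mP hb' e hx1
      · right; left
        rw [h15, ← h16]
        exact ⟨h1, h2, h3, h4, ⟨hX ▸ h5, hX' ▸ h6⟩, ⟨hY ▸ h7, hY' ▸ h8⟩, ⟨h9, Or.inl h10⟩,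
          ⟨h11, Or.inr ⟨h12, h13, h14⟩⟩⟩
  · rcases h12 with h12 | ⟨-, h15, -⟩
    -- The first agent is indifferent: enlarging `y` or reducing `x` makes its preference strict.
    · rcases h8.lt_or_eq with h15 | h15
      · obtain ⟨y', hy1, hy2⟩ := exists_between (lt_min h15
          ((mP hb' e').lt_iff_lt.1 (h12.trans_eq (part_partInv hb' e' _).symm)))
        rw [lt_min_iff] at hy2
        refine Or.inr (Or.inr (strict x y' h5 h6 (h7.trans hy1.le) hy2.1.le ?_ ?_))
        · rw [h10]; exact mP hb e' hy1
        · have := mP hb' e' hy2.2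
          rwa [part_partInv hb'] at this
      rcases h5.lt_or_eq with h16 | h16
      · obtain ⟨x', hx1, hx2⟩ := exists_between (max_lt h16 ((part_lt_iff hb').1 h12))
        rw [max_lt_iff] at hx1
        exact Or.inr (Or.inr (strict x' y hx1.1.le (hx2.le.trans h6) h7 h8 (h10 ▸ mP hb e hx2)
          ((part_lt_iff hb').2 hx1.2)))
      · left
        rw [h16, ← h15]
        exact ⟨h1, h2, h3, h4, ⟨hX ▸ h5, hX' ▸ h6⟩, ⟨hY ▸ h7, hY' ▸ h8⟩,
          ⟨h9, Or.inr ⟨h10, h13, h14⟩⟩, ⟨h11, Or.inl h12⟩⟩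
    -- Both agents indifferent: each head would have to precede the other.
    · exact absurd h13 (lt_asymm h15)

end TaskGraph

end PresentBias

namespace PresentBias

namespace TaskGraph

variable {n m : ℕ} {G : TaskGraph n m} {C : Chunking m}
variable {β B : ℝ} {ord : Fin n → ℕ} {δ : Fin n → ℝ}

/-! ### Dynamic programming over pairs of vertices -/

/-- The numbers of chunks for which two agents can be made to take `e` together. -/
def soloSet (G : TaskGraph n m) (B : ℝ) (δ : Fin n → ℝ) (k : ℕ) (b b' : ℝ) (e : Fin m) : Set ℕ :=
  {w | ∃ l, SoloPlan G B δ k b b' e l w}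

/-- The numbers of chunks for which two agents can be made to take `e` and `e'`. -/
def pairSet (G : TaskGraph n m) (B : ℝ) (δ : Fin n → ℝ) (k : ℕ) (b b' : ℝ) (e e' : Fin m) : Set ℕ :=
  {w | (e' = e ∧ ∃ l, SoloPlan G B δ k b b' e l w) ∨
    (e' ≠ e ∧ ∃ l x l' y f z, PairPlan G B δ k b b' e e' l x l' y f z w)}

/-- In `ord`, the tails of edges and the sink have numbers of their own. -/
structure Layout (G : TaskGraph n m) (β B : ℝ) (ord : Fin n → ℕ) (δ : Fin n → ℝ) : Prop
    extends G.IsDist β B ord δ where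
  inj : ∀ u v, ord u = ord v → (u = G.sink ∨ ∃ e, G.tail e = u) → u = v

/-- The table `V` with domain `F` accounts for all ways to continue from a pair of vertices. -/
structure Complete (G : TaskGraph n m) (B : ℝ) (ord : Fin n → ℕ) (δ : Fin n → ℝ) (k : ℕ) (b b' : ℝ)
    (F : ℕ → ℕ → ℕ → Prop) (V : ℕ → ℕ → ℕ → ℝ) : Prop where
  base : ∀ j ≤ k, F (ord G.sink) (ord G.sink) j ∧ V (ord G.sink) (ord G.sink) j ≤ 0
  left : ∀ e v j w, ord v < ord (G.tail e) → IsLeast (G.soloSet B δ k b b e) w → w ≤ j → j ≤ k →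
    F (ord (G.head e)) (ord v) (j - w) → F (ord (G.tail e)) (ord v) j ∧
      V (ord (G.tail e)) (ord v) j ≤ G.cost e + V (ord (G.head e)) (ord v) (j - w)
  right : ∀ e v j w, ord v < ord (G.tail e) → IsLeast (G.soloSet B δ k b' b' e) w → w ≤ j → j ≤ k →
    F (ord v) (ord (G.head e)) (j - w) → F (ord v) (ord (G.tail e)) j ∧
      V (ord v) (ord (G.tail e)) j ≤ G.cost e + V (ord v) (ord (G.head e)) (j - w)
  both : ∀ e e' j w, G.tail e' = G.tail e → IsLeast (G.pairSet B δ k b b' e e') w → w ≤ j → j ≤ k →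
    F (ord (G.head e)) (ord (G.head e')) (j - w) → F (ord (G.tail e)) (ord (G.tail e)) j ∧
      V (ord (G.tail e)) (ord (G.tail e)) j ≤
        G.cost e + G.cost e' + V (ord (G.head e)) (ord (G.head e')) (j - w)

/-- The vertices in which a path starts an edge. -/
def tails (G : TaskGraph n m) (P : List (Fin m)) : Finset (Fin n) := (P.map G.tail).toFinset

theorem tails_cons (e : Fin m) (P : List (Fin m)) :
    G.tails (e :: P) = insert (G.tail e) (G.tails P) := by
  simp [tails]

theorem sum_use_le (s : Finset (Fin n)) : ∑ u ∈ s, G.use C u ≤ chunksUsed C := by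
  refine (Finset.sum_le_sum_of_subset (Finset.subset_univ s)).trans ?_
  simp only [use, chunksUsed]
  rw [Finset.sum_fiberwise]

theorem chunksUsed_le {C C' : Chunking m} {u : Fin n}
    (h : ∀ f, G.tail f ≠ u → C' f = C f) : chunksUsed C' ≤ chunksUsed C + G.use C' u := by
  rw [chunksUsed, chunksUsed, use]
  rw [← Finset.sum_filter_add_sum_filter_not (s := Finset.univ) (p := fun e => G.tail e = u), add_comm]
  refine Nat.add_le_add_right ?_ _
  refine le_trans (le_of_eq (Finset.sum_congr rfl fun f hf => ?_))
    (Finset.sum_le_sum_of_subset (Finset.filter_subset (fun e => ¬ G.tail e = u) Finset.univ))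
  rw [h f (by simpa using hf)]

namespace IsDist

variable (D : G.IsDist β B ord δ)
include D

theorem ord_sink_le {u : Fin n} {P : List (Fin m)} (h : G.IsPath u P) :
    ord G.sink ≤ ord u ∧ (P ≠ [] → ord G.sink < ord u) ∧ δ u < B ∧
      ∀ v ∈ G.tails P, ord v ≤ ord u := by
  induction P generalizing u with
  | nil =>
    rw [IsPath] at h
    subst h
    exact ⟨le_rfl, fun h => absurd rfl h, D.sink_le.trans_lt D.bound_pos, by simp [tails]⟩
  | cons e P ih =>
    obtain ⟨rfl, h⟩ := h
    have h1 := ih h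
    have h2 := D.ord_lt e
    refine ⟨by omega, fun _ => by omega, D.live_tail h1.2.2.1, fun v hv => ?_⟩
    rw [tails_cons, Finset.mem_insert] at hv
    rcases hv with rfl | hv
    · exact le_rfl
    · have := h1.2.2.2 v hv
      omega

theorem alive_of_isPath {e : Fin m} {P : List (Fin m)} (h : G.IsPath (G.head e) P) :
    Alive G B δ (G.tail e) := ⟨e, rfl, (D.ord_sink_le h).2.2.1⟩

theorem notMem_tails {e : Fin m} {v : Fin n} {Q : List (Fin m)} (h : G.IsPath v Q)
    (hv : ord v < ord (G.tail e)) : G.tail e ∉ G.tails Q := fun hm => by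
  have := (D.ord_sink_le h).2.2.2 _ hm
  omega

theorem source_live : δ G.source < B := by
  have h : ∀ u, Relation.ReflTransGen (fun u w => ∃ e, G.tail e = u ∧ G.head e = w) u G.sink →
      δ u < B := by
    intro u hu
    induction hu using Relation.ReflTransGen.head_induction_on with
    | refl => exact D.sink_le.trans_lt D.bound_pos
    | head h _ ih =>
      obtain ⟨e, rfl, rfl⟩ := h
      exact D.live_tail ih
  exact h _ G.reachable

theorem exists_natural {b : ℝ} (hb : 1 < b) (hbβ : b ≤ β) {u : Fin n} (hu : Alive G B δ u) :
    ∃ e, G.tail e = u ∧ Natural G B δ b e ∧ δ (G.head e) < B := by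
  obtain ⟨e₀, he₀, hlt⟩ := hu
  obtain ⟨e₁, he₁, hmin⟩ := Finset.exists_min_image ({f | G.tail f = u} : Finset (Fin m))
    (G.whole δ b) ⟨e₀, by simpa using he₀⟩
  obtain ⟨e, he, hmin'⟩ := Finset.exists_min_image
    ({f | G.tail f = u ∧ G.whole δ b f = G.whole δ b e₁} : Finset (Fin m)) G.head
    ⟨e₁, by simpa using he₁⟩
  simp only [Finset.mem_filter, Finset.mem_univ, true_and] at he₁ he hmin hmin'
  have hw : G.whole δ b e < B := by
    rw [he.2]
    exact (hmin e₀ he₀).trans_lt (D.whole_lt hb hbβ hlt)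
  have hle : G.whole δ b e ≤ G.altMin B δ b e := by
    rw [le_altMin]
    exact ⟨hw.le, fun f _ hf => by rw [he.2]; exact hmin f (hf.trans he.1)⟩
  refine ⟨e, he.1, ?_, not_le.1 fun h => absurd hw (not_lt.2 (le_whole hb h))⟩
  rcases hle.lt_or_eq with h | h
  · exact Or.inl h
  · refine Or.inr ⟨h, lt_altHead.2 fun f hf ht hv => ?_⟩
    exact lt_of_le_of_ne (hmin' f ⟨ht.trans he.1, by rw [hv, ← h, he.2]⟩) (head_ne hf ht).symm

theorem exists_natural_path {b : ℝ} (hb : 1 < b) (hbβ : b ≤ β) (u : Fin n) (hu : δ u < B) :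
    ∃ P, G.IsPath u P ∧ ∀ e ∈ P, Natural G B δ b e := by
  induction hk : ord u using Nat.strong_induction_on generalizing u with
  | _ k ih =>
    by_cases hs : u = G.sink
    · exact ⟨[], hs, by simp⟩
    have ha : Alive G B δ u := by
      rcases D.attained u with h | h | ⟨e, he, h⟩
      · exact absurd h.1 hs
      · exact absurd h hu.ne
      · exact ⟨e, he, by linarith [G.cost_nonneg e]⟩
    obtain ⟨e, rfl, hN, hl⟩ := D.exists_natural hb hbβ ha
    obtain ⟨P, hP, hPN⟩ := ih _ (by rw [← hk]; exact D.ord_lt e) _ hl rfl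
    refine ⟨e :: P, ⟨rfl, hP⟩, fun f hf => ?_⟩
    rcases List.mem_cons.1 hf with rfl | hf
    · exact hN
    · exact hPN f hf

end IsDist

namespace Layout

variable (D : G.Layout β B ord δ) {b : ℝ} (hb : 1 < b) (hbβ : b ≤ β)
  {b' : ℝ} (hb' : 1 < b') (hbβ' : b' ≤ β) {k : ℕ}
  {F : ℕ → ℕ → ℕ → Prop} {V : ℕ → ℕ → ℕ → ℝ} (hT : Complete G B ord δ k b b' F V)
include D hb hbβ hb' hbβ' hT

/-- Induction along two paths that agents really take, advancing the agent whose vertex has the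
larger number, or both at a common vertex. The rest of the paths avoids this vertex, so its chunks
are charged once. Replacing them by the least number `w` for which the same edges can be taken
changes no cost and leaves at least as large a budget for the rest. -/
theorem le_of_travels (hC : G.IsChunking C) (u v : Fin n) (P Q : List (Fin m))
    (hP : G.IsPath u P) (hQ : G.IsPath v Q) (tP : ∀ e ∈ P, G.Travels C b e)
    (tQ : ∀ e ∈ Q, G.Travels C b' e) (j : ℕ) (hj : j ≤ k)
    (hu : ∑ w ∈ G.tails P ∪ G.tails Q, G.use C w ≤ j) :
    F (ord u) (ord v) j ∧ V (ord u) (ord v) j ≤ G.pathCost P + G.pathCost Q := by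
  induction hs : ord u + ord v using Nat.strong_induction_on generalizing u v P Q j with
  | _ s ih =>
    have D' := D.toIsDist
    have oP := D'.ord_sink_le hP
    have oQ := D'.ord_sink_le hQ
    rcases lt_trichotomy (ord u) (ord v) with huv | huv | huv
    · -- the second agent moves
      rcases Q with - | ⟨e, Q⟩
      · rw [IsPath] at hQ; subst hQ; omega
      obtain ⟨rfl, hQ⟩ := hQ
      have hal := D'.alive_of_isPath hQ
      have hne : G.tail e ∉ G.tails P ∪ G.tails Q := by
        rw [Finset.mem_union, not_or]
        exact ⟨D'.notMem_tails hP huv, D'.notMem_tails hQ (D'.ord_lt e)⟩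
      rw [tails_cons, Finset.union_insert, Finset.sum_insert hne] at hu
      obtain ⟨l, w₀, hw₀, hp⟩ := D'.exists_soloPlan hb' hbβ' hb' hbβ' hC hal (tQ e (by simp))
        (tQ e (by simp)) (k := k) (by omega)
      obtain ⟨w, hw⟩ : ∃ w, IsLeast (G.soloSet B δ k b' b' e) w :=
        ⟨_, Nat.sInf_mem ⟨w₀, l, hp⟩, fun _ h => Nat.sInf_le h⟩
      have hw1 : w ≤ w₀ := hw.2 ⟨l, hp⟩
      have hlt := D'.ord_lt e
      obtain ⟨h1, h2⟩ := ih _ (by omega) u (G.head e) P Q hP hQ tP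
        (fun f hf => tQ f (by simp [hf])) (j - w) (by omega) (by omega) rfl
      obtain ⟨h3, h4⟩ := hT.right e u j w huv hw (by omega) hj h1
      refine ⟨h3, h4.trans ?_⟩
      simp only [pathCost, List.map_cons, List.sum_cons] at h2 ⊢
      linarith
    · rcases P with - | ⟨e, P⟩ <;> rcases Q with - | ⟨e', Q⟩
      · rw [IsPath] at hP hQ
        subst hP hQ
        have := hT.base j hj
        exact ⟨this.1, by simpa [pathCost] using this.2⟩
      · have := oQ.2.1 (by simp)
        rw [IsPath] at hP
        rw [hP] at huv
        omega
      · have := oP.2.1 (by simp)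
        rw [IsPath] at hQ
        rw [hQ] at huv
        omega
      · obtain ⟨rfl, hP⟩ := hP
        obtain ⟨rfl, hQ⟩ := hQ
        -- Equal numbers mean the same vertex, since one of them is a tail.
        have htt : G.tail e' = G.tail e := (D.inj _ _ huv (Or.inr ⟨e, rfl⟩)).symm
        have hal := D'.alive_of_isPath hP
        have hne : G.tail e ∉ G.tails P ∪ G.tails Q := by
          rw [Finset.mem_union, not_or]
          exact ⟨D'.notMem_tails hP (D'.ord_lt e), D'.notMem_tails hQ (huv ▸ D'.ord_lt e')⟩
        rw [tails_cons, tails_cons, htt, Finset.insert_union, Finset.union_insert,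
          Finset.insert_eq_of_mem (Finset.mem_insert_self _ _), Finset.sum_insert hne] at hu
        obtain ⟨w₀, hw₀, hp⟩ : ∃ w₀, w₀ ≤ G.use C (G.tail e) ∧ w₀ ∈ G.pairSet B δ k b b' e e' := by
          by_cases hee : e' = e
          · subst hee
            obtain ⟨l, w₀, hw₀, hp⟩ := D'.exists_soloPlan hb hbβ hb' hbβ' hC hal (tP e' (by simp))
              (tQ e' (by simp)) (k := k) (by omega)
            exact ⟨w₀, hw₀, Or.inl ⟨rfl, l, hp⟩⟩
          · obtain ⟨l, x, l', y, f, z, w₀, hw₀, hp⟩ := D'.exists_pairPlan hb hbβ hb' hbβ' hC hee htt hal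
              (tP e (by simp)) (tQ e' (by simp)) (k := k) (by omega)
            exact ⟨w₀, hw₀, Or.inr ⟨hee, l, x, l', y, f, z, hp⟩⟩
        obtain ⟨w, hw⟩ : ∃ w, IsLeast (G.pairSet B δ k b b' e e') w :=
          ⟨_, Nat.sInf_mem ⟨w₀, hp⟩, fun _ h => Nat.sInf_le h⟩
        have hw1 : w ≤ w₀ := hw.2 hp
        have hlt := D'.ord_lt e
        have hlt' := D'.ord_lt e'
        obtain ⟨h1, h2⟩ := ih _ (by omega) (G.head e) (G.head e') P Q hP hQ
          (fun f hf => tP f (by simp [hf])) (fun f hf => tQ f (by simp [hf])) (j - w) (by omega)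
          (by omega) rfl
        obtain ⟨h3, h4⟩ := hT.both e e' j w htt hw (by omega) hj h1
        rw [htt]
        refine ⟨h3, h4.trans ?_⟩
        simp only [pathCost, List.map_cons, List.sum_cons] at h2 ⊢
        linarith
    · rcases P with - | ⟨e, P⟩
      · rw [IsPath] at hP; subst hP; omega
      obtain ⟨rfl, hP⟩ := hP
      have hal := D'.alive_of_isPath hP
      have hne : G.tail e ∉ G.tails P ∪ G.tails Q := by
        rw [Finset.mem_union, not_or]
        exact ⟨D'.notMem_tails hP (D'.ord_lt e), D'.notMem_tails hQ huv⟩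
      rw [tails_cons, Finset.insert_union, Finset.sum_insert hne] at hu
      obtain ⟨l, w₀, hw₀, hp⟩ := D'.exists_soloPlan hb hbβ hb hbβ hC hal (tP e (by simp))
        (tP e (by simp)) (k := k) (by omega)
      obtain ⟨w, hw⟩ : ∃ w, IsLeast (G.soloSet B δ k b b e) w :=
        ⟨_, Nat.sInf_mem ⟨w₀, l, hp⟩, fun _ h => Nat.sInf_le h⟩
      have hw1 : w ≤ w₀ := hw.2 ⟨l, hp⟩
      have hlt := D'.ord_lt e
      obtain ⟨h1, h2⟩ := ih _ (by omega) (G.head e) v P Q hP hQ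
        (fun f hf => tP f (by simp [hf])) tQ (j - w) (by omega) (by omega) rfl
      obtain ⟨h3, h4⟩ := hT.left e v j w huv hw (by omega) hj h1
      refine ⟨h3, h4.trans ?_⟩
      simp only [pathCost, List.map_cons, List.sum_cons] at h2 ⊢
      linarith

/-- If no edge is chunked, the agents still reach the sink. -/
theorem source_mem : F (ord G.source) (ord G.source) k := by
  have D' := D.toIsDist
  obtain ⟨P, hP, hPN⟩ := D'.exists_natural_path hb hbβ _ D'.source_live
  obtain ⟨Q, hQ, hQN⟩ := D'.exists_natural_path hb' hbβ' _ D'.source_live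
  have hC : G.IsChunking (fun e => [G.cost e]) := fun e => by simp [G.cost_nonneg e]
  have hal : ∀ (u : Fin n) (P : List (Fin m)), G.IsPath u P → ∀ e ∈ P, Alive G B δ (G.tail e) := by
    intro u P
    induction P generalizing u with
    | nil => simp
    | cons e P ih =>
      rintro ⟨-, hP⟩ f hf
      rcases List.mem_cons.1 hf with rfl | hf
      · exact D'.alive_of_isPath hP
      · exact ih _ hP f hf
  refine (D.le_of_travels hb hbβ hb' hbβ' hT hC _ _ P Q hP hQ (fun e he => ?_) (fun e he => ?_) k
    le_rfl ?_).1
  · exact D'.travels_of_natural hC hb hbβ (hal _ _ hP e he) (hPN e he) (fun f _ => rfl)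
  · exact D'.travels_of_natural hC hb' hbβ' (hal _ _ hQ e he) (hQN e he) (fun f _ => rfl)
  · exact (sum_use_le _).trans (by simp [chunksUsed])

theorem isOptimal (hC : G.IsChunking C) {P Q : List (Fin m)} (hP : G.IsPath G.source P)
    (hQ : G.IsPath G.source Q) (tP : ∀ e ∈ P, G.Travels C b e) (tQ : ∀ e ∈ Q, G.Travels C b' e)
    (hk : chunksUsed C ≤ k)
    (hV : G.pathCost P + G.pathCost Q = V (ord G.source) (ord G.source) k) :
    G.IsOptimal C b b' k := by
  refine ⟨P, Q, ⟨hC, hk, ⟨hP, tP⟩, ⟨hQ, tQ⟩⟩, fun C' P' Q' h => ?_⟩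
  obtain ⟨hC', hk', ⟨hP', tP'⟩, ⟨hQ', tQ'⟩⟩ := h
  rw [hV]
  exact (D.le_of_travels hb hbβ hb' hbβ' hT hC' _ _ P' Q' hP' hQ' tP' tQ' k le_rfl
    ((sum_use_le _).trans hk')).2

end Layout

end TaskGraph

end PresentBias

namespace PresentBias

/-! ### The program: preparation -/

abbrev nr := NExp.reg
abbrev nl := NExp.lit
abbrev na := NExp.get
abbrev rr := RExp.reg
abbrev rl := RExp.lit
abbrev ra := RExp.get

open TaskGraph Cmd

variable {n m : ℕ} {G : TaskGraph n m} {b₁ b₂ : ℝ} {k : ℕ}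

/-- The memory holds the input. -/
structure HasInput (G : TaskGraph n m) (b₁ b₂ : ℝ) (k : ℕ) (σ : Mem) : Prop where
  regN : σ.nreg 0 = n
  regM : σ.nreg 1 = m
  sink : σ.nreg 3 = G.sink
  source : σ.nreg 2 = G.source
  regK : σ.nreg 4 = k
  b₁ : σ.rreg 0 = b₁
  b₂ : σ.rreg 1 = b₂
  tail : ∀ e : Fin m, σ.narr 0 e = G.tail e
  head : ∀ e : Fin m, σ.narr 1 e = G.head e
  cost : ∀ e : Fin m, σ.rarr 0 e = G.cost e

/-- The program does not overwrite the input. -/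
def Cmd.keepsInput (c : Cmd) : Bool :=
  c.keepsN 0 && c.keepsN 1 && c.keepsN 2 && c.keepsN 3 && c.keepsN 4 && c.keepsR 0 && c.keepsR 1 &&
    c.keepsNA 0 && c.keepsNA 1 && c.keepsRA 0

theorem HasInput.keep {c : Cmd} {σ τ : Mem} (h : HasInput G b₁ b₂ k σ) (hk : Keep c σ τ)
    (hc : c.keepsInput = true) : HasInput G b₁ b₂ k τ := by
  simp only [Cmd.keepsInput, Bool.and_eq_true] at hc
  obtain ⟨⟨⟨⟨⟨⟨⟨⟨⟨h0, h1⟩, h2⟩, h3⟩, h4⟩, r0⟩, r1⟩, a0⟩, a1⟩, ra0⟩ := hc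
  constructor
  · rw [hk.n _ h0, h.regN]
  · rw [hk.n _ h1, h.regM]
  · rw [hk.n _ h3, h.sink]
  · rw [hk.n _ h2, h.source]
  · rw [hk.n _ h4, h.regK]
  · rw [hk.r _ r0, h.b₁]
  · rw [hk.r _ r1, h.b₂]
  · rw [hk.na _ a0]; exact h.tail
  · rw [hk.na _ a1]; exact h.head
  · rw [hk.ra _ ra0]; exact h.cost

/-- Compute a bound for all perceived costs. -/
def boundCmd : Cmd :=
  rset 2 (rl 0) ;; upTo 5 (nr 1) (rset 2 (.add (rr 2) (ra 0 (nr 5)))) ;;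
  rset 3 (.add (.mul (.add (rr 1) (rl 2)) (rr 2)) (rl 1))

/-- The summand 1 makes the inequality in `IsDist.big` strict even if all costs vanish. -/
def bound (G : TaskGraph n m) (b₂ : ℝ) : ℝ := (b₂ + 2) * G.totalCost + 1

theorem boundCmd_runs {σ : Mem} (h : HasInput G b₁ b₂ k σ) :
    Runs boundCmd σ (100 * (m + 1)) fun τ => τ.rreg 3 = bound G b₂ := by
  refine Runs.le (s := 2 + (m * (10 + 9) + 9 + 50)) ?_ (by omega)
  refine Runs.seq' (R := fun τ => τ.rreg 2 = 0) (.flat rfl (by decide) fun _ => by simp)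
    fun τ hτ h2 => ?_
  have hi := h.keep hτ rfl
  refine Runs.seq' (R := fun τ => τ.rreg 2 = G.totalCost) ?_ fun ρ hρ h3 => ?_
  · refine Runs.upTo' (fun j ρ => ρ.rreg 2 = ∑ e ∈ ({e : Fin m | (e : ℕ) < j} : Finset (Fin m)), G.cost e) (N := m) (t := 10)
      rfl (fun ρ hρ => ?_) (by simp [h2]) (fun j hj ρ hρ hρj hJ => ?_) le_rfl fun ρ hρ hJ => ?_
    · exact (hi.keep hρ rfl).regM
    · refine .flat rfl (by decide) fun _ => ?_
      have hc := (hi.keep hρ rfl).cost ⟨j, hj⟩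
      simp only [run_rset, RExp.eval_add, RExp.eval_reg, RExp.eval_get, NExp.eval_reg, Mem.setN_rreg,
        Mem.setR_rreg, if_true, hρj, hJ]
      change ρ.rarr 0 j = _ at hc
      have : ({e : Fin m | (e : ℕ) < j + 1} : Finset (Fin m)) =
          insert ⟨j, hj⟩ ({e : Fin m | (e : ℕ) < j} : Finset (Fin m)) := by
        ext e; simp [Fin.ext_iff]; omega
      rw [this, Finset.sum_insert (by simp), add_comm, hc]
    · rw [hJ, totalCost]
      congr 1
      ext e; simp
  · have hi' := hi.keep hρ rfl
    refine .flat rfl (by decide) fun _ => ?_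
    simp [bound, h3, hi'.b₂]

/-- Number the vertices and compute the distances to the sink. -/
def orderStep : Cmd :=
  nset 7 (nl 0) ;;
  upTo 6 (nr 1) (when (.conj (.neq (na 4 (nr 6)) (nl 0)) (.neq (na 5 (na 1 (nr 6))) (nl 0)))
    (nset 7 (nr 6))) ;;
  nput 4 (nr 7) (nl 1) ;; nput 5 (na 0 (nr 7)) (.sub (na 5 (na 0 (nr 7))) (nl 1)) ;;
  nput 6 (na 0 (nr 7)) (.add (nr 5) (nl 2)) ;;
  when (.rle (.add (ra 0 (nr 7)) (ra 2 (na 1 (nr 7)))) (ra 2 (na 0 (nr 7))))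
    (rput 2 (na 0 (nr 7)) (.add (ra 0 (nr 7)) (ra 2 (na 1 (nr 7)))))

/-- Topological sorting from the sink side, merged with the computation of shortest paths. Array 4
flags the edges that are placed, array 5 counts the edges out of each vertex that are not, array 6
holds the numbers and real array 2 the distances. Placing an edge gives its tail a fresh number, so
the last edge placed at a vertex determines its final number. Only the first loop runs over all
vertices. -/
def orderCmd : Cmd :=
  upTo 5 (nr 0) (rput 2 (nr 5) (rr 3)) ;; rput 2 (nr 3) (rl 0) ;;
  upTo 5 (nr 1) (nput 5 (na 0 (nr 5)) (.add (na 5 (na 0 (nr 5))) (nl 1))) ;; nput 6 (nr 3) (nl 1) ;;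
  upTo 5 (nr 1) orderStep

/-- The state after `i` edges have been placed. -/
structure Placed (G : TaskGraph n m) (B : ℝ) (i : ℕ) (τ : Mem) : Prop where
  flag : ∀ e : Fin m, τ.narr 4 e = 0 ∨ τ.narr 4 e = 1
  card : ({e : Fin m | τ.narr 4 e = 1} : Finset (Fin m)).card = i
  count : ∀ v : Fin n, τ.narr 5 v = ({e : Fin m | G.tail e = v ∧ τ.narr 4 e = 0} : Finset (Fin m)).card
  le : ∀ v : Fin n, τ.narr 6 v ≤ i + 1
  inj : ∀ u v : Fin n, τ.narr 6 u = τ.narr 6 v → 2 ≤ τ.narr 6 u → u = v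
  head : ∀ e : Fin m, τ.narr 4 e = 1 →
    τ.narr 5 (G.head e) = 0 ∧ τ.narr 6 (G.head e) < τ.narr 6 (G.tail e)
  zero : ∀ v : Fin n, τ.narr 6 v = 0 → v ≠ G.sink
  one : ∀ v : Fin n, τ.narr 6 v = 1 → v = G.sink
  dist_le : ∀ v : Fin n, τ.rarr 2 v ≤ B
  sink : τ.rarr 2 G.sink ≤ 0
  edge : ∀ e : Fin m, τ.narr 4 e = 1 → τ.rarr 2 (G.tail e) ≤ G.cost e + τ.rarr 2 (G.head e)
  attained : ∀ v : Fin n, (v = G.sink ∧ τ.rarr 2 v = 0) ∨ τ.rarr 2 v = B ∨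
    ∃ e : Fin m, τ.narr 4 e = 1 ∧ G.tail e = v ∧ τ.rarr 2 v = G.cost e + τ.rarr 2 (G.head e)

/-- Among the heads of unplaced edges choose one from which no other can be reached, which exists
because the finite graph is acyclic. An unplaced edge out of it would lead to a further such head.
-/
theorem Placed.exists_next {B : ℝ} {i : ℕ} {τ : Mem} (h : Placed G B i τ) (hi : i < m) :
    ∃ e : Fin m, τ.narr 4 e = 0 ∧ τ.narr 5 (G.head e) = 0 := by
  have hne : ∃ e : Fin m, τ.narr 4 e = 0 := by
    by_contra hno
    push Not at hno
    have : ({e : Fin m | τ.narr 4 e = 1} : Finset (Fin m)) = Finset.univ := by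
      ext e
      simpa using (h.flag e).resolve_left (hno e)
    have hc := h.card
    rw [this, Finset.card_univ, Fintype.card_fin] at hc
    omega
  let r : Fin n → Fin n → Prop := fun w u => Relation.TransGen (fun u w => ∃ e, G.tail e = u ∧ G.head e = w) u w
  have hwf : WellFounded r := by
    have : IsTrans (Fin n) r := ⟨fun a b c hab hbc => Relation.TransGen.trans hbc hab⟩
    have : Std.Irrefl r := ⟨fun a ha => G.acyclic a ha⟩
    exact Finite.wellFounded_of_trans_of_irrefl r
  obtain ⟨e₀, he₀⟩ := hne
  obtain ⟨v, ⟨e, he, rfl⟩, hmin⟩ := hwf.has_min {v | ∃ e : Fin m, τ.narr 4 e = 0 ∧ G.head e = v}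
    ⟨_, e₀, he₀, rfl⟩
  refine ⟨e, he, ?_⟩
  rw [h.count, Finset.card_eq_zero, Finset.filter_eq_empty_iff]
  rintro f - ⟨hf, hf0⟩
  exact hmin (G.head f) ⟨f, hf0, rfl⟩ (Relation.TransGen.single ⟨f, hf, rfl⟩)

/-- All edges out of the head of `p` are placed, so its number and distance are final. The tail of
`p` receives the number `i + 2`, above all numbers used so far. It is not the head of any placed
edge, because `p` itself was an unplaced edge out of it; hence nothing established earlier is
disturbed. -/
theorem Placed.step {B : ℝ} {i : ℕ} {σ τ : Mem} (h : Placed G B i σ) {p : Fin m}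
    (hp : σ.narr 4 p = 0) (hp' : σ.narr 5 (G.head p) = 0)
    (h4 : ∀ e : Fin m, τ.narr 4 e = if e = p then 1 else σ.narr 4 e)
    (h5 : ∀ v : Fin n, τ.narr 5 v = if v = G.tail p then σ.narr 5 v - 1 else σ.narr 5 v)
    (h6 : ∀ v : Fin n, τ.narr 6 v = if v = G.tail p then i + 2 else σ.narr 6 v)
    (h2 : ∀ v : Fin n, τ.rarr 2 v = if v = G.tail p then
      min (σ.rarr 2 v) (G.cost p + σ.rarr 2 (G.head p)) else σ.rarr 2 v) :
    Placed G B (i + 1) τ := by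
  have hpos : ∀ e : Fin m, σ.narr 5 (G.head e) = 0 → G.head e ≠ G.tail p := by
    intro e he heq
    rw [heq, h.count, Finset.card_eq_zero, Finset.filter_eq_empty_iff] at he
    exact he (Finset.mem_univ p) ⟨rfl, hp⟩
  have hone : ∀ e : Fin m, τ.narr 4 e = 1 ↔ e = p ∨ σ.narr 4 e = 1 := by
    intro e; rw [h4]; split_ifs with hep <;> simp [hep]
  have hhead : ∀ e : Fin m, τ.narr 4 e = 1 → σ.narr 5 (G.head e) = 0 := by
    intro e he
    rcases (hone e).1 he with rfl | he
    · exact hp'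
    · exact (h.head e he).1
  constructor
  · intro e
    rw [h4]
    split_ifs
    · exact Or.inr rfl
    · exact h.flag e
  · rw [← h.card, ← Finset.card_insert_of_notMem (s := ({e : Fin m | σ.narr 4 e = 1} : Finset (Fin m)))
      (a := p) (by simp [hp])]
    congr 1
    ext e
    simp [hone]
  · intro v
    rw [h5]
    have hE : ({e : Fin m | G.tail e = v ∧ τ.narr 4 e = 0} : Finset (Fin m)) =
        ({e : Fin m | G.tail e = v ∧ σ.narr 4 e = 0} : Finset (Fin m)).erase p := by
      ext e
      simp only [Finset.mem_filter, Finset.mem_univ, true_and, Finset.mem_erase, h4]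
      split_ifs with hep <;> simp [hep]
    rw [hE]
    split_ifs with hv
    · rw [Finset.card_erase_of_mem (by simp [hv, hp]), h.count]
    · rw [Finset.erase_eq_of_notMem (by simp [Ne.symm hv]), h.count]
  · intro v
    rw [h6]
    split_ifs
    · omega
    · have := h.le v; omega
  · intro u v huv h2u
    have hu := h.le u
    have hv := h.le v
    rw [h6] at huv h2u
    rw [h6 v] at huv
    split_ifs at huv h2u with hu' hv' hv'
    · rw [hu', hv']
    · omega
    · omega
    · exact h.inj u v huv h2u
  · intro e he
    have hz := hhead e he
    have hne := hpos e hz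
    rw [h5, h6, h6, if_neg hne, if_neg hne]
    refine ⟨hz, ?_⟩
    have h7 := h.le (G.head e)
    split_ifs with ht
    · omega
    · rcases (hone e).1 he with rfl | he
      · exact absurd rfl ht
      · exact (h.head e he).2
  · intro v hv
    rw [h6] at hv
    split_ifs at hv
    exact h.zero v hv
  · intro v hv
    rw [h6] at hv
    split_ifs at hv
    · omega
    · exact h.one v hv
  · intro v
    rw [h2]
    split_ifs
    · exact (min_le_left _ _).trans (h.dist_le v)
    · exact h.dist_le v
  · rw [h2]
    split_ifs
    · exact (min_le_left _ _).trans h.sink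
    · exact h.sink
  · intro e he
    rw [h2, h2, if_neg (hpos e (hhead e he))]
    rcases (hone e).1 he with rfl | he
    · rw [if_pos rfl]; exact min_le_right _ _
    · split_ifs
      · exact (min_le_left _ _).trans (h.edge e he)
      · exact h.edge e he
  · intro v
    have hkeep : ∀ e : Fin m, τ.narr 4 e = 1 → τ.rarr 2 (G.head e) = σ.rarr 2 (G.head e) :=
      fun e he => by rw [h2, if_neg (hpos e (hhead e he))]
    have hold : τ.rarr 2 v = σ.rarr 2 v → (v = G.sink ∧ τ.rarr 2 v = 0) ∨ τ.rarr 2 v = B ∨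
        ∃ e : Fin m, τ.narr 4 e = 1 ∧ G.tail e = v ∧ τ.rarr 2 v = G.cost e + τ.rarr 2 (G.head e) := by
      intro hv
      rw [hv]
      rcases h.attained v with h1 | h1 | ⟨e, he, ht, h1⟩
      · exact Or.inl h1
      · exact Or.inr (Or.inl h1)
      · have he' := (hone e).2 (Or.inr he)
        exact Or.inr (Or.inr ⟨e, he', ht, by rw [hkeep e he', h1]⟩)
    by_cases hv : v = G.tail p
    · rcases min_choice (σ.rarr 2 v) (G.cost p + σ.rarr 2 (G.head p)) with h3 | h3
      · exact hold (by rw [h2, if_pos hv, h3])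
      · have hp1 := (hone p).2 (Or.inl rfl)
        exact Or.inr (Or.inr ⟨p, hp1, hv.symm, by rw [h2, if_pos hv, h3, hkeep p hp1]⟩)
    · exact hold (by rw [h2, if_neg hv])

theorem orderStep_runs {B : ℝ} {i : ℕ} {σ : Mem} (h : HasInput G b₁ b₂ k σ) (hi : i < m)
    (h5 : σ.nreg 5 = i) (hP : Placed G B i σ) :
    Runs orderStep σ (40 * m + 100) fun τ => Placed G B (i + 1) τ := by
  refine Runs.le (s := 2 + (m * (30 + 9) + 9 + 80)) ?_ (by omega)
  refine Runs.seq' (R := fun τ => True) (.flat rfl (by decide) fun _ => trivial) fun τ hτ _ => ?_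
  have hτi := h.keep hτ rfl
  refine Runs.seq' (R := fun τ => ∃ p : Fin m, τ.nreg 7 = p ∧ σ.narr 4 p = 0 ∧
    σ.narr 5 (G.head p) = 0) ?_ fun ρ hρ hp => ?_
  · refine Runs.upTo' (fun j ρ => ∀ e : Fin m, (e : ℕ) < j → σ.narr 4 e = 0 → σ.narr 5 (G.head e) = 0 →
      ∃ p : Fin m, ρ.nreg 7 = p ∧ σ.narr 4 p = 0 ∧ σ.narr 5 (G.head p) = 0) (N := m) (t := 30)
      rfl (fun ρ hρ => (hτi.keep hρ rfl).regM) (fun e he => by omega) (fun j hj ρ hρ hρj hJ => ?_) le_rfl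
      fun ρ hρ hJ => ?_
    · refine .flat rfl (by decide) fun _ => ?_
      have hin := hτi.keep hρ rfl
      have hh := hin.head ⟨j, hj⟩
      have a4 : ρ.narr 4 = σ.narr 4 := (hρ.na 4 rfl).trans (hτ.na 4 rfl)
      have a5 : ρ.narr 5 = σ.narr 5 := (hρ.na 5 rfl).trans (hτ.na 5 rfl)
      simp only at hh
      simp only [when, Cmd.skip, run_ite, BExp.eval_conj, BExp.eval_neq, NExp.eval_get, NExp.eval_reg, NExp.eval_lit,
        hρj, a4, a5, hh, run_nset]
      split_ifs with hc
      · intro e _ _ _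
        exact ⟨⟨j, hj⟩, by simp, hc.1, hc.2⟩
      · intro e he h1 h2
        have hne : (e : ℕ) ≠ j := by
          rintro rfl
          exact hc ⟨h1, h2⟩
        simpa using hJ e (by omega) h1 h2
    · obtain ⟨e, he, he'⟩ := hP.exists_next hi
      exact hJ e e.2 he he'
  · obtain ⟨p, hp7, hp4, hp5⟩ := hp
    refine .flat rfl (by decide) fun _ => ?_
    have hin := hτi.keep hρ rfl
    have a4 : ρ.narr 4 = σ.narr 4 := (hρ.na 4 rfl).trans (hτ.na 4 rfl)
    have a5 : ρ.narr 5 = σ.narr 5 := (hρ.na 5 rfl).trans (hτ.na 5 rfl)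
    have a6 : ρ.narr 6 = σ.narr 6 := (hρ.na 6 rfl).trans (hτ.na 6 rfl)
    have a2 : ρ.rarr 2 = σ.rarr 2 := (hρ.ra 2 rfl).trans (hτ.ra 2 rfl)
    have r5 : ρ.nreg 5 = i := (hρ.n 5 rfl).trans ((hτ.n 5 rfl).trans h5)
    have ht := hin.tail p
    have hh := hin.head p
    have hc := hin.cost p
    refine hP.step hp4 hp5 ?_ ?_ ?_ ?_
    · intro e
      simp only [when, Cmd.skip, run_seq, run_ite, run_nput]
      split_ifs <;> simp [hp7, ← Fin.ext_iff, a4] <;> simp_all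
    · intro v
      simp only [when, Cmd.skip, run_seq, run_ite, run_nput]
      split_ifs <;> simp [hp7, ht, ← Fin.ext_iff, a5] <;> simp_all
    · intro v
      simp only [when, Cmd.skip, run_seq, run_ite, run_nput]
      split_ifs <;> simp [hp7, ht, ← Fin.ext_iff, a6, r5] <;> simp_all
    · intro v
      simp only [when, Cmd.skip, run_seq, run_ite, run_nput]
      simp only [BExp.eval_rle, RExp.eval_add, RExp.eval_get, NExp.eval_reg, NExp.eval_get, Mem.putN_rarr,
        Mem.putN_nreg, Mem.putN_narr_apply, hp7, ht, hh, hc, a2, show (0:ℕ) ≠ 4 by decide, show (0:ℕ) ≠ 5 by decide,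
        show (0:ℕ) ≠ 6 by decide, show (1:ℕ) ≠ 4 by decide, show (1:ℕ) ≠ 5 by decide,
        show (1:ℕ) ≠ 6 by decide, false_and, if_false]
      by_cases hv : v = G.tail p
      · subst hv
        rw [if_pos (rfl : G.tail p = G.tail p)]
        split_ifs with h1
        · simp [hp7, ht, hh, hc, a2, min_eq_right h1]
        · simp [hp7, ht, a2, min_eq_left (not_le.1 h1).le]
      · split_ifs with h1
        · simp [hp7, ht, hh, hc, a2, hv, ← Fin.ext_iff]
        · simp [a2]

/-- The memory holds the bound, the numbers of the vertices and the distances. -/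
structure HasDist (G : TaskGraph n m) (b₂ : ℝ) (ord : Fin n → ℕ) (δ : Fin n → ℝ) (σ : Mem) :
    Prop where
  bound : σ.rreg 3 = bound G b₂
  ord : ∀ v : Fin n, σ.narr 6 v = ord v
  dist : ∀ v : Fin n, σ.rarr 2 v = δ v

/-- The program does not overwrite the numbers of the vertices and the distances. -/
def Cmd.keepsDist (c : Cmd) : Bool := c.keepsR 3 && c.keepsNA 6 && c.keepsRA 2

theorem HasDist.keep {ord : Fin n → ℕ} {δ : Fin n → ℝ} {c : Cmd} {σ τ : Mem}
    (h : HasDist G b₂ ord δ σ) (hk : Keep c σ τ) (hc : c.keepsDist = true) :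
    HasDist G b₂ ord δ τ := by
  simp only [Cmd.keepsDist, Bool.and_eq_true] at hc
  obtain ⟨⟨h0, h1⟩, h2⟩ := hc
  constructor
  · rw [hk.r _ h0, h.bound]
  · rw [hk.na _ h1]; exact h.ord
  · rw [hk.ra _ h2]; exact h.dist

theorem orderCmd_runs {σ : Mem} (h : HasInput G b₁ b₂ k σ) (hb : 1 < b₁) (hbb : b₁ < b₂)
    (hB : σ.rreg 3 = bound G b₂)
    (h4 : ∀ i, σ.narr 4 i = 0) (h5 : ∀ i, σ.narr 5 i = 0) (h6 : ∀ i, σ.narr 6 i = 0) :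
    Runs orderCmd σ (100 * (m * m + n + 2 * m + 1)) fun τ => ∃ ord δ,
      Layout G b₂ (bound G b₂) ord δ ∧ (∀ v, ord v ≤ m + 1) ∧ (∀ v : Fin n, τ.narr 6 v = ord v) ∧
      ∀ v : Fin n, τ.rarr 2 v = δ v := by
  have hS := G.totalCost_nonneg
  have hBpos : 0 < bound G b₂ := by
    have : 0 ≤ (b₂ + 2) * G.totalCost := by apply mul_nonneg <;> linarith
    simp only [bound]; linarith
  refine Runs.le (s := n * (10 + 9) + 9 + (20 + (m * (20 + 9) + 9 + (20 + (m * (40 * m + 100 + 9) + 9)))))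
    ?_ (by nlinarith)
  refine Runs.seq' (R := fun τ => ∀ v : Fin n, τ.rarr 2 v = bound G b₂) ?_ fun τ hτ h1 => ?_
  · refine Runs.upTo' (fun j ρ => ∀ v : Fin n, (v : ℕ) < j → ρ.rarr 2 v = bound G b₂) (N := n) (t := 10)
      rfl (fun ρ hρ => (h.keep hρ rfl).regN) (fun v hv => by omega) (fun j hj ρ hρ hρj hJ => ?_) le_rfl
      fun ρ hρ hJ v => hJ v v.2
    refine .flat rfl (by decide) fun _ v hv => ?_
    have := hρ.r 3 rfl
    simp only [run_rput, NExp.eval_reg, RExp.eval_reg, Mem.setN_rarr, Mem.putR_rarr_apply, true_and, hρj,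
      this, hB]
    split_ifs with hvj
    · rfl
    · exact hJ v (by omega)
  have hτi := h.keep hτ rfl
  refine Runs.seq' (R := fun ρ => ∀ v : Fin n, ρ.rarr 2 v = if v = G.sink then 0 else bound G b₂) ?_
    fun ρ hρ h2 => ?_
  · refine .flat rfl (by decide) fun _ v => ?_
    simp [hτi.sink, h1, ← Fin.ext_iff]
  have hρi := hτi.keep hρ rfl
  refine Runs.seq' (R := fun μ => ∀ v : Fin n, μ.narr 5 v =
      ({e : Fin m | G.tail e = v} : Finset (Fin m)).card) ?_ fun μ hμ h3 => ?_
  · refine Runs.upTo' (fun j μ => ∀ v : Fin n, μ.narr 5 v =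
      ({e : Fin m | (e : ℕ) < j ∧ G.tail e = v} : Finset (Fin m)).card) (N := m) (t := 20)
      rfl (fun ρ hρ => (hρi.keep hρ rfl).regM) (fun v => ?_) (fun j hj μ hμ hμj hJ => ?_) le_rfl
      fun μ hμ hJ v => ?_
    · have a5 : ρ.narr 5 = σ.narr 5 := (hρ.na 5 rfl).trans (hτ.na 5 rfl)
      simp [a5, h5]
    · refine .flat rfl (by decide) fun _ v => ?_
      have ht := (hρi.keep hμ rfl).tail ⟨j, hj⟩
      simp only at ht
      have hE : ({e : Fin m | (e : ℕ) < j + 1 ∧ G.tail e = v} : Finset (Fin m)) =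
          if G.tail ⟨j, hj⟩ = v then insert ⟨j, hj⟩ ({e : Fin m | (e : ℕ) < j ∧ G.tail e = v} : Finset (Fin m))
          else ({e : Fin m | (e : ℕ) < j ∧ G.tail e = v} : Finset (Fin m)) := by
        ext e
        split_ifs with hv
        · simp only [Finset.mem_filter, Finset.mem_univ, true_and, Finset.mem_insert, Fin.ext_iff]
          constructor
          · rintro ⟨h1, h2⟩
            by_cases hej : (e : ℕ) = j
            · exact Or.inl hej
            · exact Or.inr ⟨by omega, h2⟩
          · rintro (h1 | h1)
            · have : e = ⟨j, hj⟩ := Fin.ext h1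
              subst this
              exact ⟨by simp, by rw [hv]⟩
            · exact ⟨by omega, h1.2⟩
        · simp only [Finset.mem_filter, Finset.mem_univ, true_and]
          constructor
          · rintro ⟨h1, h2⟩
            have : (e : ℕ) ≠ j := by
              intro hej
              have : e = ⟨j, hj⟩ := Fin.ext hej
              subst this
              exact hv h2
            exact ⟨by omega, h2⟩
          · rintro ⟨h1, h2⟩
            exact ⟨by omega, h2⟩
      rw [hE]
      simp only [run_nput, NExp.eval_get, NExp.eval_add, NExp.eval_lit, NExp.eval_reg, hμj, ht, Mem.setN_narr,
        Mem.putN_narr_apply, true_and, ← Fin.ext_iff, hJ]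
      by_cases hv : G.tail ⟨j, hj⟩ = v
      · rw [if_pos hv.symm, if_pos hv, Finset.card_insert_of_notMem (by simp), hv]
      · rw [if_neg (Ne.symm hv), if_neg hv]
    · rw [hJ]
      congr 1
      ext e; simp
  have hμi := hρi.keep hμ rfl
  have a2 : μ.rarr 2 = ρ.rarr 2 := hμ.ra 2 rfl
  have a4 : μ.narr 4 = σ.narr 4 := (hμ.na 4 rfl).trans ((hρ.na 4 rfl).trans (hτ.na 4 rfl))
  have a6 : μ.narr 6 = σ.narr 6 := (hμ.na 6 rfl).trans ((hρ.na 6 rfl).trans (hτ.na 6 rfl))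
  refine Runs.seq' (R := fun ν => Placed G (bound G b₂) 0 ν) ?_ fun ν hν h7 => ?_
  · refine .flat rfl (by decide) fun _ => ?_
    have e4 : ∀ i, ((nput 6 (nr 3) (nl 1)).run μ).narr 4 i = 0 := by simp [a4, h4]
    have e5 : ∀ i, ((nput 6 (nr 3) (nl 1)).run μ).narr 5 i = μ.narr 5 i := by simp
    have e6 : ∀ v : Fin n, ((nput 6 (nr 3) (nl 1)).run μ).narr 6 v = if v = G.sink then 1 else 0 := by
      simp [a6, h6, hμi.sink, ← Fin.ext_iff]
    have e2 : ∀ v : Fin n, ((nput 6 (nr 3) (nl 1)).run μ).rarr 2 v =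
        if v = G.sink then 0 else bound G b₂ := by simp [a2, h2]
    generalize (nput 6 (nr 3) (nl 1)).run μ = ν at e4 e5 e6 e2 ⊢
    constructor
    · exact fun e => Or.inl (e4 e)
    · rw [Finset.card_eq_zero, Finset.filter_eq_empty_iff]
      intro e _
      simp [e4]
    · intro v
      rw [e5, h3]
      congr 1
      ext e
      simp [e4]
    · intro v; rw [e6]; split_ifs <;> omega
    · intro u v huv hu; rw [e6] at hu; split_ifs at hu <;> omega
    · intro e he; rw [e4] at he; omega
    · intro v hv; rw [e6] at hv; split_ifs at hv with h8; exact h8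
    · intro v hv; rw [e6] at hv; split_ifs at hv with h8; exact h8
    · intro v; rw [e2]; split_ifs
      · exact hBpos.le
      · exact le_rfl
    · rw [e2, if_pos rfl]
    · intro e he; rw [e4] at he; omega
    · intro v; rw [e2]
      by_cases hv : v = G.sink
      · exact Or.inl ⟨hv, if_pos hv⟩
      · exact Or.inr (Or.inl (if_neg hv))
  have hνi := hμi.keep hν rfl
  refine Runs.upTo' (fun i τ => Placed G (bound G b₂) i τ) (N := m) (t := 40 * m + 100)
    rfl (fun ρ hρ => (hνi.keep hρ rfl).regM) ?_ (fun j hj ξ hξ hξj hJ => ?_) le_rfl fun ξ hξ hJ => ?_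
  · exact ⟨h7.flag, h7.card, h7.count, h7.le, h7.inj, h7.head, h7.zero, h7.one, h7.dist_le, h7.sink,
      h7.edge, h7.attained⟩
  · refine (orderStep_runs (hνi.keep hξ rfl) hj hξj hJ).imp fun η _ h7 => ?_
    exact ⟨h7.flag, h7.card, h7.count, h7.le, h7.inj, h7.head, h7.zero, h7.one, h7.dist_le, h7.sink,
      h7.edge, h7.attained⟩
  · have hall : ∀ e : Fin m, ξ.narr 4 e = 1 := by
      have := (Finset.card_eq_iff_eq_univ _).1 (hJ.card.trans (Fintype.card_fin m).symm)
      intro e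
      have he := Finset.mem_univ e
      rw [← this] at he
      simpa using he
    refine ⟨fun v => ξ.narr 6 v, fun v => ξ.rarr 2 v, ⟨⟨hb.trans hbb, ?_, fun e => (hJ.head e (hall e)).2,
      hJ.dist_le, hJ.sink, fun e => hJ.edge e (hall e), fun v => ?_⟩, fun u v huv hu => ?_⟩,
      hJ.le, fun _ => rfl, fun _ => rfl⟩
    · simp only [bound]; linarith
    · rcases hJ.attained v with h8 | h8 | ⟨e, -, h8⟩
      · exact Or.inl h8
      · exact Or.inr (Or.inl h8)
      · exact Or.inr (Or.inr ⟨e, h8⟩)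
    -- Number 0 is shared by all vertices other than the sink that have no outgoing edges, and a
    -- vertex with number 1 is the sink; all numbers from 2 on are unique.
    · rcases Nat.lt_or_ge (ξ.narr 6 u) 2 with h8 | h8
      · have h9 : ξ.narr 6 u ≠ 0 := by
          rcases hu with rfl | ⟨e, rfl⟩
          · exact fun h => hJ.zero _ h rfl
          · have := (hJ.head e (hall e)).2; omega
        rw [hJ.one u (by omega), hJ.one v (by omega)]
      · exact hJ.inj u v huv h8

end PresentBias

namespace PresentBias

open TaskGraph Cmd

set_option linter.unusedSimpArgs false

variable {n m : ℕ} {G : TaskGraph n m} {b₁ b₂ : ℝ} {k : ℕ} {ord : Fin n → ℕ} {δ : Fin n → ℝ}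

/-! ### The program: alternatives to an edge -/

/-- The biases of the two agents, and the bias of an unbiased agent. -/
def bias (b₁ b₂ : ℝ) : ℕ → ℝ
  | 0 => b₁
  | 1 => b₂
  | _ => 1

def biasX : ℕ → RExp
  | 0 => rr 0
  | 1 => rr 1
  | _ => rl 1

theorem HasInput.eval_biasX {σ : Mem} (h : HasInput G b₁ b₂ k σ) (a : ℕ) :
    (biasX a).eval σ = bias b₁ b₂ a := by
  rcases a with _ | _ | _
  · exact h.b₁
  · exact h.b₂
  · exact Nat.cast_one

/-- The best alternative to the edge in register 6, for an agent, and the first vertex to which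
such an alternative leads. -/
def altScan (a : ℕ) : Cmd :=
  rset 4 (rr 3) ;; nset 9 (nr 0) ;;
  upTo 7 (nr 1) (when (.conj (.neq (na 0 (nr 7)) (na 0 (nr 6))) (.neg (.neq (nr 7) (nr 6))))
    (rset 5 (.add (.mul (biasX a) (ra 0 (nr 7))) (ra 2 (na 1 (nr 7)))) ;;
      ite (.rlt (rr 5) (rr 4)) (rset 4 (rr 5) ;; nset 9 (na 1 (nr 7)))
        (when (.conj (.req (rr 5) (rr 4)) (.nlt (na 1 (nr 7)) (nr 9))) (nset 9 (na 1 (nr 7))))))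

theorem altScan_runs {σ : Mem} {a : ℕ} (h : HasInput G b₁ b₂ k σ) (hd : HasDist G b₂ ord δ σ)
    {e : Fin m} (he : σ.nreg 6 = e) :
    Runs (altScan a) σ (80 * m + 20) fun τ => τ.rreg 4 = G.altMin (bound G b₂) δ (bias b₁ b₂ a) e ∧
      τ.nreg 9 = G.altHead (bound G b₂) δ (bias b₁ b₂ a) e := by
  set b := bias b₁ b₂ a with hb
  refine Runs.le (s := 2 + (2 + (m * (70 + 9) + 9))) ?_ (by omega)
  refine Runs.seq' (R := fun τ => τ.rreg 4 = bound G b₂) (.flat rfl (by simp [Cmd.cost, RExp.size])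
    fun _ => by simp [hd.bound]) fun τ hτ h4 => ?_
  refine Runs.seq' (R := fun τ => τ.rreg 4 = bound G b₂ ∧ τ.nreg 9 = n) (.flat rfl
    (by simp [Cmd.cost, NExp.size]) fun _ => by simp [h4, (h.keep hτ rfl).regN]) fun ρ hρ h9 => ?_
  have hi := (h.keep hτ rfl).keep hρ rfl
  have hdi := (hd.keep hτ rfl).keep hρ rfl
  have he' : ρ.nreg 6 = e := by rw [hρ.n 6 rfl, hτ.n 6 rfl, he]
  -- The two running minima are characterized by the numbers that lie below them, which makes the
  -- update a matter of logic and the final comparison with the folds immediate.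
  refine Runs.upTo' (fun j μ =>
    (∀ x, x ≤ μ.rreg 4 ↔ x ≤ bound G b₂ ∧
      ∀ f : Fin m, (f : ℕ) < j → f ≠ e → G.tail f = G.tail e → x ≤ G.whole δ b f) ∧
    ∀ x, x < μ.nreg 9 ↔ x < n ∧ ∀ f : Fin m, (f : ℕ) < j → f ≠ e → G.tail f = G.tail e →
      G.whole δ b f = μ.rreg 4 → x < G.head f) (N := m) (t := 70) rfl
    (fun μ hμ => (hi.keep hμ rfl).regM) ?_ (fun j hj μ hμ hμj hJ => ?_) le_rfl fun μ hμ hJ => ?_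
  · simp [h9]
  · obtain ⟨hJ, hJ'⟩ := hJ
    have hin := hi.keep hμ rfl
    have hdn := hdi.keep hμ rfl
    have hμe : μ.nreg 6 = e := by rw [hμ.n 6 rfl, he']
    set f : Fin m := ⟨j, hj⟩ with hf
    have hfj : (f : ℕ) = j := rfl
    have hsplit : ∀ p : Fin m → Prop, (∀ g : Fin m, (g : ℕ) < j + 1 → p g) ↔
        (∀ g : Fin m, (g : ℕ) < j → p g) ∧ p f := by
      intro p
      refine ⟨fun hp => ⟨fun g hg => hp g (by omega), hp f (by omega)⟩, fun hp g hg => ?_⟩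
      by_cases hgj : (g : ℕ) = j
      · have : g = f := Fin.ext hgj
        rw [this]; exact hp.2
      · exact hp.1 g (by omega)
    have ht := hin.tail f
    have hte := hin.tail e
    have hh := hin.head f
    have hc := hin.cost f
    have hw : b * G.cost f + δ (G.head f) = G.whole δ b f := rfl
    refine .flat rfl (by rcases a with _ | _ | _ <;> simp [biasX] <;> decide) fun _ => ?_
    simp only [hsplit]
    simp only [when, Cmd.skip, run_ite, run_seq, run_rset, run_nset, BExp.eval_conj, BExp.eval_neg,
      BExp.eval_neq, BExp.eval_rlt, BExp.eval_req, BExp.eval_nlt, NExp.eval_get, NExp.eval_reg,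
      RExp.eval_add, RExp.eval_mul, RExp.eval_get, RExp.eval_reg, hin.eval_biasX, hμj, hμe,
      ← hfj, ht, hte, hh, hc, hdn.dist, ← hb, hw, Mem.setR_rreg, if_true, ← Fin.ext_iff,
      Mem.setR_nreg, Mem.setR_narr, Nat.reduceEqDiff, reduceIte]
    simp only [hfj]
    split_ifs with h1 h2 h3
    · have hlt : G.whole δ b f < μ.rreg 4 := h2
      simp only [Mem.setN_rreg, Mem.setR_rreg, Mem.setN_nreg, if_true, Mem.setR_narr, hh, hfj,
        show (9:ℕ) ≠ 7 by decide, if_false]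
      refine ⟨fun x => ⟨fun hx => ⟨((hJ x).1 (by linarith)).1, ((hJ x).1 (by linarith)).2, fun _ _ => hx⟩,
        fun hx => hx.2.2 h1.2 h1.1⟩, fun x => ?_⟩
      have h5 := hJ (G.whole δ b f)
      constructor
      · intro hx
        refine ⟨lt_trans hx (G.head f).2, fun g hg hge hgt hgw => ?_, fun _ _ _ => hx⟩
        have := ((hJ (μ.rreg 4)).1 le_rfl).2 g hg hge hgt
        rw [hgw] at this
        linarith
      · exact fun hx => hx.2.2 h1.2 h1.1 trivial
    · have heq : G.whole δ b f = μ.rreg 4 := h3.1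
      have hlt : (G.head f : ℕ) < μ.nreg 9 := h3.2
      simp only [Mem.setN_rreg, Mem.setR_rreg, Mem.setN_nreg, if_true, Mem.setR_narr, hh, hfj,
        show (9:ℕ) ≠ 7 by decide, show (4:ℕ) ≠ 5 by decide, if_false]
      refine ⟨fun x => ⟨fun hx => ⟨((hJ x).1 hx).1, ((hJ x).1 hx).2, fun _ _ => by linarith⟩,
        fun hx => (hJ x).2 ⟨hx.1, hx.2.1⟩⟩, fun x => ?_⟩
      constructor
      · intro hx
        have := (hJ' x).1 (hx.trans hlt)
        exact ⟨this.1, this.2, fun _ _ _ => hx⟩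
      · exact fun hx => hx.2.2 h1.2 h1.1 heq
    · have h4 : μ.rreg 4 ≤ G.whole δ b f := not_lt.1 h2
      simp only [Mem.setN_rreg, Mem.setR_rreg, Mem.setN_nreg, Mem.setR_nreg, 
        show (9:ℕ) ≠ 7 by decide, show (9:ℕ) ≠ 999 by decide, show (4:ℕ) ≠ 5 by decide, if_false]
      refine ⟨fun x => ⟨fun hx => ⟨((hJ x).1 hx).1, ((hJ x).1 hx).2, fun _ _ => by linarith⟩,
        fun hx => (hJ x).2 ⟨hx.1, hx.2.1⟩⟩, fun x => ?_⟩
      constructor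
      · intro hx
        refine ⟨((hJ' x).1 hx).1, ((hJ' x).1 hx).2, fun _ _ hw => ?_⟩
        have : ¬ (G.head f : ℕ) < μ.nreg 9 := fun h => h3 ⟨hw, h⟩
        omega
      · exact fun hx => (hJ' x).2 ⟨hx.1, hx.2.1⟩
    · simp only [Mem.setN_rreg, Mem.setN_nreg, show (9:ℕ) ≠ 7 by decide, show (9:ℕ) ≠ 999 by decide, if_false]
      refine ⟨fun x => ⟨fun hx => ⟨((hJ x).1 hx).1, ((hJ x).1 hx).2, fun h5 h6 => absurd ⟨h6, h5⟩ h1⟩,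
        fun hx => (hJ x).2 ⟨hx.1, hx.2.1⟩⟩, fun x => ⟨fun hx => ⟨((hJ' x).1 hx).1, ((hJ' x).1 hx).2,
        fun h5 h6 => absurd ⟨h6, h5⟩ h1⟩, fun hx => (hJ' x).2 ⟨hx.1, hx.2.1⟩⟩⟩
  · have h4 : μ.rreg 4 = G.altMin (bound G b₂) δ b e := by
      refine eq_of_forall_le_iff fun x => ?_
      rw [hJ.1, le_altMin]
      exact and_congr_right fun _ => ⟨fun h f hf ht => h f f.2 hf ht, fun h f _ hf ht => h f hf ht⟩
    refine ⟨h4, eq_of_forall_lt_iff fun x => ?_⟩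
    rw [hJ.2, altHead, Finset.lt_fold_min]
    refine and_congr_right fun _ => ?_
    simp only [Finset.mem_filter, mem_alts, and_imp, h4]
    exact ⟨fun h f hf ht => h f f.2 hf ht, fun h f _ hf ht => h f hf ht⟩

/-- The memory holds the best alternatives for an agent, and which edges it takes naturally. -/
structure HasAlts (G : TaskGraph n m) (b₁ b₂ : ℝ) (δ : Fin n → ℝ) (a : ℕ) (σ : Mem) : Prop where
  min : ∀ e : Fin m, σ.rarr (10 + a) e = G.altMin (bound G b₂) δ (bias b₁ b₂ a) e
  head : ∀ e : Fin m, σ.narr (20 + a) e = G.altHead (bound G b₂) δ (bias b₁ b₂ a) e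
  natural : ∀ e : Fin m, σ.narr (23 + a) e ≠ 0 ↔ Natural G (bound G b₂) δ (bias b₁ b₂ a) e

theorem HasAlts.keep {a : ℕ} {c : Cmd} {σ τ : Mem} (h : HasAlts G b₁ b₂ δ a σ) (hk : Keep c σ τ)
    (h1 : c.keepsRA (10 + a) = true) (h2 : c.keepsNA (20 + a) = true)
    (h3 : c.keepsNA (23 + a) = true) : HasAlts G b₁ b₂ δ a τ :=
  ⟨by rw [hk.ra _ h1]; exact h.min, by rw [hk.na _ h2]; exact h.head,
    by rw [hk.na _ h3]; exact h.natural⟩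

/-- The perceived cost of the edge with index `e`, not chunked. -/
def wholeX (a : ℕ) (e : NExp) : RExp := .add (.mul (biasX a) (ra 0 e)) (ra 2 (na 1 e))

theorem eval_wholeX {σ : Mem} (h : HasInput G b₁ b₂ k σ) (hd : HasDist G b₂ ord δ σ) (a : ℕ)
    {x : NExp} {e : Fin m} (hx : x.eval σ = e) :
    (wholeX a x).eval σ = G.whole δ (bias b₁ b₂ a) e := by
  simp only [wholeX, RExp.eval_add, RExp.eval_mul, RExp.eval_get, NExp.eval_get, hx, h.eval_biasX,
    h.cost, h.head, hd.dist]
  rfl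

def altRow (a : ℕ) : Cmd :=
  upTo 6 (nr 1) (altScan a ;; rput (10 + a) (nr 6) (rr 4) ;; nput (20 + a) (nr 6) (nr 9) ;;
    ite (.disj (.rlt (wholeX a (nr 6)) (rr 4))
      (.conj (.req (wholeX a (nr 6)) (rr 4)) (.nlt (na 1 (nr 6)) (nr 9))))
      (nput (23 + a) (nr 6) (nl 1)) (nput (23 + a) (nr 6) (nl 0)))

theorem altRow_runs {σ : Mem} {a : ℕ} (ha : a < 3) (h : HasInput G b₁ b₂ k σ)
    (hd : HasDist G b₂ ord δ σ) :
    Runs (altRow a) σ (m * (80 * m + 120) + 9) (HasAlts G b₁ b₂ δ a) := by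
  have hkI : (altRow a).keepsInput = true := by interval_cases a <;> rfl
  have hkD : (altRow a).keepsDist = true := by interval_cases a <;> rfl
  have hkI' : (altScan a).keepsInput = true := by interval_cases a <;> rfl
  have hkD' : (altScan a).keepsDist = true := by interval_cases a <;> rfl
  refine Runs.upTo' (fun j μ =>
    (∀ e : Fin m, (e : ℕ) < j → μ.rarr (10 + a) e = G.altMin (bound G b₂) δ (bias b₁ b₂ a) e) ∧
    (∀ e : Fin m, (e : ℕ) < j → μ.narr (20 + a) e = G.altHead (bound G b₂) δ (bias b₁ b₂ a) e) ∧
    (∀ e : Fin m, (e : ℕ) < j → (μ.narr (23 + a) e ≠ 0 ↔ Natural G (bound G b₂) δ (bias b₁ b₂ a) e)))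
    (N := m) (t := 80 * m + 20 + 90) rfl
    (fun μ hμ => (h.keep hμ hkI).regM) ?_ (fun j hj μ hμ hμj hJ => ?_) (by simp [NExp.size]; nlinarith)
    fun μ hμ hJ => ⟨fun e => hJ.1 e e.2, fun e => hJ.2.1 e e.2, fun e => hJ.2.2 e e.2⟩
  · simp
  · refine Runs.seq' (altScan_runs (e := ⟨j, hj⟩) (h.keep hμ hkI) (hd.keep hμ hkD) hμj)
      fun τ hτ hR => ?_
    obtain ⟨h4, h9⟩ := hR
    have hτi := (h.keep hμ hkI).keep hτ hkI'
    have hτd := (hd.keep hμ hkD).keep hτ hkD'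
    have h6 : τ.nreg 6 = j := by rw [hτ.n 6 rfl, hμj]
    have e10 : τ.rarr (10 + a) = μ.rarr (10 + a) := hτ.ra _ rfl
    have e20 : τ.narr (20 + a) = μ.narr (20 + a) := hτ.na _ rfl
    have e23 : τ.narr (23 + a) = μ.narr (23 + a) := hτ.na _ rfl
    set f : Fin m := ⟨j, hj⟩ with hf
    have hfj : (f : ℕ) = j := rfl
    have hh := hτi.head f
    refine .flat rfl (by interval_cases a <;> decide) fun hK => ?_
    have hsplit : ∀ e : Fin m, (e : ℕ) < j + 1 → e ≠ f → (e : ℕ) < j ∧ (e : ℕ) ≠ j := by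
      intro e he hef
      have : (e : ℕ) ≠ j := fun h => hef (Fin.ext h)
      omega
    refine ⟨fun e he => ?_, fun e he => ?_, fun e he => ?_⟩
    · by_cases hef : e = f
      · subst hef
        simp only [run_seq, run_ite]
        split_ifs <;> simp [h6, h4, hfj]
      · obtain ⟨h1, h2⟩ := hsplit e he hef
        simp only [run_seq, run_ite]
        split_ifs <;> simp [h6, h2, e10, hJ.1 e h1]
    · by_cases hef : e = f
      · subst hef
        simp only [run_seq, run_ite]
        split_ifs <;> simp [h6, h9, hfj]
      · obtain ⟨h1, h2⟩ := hsplit e he hef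
        simp only [run_seq, run_ite]
        split_ifs <;> simp [h6, h2, e20, hJ.2.1 e h1]
    · by_cases hef : e = f
      · subst hef
        have hi' : HasInput G b₁ b₂ k ((nput (20 + a) (nr 6) (nr 9)).run
            ((rput (10 + a) (nr 6) (rr 4)).run τ)) := by
          constructor <;> interval_cases a <;> simp [hτi.regN, hτi.regM, hτi.sink, hτi.source, hτi.regK,
            hτi.b₁, hτi.b₂, hτi.tail, hτi.head, hτi.cost]
        have hd' : HasDist G b₂ ord δ ((nput (20 + a) (nr 6) (nr 9)).run
            ((rput (10 + a) (nr 6) (rr 4)).run τ)) := by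
          constructor <;> interval_cases a <;> simp [hτd.bound, hτd.ord, hτd.dist]
        have hw := eval_wholeX hi' hd' a (x := nr 6) (e := f) h6
        have hhd := hi'.head f
        simp only [run_seq, run_ite, BExp.eval_disj, BExp.eval_conj, BExp.eval_rlt, BExp.eval_req,
          BExp.eval_nlt, hw, NExp.eval_get, NExp.eval_reg]
        simp only [run_nput, run_rput, Mem.putN_nreg, Mem.putR_nreg, Mem.putN_rreg, Mem.putR_rreg,
          RExp.eval_reg, h4, h9, h6, NExp.eval_reg, ← hfj] at hhd ⊢
        rw [hhd, Natural]
        split_ifs with h1 <;> simp [h6, ← hfj, h1]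
      · obtain ⟨h1, h2⟩ := hsplit e he hef
        rw [← hJ.2.2 e h1]
        simp only [run_seq, run_ite]
        split_ifs <;> simp [h6, h2, e23]

end PresentBias

/-! ### Conditional commands, and loops that fill arrays entry by entry. -/

namespace PresentBias

theorem Runs.when {p : BExp} {c : Cmd} {σ : Mem} {t : ℕ} {Q : Mem → Prop}
    (h : p.eval σ → Runs c σ t Q) (h' : ¬ p.eval σ → Q (σ.setN 999 0)) :
    Runs (Cmd.when p c) σ (p.size + max t 2 + 1) Q :=
  Runs.ite h fun hp => .skip (h' hp)

/-- A loop whose passes establish the property `P j` for each index `j` and keep it. -/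
theorem Runs.forEach {i : ℕ} {hi : NExp} {c : Cmd} {σ : Mem} {Q : Mem → Prop}
    (P : ℕ → Mem → Prop) {N : ℕ} {t : ℕ} {b : ℕ}
    (hbody : c.keepsN i = true)
    (hN : ∀ τ, Keep (Cmd.upTo i hi c) σ τ → hi.eval τ = N)
    (hset : ∀ j ρ v, P j ρ → P j (ρ.setN i v))
    (hstep : ∀ j < N, ∀ τ, Keep (Cmd.upTo i hi c) σ τ → τ.nreg i = j →
      Runs c τ t fun ρ => P j ρ ∧ ∀ l, l ≠ j → P l τ → P l ρ)
    (hb : N * (t + (hi.size + 8)) + (hi.size + 8) ≤ b)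
    (hQ : ∀ τ, Keep (Cmd.upTo i hi c) σ τ → (∀ j < N, P j τ) → Q τ) :
    Runs (Cmd.upTo i hi c) σ b Q := by
  refine Runs.upTo' (fun j τ => ∀ l < j, P l τ) hbody hN (fun l hl => by omega)
    (fun j hj τ hτ hi hJ => ?_) hb hQ
  refine (hstep j hj τ hτ hi).imp fun ρ _ h l hl => hset _ _ _ ?_
  by_cases hlj : l = j
  · rw [hlj]; exact h.1
  · exact h.2 l hlj (hJ l (by omega))

open TaskGraph Cmd

set_option linter.unusedSimpArgs false

variable {n m : ℕ} {G : TaskGraph n m} {b₁ b₂ : ℝ} {k : ℕ} {ord : Fin n → ℕ} {δ : Fin n → ℝ}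

/-! ### The program: both agents on one edge -/

/-- The real registers from `r` hold a value of `thr` and its parameters. -/
structure ThrAt (r : ℕ) (x x' : RExp) (b Λ b' Λ' M d : ℝ) (j : ℕ) (σ : Mem) : Prop where
  val : σ.rreg r = thr b Λ b' Λ' M d j
  limit : σ.rreg (r + 1) = Λ
  limit' : σ.rreg (r + 2) = Λ'
  leave : σ.rreg (r + 3) = M
  dist : σ.rreg (r + 4) = d
  bias : x.eval σ = b
  bias' : x'.eval σ = b'

def thrInit (r : ℕ) (x x' : RExp) : Cmd :=
  rmin r (.div (.sub (rr (r + 1)) (rr (r + 4))) x) (.div (.sub (rr (r + 2)) (rr (r + 4))) x')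

def thrStep (r : ℕ) (x x' : RExp) : Cmd :=
  rmin (r + 5) (.add (rr r) (rr (r + 4))) (rr (r + 3)) ;;
  rmin r (.add (rr r) (.div (.sub (rr (r + 1)) (rr (r + 5))) x))
    (.add (rr r) (.div (.sub (rr (r + 2)) (rr (r + 5))) x'))

theorem ThrAt.init {r : ℕ} {a a' : ℕ} {b Λ b' Λ' M d : ℝ} {σ : Mem} (hr : 2 ≤ r)
    (h1 : σ.rreg (r + 1) = Λ) (h2 : σ.rreg (r + 2) = Λ') (h3 : σ.rreg (r + 3) = M)
    (h4 : σ.rreg (r + 4) = d) (h5 : (biasX a).eval σ = b) (h6 : (biasX a').eval σ = b') :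
    ThrAt r (biasX a) (biasX a') b Λ b' Λ' M d 0 ((thrInit r (biasX a) (biasX a')).run σ) := by
  have hX : ∀ (a : ℕ) (w : ℝ), (biasX a).eval (σ.setR r w) = (biasX a).eval σ := by
    intro a w
    rcases a with _ | _ | _ <;> simp [biasX] <;> omega
  constructor <;> simp [thrInit, hX, thr, h1, h2, h3, h4, h5, h6]

theorem ThrAt.step {r : ℕ} {a a' : ℕ} {b Λ b' Λ' M d : ℝ} {j : ℕ} {σ : Mem} (hr : 2 ≤ r)
    (h : ThrAt r (biasX a) (biasX a') b Λ b' Λ' M d j σ) :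
    ThrAt r (biasX a) (biasX a') b Λ b' Λ' M d (j + 1)
      ((thrStep r (biasX a) (biasX a')).run σ) := by
  have hX : ∀ (a : ℕ) (w : ℝ) (r' : ℕ) (σ : Mem), 2 ≤ r' →
      (biasX a).eval (σ.setR r' w) = (biasX a).eval σ := by
    intro a w r' σ hr'
    rcases a with _ | _ | _ <;> simp [biasX] <;> omega
  constructor <;> simp [thrStep, hX, thr, h.val, h.limit, h.limit', h.leave, h.dist, h.bias, h.bias',
    hr, show 2 ≤ r + 5 by omega]

def partInvCmd (r a : ℕ) (e : NExp) (v : RExp) : Cmd :=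
  rmax r (.div (.sub v (.add (ra 0 e) (ra 2 (na 1 e)))) (.sub (biasX a) (rl 1)))
    (.div (.sub v (ra 12 e)) (biasX a))

/-- The memory that the evaluation of perceived costs needs. -/
structure Ready (G : TaskGraph n m) (b₁ b₂ : ℝ) (k : ℕ) (ord : Fin n → ℕ) (δ : Fin n → ℝ) (σ : Mem) :
    Prop where
  inp : HasInput G b₁ b₂ k σ
  dist : HasDist G b₂ ord δ σ
  alts : ∀ a < 3, HasAlts G b₁ b₂ δ a σ

def Cmd.keepsReady (c : Cmd) : Bool :=
  c.keepsInput && c.keepsDist && c.keepsRA 10 && c.keepsRA 11 && c.keepsRA 12 && c.keepsNA 20 &&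
    c.keepsNA 21 && c.keepsNA 22 && c.keepsNA 23 && c.keepsNA 24 && c.keepsNA 25

theorem Ready.keep {c : Cmd} {σ τ : Mem} (h : Ready G b₁ b₂ k ord δ σ) (hk : Keep c σ τ)
    (hc : c.keepsReady = true) : Ready G b₁ b₂ k ord δ τ := by
  simp only [Cmd.keepsReady, Bool.and_eq_true] at hc
  obtain ⟨⟨⟨⟨⟨⟨⟨⟨⟨⟨h0, h1⟩, r0⟩, r1⟩, r2⟩, a0⟩, a1⟩, a2⟩, a3⟩, a4⟩, a5⟩ := hc
  refine ⟨h.inp.keep hk h0, h.dist.keep hk h1, fun a ha => ?_⟩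
  interval_cases a
  · exact (h.alts 0 (by omega)).keep hk r0 a0 a3
  · exact (h.alts 1 (by omega)).keep hk r1 a1 a4
  · exact (h.alts 2 (by omega)).keep hk r2 a2 a5

section
variable {σ : Mem} (h : Ready G b₁ b₂ k ord δ σ)
include h

theorem Ready.altOne (e : Fin m) : σ.rarr 12 e = G.altMin (bound G b₂) δ 1 e :=
  (h.alts 2 (by omega)).min e

theorem Ready.run_partInvCmd (r a : ℕ) {x : NExp} {e : Fin m} (hx : x.eval σ = e) (v : RExp) :
    (partInvCmd r a x v).run σ =
      σ.setR r (G.partInv (bound G b₂) δ (bias b₁ b₂ a) e (v.eval σ)) := by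
  simp only [partInvCmd, run_rmax, RExp.eval_div, RExp.eval_sub, RExp.eval_add, RExp.eval_get, hx,
    NExp.eval_get, h.inp.cost, h.inp.head, h.inp.eval_biasX, h.dist.dist, RExp.eval_lit, Nat.cast_one,
    h.altOne, partInv]

end

/-- The memory tells how two agents can take the edge `e`. -/
structure SoloAt (G : TaskGraph n m) (b₁ b₂ : ℝ) (k : ℕ) (δ : Fin n → ℝ) (a a' s : ℕ) (e : Fin m)
    (σ : Mem) : Prop where
  least : (σ.narr (26 + s) e = 0 ∧
      ∀ l ≤ k, ¬ Feas G (bound G b₂) δ (bias b₁ b₂ a) (bias b₁ b₂ a') e l) ∨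
    (Feas G (bound G b₂) δ (bias b₁ b₂ a) (bias b₁ b₂ a') e (σ.narr (26 + s) e) ∧
      σ.narr (26 + s) e ≤ k ∧ ∀ l, Feas G (bound G b₂) δ (bias b₁ b₂ a) (bias b₁ b₂ a') e l →
        σ.narr (26 + s) e ≤ l)
  code : ∀ w, σ.narr (29 + s) e = w + 1 ↔
    IsLeast (G.soloSet (bound G b₂) δ k (bias b₁ b₂ a) (bias b₁ b₂ a') e) w
  first : σ.rarr (13 + s) e = G.maxFirst (bound G b₂) δ (bias b₁ b₂ a) (bias b₁ b₂ a') e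

theorem SoloAt.congr {a a' s : ℕ} {e : Fin m} {σ τ : Mem} (h : SoloAt G b₁ b₂ k δ a a' s e σ)
    (h1 : τ.narr (26 + s) e = σ.narr (26 + s) e) (h2 : τ.narr (29 + s) e = σ.narr (29 + s) e)
    (h3 : τ.rarr (13 + s) e = σ.rarr (13 + s) e) : SoloAt G b₁ b₂ k δ a a' s e τ :=
  ⟨by rw [h1]; exact h.least, by rw [h2]; exact h.code, by rw [h3]; exact h.first⟩

open Classical in
-- If the edge is natural for both agents, no chunk is needed; otherwise the least feasible number
-- of pieces is the answer. Codes are one larger than the number of chunks, so that 0 can stand for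
-- the absence of a plan.
theorem isLeast_soloSet {B : ℝ} {b b' : ℝ} {e : Fin m} {l : ℕ}
    (h : (l = 0 ∧ ∀ l ≤ k, ¬ Feas G B δ b b' e l) ∨
      (Feas G B δ b b' e l ∧ l ≤ k ∧ ∀ l', Feas G B δ b b' e l' → l ≤ l')) (w : ℕ) :
    (if Natural G B δ b e ∧ Natural G B δ b' e then 1 else if l = 0 then 0 else l + 1) = w + 1 ↔
      IsLeast (G.soloSet B δ k b b' e) w := by
  split_ifs with h1 h2
  · have h0 : IsLeast (G.soloSet B δ k b b' e) 0 :=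
      ⟨⟨1, Or.inl ⟨rfl, rfl, h1⟩⟩, fun _ _ => Nat.zero_le _⟩
    constructor
    · intro hw
      obtain rfl : w = 0 := by omega
      exact h0
    · intro hw
      rw [hw.unique h0]
  · constructor
    · intro hw; simp at hw
    · rintro ⟨⟨l', ⟨-, -, h3⟩ | ⟨h3, h4, -⟩⟩, -⟩
      · exact absurd h3 h1
      · rcases h with h | h
        · exact absurd h3 (h.2 l' h4)
        · have := h.1.1; omega
  · obtain ⟨h3, h4, h5⟩ := h.resolve_left fun h => h2 h.1
    have hl : IsLeast (G.soloSet B δ k b b' e) l := by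
      refine ⟨⟨l, Or.inr ⟨h3, h4, rfl⟩⟩, ?_⟩
      rintro w' ⟨l', ⟨-, -, h6⟩ | ⟨h6, -, rfl⟩⟩
      · exact absurd h6 h1
      · exact h5 _ h6
    constructor
    · intro hw
      obtain rfl : w = l := by omega
      exact hl
    · intro hw
      rw [hw.unique hl]

def loadCmd (a a' : ℕ) : Cmd :=
  rset 5 (ra (10 + a) (nr 6)) ;; rset 6 (ra (10 + a') (nr 6)) ;; rset 7 (ra 12 (nr 6)) ;;
  rset 8 (ra 2 (na 1 (nr 6)))

/-- While register 7 counts `j`, register 4 runs through the values of `reach`, and `j + 1` pieces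
are feasible if the cost of the edge is at most `reach j`. Register 8 records whether `reach 0` is
nonnegative. The first success is kept, as register 9 is nonzero from then on. -/
def leastCmd (a a' : ℕ) : Cmd :=
  upTo 7 (nr 4) (when (.conj (.conj (.nle (nl 1) (nr 7)) (.neq (nr 9) (nl 0)))
      (.conj (.nle (nl 1) (nr 8)) (.rle (ra 0 (nr 6)) (rr 4)))) (nset 9 (.add (nr 7) (nl 1))) ;;
    thrStep 4 (biasX a) (biasX a'))

def soloRow (a a' s : ℕ) : Cmd :=
  upTo 6 (nr 1) ((loadCmd a a' ;; thrInit 4 (biasX a) (biasX a')) ;;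
    (ite (.rle (rl 0) (rr 4)) (nset 8 (nl 1)) (nset 8 (nl 0)) ;; nset 9 (nl 0)) ;;
    leastCmd a a' ;;
    (partInvCmd 4 a (nr 6) (ra (10 + a) (nr 6)) ;; partInvCmd 5 a' (nr 6) (ra (10 + a') (nr 6))) ;;
    (rmin 4 (rr 4) (rr 5) ;; rmin 4 (ra 0 (nr 6)) (rr 4)) ;;
    rput (13 + s) (nr 6) (rr 4) ;; nput (26 + s) (nr 6) (nr 9) ;;
    ite (.conj (.nle (nl 1) (na (23 + a) (nr 6))) (.nle (nl 1) (na (23 + a') (nr 6))))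
      (nput (29 + s) (nr 6) (nl 1))
      (ite (.neq (nr 9) (nl 0)) (nput (29 + s) (nr 6) (nl 0))
        (nput (29 + s) (nr 6) (.add (nr 9) (nl 1)))))

theorem leastCmd_runs {σ : Mem} {a a' : ℕ} (ha : a < 2) (ha' : a' < 2) (h : Ready G b₁ b₂ k ord δ σ)
    {e : Fin m} (he : σ.nreg 6 = e)
    (hT : ThrAt 4 (biasX a) (biasX a') (bias b₁ b₂ a) (G.altMin (bound G b₂) δ (bias b₁ b₂ a) e)
      (bias b₁ b₂ a') (G.altMin (bound G b₂) δ (bias b₁ b₂ a') e) (G.altMin (bound G b₂) δ 1 e)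
      (δ (G.head e)) 0 σ)
    (h8 : 1 ≤ σ.nreg 8 ↔ 0 ≤ G.reach (bound G b₂) δ (bias b₁ b₂ a) (bias b₁ b₂ a') e 0)
    (h9 : σ.nreg 9 = 0) :
    Runs (leastCmd a a') σ (k * 99 + 9) fun τ => (τ.nreg 9 = 0 ∧
      ∀ l ≤ k, ¬ Feas G (bound G b₂) δ (bias b₁ b₂ a) (bias b₁ b₂ a') e l) ∨
    (Feas G (bound G b₂) δ (bias b₁ b₂ a) (bias b₁ b₂ a') e (τ.nreg 9) ∧
      τ.nreg 9 ≤ k ∧ ∀ l, Feas G (bound G b₂) δ (bias b₁ b₂ a) (bias b₁ b₂ a') e l →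
        τ.nreg 9 ≤ l) := by
  have hkR : (leastCmd a a').keepsReady = true := by interval_cases a <;> interval_cases a' <;> rfl
  refine Runs.upTo' (fun j μ => ThrAt 4 (biasX a) (biasX a') (bias b₁ b₂ a)
      (G.altMin (bound G b₂) δ (bias b₁ b₂ a) e) (bias b₁ b₂ a')
      (G.altMin (bound G b₂) δ (bias b₁ b₂ a') e) (G.altMin (bound G b₂) δ 1 e)
      (δ (G.head e)) j μ ∧
    ((μ.nreg 9 = 0 ∧ ∀ l ≤ j, ¬ Feas G (bound G b₂) δ (bias b₁ b₂ a) (bias b₁ b₂ a') e l) ∨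
    (Feas G (bound G b₂) δ (bias b₁ b₂ a) (bias b₁ b₂ a') e (μ.nreg 9) ∧ μ.nreg 9 ≤ j ∧
      ∀ l, Feas G (bound G b₂) δ (bias b₁ b₂ a) (bias b₁ b₂ a') e l → μ.nreg 9 ≤ l)))
    (N := k) (t := 90) rfl (fun μ hμ => (h.keep hμ hkR).inp.regK) ?_ (fun j hj μ hμ hμj hJ => ?_)
    le_rfl fun μ hμ hJ => hJ.2
  · refine ⟨?_, Or.inl ⟨by simp [h9], fun l hl hF => ?_⟩⟩
    · have hX : ∀ a v, (biasX a).eval (σ.setN 7 v) = (biasX a).eval σ := by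
        intro a v
        rcases a with _ | _ | _ <;> rfl
      exact ⟨hT.val, hT.limit, hT.limit', hT.leave, hT.dist, (hX _ _).trans hT.bias,
        (hX _ _).trans hT.bias'⟩
    · have := hF.1; omega
  · obtain ⟨hJ1, hJ2⟩ := hJ
    have hin := h.keep hμ hkR
    have e6 : μ.nreg 6 = e := by rw [hμ.n 6 rfl, he]
    have e8 : μ.nreg 8 = σ.nreg 8 := hμ.n 8 rfl
    have hX : ∀ a v r (σ : Mem), (biasX a).eval (σ.setN r v) = (biasX a).eval σ := by
      intro a v r σ
      rcases a with _ | _ | _ <;> rfl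
    refine Runs.le (Runs.seq' (s := 30) (t := 60) (R := fun ρ => ThrAt 4 (biasX a) (biasX a') (bias b₁ b₂ a)
      (G.altMin (bound G b₂) δ (bias b₁ b₂ a) e) (bias b₁ b₂ a')
      (G.altMin (bound G b₂) δ (bias b₁ b₂ a') e) (G.altMin (bound G b₂) δ 1 e)
      (δ (G.head e)) j ρ ∧ ((ρ.nreg 9 = 0 ∧ ∀ l ≤ j + 1, ¬ Feas G (bound G b₂) δ (bias b₁ b₂ a) (bias b₁ b₂ a') e l) ∨
    (Feas G (bound G b₂) δ (bias b₁ b₂ a) (bias b₁ b₂ a') e (ρ.nreg 9) ∧ ρ.nreg 9 ≤ j + 1 ∧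
      ∀ l, Feas G (bound G b₂) δ (bias b₁ b₂ a) (bias b₁ b₂ a') e l → ρ.nreg 9 ≤ l)))
      ?_ fun ρ hρ hR => ?_) le_rfl
    · refine Runs.le (Runs.when (t := 4) (fun hp => ?_) fun hp => ?_) (by decide)
      · refine .flat rfl (by decide) fun _ => ?_
        simp only [BExp.eval_conj, BExp.eval_nle, NExp.eval_lit, NExp.eval_reg, BExp.eval_neq,
          BExp.eval_rle, RExp.eval_get, RExp.eval_reg, hμj, e8, h8, e6, hin.inp.cost] at hp
        obtain ⟨⟨hp1, hp2⟩, hp3, hp4⟩ := hp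
        refine ⟨⟨hJ1.val, hJ1.limit, hJ1.limit', hJ1.leave, hJ1.dist, (hX _ _ _ _).trans hJ1.bias,
          (hX _ _ _ _).trans hJ1.bias'⟩, Or.inr ?_⟩
        simp only [run_nset, Mem.setN_nreg, if_true, NExp.eval_add, NExp.eval_reg, NExp.eval_lit, hμj]
        refine ⟨⟨by omega, hp3, by rw [hJ1.val] at hp4; exact hp4⟩, le_rfl, fun l hl => ?_⟩
        rcases hJ2 with hJ2 | hJ2
        · by_contra hlt
          exact hJ2.2 l (by omega) hl
        · have := hJ2.1.1; omega
      · simp only [BExp.eval_conj, BExp.eval_nle, NExp.eval_lit, NExp.eval_reg, BExp.eval_neq,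
          BExp.eval_rle, RExp.eval_get, RExp.eval_reg, hμj, e8, h8, e6, hin.inp.cost] at hp
        refine ⟨⟨hJ1.val, hJ1.limit, hJ1.limit', hJ1.leave, hJ1.dist, (hX _ _ _ _).trans hJ1.bias,
          (hX _ _ _ _).trans hJ1.bias'⟩, ?_⟩
        simp only [Mem.setN_nreg, show (9 : ℕ) ≠ 999 by decide, if_false]
        rcases hJ2 with hJ2 | hJ2
        · refine Or.inl ⟨hJ2.1, fun l hl hF => ?_⟩
          by_cases hlj : l = j + 1
          · subst hlj
            exact hp ⟨⟨by have := hF.1; omega, hJ2.1⟩, hF.2.1, by rw [hJ1.val]; exact hF.2.2⟩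
          · exact hJ2.2 l (by omega) hF
        · exact Or.inr ⟨hJ2.1, by omega, hJ2.2.2⟩
    · refine .flat rfl (by interval_cases a <;> interval_cases a' <;> decide) fun hK => ?_
      have h1 := hR.1.step (by decide)
      refine ⟨⟨h1.val, h1.limit, h1.limit', h1.leave, h1.dist, (hX _ _ _ _).trans h1.bias,
          (hX _ _ _ _).trans h1.bias'⟩, ?_⟩
      have h2 : ((thrStep 4 (biasX a) (biasX a')).run ρ).nreg 9 = ρ.nreg 9 := hK.n 9 rfl
      simp only [Mem.setN_nreg, show (9 : ℕ) ≠ 7 by decide, if_false, h2]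
      exact hR.2

theorem soloRow_runs {σ : Mem} {a a' s : ℕ} (ha : a < 2) (ha' : a' < 2) (hs : s < 3)
    (h : Ready G b₁ b₂ k ord δ σ) :
    Runs (soloRow a a' s) σ (m * (100 * k + 300) + 9)
      fun τ => ∀ e, SoloAt G b₁ b₂ k δ a a' s e τ := by
  have hkR : (soloRow a a' s).keepsReady = true := by
    interval_cases a <;> interval_cases a' <;> interval_cases s <;> rfl
  refine Runs.forEach (fun i τ => ∀ e : Fin m, (e : ℕ) = i → SoloAt G b₁ b₂ k δ a a' s e τ)
    (N := m) (t := 100 * k + 291) rfl (fun τ hτ => (h.keep hτ hkR).inp.regM)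
    (fun i ρ v hP e he => (hP e he).congr rfl rfl rfl) (fun j hj μ hμ hμj => ?_)
    (by simp only [NExp.size]; nlinarith) (fun τ _ hP e => hP e e.2 e rfl)
  have hin := h.keep hμ hkR
  set f : Fin m := ⟨j, hj⟩ with hf
  have hA := hin.alts a (by omega)
  have hA' := hin.alts a' (by omega)
  have hfj : (f : ℕ) = j := rfl
  have hX : ∀ a r w (σ : Mem), 2 ≤ r → (biasX a).eval (σ.setR r w) = (biasX a).eval σ := by
    intro a r w σ hr
    rcases a with _ | _ | _ <;> simp [biasX] <;> omega
  refine Runs.le (s := 60 + (20 + ((k * 99 + 9) + (90 + (20 + 50))))) ?_ (by omega)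
  refine Runs.seq' (R := fun τ => ThrAt 4 (biasX a) (biasX a') (bias b₁ b₂ a)
      (G.altMin (bound G b₂) δ (bias b₁ b₂ a) f) (bias b₁ b₂ a')
      (G.altMin (bound G b₂) δ (bias b₁ b₂ a') f) (G.altMin (bound G b₂) δ 1 f)
      (δ (G.head f)) 0 τ) ?_ fun τ hτ h1 => ?_
  · refine .flat rfl (by interval_cases a <;> interval_cases a' <;> decide) fun _ => ?_
    refine ThrAt.init (by decide) ?_ ?_ ?_ ?_ ?_ ?_ <;>
      simp [loadCmd, hμj, ← hfj, hA.min, hA'.min, hin.altOne, hin.inp.head, hin.dist.dist, hX,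
        hin.inp.eval_biasX]
  have hkτ : (loadCmd a a' ;; thrInit 4 (biasX a) (biasX a')).keepsReady = true := by
    interval_cases a <;> interval_cases a' <;> rfl
  have hinτ := hin.keep hτ hkτ
  refine Runs.seq' (R := fun ρ => (1 ≤ ρ.nreg 8 ↔
      0 ≤ G.reach (bound G b₂) δ (bias b₁ b₂ a) (bias b₁ b₂ a') f 0) ∧ ρ.nreg 9 = 0) ?_
    fun ρ hρ h2 => ?_
  · refine .flat rfl (by decide) fun _ => ?_
    have h3 : τ.rreg 4 = G.reach (bound G b₂) δ (bias b₁ b₂ a) (bias b₁ b₂ a') f 0 := h1.val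
    simp only [run_seq, run_ite, BExp.eval_rle, RExp.eval_lit, RExp.eval_reg, h3, Nat.cast_zero]
    split_ifs with h4 <;> simp [h4]
  have hinρ := hinτ.keep hρ rfl
  have e6 : ρ.nreg 6 = f := by rw [hρ.n 6 rfl, hτ.n 6 rfl, hμj]
  refine Runs.seq' (leastCmd_runs ha ha' hinρ e6 ?_ h2.1 h2.2) fun ν hν h3 => ?_
  · have hr := fun r => hρ.r r rfl
    exact ⟨(hr _).trans h1.val, (hr _).trans h1.limit, (hr _).trans h1.limit', (hr _).trans h1.leave,
      (hr _).trans h1.dist, hinρ.inp.eval_biasX a, hinρ.inp.eval_biasX a'⟩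
  have hkν : (leastCmd a a').keepsReady = true := by interval_cases a <;> interval_cases a' <;> rfl
  have hinν := hinρ.keep hν hkν
  have hAν := hinν.alts a (by omega)
  have hAν' := hinν.alts a' (by omega)
  have e6ν : ν.nreg 6 = f := by rw [hν.n 6 rfl, e6]
  refine Runs.seq' (R := fun ξ => ξ.rreg 4 = G.partInv (bound G b₂) δ (bias b₁ b₂ a) f
      (G.altMin (bound G b₂) δ (bias b₁ b₂ a) f) ∧ ξ.rreg 5 = G.partInv (bound G b₂) δ (bias b₁ b₂ a') f
      (G.altMin (bound G b₂) δ (bias b₁ b₂ a') f)) ?_ fun ξ hξ h4 => ?_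
  · refine Runs.le (Runs.seq' (s := 45) (t := 45) (R := fun ξ => ξ.rreg 4 = G.partInv (bound G b₂) δ (bias b₁ b₂ a) f
      (G.altMin (bound G b₂) δ (bias b₁ b₂ a) f)) ?_ fun ξ hξ h5 => ?_) le_rfl
    · refine .flat rfl (by interval_cases a <;> decide) fun _ => ?_
      rw [hinν.run_partInvCmd 4 a (x := nr 6) e6ν]
      simp [e6ν, hAν.min]
    · have hkξ : (partInvCmd 4 a (nr 6) (ra (10 + a) (nr 6))).keepsReady = true := by
        interval_cases a <;> rfl
      have hinξ := hinν.keep hξ hkξ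
      have e6ξ : ξ.nreg 6 = f := by rw [hξ.n 6 rfl, e6ν]
      refine .flat rfl (by interval_cases a' <;> decide) fun _ => ?_
      rw [hinξ.run_partInvCmd 5 a' (x := nr 6) e6ξ]
      simp [e6ξ, h5, (hinξ.alts a' (by omega)).min]
  have hkξ : (partInvCmd 4 a (nr 6) (ra (10 + a) (nr 6)) ;;
      partInvCmd 5 a' (nr 6) (ra (10 + a') (nr 6))).keepsReady = true := by
    interval_cases a <;> interval_cases a' <;> rfl
  have hinξ := hinν.keep hξ hkξ
  have e6ξ : ξ.nreg 6 = f := by rw [hξ.n 6 rfl, e6ν]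
  have e9ξ : ξ.nreg 9 = ν.nreg 9 := hξ.n 9 rfl
  refine Runs.seq' (R := fun η => η.rreg 4 =
      G.maxFirst (bound G b₂) δ (bias b₁ b₂ a) (bias b₁ b₂ a') f) ?_ fun η hη h5 => ?_
  · refine .flat rfl (by decide) fun _ => ?_
    simp [h4, e6ξ, hinξ.inp.cost, maxFirst]
  have hinη := hinξ.keep hη rfl
  have e6η : η.nreg 6 = f := by rw [hη.n 6 rfl, e6ξ]
  have e9η : η.nreg 9 = ν.nreg 9 := by rw [hη.n 9 rfl, e9ξ]
  have hna : ∀ r, 26 ≤ r → η.narr r = μ.narr r := by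
    intro r hr
    have hkn : ∀ c : Cmd, c.keepsNA r = true → c.keepsNA r = true := fun _ h => h
    rw [hη.na r rfl, hξ.na r rfl, hν.na r rfl, hρ.na r rfl, hτ.na r rfl]
  have hra : η.rarr (13 + s) = μ.rarr (13 + s) := by
    rw [hη.ra _ rfl, hξ.ra _ rfl, hν.ra _ rfl, hρ.ra _ rfl, hτ.ra _ rfl]
  have hN := (hinη.alts a (by omega)).natural f
  have hN' := (hinη.alts a' (by omega)).natural f
  refine .flat rfl (by simp [Cmd.cost, NExp.size, RExp.size, BExp.size, BExp.neq]) fun _ => ⟨fun e he => ?_, fun i hij hP e he => ?_⟩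
  · have he' : e = f := Fin.ext (by omega)
    subst he'
    have hcode := isLeast_soloSet h3
    refine ⟨?_, ?_, ?_⟩
    · convert h3 using 2
      all_goals
        simp only [run_seq, run_ite]
        split_ifs <;> simp [e6η, e9η]
    · convert hcode using 3
      have g1 : ¬ 23 + a = 26 + s := by omega
      have g2 : ¬ 23 + a' = 26 + s := by omega
      by_cases q : Natural G (bound G b₂) δ (bias b₁ b₂ a) f ∧
          Natural G (bound G b₂) δ (bias b₁ b₂ a') f
      · have q1 := hN.2 q.1
        have q2 := hN'.2 q.2
        rw [if_pos q]
        simp [e6η, g1, g2, Nat.one_le_iff_ne_zero, q1, q2]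
      · rw [if_neg q]
        rw [← hN, ← hN'] at q
        split_ifs with q3 <;>
          simp [e6η, e9η, g1, g2, Nat.one_le_iff_ne_zero, q3, show ¬ (¬ η.narr (23 + a) f = 0 ∧
            ¬ η.narr (23 + a') f = 0) from q, -not_and]
    · simp only [run_seq, run_ite]
      split_ifs <;> simp [e6η, h5]
  · have hne : (e : ℕ) ≠ j := by omega
    refine (hP e he).congr ?_ ?_ ?_
    · rw [← hna _ (by omega)]
      simp only [run_seq, run_ite]
      split_ifs <;> simp [e6η, hfj, hne]
    · rw [← hna _ (by omega)]
      simp only [run_seq, run_ite]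
      split_ifs <;> simp [e6η, hfj, hne]
    · rw [← hra]
      simp only [run_seq, run_ite]
      split_ifs <;> simp [e6η, hfj, hne]

end PresentBias

namespace PresentBias

/-- A loop that looks for an index with property `P`. -/
theorem Runs.search {i : ℕ} {hi : NExp} {c : Cmd} {σ : Mem} {Q : Mem → Prop}
    (P : ℕ → Prop) (D S : Mem → Prop) {N : ℕ} {t : ℕ} {b : ℕ}
    (hbody : c.keepsN i = true)
    (hN : ∀ τ, Keep (Cmd.upTo i hi c) σ τ → hi.eval τ = N)
    (hset : ∀ ρ v, (D ρ → D (ρ.setN i v)) ∧ (S ρ → S (ρ.setN i v)))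
    (h0 : D σ)
    (hstep : ∀ j < N, ∀ τ, Keep (Cmd.upTo i hi c) σ τ → τ.nreg i = j →
      Runs c τ t fun ρ => (P j → S ρ) ∧ (¬ P j → (D τ → D ρ) ∧ (S τ → S ρ)))
    (hb : N * (t + (hi.size + 8)) + (hi.size + 8) ≤ b)
    (hQ : ∀ τ, Keep (Cmd.upTo i hi c) σ τ → (D τ ∧ ∀ l < N, ¬ P l) ∨ S τ → Q τ) :
    Runs (Cmd.upTo i hi c) σ b Q := by
  refine Runs.upTo' (fun j τ => (D τ ∧ ∀ l < j, ¬ P l) ∨ S τ) hbody hN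
    (Or.inl ⟨(hset _ _).1 h0, fun l hl => by omega⟩) (fun j hj τ hτ hi hJ => ?_) hb hQ
  refine (hstep j hj τ hτ hi).imp fun ρ _ h => ?_
  by_cases hP : P j
  · exact Or.inr ((hset _ _).2 (h.1 hP))
  · rcases hJ with ⟨h1, h2⟩ | h1
    · refine Or.inl ⟨(hset _ _).1 ((h.2 hP).1 h1), fun l hl => ?_⟩
      by_cases hlj : l = j
      · rwa [hlj]
      · exact h2 l (by omega)
    · exact Or.inr ((hset _ _).2 ((h.2 hP).2 h1))

open TaskGraph Cmd

variable {n m : ℕ} {G : TaskGraph n m} {b₁ b₂ : ℝ} {k : ℕ} {ord : Fin n → ℕ} {δ : Fin n → ℝ}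

/-! ### The program: one agent on an edge that is not chunked -/

theorem Ready.setR {σ : Mem} (h : Ready G b₁ b₂ k ord δ σ) {r : ℕ} (hr : 4 ≤ r) (w : ℝ) :
    Ready G b₁ b₂ k ord δ (σ.setR r w) := by
  obtain ⟨h1, h2, h3⟩ := h
  refine ⟨⟨h1.1, h1.2, h1.3, h1.4, h1.5, ?_, ?_, h1.8, h1.9, h1.10⟩, ⟨?_, h2.2, h2.3⟩,
    fun a ha => ⟨(h3 a ha).1, (h3 a ha).2, (h3 a ha).3⟩⟩
  · rw [Mem.setR_rreg, if_neg (by omega), h1.b₁]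
  · rw [Mem.setR_rreg, if_neg (by omega), h1.b₂]
  · rw [Mem.setR_rreg, if_neg (by omega), h2.bound]

/-- The memory that tells how the agents can take one edge. -/
structure Solved (G : TaskGraph n m) (b₁ b₂ : ℝ) (k : ℕ) (ord : Fin n → ℕ) (δ : Fin n → ℝ) (σ : Mem) :
    Prop where
  ready : Ready G b₁ b₂ k ord δ σ
  fst : ∀ e, SoloAt G b₁ b₂ k δ 0 0 0 e σ
  snd : ∀ e, SoloAt G b₁ b₂ k δ 1 1 1 e σ
  two : ∀ e, SoloAt G b₁ b₂ k δ 0 1 2 e σ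

def Cmd.keepsSolved (c : Cmd) : Bool :=
  c.keepsReady && c.keepsRA 13 && c.keepsRA 14 && c.keepsRA 15 && c.keepsNA 26 &&
    c.keepsNA 27 && c.keepsNA 28 && c.keepsNA 29 && c.keepsNA 30 && c.keepsNA 31

theorem Solved.keep {c : Cmd} {σ τ : Mem} (h : Solved G b₁ b₂ k ord δ σ) (hk : Keep c σ τ)
    (hc : c.keepsSolved = true) : Solved G b₁ b₂ k ord δ τ := by
  simp only [Cmd.keepsSolved, Bool.and_eq_true] at hc
  obtain ⟨⟨⟨⟨⟨⟨⟨⟨⟨h0, r0⟩, r1⟩, r2⟩, a0⟩, a1⟩, a2⟩, a3⟩, a4⟩, a5⟩ := hc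
  refine ⟨h.ready.keep hk h0, fun e => (h.fst e).congr ?_ ?_ ?_, fun e => (h.snd e).congr ?_ ?_ ?_,
    fun e => (h.two e).congr ?_ ?_ ?_⟩
  · rw [hk.na _ a0]
  · rw [hk.na _ a3]
  · rw [hk.ra _ r0]
  · rw [hk.na _ a1]
  · rw [hk.na _ a4]
  · rw [hk.ra _ r1]
  · rw [hk.na _ a2]
  · rw [hk.na _ a5]
  · rw [hk.ra _ r2]

theorem Solved.setR {σ : Mem} (h : Solved G b₁ b₂ k ord δ σ) {r : ℕ} (hr : 4 ≤ r) (w : ℝ) :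
    Solved G b₁ b₂ k ord δ (σ.setR r w) :=
  ⟨h.1.setR hr w, fun e => (h.2 e).congr rfl rfl rfl, fun e => (h.3 e).congr rfl rfl rfl,
    fun e => (h.4 e).congr rfl rfl rfl⟩

theorem Solved.same {σ : Mem} (h : Solved G b₁ b₂ k ord δ σ) {a : ℕ} (ha : a < 2) (e : Fin m) :
    SoloAt G b₁ b₂ k δ a a a e σ := by
  interval_cases a
  · exact h.fst e
  · exact h.snd e

def partCmd (r a : ℕ) (x : NExp) (v : RExp) : Cmd :=
  ite (.rle (.add (.sub (ra 0 x) v) (ra 2 (na 1 x))) (ra 12 x))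
    (rset r (.add (.mul (biasX a) v) (.add (.sub (ra 0 x) v) (ra 2 (na 1 x)))))
    (rset r (.add (.mul (biasX a) v) (ra 12 x)))

def winsX (a : ℕ) (x y : NExp) (p q : RExp) : BExp :=
  .conj (.rle p (ra (10 + a) x)) (.disj (.rlt p q) (.conj (.req p q) (.conj
    (.nlt (na 1 x) (na 1 y)) (.disj (.rlt p (ra (10 + a) x)) (.nlt (na 1 x) (na (20 + a) x))))))

section
variable {σ : Mem} (h : Ready G b₁ b₂ k ord δ σ)
include h

theorem Ready.run_partCmd (r a : ℕ) {x : NExp} {e : Fin m} (hx : x.eval σ = e) (v : RExp) :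
    (partCmd r a x v).run σ = σ.setR r (G.part (bound G b₂) δ (bias b₁ b₂ a) e (v.eval σ)) := by
  simp only [partCmd, run_ite, run_rset, BExp.eval_rle, RExp.eval_sub, RExp.eval_add, RExp.eval_mul,
    RExp.eval_get, hx, NExp.eval_get, h.inp.cost, h.inp.head, h.inp.eval_biasX, h.dist.dist, h.altOne,
    part, min_def]
  split_ifs <;> rfl

theorem Ready.eval_winsX {a : ℕ} (ha : a < 3) {x y : NExp} {e f : Fin m} (hx : x.eval σ = e)
    (hy : y.eval σ = f) (p q : RExp) : (winsX a x y p q).eval σ ↔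
      Wins G (bound G b₂) δ (bias b₁ b₂ a) e f (p.eval σ) (q.eval σ) := by
  simp only [winsX, BExp.eval_conj, BExp.eval_disj, BExp.eval_rle, BExp.eval_rlt, BExp.eval_req,
    BExp.eval_nlt, RExp.eval_get, NExp.eval_get, hx, hy, h.inp.head, (h.alts a ha).min,
    (h.alts a ha).head, Wins, Fin.lt_def]

end

/-- The memory tells how the agent `a'` can take `e` in pieces, while the agent `a` takes
another edge that is not chunked. -/
structure OneAt (G : TaskGraph n m) (b₁ b₂ : ℝ) (k : ℕ) (δ : Fin n → ℝ) (a a' : ℕ) (e : Fin m)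
    (σ : Mem) : Prop where
  plan : ∀ e₁, e ≠ e₁ → G.tail e = G.tail e₁ → Natural G (bound G b₂) δ (bias b₁ b₂ a) e₁ →
    σ.narr (32 + a) e ≠ 0 → OneSplit G (bound G b₂) δ k (bias b₁ b₂ a) (bias b₁ b₂ a') e₁ e
      (σ.narr (26 + a') e) (σ.narr (34 + a) e) (σ.rarr (16 + a) e) (σ.narr (32 + a) e - 1)
  least : ∀ e₁ l f z w, e ≠ e₁ → G.tail e = G.tail e₁ →
    OneSplit G (bound G b₂) δ k (bias b₁ b₂ a) (bias b₁ b₂ a') e₁ e l f z w →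
    σ.narr (32 + a) e ≠ 0 ∧ σ.narr (32 + a) e ≤ w + 1

theorem OneAt.congr {a a' : ℕ} {e : Fin m} {σ τ : Mem} (h : OneAt G b₁ b₂ k δ a a' e σ)
    (h1 : τ.narr (26 + a') e = σ.narr (26 + a') e) (h2 : τ.narr (32 + a) e = σ.narr (32 + a) e)
    (h3 : τ.narr (34 + a) e = σ.narr (34 + a) e)
    (h4 : τ.rarr (16 + a) e = σ.rarr (16 + a) e) : OneAt G b₁ b₂ k δ a a' e τ :=
  ⟨by rw [h1, h2, h3, h4]; exact h.plan, by rw [h2]; exact h.least⟩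

/-- Find the other edge that the agent takes if no edge is chunked. -/
def findCmd (a : ℕ) : Cmd :=
  upTo 7 (nr 1) (when (.conj (.neq (na 0 (nr 7)) (na 0 (nr 6))) (.conj (.neg (.neq (nr 7) (nr 6)))
    (.nle (nl 1) (na (23 + a) (nr 7))))) (nset 8 (.add (nr 7) (nl 1))))

theorem findCmd_runs {σ : Mem} {a : ℕ} (ha : a < 2) (h : Solved G b₁ b₂ k ord δ σ)
    {e : Fin m} (he : σ.nreg 6 = e) (h8 : σ.nreg 8 = 0) :
    Runs (findCmd a) σ (m * 40 + 9) fun τ => (τ.nreg 8 = 0 ∧ ∀ f, e ≠ f → G.tail e = G.tail f →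
      ¬ Natural G (bound G b₂) δ (bias b₁ b₂ a) f) ∨
      ∃ f : Fin m, τ.nreg 8 = f + 1 ∧ e ≠ f ∧ G.tail e = G.tail f ∧
        Natural G (bound G b₂) δ (bias b₁ b₂ a) f := by
  have hkR : (findCmd a).keepsReady = true := by interval_cases a <;> rfl
  refine Runs.search (fun j => ∃ f : Fin m, (f : ℕ) = j ∧ e ≠ f ∧ G.tail e = G.tail f ∧
      Natural G (bound G b₂) δ (bias b₁ b₂ a) f) (fun τ => τ.nreg 8 = 0)
    (fun τ => ∃ f : Fin m, τ.nreg 8 = f + 1 ∧ e ≠ f ∧ G.tail e = G.tail f ∧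
        Natural G (bound G b₂) δ (bias b₁ b₂ a) f) (N := m) (t := 31) rfl
    (fun τ hτ => (h.ready.keep hτ hkR).inp.regM) (by simp) h8 (fun j hj μ hμ hμj => ?_)
    le_rfl fun τ _ hτ => ?_
  · have hin := h.ready.keep hμ hkR
    have hμe : μ.nreg 6 = e := by rw [hμ.n 6 rfl, he]
    set f : Fin m := ⟨j, hj⟩ with hf
    have hfj : (f : ℕ) = j := rfl
    have hiff : (BExp.conj (.neq (na 0 (nr 7)) (na 0 (nr 6))) (.conj (.neg (.neq (nr 7) (nr 6)))
        (.nle (nl 1) (na (23 + a) (nr 7))))).eval μ ↔ e ≠ f ∧ G.tail e = G.tail f ∧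
        Natural G (bound G b₂) δ (bias b₁ b₂ a) f := by
      rw [← (hin.alts a (by omega)).natural f]
      simp only [BExp.eval_conj, BExp.eval_neq, BExp.eval_neg, BExp.eval_nle, NExp.eval_get,
        NExp.eval_reg, NExp.eval_lit, hμj, hμe, ← hfj, hin.inp.tail, ← Fin.ext_iff,
        Nat.one_le_iff_ne_zero, ne_eq, eq_comm (a := f), eq_comm (a := G.tail f)]
      tauto
    have hP : (∃ g : Fin m, (g : ℕ) = j ∧ e ≠ g ∧ G.tail e = G.tail g ∧
        Natural G (bound G b₂) δ (bias b₁ b₂ a) g) ↔ e ≠ f ∧ G.tail e = G.tail f ∧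
        Natural G (bound G b₂) δ (bias b₁ b₂ a) f :=
      ⟨fun ⟨g, hg, h⟩ => by obtain rfl : g = f := Fin.ext hg; exact h, fun h => ⟨f, rfl, h⟩⟩
    rw [hP, ← hiff]
    refine Runs.le (Runs.when (t := 4) (fun hp => ?_) fun hp => ?_)
      (by simp [BExp.size, NExp.size, BExp.neq])
    · refine .flat rfl (by decide) fun _ => ⟨fun _ => ⟨f, ?_, hiff.1 hp⟩, fun h => absurd hp h⟩
      simp [hμj, hfj]
    · exact ⟨fun h => absurd h hp, fun _ => by simp⟩
  · refine hτ.imp_left fun h => ⟨h.1, fun f h1 h2 h3 => h.2 f f.2 ⟨f, rfl, h1, h2, h3⟩⟩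

/-- Find a third edge that separates the agents. -/
def thirdCmd (a a' : ℕ) : Cmd :=
  upTo 7 (nr 1) (when (.conj (.conj (.neg (.neq (nr 7) (nr 8))) (.neg (.neq (nr 7) (nr 6))))
      (.neq (na 0 (nr 7)) (na 0 (nr 6))))
    (partInvCmd 8 a (nr 7) (rr 7) ;; partCmd 11 a' (nr 7) (rr 8) ;;
      when (.conj (.conj (.rle (rl 0) (rr 8)) (.rle (rr 8) (ra 0 (nr 7))))
          (.conj (.nlt (na 1 (nr 8)) (na 1 (nr 7))) (winsX a' (nr 6) (nr 7) (rr 10) (rr 11))))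
        (nset 9 (.add (na (26 + a') (nr 6)) (nl 3)) ;; nset 10 (.add (nr 7) (nl 1)) ;; rset 9 (rr 8))))

/-- Since `part` is a bijection, the required tie determines the first piece of the third edge; the
search has a single candidate for each edge. -/
theorem third_iff {B b b' : ℝ} (hb : 1 < b) {e e' f : Fin m} {y z : ℝ} :
    Third G B δ b b' e e' y f z ↔ z = G.partInv B δ b f (G.whole δ b e) ∧
      Third G B δ b b' e e' y f (G.partInv B δ b f (G.whole δ b e)) := by
  refine ⟨fun h => ?_, fun h => h.1 ▸ h.2⟩
  have : z = G.partInv B δ b f (G.whole δ b e) := by rw [← h.2.2.2.2.1, partInv_part hb]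
  exact ⟨this, this ▸ h⟩

theorem thirdCmd_runs {σ : Mem} {a a' : ℕ} (ha : a < 2) (ha' : a' < 2)
    (hb : 1 < bias b₁ b₂ a) (h : Solved G b₁ b₂ k ord δ σ)
    {e e' : Fin m} (he : σ.nreg 8 = e) (he' : σ.nreg 6 = e') (h9 : σ.nreg 9 = 0) {y : ℝ}
    (h7 : σ.rreg 7 = G.whole δ (bias b₁ b₂ a) e)
    (h10 : σ.rreg 10 = G.part (bound G b₂) δ (bias b₁ b₂ a') e' y) :
    Runs (thirdCmd a a') σ (m * 220 + 9) fun τ =>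
      (τ.nreg 9 = 0 ∧ ∀ f z, ¬ Third G (bound G b₂) δ (bias b₁ b₂ a) (bias b₁ b₂ a') e e' y f z) ∨
      ∃ g : Fin m, τ.nreg 9 = σ.narr (26 + a') e' + 3 ∧ τ.nreg 10 = g + 1 ∧
        Third G (bound G b₂) δ (bias b₁ b₂ a) (bias b₁ b₂ a') e e' y g (τ.rreg 9) := by
  have hkR : (thirdCmd a a').keepsSolved = true := by interval_cases a <;> interval_cases a' <;> rfl
  refine Runs.search (fun j => ∃ f : Fin m, (f : ℕ) = j ∧ Third G (bound G b₂) δ (bias b₁ b₂ a)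
      (bias b₁ b₂ a') e e' y f (G.partInv (bound G b₂) δ (bias b₁ b₂ a) f
        (G.whole δ (bias b₁ b₂ a) e))) (fun τ => τ.nreg 9 = 0)
    (fun τ => ∃ g : Fin m, τ.nreg 9 = σ.narr (26 + a') e' + 3 ∧ τ.nreg 10 = g + 1 ∧
        Third G (bound G b₂) δ (bias b₁ b₂ a) (bias b₁ b₂ a') e e' y g (τ.rreg 9)) (N := m) (t := 211) rfl
    (fun τ hτ => (h.keep hτ hkR).ready.inp.regM) (by simp) h9 (fun j hj μ hμ hμj => ?_)
    le_rfl fun τ _ hτ => ?_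
  · have hin := h.keep hμ hkR
    have e6 : μ.nreg 6 = e' := by rw [hμ.n 6 rfl, he']
    have e8 : μ.nreg 8 = e := by rw [hμ.n 8 rfl, he]
    have e7 : μ.rreg 7 = σ.rreg 7 := hμ.r 7 rfl
    have e10 : μ.rreg 10 = σ.rreg 10 := hμ.r 10 rfl
    have e26 : μ.narr (26 + a') = σ.narr (26 + a') := hμ.na _ rfl
    set f : Fin m := ⟨j, hj⟩ with hf
    have hfj : (f : ℕ) = j := rfl
    set z := G.partInv (bound G b₂) δ (bias b₁ b₂ a) f (G.whole δ (bias b₁ b₂ a) e) with hz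
    have hP : (∃ g : Fin m, (g : ℕ) = j ∧ Third G (bound G b₂) δ (bias b₁ b₂ a)
        (bias b₁ b₂ a') e e' y g (G.partInv (bound G b₂) δ (bias b₁ b₂ a) g
        (G.whole δ (bias b₁ b₂ a) e))) ↔ Third G (bound G b₂) δ (bias b₁ b₂ a)
        (bias b₁ b₂ a') e e' y f z :=
      ⟨fun ⟨g, hg, h⟩ => by obtain rfl : g = f := Fin.ext hg; exact h, fun h => ⟨f, rfl, h⟩⟩
    rw [hP]
    refine Runs.le (Runs.when (t := 180) (fun hp => ?_) fun hp => ?_) (by decide)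
    · have hp' : f ≠ e ∧ f ≠ e' ∧ G.tail f = G.tail e' := by
        simpa [hμj, e6, e8, ← hfj, hin.ready.inp.tail, ← Fin.ext_iff, and_assoc] using hp
      have s1 := hin.ready.run_partInvCmd 8 a (x := nr 7) (e := f) hμj (rr 7)
      rw [RExp.eval_reg, e7, h7, ← hz] at s1
      have hin1 := hin.ready.setR (r := 8) (by decide) z
      have s2 := hin1.run_partCmd 11 a' (x := nr 7) (e := f) hμj (rr 8)
      rw [RExp.eval_reg, Mem.setR_rreg, if_pos rfl] at s2
      have hin2 := hin1.setR (r := 11) (by decide) (G.part (bound G b₂) δ (bias b₁ b₂ a') f z)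
      have hw := hin2.eval_winsX (a := a') (x := nr 6) (y := nr 7) (e := e') (f := f)
        (by omega) e6 hμj (rr 10) (rr 11)
      refine .flat rfl (by interval_cases a <;> interval_cases a' <;> decide) fun _ => ?_
      have hT : Third G (bound G b₂) δ (bias b₁ b₂ a) (bias b₁ b₂ a') e e' y f z ↔
          ((0 ≤ z ∧ z ≤ G.cost f) ∧ (G.head e : ℕ) < G.head f ∧
          Wins G (bound G b₂) δ (bias b₁ b₂ a') e' f (G.part (bound G b₂) δ (bias b₁ b₂ a') e' y)
            (G.part (bound G b₂) δ (bias b₁ b₂ a') f z)) := by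
        rw [Third, part_partInv hb]
        simp only [hp', ne_eq, not_false_iff, true_and, Fin.lt_def]
      have hc : (BExp.conj (.conj (.rle (rl 0) (rr 8)) (.rle (rr 8) (ra 0 (nr 7))))
          (.conj (.nlt (na 1 (nr 8)) (na 1 (nr 7))) (winsX a' (nr 6) (nr 7) (rr 10) (rr 11)))).eval
          ((μ.setR 8 z).setR 11 (G.part (bound G b₂) δ (bias b₁ b₂ a') f z)) ↔
          Third G (bound G b₂) δ (bias b₁ b₂ a) (bias b₁ b₂ a') e e' y f z := by
        rw [hT, BExp.eval_conj, BExp.eval_conj, BExp.eval_conj, hw]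
        simp [hμj, e8, ← hfj, hin.ready.inp.cost, hin.ready.inp.head, e10, h10]
      rw [run_seq, run_seq, s1, s2, Cmd.when, run_ite]
      split_ifs with h1
      · refine ⟨fun _ => ⟨f, ?_, ?_, ?_⟩, fun h2 => absurd (hc.1 h1) h2⟩
        · simp [e26, e6]
        · simp [hμj, hfj]
        · simpa using hc.1 h1
      · exact ⟨fun h2 => absurd (hc.2 h2) h1, fun _ => by simp [Cmd.skip]⟩
    · have hp' : ¬ (f ≠ e ∧ f ≠ e' ∧ G.tail f = G.tail e') := by
        intro h1; apply hp
        simpa [hμj, e6, e8, ← hfj, hin.ready.inp.tail, ← Fin.ext_iff, and_assoc] using h1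
      exact ⟨fun h1 => absurd ⟨h1.1, h1.2.1, h1.2.2.1⟩ hp', fun _ => by simp⟩
  · refine hτ.imp_left fun h => ⟨h.1, fun f z hT => h.2 f f.2 ⟨f, rfl, ((third_iff hb).1 hT).2⟩⟩

/-- By `Natural.unique`, at most one other edge can be the undivided one. So the data depend on the
chunked edge alone and are found by two linear searches: for that natural edge, and for a third edge
if there is a tie. Computed for every edge beforehand, they cost `m²` steps and nothing later for
each pair. Array `32 + a` holds the number of chunks plus one, array `34 + a` the third edge plus
one. -/
def oneRow (a a' : ℕ) : Cmd :=
  upTo 6 (nr 1) ((nset 8 (nl 0) ;; nset 9 (nl 0) ;; nset 10 (nl 0)) ;; findCmd a ;;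
    when (.conj (.nle (nl 1) (nr 8)) (.nle (nl 1) (na (26 + a') (nr 6))))
      ((nset 8 (.sub (nr 8) (nl 1)) ;; rset 7 (wholeX a (nr 8)) ;;
          partCmd 6 a (nr 6) (ra (13 + a') (nr 6)) ;; partCmd 10 a' (nr 6) (ra (13 + a') (nr 6))) ;;
        ite (.rlt (rr 7) (rr 6)) (nset 9 (.add (na (26 + a') (nr 6)) (nl 1)))
          (when (.conj (.req (rr 7) (rr 6)) (.nlt (na 1 (nr 8)) (na 1 (nr 6)))) (thirdCmd a a'))) ;;
    nput (32 + a) (nr 6) (nr 9) ;; nput (34 + a) (nr 6) (nr 10) ;; rput (16 + a) (nr 6) (rr 9))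

theorem oneRow_runs {σ : Mem} {a a' : ℕ} (ha : a < 2) (ha' : a' < 2)
    (hb : 1 < bias b₁ b₂ a) (h : Solved G b₁ b₂ k ord δ σ) :
    Runs (oneRow a a') σ (m * (300 * m + 400) + 9) fun τ => ∀ e, OneAt G b₁ b₂ k δ a a' e τ := by
  have hkR : (oneRow a a').keepsSolved = true := by
    interval_cases a <;> interval_cases a' <;> rfl
  refine Runs.forEach (fun i τ => ∀ e : Fin m, (e : ℕ) = i → OneAt G b₁ b₂ k δ a a' e τ)
    (N := m) (t := 300 * m + 390) rfl (fun τ hτ => (h.keep hτ hkR).ready.inp.regM)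
    (fun i ρ v hP e he => (hP e he).congr rfl rfl rfl rfl) (fun j hj μ hμ hμj => ?_)
    (by simp only [NExp.size]; nlinarith) (fun τ _ hP e => hP e e.2 e rfl)
  have hin := h.keep hμ hkR
  set f : Fin m := ⟨j, hj⟩ with hf
  have hfj : (f : ℕ) = j := rfl
  refine Runs.le (s := 6 + ((m * 40 + 9) + ((m * 220 + 300) + 20))) ?_ (by omega)
  refine Runs.seq' (R := fun τ => τ.nreg 8 = 0 ∧ τ.nreg 9 = 0 ∧ τ.nreg 10 = 0)
    (.flat rfl (by decide) fun _ => by simp) fun τ hτ h1 => ?_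
  have hinτ := hin.keep hτ rfl
  refine Runs.seq' (findCmd_runs (e := f) ha hinτ (by rw [hτ.n 6 rfl, hμj]) h1.1) fun ρ hρ h2 => ?_
  have hkρ : (findCmd a).keepsSolved = true := by interval_cases a <;> rfl
  have hinρ := hinτ.keep hρ hkρ
  have e6 : ρ.nreg 6 = f := by rw [hρ.n 6 rfl, hτ.n 6 rfl, hμj]
  have e9 : ρ.nreg 9 = 0 := by rw [hρ.n 9 rfl, h1.2.1]
  have e10 : ρ.nreg 10 = 0 := by rw [hρ.n 10 rfl, h1.2.2]
  have hS := hinρ.same ha' f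
  refine Runs.seq' (R := fun ν =>
    (∀ e₁, f ≠ e₁ → G.tail f = G.tail e₁ → Natural G (bound G b₂) δ (bias b₁ b₂ a) e₁ →
      ν.nreg 9 ≠ 0 → OneSplit G (bound G b₂) δ k (bias b₁ b₂ a) (bias b₁ b₂ a') e₁ f
      (ρ.narr (26 + a') f) (ν.nreg 10) (ν.rreg 9) (ν.nreg 9 - 1)) ∧
    ∀ e₁ l g z w, f ≠ e₁ → G.tail f = G.tail e₁ →
      OneSplit G (bound G b₂) δ k (bias b₁ b₂ a) (bias b₁ b₂ a') e₁ f l g z w →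
      ν.nreg 9 ≠ 0 ∧ ν.nreg 9 ≤ w + 1) ?_ fun ν hν h3 => ?_
  · refine Runs.le (Runs.when (t := 150 + (10 + (m * 220 + 9 + 30))) (fun hp => ?_) fun hp => ?_)
      (by simp [BExp.size, NExp.size]; omega)
    · simp only [BExp.eval_conj, BExp.eval_nle, NExp.eval_lit, NExp.eval_reg, NExp.eval_get, e6] at hp
      obtain ⟨e, he, hne, ht, hnat⟩ := h2.resolve_left fun h => by omega
      obtain ⟨hF, hFk, hFl⟩ := hS.least.resolve_left fun h => by omega
      set y := G.maxFirst (bound G b₂) δ (bias b₁ b₂ a') (bias b₁ b₂ a') f with hy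
      have huniq : ∀ e₁, G.tail f = G.tail e₁ →
          Natural G (bound G b₂) δ (bias b₁ b₂ a) e₁ → e₁ = e := fun e₁ h1 h2 =>
        hnat.unique h2 (h1.symm.trans ht)
      refine Runs.seq' (R := fun ν => ν.nreg 8 = e ∧ ν.rreg 7 = G.whole δ (bias b₁ b₂ a) e ∧
        ν.rreg 6 = G.part (bound G b₂) δ (bias b₁ b₂ a) f y ∧
        ν.rreg 10 = G.part (bound G b₂) δ (bias b₁ b₂ a') f y) ?_ fun ν hν h3 => ?_
      · refine .flat rfl (by interval_cases a <;> interval_cases a' <;> decide) fun _ => ?_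
        have i1 : Solved G b₁ b₂ k ord δ (ρ.setN 8 e) :=
          hinρ.keep (c := nset 8 (nl 0)) ⟨fun r hr => by
            simp only [Cmd.keepsN, bne_iff_ne, ne_eq] at hr; simp [Ne.symm hr],
            fun _ _ => rfl, fun _ _ => rfl, fun _ _ => rfl⟩ rfl
        have i2 := i1.setR (r := 7) (by decide) (G.whole δ (bias b₁ b₂ a) e)
        have i3 := i2.setR (r := 6) (by decide) (G.part (bound G b₂) δ (bias b₁ b₂ a) f y)
        have hx : ∀ s : Mem, s.nreg 6 = f → (nr 6).eval s = f := fun _ h => h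
        have q0 : (nset 8 (.sub (nr 8) (nl 1))).run ρ = ρ.setN 8 e := by simp [he]
        have q1 := eval_wholeX i1.ready.inp i1.ready.dist a (x := nr 8) (e := e) (by simp)
        have q2 := i2.ready.run_partCmd 6 a (x := nr 6) (e := f) (by simpa using e6) (ra (13 + a') (nr 6))
        have q3 := i3.ready.run_partCmd 10 a' (x := nr 6) (e := f) (by simpa using e6) (ra (13 + a') (nr 6))
        have v2 : (ra (13 + a') (nr 6)).eval ((ρ.setN 8 e).setR 7 (G.whole δ (bias b₁ b₂ a) e)) = y := by
          simpa [e6] using hS.first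
        have v3 : (ra (13 + a') (nr 6)).eval (((ρ.setN 8 e).setR 7 (G.whole δ (bias b₁ b₂ a) e)).setR 6
            (G.part (bound G b₂) δ (bias b₁ b₂ a) f y)) = y := by
          simpa [e6] using hS.first
        rw [v2] at q2
        rw [v3] at q3
        rw [run_seq, run_seq, run_seq, q0, run_rset, q1, q2, q3]
        simp
      · obtain ⟨g8, g7, g6, g10⟩ := h3
        have hkν : (nset 8 (.sub (nr 8) (nl 1)) ;; rset 7 (wholeX a (nr 8)) ;;
          partCmd 6 a (nr 6) (ra (13 + a') (nr 6)) ;;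
          partCmd 10 a' (nr 6) (ra (13 + a') (nr 6))).keepsSolved = true := by
          interval_cases a <;> interval_cases a' <;> rfl
        have hinν := hinρ.keep hν hkν
        have f6 : ν.nreg 6 = f := by rw [hν.n 6 rfl, e6]
        have f9 : ν.nreg 9 = 0 := by rw [hν.n 9 rfl, e9]
        have f10 : ν.nreg 10 = 0 := by rw [hν.n 10 rfl, e10]
        have f26 : ν.narr (26 + a') = ρ.narr (26 + a') := hν.na _ rfl
        refine Runs.le (Runs.ite (s := 10) (t := m * 220 + 9 + 30) (fun hq => ?_) fun hq => ?_)
          (by simp [BExp.size, BExp.rlt, RExp.size])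
        · simp only [BExp.eval_rlt, RExp.eval_reg, g7, g6] at hq
          refine .flat rfl (by simp [Cmd.cost, NExp.size]) fun _ => ⟨fun e₁ n1 n2 n3 _ => ?_,
            fun e₁ l g z w n1 n2 hO => ?_⟩
          · rw [huniq e₁ n2 n3]
            refine ⟨hnat, hF, hFk, Or.inl ⟨?_, ?_, hq⟩⟩
            · simp [f10]
            · simp [f6, f26]
          · have := hFl l hO.2.1
            have : l ≤ w := by
              rcases hO.2.2.2 with h1 | ⟨_, _, h1, _⟩ <;> omega
            simp only [run_nset, Mem.setN_nreg, if_true, NExp.eval_add, NExp.eval_get, NExp.eval_reg, f6,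
              f26, NExp.eval_lit]
            omega
        · simp only [BExp.eval_rlt, RExp.eval_reg, g7, g6, not_lt] at hq
          -- Without a strict preference for `e`, every plan needs a third edge and therefore `l +
          -- 2` chunks.
          have hlow : ∀ l g z w, OneSplit G (bound G b₂) δ k (bias b₁ b₂ a) (bias b₁ b₂ a') e f l g z w →
              ∃ q : Fin m, w = l + 2 ∧ (G.whole δ (bias b₁ b₂ a) e = G.part (bound G b₂) δ (bias b₁ b₂ a) f y ∧
                G.head e < G.head f) ∧ Third G (bound G b₂) δ (bias b₁ b₂ a) (bias b₁ b₂ a') e f y q z := by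
            rintro l g z w ⟨-, -, -, ⟨-, -, h1⟩ | ⟨q, -, h1, h2, h3, h4⟩⟩
            · exact absurd h1 (not_lt.2 hq)
            · exact ⟨q, h1, ⟨h2, h3⟩, h4⟩
          refine Runs.le (Runs.when (t := m * 220 + 9) (fun hr => ?_) fun hr => ?_)
            (by simp [BExp.size, BExp.req, RExp.size, BExp.nlt, NExp.size]; omega)
          · have hr' : G.whole δ (bias b₁ b₂ a) e = G.part (bound G b₂) δ (bias b₁ b₂ a) f y ∧
                G.head e < G.head f := by
              simpa [g7, g6, g8, f6, hinν.ready.inp.head] using hr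
            refine (thirdCmd_runs ha ha' hb hinν g8 f6 f9 g7 g10).imp fun ξ _ h4 => ?_
            rcases h4 with ⟨h4, h5⟩ | ⟨g, h4, h5, h6⟩
            · refine ⟨fun e₁ _ _ _ h6 => absurd h4 h6, fun e₁ l g z w n1 n2 hO => ?_⟩
              obtain rfl := huniq e₁ n2 hO.1
              obtain ⟨q, -, -, hT⟩ := hlow l g z w hO
              exact absurd hT (h5 q z)
            · refine ⟨fun e₁ n1 n2 n3 _ => ?_, fun e₁ l q z w n1 n2 hO => ?_⟩
              · rw [huniq e₁ n2 n3]
                refine ⟨hnat, hF, hFk, Or.inr ⟨g, h5, ?_, hr'.1, hr'.2, h6⟩⟩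
                rw [h4, f26]; omega
              · obtain rfl := huniq e₁ n2 hO.1
                obtain ⟨q', hw, -⟩ := hlow l q z w hO
                have := hFl l hO.2.1
                rw [h4, f26]; omega
          · refine ⟨fun e₁ _ _ _ h6 => absurd f9 (by simpa using h6), fun e₁ l g z w n1 n2 hO => ?_⟩
            obtain rfl := huniq e₁ n2 hO.1
            obtain ⟨q, -, h6, -⟩ := hlow l g z w hO
            refine absurd ?_ hr
            simpa [g7, g6, g8, f6, hinν.ready.inp.head] using h6
    · simp only [BExp.eval_conj, BExp.eval_nle, NExp.eval_lit, NExp.eval_reg, NExp.eval_get, e6] at hp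
      refine ⟨fun e₁ _ _ _ h6 => absurd e9 (by simpa using h6), fun e₁ l g z w n1 n2 hO => absurd ⟨?_, ?_⟩ hp⟩
      · rcases h2 with h2 | ⟨e, h2, -⟩
        · exact absurd hO.1 (h2.2 e₁ n1 n2)
        · omega
      · rcases hS.least with h3 | h3
        · exact absurd hO.2.1 (h3.2 l hO.2.2.1)
        · have := h3.1.1; omega
  · have hkν : (when (.conj (.nle (nl 1) (nr 8)) (.nle (nl 1) (na (26 + a') (nr 6))))
      ((nset 8 (.sub (nr 8) (nl 1)) ;; rset 7 (wholeX a (nr 8)) ;;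
          partCmd 6 a (nr 6) (ra (13 + a') (nr 6)) ;; partCmd 10 a' (nr 6) (ra (13 + a') (nr 6))) ;;
        Cmd.ite (.rlt (rr 7) (rr 6)) (nset 9 (.add (na (26 + a') (nr 6)) (nl 1)))
          (when (.conj (.req (rr 7) (rr 6)) (.nlt (na 1 (nr 8)) (na 1 (nr 6)))) (thirdCmd a a')))).keepsNA
        (26 + a') = true := rfl
    have f6 : ν.nreg 6 = f := by rw [hν.n 6 rfl, e6]
    have f26 : ν.narr (26 + a') = ρ.narr (26 + a') := hν.na _ hkν
    have hna : ∀ r, ν.narr r = μ.narr r := by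
      intro r
      rw [hν.na r rfl, hρ.na r rfl, hτ.na r rfl]
    have hra : ∀ r, ν.rarr r = μ.rarr r := by
      intro r
      rw [hν.ra r rfl, hρ.ra r rfl, hτ.ra r rfl]
    refine .flat rfl (by simp [Cmd.cost, NExp.size, RExp.size]) fun _ =>
      ⟨fun e he => ?_, fun i hij hP e he => ?_⟩
    · have he' : e = f := Fin.ext (by omega)
      subst he'
      have g1 : ¬ 26 + a' = 32 + a := by omega
      have g2 : ¬ 26 + a' = 34 + a := by omega
      constructor
      · simpa [f6, g1, g2, f26] using h3.1
      · simpa [f6] using h3.2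
    · have hne : (e : ℕ) ≠ j := by omega
      refine (hP e he).congr ?_ ?_ ?_ ?_ <;> simp [f6, hfj, hne, hna, hra]

end PresentBias

namespace PresentBias

open TaskGraph Cmd

variable {n m : ℕ} {G : TaskGraph n m} {b₁ b₂ : ℝ} {k : ℕ} {ord : Fin n → ℕ} {δ : Fin n → ℝ}

/-! ### The program: two edges with the same tail -/

@[simp] theorem bias_zero : bias b₁ b₂ 0 = b₁ := rfl
@[simp] theorem bias_one : bias b₁ b₂ 1 = b₂ := rfl

/-- The memory that the search for a plan for the edges `e` and `e'` needs. -/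
structure AtPair (G : TaskGraph n m) (b₁ b₂ : ℝ) (k : ℕ) (ord : Fin n → ℕ) (δ : Fin n → ℝ)
    (e e' : Fin m) (σ : Mem) : Prop where
  solved : Solved G b₁ b₂ k ord δ σ
  one : ∀ e, OneAt G b₁ b₂ k δ 0 1 e σ
  one' : ∀ e, OneAt G b₁ b₂ k δ 1 0 e σ
  fst : σ.nreg 10 = e
  snd : σ.nreg 11 = e'

def Cmd.keepsPair (c : Cmd) : Bool :=
  c.keepsSolved && c.keepsN 10 && c.keepsN 11 && c.keepsNA 32 && c.keepsNA 33 && c.keepsNA 34 &&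
    c.keepsNA 35 && c.keepsRA 16 && c.keepsRA 17

theorem AtPair.keep {e e' : Fin m} {c : Cmd} {σ τ : Mem} (h : AtPair G b₁ b₂ k ord δ e e' σ)
    (hk : Keep c σ τ) (hc : c.keepsPair = true) : AtPair G b₁ b₂ k ord δ e e' τ := by
  simp only [Cmd.keepsPair, Bool.and_eq_true] at hc
  obtain ⟨⟨⟨⟨⟨⟨⟨⟨h0, n0⟩, n1⟩, a0⟩, a1⟩, a2⟩, a3⟩, r0⟩, r1⟩ := hc
  have hs := h.solved.keep hk h0
  simp only [Cmd.keepsSolved, Bool.and_eq_true] at h0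
  obtain ⟨⟨⟨⟨⟨⟨-, b0⟩, b1⟩, -⟩, -⟩, -⟩, -⟩ := h0
  refine ⟨hs, fun e => (h.one e).congr ?_ ?_ ?_ ?_, fun e => (h.one' e).congr ?_ ?_ ?_ ?_, ?_, ?_⟩
  · rw [hk.na _ b1]
  · rw [hk.na _ a0]
  · rw [hk.na _ a2]
  · rw [hk.ra _ r0]
  · rw [hk.na _ b0]
  · rw [hk.na _ a1]
  · rw [hk.na _ a3]
  · rw [hk.ra _ r1]
  · rw [hk.n _ n0, h.fst]
  · rw [hk.n _ n1, h.snd]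

/-- The memory holds a plan for the edges `e` and `e'`, unless register 12 is zero. -/
def HasPlan (G : TaskGraph n m) (b₁ b₂ : ℝ) (k : ℕ) (δ : Fin n → ℝ) (e e' : Fin m) (σ : Mem) : Prop :=
  σ.nreg 12 ≠ 0 → PairPlan G (bound G b₂) δ k b₁ b₂ e e' (σ.nreg 13) (σ.rreg 20) (σ.nreg 14)
    (σ.rreg 21) (σ.nreg 15) (σ.rreg 22) (σ.nreg 12 - 1)

/-- Register 12 holds one more than the number of chunks of the best plan so far. -/
def Covers (w : ℕ) (σ : Mem) : Prop := σ.nreg 12 ≠ 0 ∧ σ.nreg 12 ≤ w + 1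

/-- The plan in `τ` is not worse than the plan in `σ`. -/
structure Improves (G : TaskGraph n m) (b₁ b₂ : ℝ) (k : ℕ) (δ : Fin n → ℝ) (e e' : Fin m)
    (σ τ : Mem) : Prop where
  plan : HasPlan G b₁ b₂ k δ e e' σ → HasPlan G b₁ b₂ k δ e e' τ
  covers : ∀ w, Covers w σ → Covers w τ

theorem Improves.trans {e e' : Fin m} {σ τ ρ : Mem} (h : Improves G b₁ b₂ k δ e e' σ τ)
    (h' : Improves G b₁ b₂ k δ e e' τ ρ) : Improves G b₁ b₂ k δ e e' σ ρ :=
  ⟨fun hp => h'.plan (h.plan hp), fun w hw => h'.covers w (h.covers w hw)⟩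

theorem Improves.of_eq {e e' : Fin m} {σ τ : Mem} (h1 : τ.nreg 12 = σ.nreg 12)
    (h2 : τ.nreg 13 = σ.nreg 13) (h3 : τ.nreg 14 = σ.nreg 14) (h4 : τ.nreg 15 = σ.nreg 15)
    (h5 : τ.rreg 20 = σ.rreg 20) (h6 : τ.rreg 21 = σ.rreg 21) (h7 : τ.rreg 22 = σ.rreg 22) :
    Improves G b₁ b₂ k δ e e' σ τ := by
  refine ⟨fun h => ?_, fun w h => ?_⟩
  · rw [HasPlan, h1, h2, h3, h4, h5, h6, h7]; exact h
  · rw [Covers, h1]; exact h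

def Cmd.keepsPlan (c : Cmd) : Bool :=
  c.keepsN 12 && c.keepsN 13 && c.keepsN 14 && c.keepsN 15 && c.keepsR 20 && c.keepsR 21 &&
    c.keepsR 22

theorem Keep.improves {e e' : Fin m} {c : Cmd} {σ τ : Mem} (hk : Keep c σ τ)
    (hc : c.keepsPlan = true) : Improves G b₁ b₂ k δ e e' σ τ := by
  simp only [Cmd.keepsPlan, Bool.and_eq_true] at hc
  obtain ⟨⟨⟨⟨⟨⟨h1, h2⟩, h3⟩, h4⟩, h5⟩, h6⟩, h7⟩ := hc
  exact .of_eq (hk.n _ h1) (hk.n _ h2) (hk.n _ h3) (hk.n _ h4) (hk.r _ h5) (hk.r _ h6) (hk.r _ h7)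

/-- Replace the plan by that in the registers from 18, if it needs fewer chunks. -/
def offerCmd : Cmd :=
  when (.disj (.neq (nr 12) (nl 0)) (.nlt (nr 18) (nr 12)))
    (nset 12 (nr 18) ;; nset 13 (nr 19) ;; nset 14 (nr 20) ;; nset 15 (nr 21) ;; rset 20 (rr 23) ;;
      rset 21 (rr 24) ;; rset 22 (rr 25))

theorem offerCmd_runs {e e' : Fin m} {w : ℕ} {σ : Mem} (hw : σ.nreg 18 = w + 1)
    (h : PairPlan G (bound G b₂) δ k b₁ b₂ e e' (σ.nreg 19) (σ.rreg 23) (σ.nreg 20) (σ.rreg 24)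
      (σ.nreg 21) (σ.rreg 25) w) :
    Runs offerCmd σ 40 fun τ => Improves G b₁ b₂ k δ e e' σ τ ∧ Covers w τ := by
  refine Runs.le (Runs.when (t := 20) (fun hp => ?_) fun hp => ?_) (by decide)
  · simp only [BExp.eval_disj, BExp.eval_neq, BExp.eval_nlt, NExp.eval_reg, NExp.eval_lit] at hp
    refine .flat rfl (by decide) fun _ => ⟨⟨fun _ => ?_, fun w' hw' => ?_⟩, ?_⟩
    · simpa [HasPlan, hw] using h
    · simp only [Covers] at hw' ⊢
      simp only [run_seq, run_nset, run_rset, Mem.setN_nreg, Mem.setR_nreg, NExp.eval_reg]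
      simp only [Nat.reduceEqDiff, if_false, if_true]
      omega
    · simp [Covers, hw]
  · simp only [BExp.eval_disj, BExp.eval_neq, BExp.eval_nlt, NExp.eval_reg, NExp.eval_lit] at hp
    refine ⟨.of_eq ?_ ?_ ?_ ?_ ?_ ?_ ?_, ?_⟩
    any_goals simp
    simp only [Covers, Mem.setN_nreg, Nat.reduceEqDiff, if_false]
    omega

/-- Put the third candidate for the first pieces into the registers 23 and 24. -/
def midCmd : Cmd :=
  (partCmd 60 1 (nr 11) (rr 29) ;; partInvCmd 61 1 (nr 10) (rr 60) ;;
    partCmd 62 0 (nr 11) (rr 27) ;; partInvCmd 63 0 (nr 10) (rr 62) ;;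
    rmax 61 (.sub (.add (ra 0 (nr 10)) (ra 2 (na 1 (nr 10)))) (ra 12 (nr 11))) (rr 61) ;;
    rmax 61 (rr 28) (rr 61) ;; rmin 63 (rr 26) (rr 63) ;;
    rset 23 (.div (.add (rr 61) (rr 63)) (rl 2))) ;;
  (partCmd 60 0 (nr 10) (rr 23) ;; partInvCmd 61 0 (nr 11) (rr 60) ;;
    partCmd 62 1 (nr 10) (rr 23) ;; partInvCmd 63 1 (nr 11) (rr 62) ;;
    rmax 61 (rr 29) (rr 61) ;; rmin 63 (rr 27) (rr 63) ;;
    rset 24 (.div (.add (rr 61) (rr 63)) (rl 2)))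

theorem midCmd_runs {e e' : Fin m} {σ : Mem} (h : AtPair G b₁ b₂ k ord δ e e' σ) :
    Runs midCmd σ 400 fun τ =>
      τ.rreg 23 = G.midFirst (bound G b₂) δ b₁ b₂ e e' (σ.rreg 28) (σ.rreg 26) (σ.rreg 29) (σ.rreg 27) ∧
      τ.rreg 24 = G.midSecond (bound G b₂) δ b₁ b₂ e e' (σ.rreg 29) (σ.rreg 27) (τ.rreg 23) := by
  refine Runs.le (Runs.seq' (s := 200) (t := 200) (R := fun τ => τ.rreg 23 =
    G.midFirst (bound G b₂) δ b₁ b₂ e e' (σ.rreg 28) (σ.rreg 26) (σ.rreg 29) (σ.rreg 27)) ?_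
    fun τ hτ h1 => ?_) le_rfl
  · refine .flat rfl (by decide) fun _ => ?_
    have hr := h.solved.ready
    have s1 := hr.run_partCmd 60 1 (x := nr 11) (e := e') h.snd (rr 29)
    have r1 := hr.setR (r := 60) (by decide) (G.part (bound G b₂) δ (bias b₁ b₂ 1) e' (σ.rreg 29))
    have s2 := r1.run_partInvCmd 61 1 (x := nr 10) (e := e) h.fst (rr 60)
    have r2 := r1.setR (r := 61) (by decide) (G.partInv (bound G b₂) δ (bias b₁ b₂ 1) e
      (G.part (bound G b₂) δ (bias b₁ b₂ 1) e' (σ.rreg 29)))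
    have s3 := r2.run_partCmd 62 0 (x := nr 11) (e := e') h.snd (rr 27)
    have r3 := r2.setR (r := 62) (by decide) (G.part (bound G b₂) δ (bias b₁ b₂ 0) e' (σ.rreg 27))
    have s4 := r3.run_partInvCmd 63 0 (x := nr 10) (e := e) h.fst (rr 62)
    simp only [RExp.eval_reg, Mem.setR_rreg, Nat.reduceEqDiff, if_true, if_false] at s1 s2 s3 s4
    simp only [run_seq, s1, s2, s3, s4]
    simp [h.fst, h.snd, hr.inp.cost, hr.inp.head, hr.dist.dist, hr.altOne, midFirst]
  · refine .flat rfl (by decide) fun hK => ?_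
    have hp := h.keep hτ rfl
    have hr := hp.solved.ready
    have e29 : τ.rreg 29 = σ.rreg 29 := hτ.r 29 rfl
    have e27 : τ.rreg 27 = σ.rreg 27 := hτ.r 27 rfl
    have s1 := hr.run_partCmd 60 0 (x := nr 10) (e := e) hp.fst (rr 23)
    have r1 := hr.setR (r := 60) (by decide) (G.part (bound G b₂) δ (bias b₁ b₂ 0) e (τ.rreg 23))
    have s2 := r1.run_partInvCmd 61 0 (x := nr 11) (e := e') hp.snd (rr 60)
    have r2 := r1.setR (r := 61) (by decide) (G.partInv (bound G b₂) δ (bias b₁ b₂ 0) e'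
      (G.part (bound G b₂) δ (bias b₁ b₂ 0) e (τ.rreg 23)))
    have s3 := r2.run_partCmd 62 1 (x := nr 10) (e := e) hp.fst (rr 23)
    have r3 := r2.setR (r := 62) (by decide) (G.part (bound G b₂) δ (bias b₁ b₂ 1) e (τ.rreg 23))
    have s4 := r3.run_partInvCmd 63 1 (x := nr 11) (e := e') hp.snd (rr 62)
    simp only [RExp.eval_reg, Mem.setR_rreg, Nat.reduceEqDiff, if_true, if_false] at s1 s2 s3 s4
    rw [hK.r 23 rfl]
    refine ⟨h1, ?_⟩
    simp only [run_seq, s1, s2, s3, s4]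
    simp [e29, e27, midSecond]

/-- Offer the plan that divides both edges, starting with the pieces in the registers 23 and 24. -/
def testCmd : Cmd :=
  (partCmd 60 0 (nr 10) (rr 23) ;; partCmd 61 0 (nr 11) (rr 24) ;; partCmd 62 1 (nr 11) (rr 24) ;;
    partCmd 63 1 (nr 10) (rr 23)) ;;
  when (.conj (.conj (.conj (.rle (rr 28) (rr 23)) (.rle (rr 23) (rr 26)))
      (.conj (.rle (rr 29) (rr 24)) (.rle (rr 24) (rr 27))))
      (.conj (winsX 0 (nr 10) (nr 11) (rr 60) (rr 61)) (winsX 1 (nr 11) (nr 10) (rr 62) (rr 63))))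
    offerCmd

/-- The registers describe plans that divide the edges into `l` and `l'` pieces. -/
structure Staged (G : TaskGraph n m) (b₁ b₂ : ℝ) (δ : Fin n → ℝ) (e e' : Fin m) (l l' : ℕ)
    (σ : Mem) : Prop where
  code : σ.nreg 18 = l + l' + 1
  fst : σ.nreg 19 = l
  snd : σ.nreg 20 = l'
  third : σ.nreg 21 = 0
  hi : σ.rreg 26 = G.maxFirst (bound G b₂) δ b₁ b₁ e
  hi' : σ.rreg 27 = G.maxFirst (bound G b₂) δ b₂ b₂ e'
  lo : σ.rreg 28 = max 0 (G.cost e - G.reach (bound G b₂) δ b₁ b₁ e (l - 2))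
  lo' : σ.rreg 29 = max 0 (G.cost e' - G.reach (bound G b₂) δ b₂ b₂ e' (l' - 2))

def Cmd.keepsStaged (c : Cmd) : Bool :=
  c.keepsN 18 && c.keepsN 19 && c.keepsN 20 && c.keepsN 21 && c.keepsR 26 && c.keepsR 27 &&
    c.keepsR 28 && c.keepsR 29

theorem Staged.keep {e e' : Fin m} {l l' : ℕ} {c : Cmd} {σ τ : Mem}
    (h : Staged G b₁ b₂ δ e e' l l' σ) (hk : Keep c σ τ) (hc : c.keepsStaged = true) :
    Staged G b₁ b₂ δ e e' l l' τ := by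
  simp only [Cmd.keepsStaged, Bool.and_eq_true] at hc
  obtain ⟨⟨⟨⟨⟨⟨⟨h1, h2⟩, h3⟩, h4⟩, h5⟩, h6⟩, h7⟩, h8⟩ := hc
  exact ⟨by rw [hk.n _ h1, h.code], by rw [hk.n _ h2, h.fst], by rw [hk.n _ h3, h.snd],
    by rw [hk.n _ h4, h.third], by rw [hk.r _ h5, h.hi], by rw [hk.r _ h6, h.hi'],
    by rw [hk.r _ h7, h.lo], by rw [hk.r _ h8, h.lo']⟩

theorem testCmd_runs {e e' : Fin m} {l l' : ℕ} {σ : Mem} (h : AtPair G b₁ b₂ k ord δ e e' σ)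
    (hs : Staged G b₁ b₂ δ e e' l l' σ) (hl : 2 ≤ l ∧ l ≤ k) (hl' : 2 ≤ l' ∧ l' ≤ k)
    (h0 : 0 ≤ G.reach (bound G b₂) δ b₁ b₁ e 0) (h0' : 0 ≤ G.reach (bound G b₂) δ b₂ b₂ e' 0) :
    Runs testCmd σ 400 fun τ => Improves G b₁ b₂ k δ e e' σ τ ∧
      (BothSplit G (bound G b₂) δ k b₁ b₂ e e' l (σ.rreg 23) l' (σ.rreg 24) → Covers (l + l') τ) := by
  refine Runs.le (s := 200 + (150 + max 40 2 + 1)) (Runs.seq' (R := fun τ =>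
    τ.rreg 60 = G.part (bound G b₂) δ b₁ e (σ.rreg 23) ∧
    τ.rreg 61 = G.part (bound G b₂) δ b₁ e' (σ.rreg 24) ∧
    τ.rreg 62 = G.part (bound G b₂) δ b₂ e' (σ.rreg 24) ∧
    τ.rreg 63 = G.part (bound G b₂) δ b₂ e (σ.rreg 23)) ?_ fun τ hτ h1 => ?_) (by decide)
  · refine .flat rfl (by decide) fun _ => ?_
    have hr := h.solved.ready
    have s1 := hr.run_partCmd 60 0 (x := nr 10) (e := e) h.fst (rr 23)
    have r1 := hr.setR (r := 60) (by decide) (G.part (bound G b₂) δ (bias b₁ b₂ 0) e (σ.rreg 23))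
    have s2 := r1.run_partCmd 61 0 (x := nr 11) (e := e') h.snd (rr 24)
    have r2 := r1.setR (r := 61) (by decide) (G.part (bound G b₂) δ (bias b₁ b₂ 0) e' (σ.rreg 24))
    have s3 := r2.run_partCmd 62 1 (x := nr 11) (e := e') h.snd (rr 24)
    have r3 := r2.setR (r := 62) (by decide) (G.part (bound G b₂) δ (bias b₁ b₂ 1) e' (σ.rreg 24))
    have s4 := r3.run_partCmd 63 1 (x := nr 10) (e := e) h.fst (rr 23)
    simp only [RExp.eval_reg, Mem.setR_rreg, Nat.reduceEqDiff, if_false] at s1 s2 s3 s4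
    simp only [run_seq, s1, s2, s3, s4]
    simp
  · have hp := h.keep hτ rfl
    have hst := hs.keep hτ rfl
    have e23 : τ.rreg 23 = σ.rreg 23 := hτ.r 23 rfl
    have e24 : τ.rreg 24 = σ.rreg 24 := hτ.r 24 rfl
    obtain ⟨g0, g1, g2, g3⟩ := h1
    have w1 := hp.solved.ready.eval_winsX (a := 0) (x := nr 10) (y := nr 11) (e := e) (f := e')
      (by decide) hp.fst hp.snd (rr 60) (rr 61)
    have w2 := hp.solved.ready.eval_winsX (a := 1) (x := nr 11) (y := nr 10) (e := e') (f := e)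
      (by decide) hp.snd hp.fst (rr 62) (rr 63)
    have hI : Improves G b₁ b₂ k δ e e' σ τ := hτ.improves rfl
    have hiff : (BExp.conj (.conj (.conj (.rle (rr 28) (rr 23)) (.rle (rr 23) (rr 26)))
      (.conj (.rle (rr 29) (rr 24)) (.rle (rr 24) (rr 27))))
      (.conj (winsX 0 (nr 10) (nr 11) (rr 60) (rr 61)) (winsX 1 (nr 11) (nr 10) (rr 62) (rr 63)))).eval τ ↔
      BothSplit G (bound G b₂) δ k b₁ b₂ e e' l (σ.rreg 23) l' (σ.rreg 24) := by
      simp only [BExp.eval_conj, BExp.eval_rle, w1, w2, RExp.eval_reg, hst.hi, hst.hi', hst.lo, hst.lo',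
        e23, e24, g0, g1, g2, g3, bias_zero, bias_one, BothSplit, hl, hl', h0, h0', true_and, and_assoc]
    refine Runs.le (Runs.when (t := 40) (fun hq => ?_) fun hq => ?_) (by decide)
    · have hB := hiff.1 hq
      refine (offerCmd_runs (e := e) (e' := e') (w := l + l') hst.code ?_).imp fun ρ _ h2 =>
        ⟨hI.trans h2.1, fun _ => h2.2⟩
      rw [hst.fst, hst.snd, hst.third, e23, e24]
      exact Or.inr (Or.inl ⟨rfl, rfl, hB⟩)
    · refine ⟨hI.trans (.of_eq ?_ ?_ ?_ ?_ ?_ ?_ ?_), fun hB => absurd (hiff.2 hB) hq⟩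
      all_goals simp

/-- Offer the best plans that divide the edges into as many pieces as the registers 16 and 17 say,
increased by two. -/
def divideCmd : Cmd :=
  (nset 18 (.add (.add (nr 16) (nr 17)) (nl 5)) ;; nset 19 (.add (nr 16) (nl 2)) ;;
    nset 20 (.add (nr 17) (nl 2)) ;; nset 21 (nl 0) ;;
    rset 26 (ra 13 (nr 10)) ;; rset 27 (ra 14 (nr 11)) ;;
    rmax 28 (rl 0) (.sub (ra 0 (nr 10)) (rr 30)) ;; rmax 29 (rl 0) (.sub (ra 0 (nr 11)) (rr 40))) ;;
  (rset 23 (rr 28) ;; rset 24 (rr 27)) ;; testCmd ;; (rset 23 (rr 26) ;; rset 24 (rr 29)) ;; testCmd ;;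
  midCmd ;; testCmd

/-- By `BothSplit.candidate`, the tests of two corners and of the midpoint candidate decide whether
any first pieces are suitable for these numbers of pieces. -/
theorem divideCmd_runs {e e' : Fin m} {i i' : ℕ} {σ : Mem} (hb : 1 < b₁) (hbb : b₁ < b₂)
    (hne : e' ≠ e) (ht : G.tail e' = G.tail e) (h : AtPair G b₁ b₂ k ord δ e e' σ)
    (hi : σ.nreg 16 = i) (hi' : σ.nreg 17 = i') (hk : i + 2 ≤ k) (hk' : i' + 2 ≤ k)
    (hT : σ.rreg 30 = G.reach (bound G b₂) δ b₁ b₁ e i)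
    (hT' : σ.rreg 40 = G.reach (bound G b₂) δ b₂ b₂ e' i')
    (h0 : 0 ≤ G.reach (bound G b₂) δ b₁ b₁ e 0) (h0' : 0 ≤ G.reach (bound G b₂) δ b₂ b₂ e' 0) :
    Runs divideCmd σ 1700 fun τ => Improves G b₁ b₂ k δ e e' σ τ ∧
      ∀ x y, BothSplit G (bound G b₂) δ k b₁ b₂ e e' (i + 2) x (i' + 2) y →
        Covers (i + 2 + (i' + 2)) τ := by
  have hl : 2 ≤ i + 2 ∧ i + 2 ≤ k := ⟨by omega, hk⟩
  have hl' : 2 ≤ i' + 2 ∧ i' + 2 ≤ k := ⟨by omega, hk'⟩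
  refine Runs.le (s := 60 + (10 + (400 + (10 + (400 + (400 + 400)))))) ?_ (by decide)
  refine Runs.seq' (R := Staged G b₁ b₂ δ e e' (i + 2) (i' + 2)) ?_ fun τ hτ h1 => ?_
  · refine .flat rfl (by decide) fun _ => ?_
    have a1 := (h.solved.fst e).first
    have a2 := (h.solved.snd e').first
    simp only [Nat.add_zero, bias_zero, bias_one, Nat.reduceAdd] at a1 a2
    constructor <;> simp [hi, hi', h.fst, h.snd, a1, a2, hT, hT', h.solved.ready.inp.cost]
    omega
  have p1 := h.keep hτ rfl
  have I1 : Improves G b₁ b₂ k δ e e' σ τ := hτ.improves rfl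
  refine Runs.seq' (R := fun τ => τ.rreg 23 = τ.rreg 28 ∧ τ.rreg 24 = τ.rreg 27)
    (.flat rfl (by decide) fun _ => by simp) fun τ₂ hτ₂ q2 => ?_
  have p2 := p1.keep hτ₂ rfl
  have s2 := h1.keep hτ₂ rfl
  have I2 := I1.trans (hτ₂.improves rfl)
  refine Runs.seq' (testCmd_runs p2 s2 hl hl' h0 h0') fun τ₃ hτ₃ q3 => ?_
  have p3 := p2.keep hτ₃ rfl
  have s3 := s2.keep hτ₃ rfl
  have I3 := I2.trans q3.1
  refine Runs.seq' (R := fun τ => τ.rreg 23 = τ.rreg 26 ∧ τ.rreg 24 = τ.rreg 29)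
    (.flat rfl (by decide) fun _ => by simp) fun τ₄ hτ₄ q4 => ?_
  have p4 := p3.keep hτ₄ rfl
  have s4 := s3.keep hτ₄ rfl
  have I4 : Improves G b₁ b₂ k δ e e' τ₃ τ₄ := hτ₄.improves rfl
  refine Runs.seq' (testCmd_runs p4 s4 hl hl' h0 h0') fun τ₅ hτ₅ q5 => ?_
  have p5 := p4.keep hτ₅ rfl
  have s5 := s4.keep hτ₅ rfl
  refine Runs.seq' (midCmd_runs p5) fun τ₆ hτ₆ q6 => ?_
  have p6 := p5.keep hτ₆ rfl
  have s6 := s5.keep hτ₆ rfl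
  have I6 : Improves G b₁ b₂ k δ e e' τ₅ τ₆ := hτ₆.improves rfl
  refine (testCmd_runs p6 s6 hl hl' h0 h0').imp fun τ₇ _ q7 => ?_
  have I67 := I6.trans q7.1
  have I57 := I4.trans (q5.1.trans I67)
  refine ⟨I3.trans I57, fun x y hB => ?_⟩
  obtain ⟨q6, q6'⟩ := q6
  rw [s5.lo, s5.hi, s5.lo', s5.hi'] at q6
  rw [q6, s5.lo', s5.hi'] at q6'
  rw [q2.1, q2.2, s2.lo, s2.hi'] at q3
  rw [q4.1, q4.2, s4.hi, s4.lo'] at q5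
  rcases hB.candidate hb hbb hne ht rfl rfl rfl rfl with h2 | h2 | ⟨x, y, rfl, rfl, h2⟩
  · exact I57.covers _ (q3.2 h2)
  · exact I67.covers _ (q5.2 h2)
  · refine q7.2 ?_
    rw [q6', q6]
    exact h2

end PresentBias

namespace PresentBias

open TaskGraph Cmd

variable {n m : ℕ} {G : TaskGraph n m} {b₁ b₂ : ℝ} {k : ℕ} {ord : Fin n → ℕ} {δ : Fin n → ℝ}

theorem eval_biasX_setN (a r v : ℕ) (σ : Mem) : (biasX a).eval (σ.setN r v) = (biasX a).eval σ := by
  rcases a with _ | _ | _ <;> rfl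

theorem ThrAt.setN {r a a' : ℕ} {b Λ b' Λ' M d : ℝ} {j : ℕ} {σ : Mem}
    (h : ThrAt r (biasX a) (biasX a') b Λ b' Λ' M d j σ) (i v : ℕ) :
    ThrAt r (biasX a) (biasX a') b Λ b' Λ' M d j (σ.setN i v) :=
  ⟨h.val, h.limit, h.limit', h.leave, h.dist, (eval_biasX_setN _ _ _ _).trans h.bias,
    (eval_biasX_setN _ _ _ _).trans h.bias'⟩

theorem ThrAt.keep {r a a' : ℕ} {b Λ b' Λ' M d : ℝ} {j : ℕ} {σ τ : Mem} {c : Cmd}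
    (h : ThrAt r (biasX a) (biasX a') b Λ b' Λ' M d j σ) (hk : Keep c σ τ)
    (h0 : c.keepsR r = true) (h1 : c.keepsR (r + 1) = true) (h2 : c.keepsR (r + 2) = true)
    (h3 : c.keepsR (r + 3) = true) (h4 : c.keepsR (r + 4) = true) (k0 : c.keepsR 0 = true)
    (k1 : c.keepsR 1 = true) : ThrAt r (biasX a) (biasX a') b Λ b' Λ' M d j τ := by
  have hX : ∀ a, (biasX a).eval τ = (biasX a).eval σ := by
    intro a
    rcases a with _ | _ | _
    · exact hk.r 0 k0
    · exact hk.r 1 k1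
    · rfl
  exact ⟨by rw [hk.r _ h0, h.val], by rw [hk.r _ h1, h.limit], by rw [hk.r _ h2, h.limit'],
    by rw [hk.r _ h3, h.leave], by rw [hk.r _ h4, h.dist], by rw [hX, h.bias], by rw [hX, h.bias']⟩

theorem Improves.setN {e e' : Fin m} {σ τ : Mem} (h : Improves G b₁ b₂ k δ e e' σ τ) {r : ℕ}
    (hr : 16 ≤ r) (v : ℕ) : Improves G b₁ b₂ k δ e e' σ (τ.setN r v) := by
  refine h.trans (.of_eq ?_ ?_ ?_ ?_ rfl rfl rfl) <;> rw [Mem.setN_nreg, if_neg (by omega)]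

theorem Covers.setN {w : ℕ} {σ : Mem} (h : Covers w σ) {r : ℕ} (hr : 16 ≤ r) (v : ℕ) :
    Covers w (σ.setN r v) := by
  rw [Covers, Mem.setN_nreg, if_neg (by omega)]
  exact h

def loadThr (r a : ℕ) (x : NExp) : Cmd :=
  rset (r + 1) (ra (10 + a) x) ;; rset (r + 2) (ra (10 + a) x) ;; rset (r + 3) (ra 12 x) ;;
  rset (r + 4) (ra 2 (na 1 x)) ;; thrInit r (biasX a) (biasX a)

theorem Ready.run_loadThr {σ : Mem} (h : Ready G b₁ b₂ k ord δ σ) {r a : ℕ} (ha : a < 3) (hr : 2 ≤ r)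
    {x e : ℕ} {f : Fin m} (hx : σ.nreg x = f) (he : e = 0) : ThrAt r (biasX a) (biasX a) (bias b₁ b₂ a)
      (G.altMin (bound G b₂) δ (bias b₁ b₂ a) f) (bias b₁ b₂ a)
      (G.altMin (bound G b₂) δ (bias b₁ b₂ a) f) (G.altMin (bound G b₂) δ 1 f) (δ (G.head f)) e
      ((loadThr r a (nr x)).run σ) := by
  have hX : ∀ (w : ℝ) (r' : ℕ) (σ : Mem), 2 ≤ r' →
      (biasX a).eval (σ.setR r' w) = (biasX a).eval σ := by
    intro w r' σ hr'
    rcases a with _ | _ | _ <;> simp [biasX] <;> omega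
  subst he
  refine ThrAt.init hr ?_ ?_ ?_ ?_ ?_ ?_
  any_goals simp [hx, (h.alts a ha).min, h.altOne, h.inp.head, h.dist.dist]
  all_goals
    rw [hX _ _ _ (by omega), hX _ _ _ (by omega), hX _ _ _ (by omega), hX _ _ _ (by omega)]
    exact h.inp.eval_biasX a

/-- Offer the best plans that divide both edges. -/
def bothCmd : Cmd :=
  loadThr 30 0 (nr 10) ;; loadThr 40 1 (nr 11) ;;
  when (.conj (.rle (rl 0) (rr 30)) (.rle (rl 0) (rr 40)))
    (upTo 16 (.sub (nr 4) (nl 1)) (thrInit 40 (biasX 1) (biasX 1) ;;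
      upTo 17 (.sub (nr 4) (nl 1)) (divideCmd ;; thrStep 40 (biasX 1) (biasX 1)) ;;
      thrStep 30 (biasX 0) (biasX 0)))

/-- All pairs of numbers of pieces from 2 to `k` are tried, each in constant time, because the
values of `reach` for the two edges are updated along with the loops in registers 30 and 40.
Register 40 is reset at the start of every outer pass; for this the invariant only needs that its
parameters are still in place, at whatever index `j`. -/
theorem bothCmd_runs {e e' : Fin m} {σ : Mem} (hb : 1 < b₁) (hbb : b₁ < b₂)
    (hne : e' ≠ e) (ht : G.tail e' = G.tail e) (hp : AtPair G b₁ b₂ k ord δ e e' σ) :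
    Runs bothCmd σ (2000 * k * k + 500) fun τ => Improves G b₁ b₂ k δ e e' σ τ ∧
      ∀ l x l' y, BothSplit G (bound G b₂) δ k b₁ b₂ e e' l x l' y → Covers (l + l') τ := by
  have hk : 50 + (50 + (20 + max ((k - 1) * (50 + ((k - 1) * (1750 + 11) + 11 + 50) + 11) + 11) 2 + 1)) ≤
      2000 * k * k + 500 := by
    rw [max_eq_left (by omega)]
    rcases k with _ | q
    · simp
    · rw [Nat.add_sub_cancel]
      have h1 : q * (50 + (q * (1750 + 11) + 11 + 50) + 11) = 1761 * (q * q) + 122 * q := by ring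
      have h2 : 2000 * (q + 1) * (q + 1) = 2000 * (q * q) + 4000 * q + 2000 := by ring
      rw [h1, h2]
      omega
  refine Runs.le ?_ hk
  refine Runs.seq' (R := ThrAt 30 (biasX 0) (biasX 0) b₁ (G.altMin (bound G b₂) δ b₁ e) b₁
    (G.altMin (bound G b₂) δ b₁ e) (G.altMin (bound G b₂) δ 1 e) (δ (G.head e)) 0)
    (.flat rfl (by decide) fun _ => hp.solved.ready.run_loadThr (a := 0) (by decide) (by decide) hp.fst rfl)
    fun τ hτ h1 => ?_
  have p1 := hp.keep hτ rfl
  have I1 : Improves G b₁ b₂ k δ e e' σ τ := hτ.improves rfl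
  refine Runs.seq' (R := ThrAt 40 (biasX 1) (biasX 1) b₂ (G.altMin (bound G b₂) δ b₂ e') b₂
    (G.altMin (bound G b₂) δ b₂ e') (G.altMin (bound G b₂) δ 1 e') (δ (G.head e')) 0)
    (.flat rfl (by decide) fun _ => p1.solved.ready.run_loadThr (a := 1) (by decide) (by decide) p1.snd rfl)
    fun ρ hρ h2 => ?_
  have p2 := p1.keep hρ rfl
  have I2 := I1.trans (hρ.improves rfl)
  have h1' := h1.keep hρ rfl rfl rfl rfl rfl rfl rfl
  have hcond : (BExp.conj (.rle (rl 0) (rr 30)) (.rle (rl 0) (rr 40))).eval ρ ↔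
      0 ≤ G.reach (bound G b₂) δ b₁ b₁ e 0 ∧ 0 ≤ G.reach (bound G b₂) δ b₂ b₂ e' 0 := by
    simp only [BExp.eval_conj, BExp.eval_rle, RExp.eval_lit, RExp.eval_reg, Nat.cast_zero, h1'.val, h2.val,
      reach]
  refine Runs.le (Runs.when (t := (k - 1) * (50 + ((k - 1) * (1750 + 11) + 11 + 50) + 11) + 11)
    (fun hc => ?_) fun hc => ?_) (Nat.add_le_add_right (Nat.add_le_add_right (by decide) _) _)
  · obtain ⟨r0, r0'⟩ := hcond.1 hc
    refine Runs.upTo' (fun i μ => ThrAt 30 (biasX 0) (biasX 0) b₁ (G.altMin (bound G b₂) δ b₁ e) b₁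
        (G.altMin (bound G b₂) δ b₁ e) (G.altMin (bound G b₂) δ 1 e) (δ (G.head e)) i μ ∧
      Improves G b₁ b₂ k δ e e' σ μ ∧
      (∃ j, ThrAt 40 (biasX 1) (biasX 1) b₂ (G.altMin (bound G b₂) δ b₂ e') b₂
        (G.altMin (bound G b₂) δ b₂ e') (G.altMin (bound G b₂) δ 1 e') (δ (G.head e')) j μ) ∧
      ∀ l x l' y, BothSplit G (bound G b₂) δ k b₁ b₂ e e' l x l' y → l < i + 2 → Covers (l + l') μ)
      (N := k - 1) (t := 50 + ((k - 1) * (1750 + 11) + 11 + 50)) rfl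
      (fun μ hμ => by simp [(p2.keep hμ rfl).solved.ready.inp.regK])
      ⟨h1'.setN _ _, I2.setN (by decide) _, ⟨0, h2.setN _ _⟩, fun l x l' y hB hl => by
        have := hB.1.1; omega⟩ (fun i hi μ hμ hμi hJ => ?_)
      (by simp [NExp.size]) fun μ _ hJ => ⟨hJ.2.1, fun l x l' y hB => hJ.2.2.2 l x l' y hB (by
        have := hB.1; omega)⟩
    obtain ⟨J1, J2, ⟨j, J3⟩, J4⟩ := hJ
    have p3 := p2.keep hμ rfl
    refine Runs.le (Runs.seq' (s := 50) (R := ThrAt 40 (biasX 1) (biasX 1) b₂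
        (G.altMin (bound G b₂) δ b₂ e') b₂ (G.altMin (bound G b₂) δ b₂ e') (G.altMin (bound G b₂) δ 1 e')
        (δ (G.head e')) 0) (.flat rfl (by decide) fun _ => .init (by decide) J3.limit J3.limit'
          J3.leave J3.dist J3.bias J3.bias') fun ν hν h3 => ?_) le_rfl
    have p4 := p3.keep hν rfl
    have J1' := J1.keep hν rfl rfl rfl rfl rfl rfl rfl
    have I4 : Improves G b₁ b₂ k δ e e' μ ν := hν.improves rfl
    have hν16 : ν.nreg 16 = i := by rw [hν.n 16 rfl, hμi]
    refine Runs.seq' (R := fun ξ => (∃ j, ThrAt 40 (biasX 1) (biasX 1) b₂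
        (G.altMin (bound G b₂) δ b₂ e') b₂ (G.altMin (bound G b₂) δ b₂ e') (G.altMin (bound G b₂) δ 1 e')
        (δ (G.head e')) j ξ) ∧ Improves G b₁ b₂ k δ e e' ν ξ ∧ ∀ x l' y,
        BothSplit G (bound G b₂) δ k b₁ b₂ e e' (i + 2) x l' y → Covers (i + 2 + l') ξ) ?_
        fun ξ hξ h5 => ?_
    · refine Runs.upTo' (fun i' ξ => ThrAt 40 (biasX 1) (biasX 1) b₂
        (G.altMin (bound G b₂) δ b₂ e') b₂ (G.altMin (bound G b₂) δ b₂ e') (G.altMin (bound G b₂) δ 1 e')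
        (δ (G.head e')) i' ξ ∧ Improves G b₁ b₂ k δ e e' ν ξ ∧ ∀ x l' y,
        BothSplit G (bound G b₂) δ k b₁ b₂ e e' (i + 2) x l' y → l' < i' + 2 → Covers (i + 2 + l') ξ)
        (N := k - 1) (t := 1750) rfl (fun μ hμ => by simp [(p4.keep hμ rfl).solved.ready.inp.regK])
        ⟨h3.setN _ _, .of_eq (by simp) (by simp) (by simp) (by simp) rfl rfl rfl,
          fun x l' y hB hl => by have := hB.2.1.1; omega⟩ (fun i' hi' ξ hξ hξi hJ => ?_)
        (by simp [NExp.size]) fun ξ _ hJ => ⟨⟨_, hJ.1⟩, hJ.2.1, fun x l' y hB => hJ.2.2 x l' y hB (by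
          have := hB.2.1; omega)⟩
      obtain ⟨K1, K2, K3⟩ := hJ
      have p5 := p4.keep hξ rfl
      have K0 := J1'.keep hξ rfl rfl rfl rfl rfl rfl rfl
      refine Runs.le (Runs.seq' (s := 1700) (t := 50) (divideCmd_runs hb hbb hne ht p5 (i := i) (i' := i')
        (by rw [hξ.n 16 rfl, hν16]) hξi (by omega) (by omega) K0.val K1.val r0 r0') fun η hη h6 => ?_) le_rfl
      have K1' := K1.keep hη rfl rfl rfl rfl rfl rfl rfl
      refine .flat rfl (by decide) fun hK => ⟨(K1'.step (by decide)).setN _ _, ?_, fun x l' y hB hl => ?_⟩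
      · exact ((K2.trans h6.1).trans (hK.improves rfl)).setN (by decide) _
      · refine Covers.setN ((hK.improves (G := G) (b₁ := b₁) (b₂ := b₂) (k := k) (δ := δ) (e := e) (e' := e')
          rfl).covers _ ?_) (by decide) _
        by_cases hl' : l' = i' + 2
        · subst hl'
          exact h6.2 x y hB
        · exact h6.1.covers _ (K3 x l' y hB (by omega))
    · have J1'' := J1'.keep hξ rfl rfl rfl rfl rfl rfl rfl
      obtain ⟨⟨j', h5⟩, h6, h7⟩ := h5
      refine .flat rfl (by decide) fun hK => ?_
      have I5 : Improves G b₁ b₂ k δ e e' ξ _ := hK.improves rfl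
      refine ⟨(J1''.step (by decide)).setN _ _, ((J2.trans I4).trans (h6.trans I5)).setN (by decide) _,
        ⟨j', (h5.keep hK rfl rfl rfl rfl rfl rfl rfl).setN _ _⟩, fun l x l' y hB hl => ?_⟩
      refine Covers.setN (I5.covers _ ?_) (by decide) _
      by_cases hl' : l = i + 2
      · subst hl'
        exact h7 x l' y hB
      · exact (I4.trans h6).covers _ (J4 l x l' y hB (by omega))
  · refine ⟨I2.setN (by decide) _, fun l x l' y hB => absurd (hcond.2 ⟨hB.2.2.1, hB.2.2.2.1⟩) hc⟩

/-- Offer the plans that divide at most one of the edges. -/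
def fewCmd : Cmd :=
  when (.conj (.nle (nl 1) (na 23 (nr 10))) (.nle (nl 1) (na 24 (nr 11))))
    ((nset 18 (nl 1) ;; nset 19 (nl 1) ;; nset 20 (nl 1) ;; nset 21 (nl 0)) ;; offerCmd) ;;
  when (.conj (.nle (nl 1) (na 23 (nr 10))) (.nle (nl 1) (na 32 (nr 11))))
    ((nset 18 (na 32 (nr 11)) ;; nset 19 (nl 1) ;; nset 20 (na 27 (nr 11)) ;; nset 21 (na 34 (nr 11)) ;;
      rset 24 (ra 14 (nr 11)) ;; rset 25 (ra 16 (nr 11))) ;; offerCmd) ;;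
  when (.conj (.nle (nl 1) (na 24 (nr 11))) (.nle (nl 1) (na 33 (nr 10))))
    ((nset 18 (na 33 (nr 10)) ;; nset 20 (nl 1) ;; nset 19 (na 26 (nr 10)) ;; nset 21 (na 35 (nr 10)) ;;
      rset 23 (ra 13 (nr 10)) ;; rset 25 (ra 17 (nr 10))) ;; offerCmd)

theorem fewCmd_runs {e e' : Fin m} {σ : Mem} (hne : e' ≠ e) (ht : G.tail e' = G.tail e)
    (hp : AtPair G b₁ b₂ k ord δ e e' σ) :
    Runs fewCmd σ 400 fun τ => Improves G b₁ b₂ k δ e e' σ τ ∧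
      (Natural G (bound G b₂) δ b₁ e → Natural G (bound G b₂) δ b₂ e' → Covers 0 τ) ∧
      (∀ l f z w, OneSplit G (bound G b₂) δ k b₁ b₂ e e' l f z w → Covers w τ) ∧
      ∀ l f z w, OneSplit G (bound G b₂) δ k b₂ b₁ e' e l f z w → Covers w τ := by
  have step : ∀ {σ τ : Mem} {w : ℕ} {c : Cmd}, Keep c σ τ → c.keepsPlan = true →
      Improves G b₁ b₂ k δ e e' σ (τ) := fun hk hc => hk.improves hc
  have skip : ∀ {σ : Mem}, Improves G b₁ b₂ k δ e e' σ (σ.setN 999 0) := by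
    intro σ; refine .of_eq ?_ ?_ ?_ ?_ rfl rfl rfl <;> simp
  refine Runs.le (s := 120 + (120 + 120)) (Runs.seq' (R := fun τ => Improves G b₁ b₂ k δ e e' σ τ ∧
      (Natural G (bound G b₂) δ b₁ e → Natural G (bound G b₂) δ b₂ e' → Covers 0 τ)) ?_
      fun τ hτ h1 => ?_) (by decide)
  · have n1 := (hp.solved.ready.alts 0 (by decide)).natural e
    have n2 := (hp.solved.ready.alts 1 (by decide)).natural e'
    refine Runs.le (Runs.when (t := 30 + 40) (fun hc => ?_) fun hc => ?_) (by decide)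
    all_goals simp only [BExp.eval_conj, BExp.eval_nle, NExp.eval_lit, NExp.eval_get, NExp.eval_reg,
      hp.fst, hp.snd, Nat.one_le_iff_ne_zero] at hc
    · refine Runs.seq' (R := fun ρ => ρ.nreg 18 = 0 + 1 ∧ ρ.nreg 19 = 1 ∧ ρ.nreg 20 = 1 ∧ ρ.nreg 21 = 0)
        (.flat rfl (by decide) fun _ => by simp) fun ρ hρ h2 => ?_
      refine (offerCmd_runs (e := e) (e' := e') (w := 0) h2.1 ?_).imp fun ν _ h3 =>
        ⟨(hρ.improves rfl).trans h3.1, fun _ _ => h3.2⟩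
      exact Or.inl ⟨h2.2.1, h2.2.2.1, h2.2.2.2, rfl, n1.1 hc.1, n2.1 hc.2⟩
    · exact ⟨skip, fun h1 h2 => absurd ⟨n1.2 h1, n2.2 h2⟩ hc⟩
  obtain ⟨I1, C1⟩ := h1
  have p1 := hp.keep hτ rfl
  refine Runs.seq' (R := fun ρ => Improves G b₁ b₂ k δ e e' τ ρ ∧
      ∀ l f z w, OneSplit G (bound G b₂) δ k b₁ b₂ e e' l f z w → Covers w ρ) ?_ fun ρ hρ h2 => ?_
  · have n1 := (p1.solved.ready.alts 0 (by decide)).natural e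
    have n2 := p1.one e'
    refine Runs.le (Runs.when (t := 50 + 40) (fun hc => ?_) fun hc => ?_) (by decide)
    all_goals simp only [BExp.eval_conj, BExp.eval_nle, NExp.eval_lit, NExp.eval_get, NExp.eval_reg,
      p1.fst, p1.snd, Nat.one_le_iff_ne_zero] at hc
    · have hpl := n2.plan e hne ht (n1.1 hc.1) hc.2
      refine Runs.seq' (R := fun ρ => ρ.nreg 18 = τ.narr 32 e' ∧ ρ.nreg 19 = 1 ∧ ρ.nreg 20 = τ.narr 27 e' ∧
        ρ.nreg 21 = τ.narr 34 e' ∧ ρ.rreg 24 = τ.rarr 14 e' ∧ ρ.rreg 25 = τ.rarr 16 e')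
        (.flat rfl (by decide) fun _ => by simp [p1.snd]) fun ρ hρ h2 => ?_
      obtain ⟨g1, g2, g3, g4, g5, g6⟩ := h2
      refine (offerCmd_runs (e := e) (e' := e') (w := τ.narr 32 e' - 1) (by rw [g1]; omega) ?_).imp
        fun ν _ h3 => ⟨(hρ.improves rfl).trans h3.1, fun l f z w hO => ?_⟩
      · refine Or.inr (Or.inr (Or.inl ⟨g2, ?_, ?_⟩))
        · rw [g5]; exact (p1.solved.snd e').first
        · rw [g3, g4, g6]; exact hpl
      · have h4 : τ.narr 32 e' ≠ 0 ∧ τ.narr 32 e' ≤ w + 1 := n2.least e l f z w hne ht hO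
        have h5 := h3.2
        simp only [Covers] at h5 ⊢
        omega
    · exact ⟨skip, fun l f z w hO => absurd ⟨n1.2 hO.1, (n2.least e l f z w hne ht hO).1⟩ hc⟩
  obtain ⟨I2, C2⟩ := h2
  have p2 := p1.keep hρ rfl
  have fin : Runs (when (.conj (.nle (nl 1) (na 24 (nr 11))) (.nle (nl 1) (na 33 (nr 10))))
    ((nset 18 (na 33 (nr 10)) ;; nset 20 (nl 1) ;; nset 19 (na 26 (nr 10)) ;; nset 21 (na 35 (nr 10)) ;;
      rset 23 (ra 13 (nr 10)) ;; rset 25 (ra 17 (nr 10))) ;; offerCmd)) ρ 120 fun ν =>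
      Improves G b₁ b₂ k δ e e' ρ ν ∧
      ∀ l f z w, OneSplit G (bound G b₂) δ k b₂ b₁ e' e l f z w → Covers w ν := by
    have n1 := (p2.solved.ready.alts 1 (by decide)).natural e'
    have n2 := p2.one' e
    refine Runs.le (Runs.when (t := 50 + 40) (fun hc => ?_) fun hc => ?_) (by decide)
    all_goals simp only [BExp.eval_conj, BExp.eval_nle, NExp.eval_lit, NExp.eval_get, NExp.eval_reg,
      p2.fst, p2.snd, Nat.one_le_iff_ne_zero] at hc
    · have hpl := n2.plan e' hne.symm ht.symm (n1.1 hc.1) hc.2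
      refine Runs.seq' (R := fun ξ => ξ.nreg 18 = ρ.narr 33 e ∧ ξ.nreg 20 = 1 ∧ ξ.nreg 19 = ρ.narr 26 e ∧
        ξ.nreg 21 = ρ.narr 35 e ∧ ξ.rreg 23 = ρ.rarr 13 e ∧ ξ.rreg 25 = ρ.rarr 17 e)
        (.flat rfl (by decide) fun _ => by simp [p2.fst]) fun ξ hξ h2 => ?_
      obtain ⟨g1, g2, g3, g4, g5, g6⟩ := h2
      refine (offerCmd_runs (e := e) (e' := e') (w := ρ.narr 33 e - 1) (by rw [g1]; omega) ?_).imp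
        fun ν _ h3 => ⟨(hξ.improves rfl).trans h3.1, fun l f z w hO => ?_⟩
      · refine Or.inr (Or.inr (Or.inr ⟨g2, ?_, ?_⟩))
        · rw [g5]; exact (p2.solved.fst e).first
        · rw [g3, g4, g6]; exact hpl
      · have h4 : ρ.narr 33 e ≠ 0 ∧ ρ.narr 33 e ≤ w + 1 := n2.least e' l f z w hne.symm ht.symm hO
        have h5 := h3.2
        simp only [Covers] at h5 ⊢
        omega
    · exact ⟨skip, fun l f z w hO =>
        absurd ⟨n1.2 hO.1, (n2.least e' l f z w hne.symm ht.symm hO).1⟩ hc⟩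
  refine fin.imp fun ν _ h3 => ⟨I1.trans (I2.trans h3.1), fun h4 h5 => ?_, fun l f z w hO => ?_, h3.2⟩
  · exact (I2.trans h3.1).covers _ (C1 h4 h5)
  · exact h3.1.covers _ (C2 l f z w hO)

/-- Find a plan with as few chunks as possible for two edges with the same tail. -/
def pairCmd : Cmd := nset 12 (nl 0) ;; fewCmd ;; bothCmd

theorem pairCmd_runs {e e' : Fin m} {σ : Mem} (hb : 1 < b₁) (hbb : b₁ < b₂)
    (hne : e' ≠ e) (ht : G.tail e' = G.tail e) (hp : AtPair G b₁ b₂ k ord δ e e' σ) :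
    Runs pairCmd σ (2000 * k * k + 902) fun τ => HasPlan G b₁ b₂ k δ e e' τ ∧
      ∀ w, τ.nreg 12 = w + 1 ↔ IsLeast (G.pairSet (bound G b₂) δ k b₁ b₂ e e') w := by
  refine Runs.le (s := 2 + (400 + (2000 * k * k + 500))) ?_ (by omega)
  refine Runs.seq' (R := fun τ => τ.nreg 12 = 0) (.flat rfl (by decide) fun _ => by simp) fun τ hτ h0 => ?_
  have p0 := hp.keep hτ rfl
  refine Runs.seq' (fewCmd_runs hne ht p0) fun ρ hρ h1 => ?_
  obtain ⟨I1, C1, C2, C3⟩ := h1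
  refine (bothCmd_runs hb hbb hne ht (p0.keep hρ rfl)).imp fun ν _ h2 => ?_
  obtain ⟨I2, C4⟩ := h2
  have hP : HasPlan G b₁ b₂ k δ e e' ν := (I1.trans I2).plan fun h => absurd h0 h
  have hC : ∀ l x l' y f z w, PairPlan G (bound G b₂) δ k b₁ b₂ e e' l x l' y f z w → Covers w ν := by
    rintro l x l' y f z w (⟨-, -, -, rfl, h3, h4⟩ | ⟨-, rfl, h3⟩ | ⟨-, -, h3⟩ | ⟨-, -, h3⟩)
    · exact I2.covers _ (C1 h3 h4)
    · exact C4 _ _ _ _ h3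
    · exact I2.covers _ (C2 _ _ _ _ h3)
    · exact I2.covers _ (C3 _ _ _ _ h3)
  refine ⟨hP, fun w => ?_⟩
  have hleast : ν.nreg 12 ≠ 0 → IsLeast (G.pairSet (bound G b₂) δ k b₁ b₂ e e') (ν.nreg 12 - 1) := by
    refine fun h => ⟨Or.inr ⟨hne, _, _, _, _, _, _, hP h⟩, ?_⟩
    rintro w (⟨h3, -⟩ | ⟨-, l, x, l', y, f, z, h3⟩)
    · exact absurd h3 hne
    · have := (hC _ _ _ _ _ _ _ h3).2
      omega
  constructor
  · intro hw
    have := hleast (by omega)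
    rwa [hw] at this
  · intro hw
    have h4 : ν.nreg 12 ≠ 0 := by
      obtain ⟨⟨h3, -⟩ | ⟨-, l, x, l', y, f, z, h3⟩, -⟩ := hw
      · exact absurd h3 hne
      · exact (hC _ _ _ _ _ _ _ h3).1
    have := (hleast h4).unique hw
    omega

end PresentBias

namespace PresentBias

open TaskGraph Cmd

variable {n m : ℕ} {G : TaskGraph n m} {b₁ b₂ : ℝ} {k : ℕ} {ord : Fin n → ℕ} {δ : Fin n → ℝ}

/-! ### The table of the dynamic program -/

/-- The position of the entry for the vertices with numbers `a` and `b` and for `j` chunks. -/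
def idx (m k a b j : ℕ) : ℕ := a * ((m + 2) * (k + 1)) + b * (k + 1) + j

theorem idx_inj {a b j a' b' j' : ℕ} (hb : b < m + 2) (hj : j < k + 1) (hb' : b' < m + 2)
    (hj' : j' < k + 1) (h : idx m k a b j = idx m k a' b' j') : a = a' ∧ b = b' ∧ j = j' := by
  have key : ∀ {K q q' r r' : ℕ}, r < K → r' < K → q * K + r = q' * K + r' → q = q' ∧ r = r' := by
    intro K q q' r r' hr hr' h
    have h1 := congrArg (· / K) h
    have h2 := congrArg (· % K) h
    simp only [mul_comm _ K, Nat.mul_add_div (show 0 < K by omega), Nat.div_eq_of_lt hr,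
      Nat.div_eq_of_lt hr', add_zero, Nat.mul_add_mod, Nat.mod_eq_of_lt hr,
      Nat.mod_eq_of_lt hr'] at h1 h2
    exact ⟨h1, h2⟩
  have hE : ∀ a b j, idx m k a b j = (a * (m + 2) + b) * (k + 1) + j := by
    intro a b j; simp only [idx]; ring
  rw [hE, hE] at h
  obtain ⟨h1, h2⟩ := key hj hj' h
  obtain ⟨h3, h4⟩ := key hb hb' h1
  exact ⟨h3, h4, h2⟩

/-- The flags make initialization unnecessary: memory outside the input is zero, so an entry is
absent until it is written. -/
def tF (m k : ℕ) (σ : Mem) (a b j : ℕ) : Prop := σ.narr 18 (idx m k a b j) ≠ 0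
def tV (m k : ℕ) (σ : Mem) (a b j : ℕ) : ℝ := σ.rarr 7 (idx m k a b j)
def tP (m k : ℕ) (σ : Mem) (a b j : ℕ) : ℕ := σ.narr 16 (idx m k a b j)
def tQ (m k : ℕ) (σ : Mem) (a b j : ℕ) : ℕ := σ.narr 17 (idx m k a b j)

/-- The agents with vertices `a` and `b` can proceed to `a'` and `b'` by one edge, or both by one
edge if `a = b`, for `w` chunks and cost `c`. The edges are `p - 1` and `q - 1`. -/
inductive Rule (G : TaskGraph n m) (b₁ b₂ : ℝ) (k : ℕ) (ord : Fin n → ℕ) (δ : Fin n → ℝ) :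
    Fin m → ℕ → ℕ → ℕ → ℕ → ℕ → ℝ → ℕ → ℕ → Prop
  | left (e : Fin m) (b w : ℕ) (hb : b < ord (G.tail e))
      (h : IsLeast (G.soloSet (bound G b₂) δ k b₁ b₁ e) w) :
      Rule G b₁ b₂ k ord δ e (ord (G.tail e)) b (ord (G.head e)) b w (G.cost e) (e + 1) 0
  | right (e : Fin m) (b w : ℕ) (hb : b < ord (G.tail e))
      (h : IsLeast (G.soloSet (bound G b₂) δ k b₂ b₂ e) w) :
      Rule G b₁ b₂ k ord δ e b (ord (G.tail e)) b (ord (G.head e)) w (G.cost e) 0 (e + 1)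
  | both (e e' : Fin m) (w : ℕ) (ht : G.tail e' = G.tail e)
      (h : IsLeast (G.pairSet (bound G b₂) δ k b₁ b₂ e e') w) :
      Rule G b₁ b₂ k ord δ e (ord (G.tail e)) (ord (G.tail e)) (ord (G.head e)) (ord (G.head e')) w
        (G.cost e + G.cost e') (e + 1) (e' + 1)

/-- The larger of the two numbers belongs to the vertex that is left, and it drops strictly. So the
table can be filled by increasing maximum, each edge being used exactly at the level of its tail. -/
theorem Rule.level (D : Layout G b₂ (bound G b₂) ord δ) {e : Fin m} {a b a' b' w p q : ℕ} {c : ℝ}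
    (h : Rule G b₁ b₂ k ord δ e a b a' b' w c p q) :
    max a b = ord (G.tail e) ∧ max a' b' < max a b := by
  have h1 := D.ord_lt e
  cases h with
  | left _ _ _ hb => omega
  | right _ _ _ hb => omega
  | both e' _ ht =>
    have h2 := D.ord_lt e'
    rw [ht] at h2
    omega

/-- Every entry of the table is justified by entries for vertices with smaller numbers. -/
def Sound (G : TaskGraph n m) (b₁ b₂ : ℝ) (k : ℕ) (ord : Fin n → ℕ) (δ : Fin n → ℝ) (s : ℕ) (σ : Mem) :
    Prop :=
  ∀ a b j, a < m + 2 → b < m + 2 → j < k + 1 → tF m k σ a b j →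
    (a = ord G.sink ∧ b = ord G.sink ∧ tV m k σ a b j = 0 ∧ tP m k σ a b j = 0 ∧ tQ m k σ a b j = 0) ∨
    (max a b ≤ s ∧ ∃ e a' b' w c, Rule G b₁ b₂ k ord δ e a b a' b' w c (tP m k σ a b j) (tQ m k σ a b j) ∧
      w ≤ j ∧ tF m k σ a' b' (j - w) ∧ tV m k σ a b j = c + tV m k σ a' b' (j - w))

/-- The entries of `τ` are at least as good as in `σ`, and the same for numbers below `s`. -/
structure Progress (m k s : ℕ) (σ τ : Mem) : Prop where
  low : ∀ a b j, a < m + 2 → b < m + 2 → j < k + 1 → max a b < s →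
    (tF m k τ a b j ↔ tF m k σ a b j) ∧ tV m k τ a b j = tV m k σ a b j
  grow : ∀ a b j, a < m + 2 → b < m + 2 → j < k + 1 → tF m k σ a b j →
    tF m k τ a b j ∧ tV m k τ a b j ≤ tV m k σ a b j

theorem Progress.trans {s : ℕ} {σ τ ρ : Mem} (h : Progress m k s σ τ) (h' : Progress m k s τ ρ) :
    Progress m k s σ ρ := by
  refine ⟨fun a b j ha hb hj hs => ?_, fun a b j ha hb hj hF => ?_⟩
  · have h1 := h.low a b j ha hb hj hs
    have h2 := h'.low a b j ha hb hj hs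
    exact ⟨h2.1.trans h1.1, h2.2.trans h1.2⟩
  · have h1 := h.grow a b j ha hb hj hF
    have h2 := h'.grow a b j ha hb hj h1.1
    exact ⟨h2.1, h2.2.trans h1.2⟩

/-- The table accounts for a way to proceed, up to `j` chunks. -/
def Closed (m k : ℕ) (a b a' b' w : ℕ) (c : ℝ) (i : ℕ) (σ : Mem) : Prop :=
  ∀ j < i, w ≤ j → tF m k σ a' b' (j - w) →
    tF m k σ a b j ∧ tV m k σ a b j ≤ c + tV m k σ a' b' (j - w)

/-- The entries after the move are of lower level and no longer change, and the entry before it can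
only improve. -/
theorem Closed.progress {a b a' b' w i s : ℕ} {c : ℝ} {σ τ : Mem} (h : Closed m k a b a' b' w c i σ)
    (hP : Progress m k s σ τ) (ha : a < m + 2) (hb : b < m + 2) (hi : i ≤ k + 1) (ha' : a' < m + 2)
    (hb' : b' < m + 2) (hs : max a' b' < s) : Closed m k a b a' b' w c i τ := by
  intro j hj hw hF
  have h1 := hP.low a' b' (j - w) ha' hb' (by omega) hs
  have h2 := h j hj hw (h1.1.1 hF)
  have h3 := hP.grow a b j ha hb (by omega) h2.1
  rw [h1.2]
  exact ⟨h3.1, h3.2.trans h2.2⟩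

/-- The table arrays have the same contents. -/
structure SameTable (σ τ : Mem) : Prop where
  f : τ.narr 18 = σ.narr 18
  v : τ.rarr 7 = σ.rarr 7
  p : τ.narr 16 = σ.narr 16
  q : τ.narr 17 = σ.narr 17

def Cmd.keepsTable (c : Cmd) : Bool := c.keepsNA 18 && c.keepsRA 7 && c.keepsNA 16 && c.keepsNA 17

theorem Keep.sameTable {c : Cmd} {σ τ : Mem} (hk : Keep c σ τ) (hc : c.keepsTable = true) :
    SameTable σ τ := by
  simp only [Cmd.keepsTable, Bool.and_eq_true] at hc
  exact ⟨hk.na _ hc.1.1.1, hk.ra _ hc.1.1.2, hk.na _ hc.1.2, hk.na _ hc.2⟩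

namespace SameTable

variable {σ τ : Mem} (h : SameTable σ τ)
include h

theorem trans {ρ : Mem} (h' : SameTable τ ρ) : SameTable σ ρ :=
  ⟨h'.f.trans h.f, h'.v.trans h.v, h'.p.trans h.p, h'.q.trans h.q⟩

theorem sound {s : ℕ} (hS : Sound G b₁ b₂ k ord δ s σ) : Sound G b₁ b₂ k ord δ s τ := by
  simp only [Sound, tF, tV, tP, tQ, h.f, h.v, h.p, h.q]
  exact hS

theorem progress (s : ℕ) : Progress m k s σ τ := by
  constructor <;> simp +contextual [tF, tV, h.f, h.v]

theorem closed {a b a' b' w i : ℕ} {c : ℝ} (hC : Closed m k a b a' b' w c i σ) :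
    Closed m k a b a' b' w c i τ := by
  simp only [Closed, tF, tV, h.f, h.v]
  exact hC

end SameTable

/-- Only the given entry of the table changes. -/
structure Writes (m k a b j : ℕ) (v : ℝ) (p q : ℕ) (σ τ : Mem) : Prop where
  other : ∀ a' b' j', b' < m + 2 → j' < k + 1 → (a' ≠ a ∨ b' ≠ b ∨ j' ≠ j) →
    (tF m k τ a' b' j' ↔ tF m k σ a' b' j') ∧ tV m k τ a' b' j' = tV m k σ a' b' j' ∧
      tP m k τ a' b' j' = tP m k σ a' b' j' ∧ tQ m k τ a' b' j' = tQ m k σ a' b' j'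
  f : tF m k τ a b j
  v : tV m k τ a b j = v
  p : tP m k τ a b j = p
  q : tQ m k τ a b j = q

/-- Every entry is justified by one of strictly lower level, whereas the entry that is written has
the current, largest level. So no existing justification refers to it. -/
theorem Writes.sound (D : Layout G b₂ (bound G b₂) ord δ) (hord : ∀ v, ord v ≤ m + 1)
    {e : Fin m} {a b a' b' w p q j s : ℕ} {c : ℝ} {σ τ : Mem}
    (hR : Rule G b₁ b₂ k ord δ e a b a' b' w c p q) (ha : a < m + 2) (hb : b < m + 2)
    (hj : j < k + 1) (hs : max a b ≤ s) (hw : w ≤ j) (hF : tF m k σ a' b' (j - w))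
    (hW : Writes m k a b j (c + tV m k σ a' b' (j - w)) p q σ τ)
    (hs' : s ≤ max a b) (hS : Sound G b₁ b₂ k ord δ s σ) : Sound G b₁ b₂ k ord δ s τ := by
  have hb'' : ∀ {e : Fin m} {a b a' b' w p q : ℕ} {c : ℝ}, Rule G b₁ b₂ k ord δ e a b a' b' w c p q →
      b < m + 2 → b' < m + 2 := by
    intro e a b a' b' w p q c h hb
    cases h with
    | left => exact hb
    | right => exact Nat.lt_succ_of_le (hord _)
    | both => exact Nat.lt_succ_of_le (hord _)
  have hne : ∀ {e : Fin m} {a₂ b₂' a' b' w p q : ℕ} {c : ℝ},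
      Rule G b₁ b₂ k ord δ e a₂ b₂' a' b' w c p q → max a₂ b₂' ≤ s → a' ≠ a ∨ b' ≠ b := by
    intro e a₂ b₂' a' b' w p q c h hl
    have := (h.level D).2
    by_contra hno
    push Not at hno
    rw [hno.1, hno.2] at this
    omega
  intro a₂ b₂' j₂ ha₂ hb₂ hj₂ hF₂
  by_cases hx : a₂ = a ∧ b₂' = b ∧ j₂ = j
  · obtain ⟨rfl, rfl, rfl⟩ := hx
    have h1 := hW.other a' b' (j₂ - w) (hb'' hR hb) (by omega) ((hne hR hs).imp_right Or.inl)
    refine Or.inr ⟨hs, e, a', b', w, c, ?_, hw, h1.1.2 hF, by rw [hW.v, h1.2.1]⟩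
    rw [hW.p, hW.q]
    exact hR
  · have hx' : a₂ ≠ a ∨ b₂' ≠ b ∨ j₂ ≠ j := by tauto
    obtain ⟨g1, g2, g3, g4⟩ := hW.other a₂ b₂' j₂ hb₂ hj₂ hx'
    rw [g2, g3, g4]
    rcases hS a₂ b₂' j₂ ha₂ hb₂ hj₂ (g1.1 hF₂) with h1 | ⟨h1, e₂, a'', b'', w₂, c₂, h2, h3, h4, h5⟩
    · exact Or.inl h1
    · have h6 := hW.other a'' b'' (j₂ - w₂) (hb'' h2 hb₂) (by omega) ((hne h2 h1).imp_right Or.inl)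
      exact Or.inr ⟨h1, e₂, a'', b'', w₂, c₂, h2, h3, h6.1.2 h4, by rw [h5, h6.2.1]⟩

theorem Writes.progress {a b j p q : ℕ} {v : ℝ} {σ τ : Mem} (hW : Writes m k a b j v p q σ τ)
    (h : tF m k σ a b j → v ≤ tV m k σ a b j) : Progress m k (max a b) σ τ := by
  refine ⟨fun a₂ b₂ j₂ ha₂ hb₂ hj₂ hl => ?_, fun a₂ b₂ j₂ ha₂ hb₂ hj₂ hF => ?_⟩
  · have h1 := hW.other a₂ b₂ j₂ hb₂ hj₂ (by by_contra hno; push Not at hno; rw [hno.1, hno.2.1] at hl; omega)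
    exact ⟨h1.1, h1.2.1⟩
  · by_cases hx : a₂ = a ∧ b₂ = b ∧ j₂ = j
    · obtain ⟨rfl, rfl, rfl⟩ := hx
      exact ⟨hW.f, by rw [hW.v]; exact h hF⟩
    · have h1 := hW.other a₂ b₂ j₂ hb₂ hj₂ (by tauto)
      exact ⟨h1.1.2 hF, h1.2.1.le⟩

/-- Account for a way to proceed from the entries at register 23 to those at register 22. -/
def relaxCmd : Cmd :=
  upTo 27 (.add (nr 4) (nl 1)) (when (.conj (.nle (nr 24) (nr 27))
      (.nle (nl 1) (na 18 (.add (nr 22) (.sub (nr 27) (nr 24))))))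
    (rset 65 (.add (rr 64) (ra 7 (.add (nr 22) (.sub (nr 27) (nr 24))))) ;;
      when (.disj (.neq (na 18 (.add (nr 23) (nr 27))) (nl 0)) (.rlt (rr 65) (ra 7 (.add (nr 23) (nr 27)))))
        (nput 18 (.add (nr 23) (nr 27)) (nl 1) ;; rput 7 (.add (nr 23) (nr 27)) (rr 65) ;;
          nput 16 (.add (nr 23) (nr 27)) (nr 25) ;; nput 17 (.add (nr 23) (nr 27)) (nr 26))))

/-- Entries are read at a lower level than they are written, so the passes for different budgets do
not interfere. -/
theorem relaxCmd_runs (D : Layout G b₂ (bound G b₂) ord δ) (hord : ∀ v, ord v ≤ m + 1) {σ : Mem}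
    (hi : HasInput G b₁ b₂ k σ) {e : Fin m} {a b a' b' w p q : ℕ} {c : ℝ}
    (hR : Rule G b₁ b₂ k ord δ e a b a' b' w c p q) (ha : a < m + 2) (hb : b < m + 2)
    (h22 : σ.nreg 22 = idx m k a' b' 0) (h23 : σ.nreg 23 = idx m k a b 0) (h24 : σ.nreg 24 = w)
    (h25 : σ.nreg 25 = p) (h26 : σ.nreg 26 = q) (h64 : σ.rreg 64 = c)
    (hS : Sound G b₁ b₂ k ord δ (ord (G.tail e)) σ) :
    Runs relaxCmd σ (120 * k + 240) fun τ => Sound G b₁ b₂ k ord δ (ord (G.tail e)) τ ∧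
      Progress m k (ord (G.tail e)) σ τ ∧ Closed m k a b a' b' w c (k + 1) τ := by
  obtain ⟨hlev, hlt⟩ := hR.level D
  have ha' : a' < m + 2 := by omega
  have hb' : b' < m + 2 := by omega
  have hadd : ∀ a b j, idx m k a b 0 + j = idx m k a b j := fun a b j => by simp [idx]
  refine Runs.upTo' (fun j μ => Sound G b₁ b₂ k ord δ (ord (G.tail e)) μ ∧
      Progress m k (ord (G.tail e)) σ μ ∧ Closed m k a b a' b' w c j μ) (N := k + 1) (t := 92) rfl
    (fun μ hμ => by simp [(hi.keep hμ rfl).regK]) ?_ (fun j hj μ hμ hμj hJ => ?_)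
    (by simp only [NExp.size]; omega) fun μ _ hJ => hJ
  · have hs : SameTable σ (σ.setN 27 0) := ⟨rfl, rfl, rfl, rfl⟩
    exact ⟨hs.sound hS, hs.progress _, fun j hj => by omega⟩
  · obtain ⟨J1, J2, J3⟩ := hJ
    have g22 : μ.nreg 22 = idx m k a' b' 0 := by rw [hμ.n 22 rfl, h22]
    have g23 : μ.nreg 23 = idx m k a b 0 := by rw [hμ.n 23 rfl, h23]
    have g24 : μ.nreg 24 = w := by rw [hμ.n 24 rfl, h24]
    have g25 : μ.nreg 25 = p := by rw [hμ.n 25 rfl, h25]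
    have g26 : μ.nreg 26 = q := by rw [hμ.n 26 rfl, h26]
    have g64 : μ.rreg 64 = c := by rw [hμ.r 64 rfl, h64]
    have done : ∀ {ν : Mem}, Sound G b₁ b₂ k ord δ (ord (G.tail e)) ν →
        Progress m k (ord (G.tail e)) μ ν → (w ≤ j → tF m k ν a' b' (j - w) →
        tF m k ν a b j ∧ tV m k ν a b j ≤ c + tV m k ν a' b' (j - w)) →
        Sound G b₁ b₂ k ord δ (ord (G.tail e)) (ν.setN 27 (j + 1)) ∧
        Progress m k (ord (G.tail e)) σ (ν.setN 27 (j + 1)) ∧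
        Closed m k a b a' b' w c (j + 1) (ν.setN 27 (j + 1)) := by
      intro ν k1 k2 k3
      have hs : SameTable ν (ν.setN 27 (j + 1)) := ⟨rfl, rfl, rfl, rfl⟩
      refine ⟨hs.sound k1, J2.trans (k2.trans (hs.progress _)), hs.closed fun j' hj' hw hF => ?_⟩
      by_cases hjj : j' = j
      · subst hjj
        exact k3 hw hF
      · exact J3.progress k2 ha hb (by omega) ha' hb' (by omega) j' (by omega) hw hF
    refine Runs.le (Runs.when (t := 72) (fun hc => ?_) fun hc => ?_) (by decide)
    all_goals simp only [BExp.eval_conj, BExp.eval_nle, NExp.eval_lit, NExp.eval_get, NExp.eval_reg,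
      NExp.eval_add, NExp.eval_sub, g22, g24, hμj, hadd, Nat.one_le_iff_ne_zero] at hc
    · obtain ⟨hw, hF⟩ := hc
      refine Runs.le (Runs.seq' (s := 12) (t := 60) (R := fun ν => ν.rreg 65 = c + tV m k μ a' b' (j - w))
        (.flat rfl (by decide) fun _ => by simp [g64, g22, hμj, g24, hadd, tV]) fun ν hν h1 => ?_) le_rfl
      have hs : SameTable μ ν := hν.sameTable rfl
      have f23 : ν.nreg 23 = idx m k a b 0 := by rw [hν.n 23 rfl, g23]
      have f27 : ν.nreg 27 = j := by rw [hν.n 27 rfl, hμj]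
      have f25 : ν.nreg 25 = p := by rw [hν.n 25 rfl, g25]
      have f26 : ν.nreg 26 = q := by rw [hν.n 26 rfl, g26]
      refine Runs.le (Runs.when (t := 26) (fun hd => ?_) fun hd => ?_) (by decide)
      all_goals simp only [BExp.eval_disj, BExp.eval_neq, NExp.eval_lit, NExp.eval_get, NExp.eval_reg,
        NExp.eval_add, f23, f27, hadd, BExp.eval_rlt, RExp.eval_reg, RExp.eval_get, h1, hs.f, hs.v] at hd
      · refine .flat rfl (by decide) fun _ => ?_
        have hW : Writes m k a b j (c + tV m k μ a' b' (j - w)) p q μ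
            ((nput 18 (.add (nr 23) (nr 27)) (nl 1) ;; rput 7 (.add (nr 23) (nr 27)) (rr 65) ;;
          nput 16 (.add (nr 23) (nr 27)) (nr 25) ;; nput 17 (.add (nr 23) (nr 27)) (nr 26)).run ν) := by
          constructor
          · intro a₂ b₂ j₂ hb₂ hj₂ hne
            have : ¬ idx m k a₂ b₂ j₂ = idx m k a b j := by
              intro h
              obtain ⟨h1, h2, h3⟩ := idx_inj hb₂ hj₂ hb hj h
              tauto
            simp [tF, tV, tP, tQ, f23, f27, hadd, this, hs.f, hs.v, hs.p, hs.q]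
          · simp [tF, f23, f27, hadd]
          · simp [tV, f23, f27, hadd, h1]
          · simp [tP, f23, f27, hadd, f25]
          · simp [tQ, f23, f27, hadd, f26]
        have hP := hW.progress fun hF' => (hd.resolve_left hF').le
        rw [hlev] at hP
        refine done (hW.sound D hord hR ha hb hj hlev.le hw hF hlev.ge J1) hP fun _ _ => ⟨hW.f, ?_⟩
        rw [hW.v, (hP.low a' b' (j - w) ha' hb' (by omega) (by omega)).2]
      · have hs' : SameTable μ (ν.setN 999 0) := hs.trans ⟨rfl, rfl, rfl, rfl⟩
        push Not at hd
        refine done (hs'.sound J1) (hs'.progress _) fun _ _ => ?_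
        simp only [tF, tV, hs'.f, hs'.v]
        exact hd
    · have hs' : SameTable μ (μ.setN 999 0) := ⟨rfl, rfl, rfl, rfl⟩
      exact done (hs'.sound J1) (hs'.progress _) fun hw hF => absurd ⟨hw, hF⟩ hc

end PresentBias

namespace PresentBias

open TaskGraph Cmd

variable {n m : ℕ} {G : TaskGraph n m} {b₁ b₂ : ℝ} {k : ℕ} {ord : Fin n → ℕ} {δ : Fin n → ℝ}

/-! ### The program: filling the table -/

/-- The memory that the dynamic program needs. -/
structure Prepared (G : TaskGraph n m) (b₁ b₂ : ℝ) (k : ℕ) (ord : Fin n → ℕ) (δ : Fin n → ℝ)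
    (σ : Mem) : Prop where
  solved : Solved G b₁ b₂ k ord δ σ
  one : ∀ e, OneAt G b₁ b₂ k δ 0 1 e σ
  one' : ∀ e, OneAt G b₁ b₂ k δ 1 0 e σ
  col : ∀ b < m + 2, σ.narr 14 b = b * (k + 1)
  row : ∀ a < m + 2, σ.narr 15 a = a * ((m + 2) * (k + 1))

def Cmd.keepsPrepared (c : Cmd) : Bool :=
  c.keepsSolved && c.keepsNA 32 && c.keepsNA 33 && c.keepsNA 34 && c.keepsNA 35 && c.keepsRA 16 &&
    c.keepsRA 17 && c.keepsNA 14 && c.keepsNA 15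

theorem Prepared.keep {c : Cmd} {σ τ : Mem} (h : Prepared G b₁ b₂ k ord δ σ) (hk : Keep c σ τ)
    (hc : c.keepsPrepared = true) : Prepared G b₁ b₂ k ord δ τ := by
  simp only [Cmd.keepsPrepared, Bool.and_eq_true] at hc
  obtain ⟨⟨⟨⟨⟨⟨⟨⟨h0, a0⟩, a1⟩, a2⟩, a3⟩, r0⟩, r1⟩, c0⟩, c1⟩ := hc
  have hs := h.solved.keep hk h0
  simp only [Cmd.keepsSolved, Bool.and_eq_true] at h0
  obtain ⟨⟨⟨⟨⟨⟨-, b0⟩, b1⟩, -⟩, -⟩, -⟩, -⟩ := h0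
  refine ⟨hs, fun e => (h.one e).congr ?_ ?_ ?_ ?_, fun e => (h.one' e).congr ?_ ?_ ?_ ?_, ?_, ?_⟩
  · rw [hk.na _ b1]
  · rw [hk.na _ a0]
  · rw [hk.na _ a2]
  · rw [hk.ra _ r0]
  · rw [hk.na _ b0]
  · rw [hk.na _ a1]
  · rw [hk.na _ a3]
  · rw [hk.ra _ r1]
  · rw [hk.na _ c0]; exact h.col
  · rw [hk.na _ c1]; exact h.row

theorem Prepared.atPair {σ : Mem} (h : Prepared G b₁ b₂ k ord δ σ) {e e' : Fin m}
    (h10 : σ.nreg 10 = e) (h11 : σ.nreg 11 = e') : AtPair G b₁ b₂ k ord δ e e' σ :=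
  ⟨h.solved, h.one, h.one', h10, h11⟩

/-- The least number of chunks for the edges at registers 10 and 11, and a plan if they differ. -/
def planCmd : Cmd := ite (.neq (nr 10) (nr 11)) (nset 12 (na 31 (nr 10))) pairCmd

theorem planCmd_runs {e e' : Fin m} {σ : Mem} (hb : 1 < b₁) (hbb : b₁ < b₂)
    (ht : G.tail e' = G.tail e) (hp : AtPair G b₁ b₂ k ord δ e e' σ) :
    Runs planCmd σ (2000 * k * k + 910) fun τ => (e' ≠ e → HasPlan G b₁ b₂ k δ e e' τ) ∧
      ∀ w, τ.nreg 12 = w + 1 ↔ IsLeast (G.pairSet (bound G b₂) δ k b₁ b₂ e e') w := by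
  refine Runs.le (Runs.ite (s := 2000 * k * k + 902) (t := 2000 * k * k + 902) (fun hc => ?_)
    fun hc => ?_) (by simp only [BExp.neq, BExp.size, NExp.size]; omega)
  all_goals simp only [BExp.eval_neq, NExp.eval_reg, hp.fst, hp.snd, Fin.val_inj] at hc
  · subst hc
    refine (Runs.flat (t := 4) rfl (by decide) fun _ => ⟨fun h => absurd rfl h, fun w => ?_⟩).le (by omega)
    have h1 : G.pairSet (bound G b₂) δ k b₁ b₂ e e = G.soloSet (bound G b₂) δ k b₁ b₂ e := by
      ext w; simp [pairSet, soloSet]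
    have h2 : σ.narr 31 e = w + 1 ↔ IsLeast (G.soloSet (bound G b₂) δ k b₁ b₂ e) w :=
      (hp.solved.two e).code w
    rw [h1, ← h2]
    simp [hp.fst]
  · exact (pairCmd_runs hb hbb (fun h => hc h.symm) ht hp).imp fun τ _ h => ⟨fun _ => h.1, h.2⟩

/-- Account for a way to proceed from the vertices at registers 34 and 35 to those at 36 and 37. -/
def stepCmd : Cmd :=
  nset 22 (.add (na 15 (nr 36)) (na 14 (nr 37))) ;;
    nset 23 (.add (na 15 (nr 34)) (na 14 (nr 35))) ;; relaxCmd

/-- The loop-free prefix `c₀` loads the registers; leaving it arbitrary lets all three kinds of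
moves share the argument. -/
theorem stepCmd_runs (D : Layout G b₂ (bound G b₂) ord δ) (hord : ∀ v, ord v ≤ m + 1) {c₀ : Cmd}
    {σ : Mem} (hp : Prepared G b₁ b₂ k ord δ σ) (hf : c₀.flat = true) (ht : c₀.cost ≤ 60)
    (h₀ : c₀.keepsPrepared = true) (h₀' : c₀.keepsTable = true)
    {e : Fin m} {a b a' b' w p q : ℕ} {c : ℝ}
    (hR : Rule G b₁ b₂ k ord δ e a b a' b' w c p q)
    (h34 : (c₀.run σ).nreg 34 = a) (h35 : (c₀.run σ).nreg 35 = b) (h36 : (c₀.run σ).nreg 36 = a')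
    (h37 : (c₀.run σ).nreg 37 = b') (h24 : (c₀.run σ).nreg 24 = w) (h25 : (c₀.run σ).nreg 25 = p)
    (h26 : (c₀.run σ).nreg 26 = q) (h64 : (c₀.run σ).rreg 64 = c)
    (hS : Sound G b₁ b₂ k ord δ (ord (G.tail e)) σ) :
    Runs (c₀ ;; stepCmd) σ (120 * k + 320) fun τ => Sound G b₁ b₂ k ord δ (ord (G.tail e)) τ ∧
      Progress m k (ord (G.tail e)) σ τ ∧ Closed m k a b a' b' w c (k + 1) τ := by
  obtain ⟨hlev, hlt⟩ := hR.level D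
  have := hord (G.tail e)
  refine Runs.le (s := 60 + (7 + (7 + (120 * k + 240)))) ?_ (by omega)
  refine Runs.seq' (R := fun τ => τ = c₀.run σ) (.flat hf ht fun _ => rfl) fun τ hτ h => ?_
  subst h
  have p1 := hp.keep hτ h₀
  have s1 : SameTable σ (c₀.run σ) := hτ.sameTable h₀'
  set τ := c₀.run σ
  refine Runs.seq' (R := fun ρ => ρ.nreg 22 = idx m k a' b' 0) (.flat rfl (by decide) fun _ => ?_)
    fun ρ hρ g22 => ?_
  · simp [h36, h37, p1.row a' (by omega), p1.col b' (by omega), idx]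
  have p2 := p1.keep hρ rfl
  have s2 := s1.trans (hρ.sameTable rfl)
  refine Runs.seq' (R := fun ρ => ρ.nreg 23 = idx m k a b 0) (.flat rfl (by decide) fun _ => ?_)
    fun ν hν g23 => ?_
  · simp [hρ.n 34 rfl, hρ.n 35 rfl, h34, h35, p2.row a (by omega), p2.col b (by omega), idx]
  have p3 := p2.keep hν rfl
  have s3 := s2.trans (hν.sameTable rfl)
  refine (relaxCmd_runs D hord p3.solved.ready.inp hR (by omega) (by omega) ?_ g23 ?_ ?_ ?_ ?_
    (s3.sound hS)).imp fun μ _ h => ⟨h.1, (s3.progress _).trans h.2.1, h.2.2⟩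
  · rw [hν.n 22 rfl, g22]
  · rw [hν.n 24 rfl, hρ.n 24 rfl, h24]
  · rw [hν.n 25 rfl, hρ.n 25 rfl, h25]
  · rw [hν.n 26 rfl, hρ.n 26 rfl, h26]
  · rw [hν.r 64 rfl, hρ.r 64 rfl, h64]

/-- The table accounts for the ways to proceed along `e` that satisfy `X`. -/
def Handled (G : TaskGraph n m) (b₁ b₂ : ℝ) (k : ℕ) (ord : Fin n → ℕ) (δ : Fin n → ℝ) (e : Fin m)
    (X : ℕ → ℕ → ℕ → ℕ → Prop) (σ : Mem) : Prop :=
  ∀ a b a' b' w c p q, Rule G b₁ b₂ k ord δ e a b a' b' w c p q → X a b p q →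
    Closed m k a b a' b' w c (k + 1) σ

theorem Handled.progress (D : Layout G b₂ (bound G b₂) ord δ) (hord : ∀ v, ord v ≤ m + 1) {e : Fin m}
    {X : ℕ → ℕ → ℕ → ℕ → Prop} {s : ℕ} {σ τ : Mem} (h : Handled G b₁ b₂ k ord δ e X σ)
    (hP : Progress m k s σ τ) (hs : ord (G.tail e) ≤ s) : Handled G b₁ b₂ k ord δ e X τ := by
  intro a b a' b' w c p q hR hX
  obtain ⟨hlev, hlt⟩ := hR.level D
  have := hord (G.tail e)
  exact (h _ _ _ _ _ _ _ _ hR hX).progress hP (by omega) (by omega) le_rfl (by omega) (by omega)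
    (by omega)

theorem SameTable.handled {e : Fin m} {X : ℕ → ℕ → ℕ → ℕ → Prop} {σ τ : Mem} (hs : SameTable σ τ)
    (h : Handled G b₁ b₂ k ord δ e X σ) : Handled G b₁ b₂ k ord δ e X τ :=
  fun _ _ _ _ _ _ _ _ hR hX => hs.closed (h _ _ _ _ _ _ _ _ hR hX)

/-- The table `τ` results from `σ` by sound changes for numbers `s` or larger. -/
structure Advance (G : TaskGraph n m) (b₁ b₂ : ℝ) (k : ℕ) (ord : Fin n → ℕ) (δ : Fin n → ℝ) (s : ℕ)
    (σ τ : Mem) : Prop where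
  sound : Sound G b₁ b₂ k ord δ s τ
  progress : Progress m k s σ τ

theorem Advance.trans {s : ℕ} {σ τ ρ : Mem} (h : Advance G b₁ b₂ k ord δ s σ τ)
    (h' : Advance G b₁ b₂ k ord δ s τ ρ) : Advance G b₁ b₂ k ord δ s σ ρ :=
  ⟨h'.sound, h.progress.trans h'.progress⟩

theorem SameTable.advance {s : ℕ} {σ τ : Mem} (h : SameTable σ τ) (hS : Sound G b₁ b₂ k ord δ s σ) :
    Advance G b₁ b₂ k ord δ s σ τ := ⟨h.sound hS, h.progress s⟩

theorem SameTable.setN {σ : Mem} (r v : ℕ) : SameTable σ (σ.setN r v) := ⟨rfl, rfl, rfl, rfl⟩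

/-- Proceed along the edge at register 31 by the first agent, the second being at register 32. -/
def leftCmd : Cmd :=
  when (.nle (nl 1) (na 29 (nr 31)))
    ((nset 34 (nr 30) ;; nset 35 (nr 32) ;; nset 36 (na 6 (na 1 (nr 31))) ;; nset 37 (nr 32) ;;
      nset 24 (.sub (na 29 (nr 31)) (nl 1)) ;; nset 25 (.add (nr 31) (nl 1)) ;; nset 26 (nl 0) ;;
      rset 64 (ra 0 (nr 31))) ;; stepCmd)

def rightCmd : Cmd :=
  when (.nle (nl 1) (na 30 (nr 31)))
    ((nset 34 (nr 32) ;; nset 35 (nr 30) ;; nset 36 (nr 32) ;; nset 37 (na 6 (na 1 (nr 31))) ;;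
      nset 24 (.sub (na 30 (nr 31)) (nl 1)) ;; nset 25 (nl 0) ;; nset 26 (.add (nr 31) (nl 1)) ;;
      rset 64 (ra 0 (nr 31))) ;; stepCmd)

/-- Proceed along the edges at registers 31 and 33. -/
def bothStepCmd : Cmd :=
  when (.nle (nl 1) (nr 12))
    ((nset 34 (nr 30) ;; nset 35 (nr 30) ;; nset 36 (na 6 (na 1 (nr 31))) ;;
      nset 37 (na 6 (na 1 (nr 33))) ;; nset 24 (.sub (nr 12) (nl 1)) ;; nset 25 (.add (nr 31) (nl 1)) ;;
      nset 26 (.add (nr 33) (nl 1)) ;; rset 64 (.add (ra 0 (nr 31)) (ra 0 (nr 33)))) ;; stepCmd)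

section

variable {e : Fin m} {σ : Mem} (D : Layout G b₂ (bound G b₂) ord δ) (hord : ∀ v, ord v ≤ m + 1)
  (hp : Prepared G b₁ b₂ k ord δ σ) (h30 : σ.nreg 30 = ord (G.tail e)) (h31 : σ.nreg 31 = e)
  (hS : Sound G b₁ b₂ k ord δ (ord (G.tail e)) σ)

include D hord hp h30 h31 hS

/-- The stored edges tell the kinds of moves apart: only a move of the first agent alone has `q =
0`, since edges are stored increased by one. -/
theorem leftCmd_runs (h32 : σ.nreg 32 < ord (G.tail e)) :
    Runs leftCmd σ (120 * k + 330) fun τ => Advance G b₁ b₂ k ord δ (ord (G.tail e)) σ τ ∧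
      Handled G b₁ b₂ k ord δ e (fun _ b _ q => q = 0 ∧ b = σ.nreg 32) τ := by
  have hc : ∀ w, σ.narr 29 e = w + 1 ↔ IsLeast (G.soloSet (bound G b₂) δ k b₁ b₁ e) w :=
    (hp.solved.fst e).code
  refine Runs.le (Runs.when (t := 120 * k + 320) (fun h1 => ?_) fun h1 => ?_)
    (by simp only [BExp.size, NExp.size]; omega)
  all_goals simp only [BExp.eval_nle, NExp.eval_lit, NExp.eval_get, NExp.eval_reg, h31] at h1
  · have hl := (hc (σ.narr 29 e - 1)).1 (by omega)
    refine (stepCmd_runs D hord hp rfl (by decide) rfl rfl (.left e _ _ h32 hl) ?_ ?_ ?_ ?_ ?_ ?_ ?_ ?_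
      hS).imp fun τ _ h => ⟨⟨h.1, h.2.1⟩, fun a b a' b' w c p q hR hX => ?_⟩
    · simp [h30]
    · simp
    · simp [h31, hp.solved.ready.inp.head, hp.solved.ready.dist.ord]
    · simp
    · simp [h31]
    · simp [h31]
    · simp
    · simp [h31, hp.solved.ready.inp.cost]
    · cases hR with
      | left _ _ hb hl' =>
        obtain ⟨-, rfl⟩ := hX
        rw [hl'.unique hl]
        exact h.2.2
      | right => omega
      | both => omega
  · refine ⟨(SameTable.setN _ _).advance hS, fun a b a' b' w c p q hR hX => ?_⟩
    cases hR with
    | left _ _ hb hl' =>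
      have := (hc w).2 hl'
      omega
    | right => omega
    | both => omega

theorem rightCmd_runs (h32 : σ.nreg 32 < ord (G.tail e)) :
    Runs rightCmd σ (120 * k + 330) fun τ => Advance G b₁ b₂ k ord δ (ord (G.tail e)) σ τ ∧
      Handled G b₁ b₂ k ord δ e (fun a _ p _ => p = 0 ∧ a = σ.nreg 32) τ := by
  have hc : ∀ w, σ.narr 30 e = w + 1 ↔ IsLeast (G.soloSet (bound G b₂) δ k b₂ b₂ e) w :=
    (hp.solved.snd e).code
  refine Runs.le (Runs.when (t := 120 * k + 320) (fun h1 => ?_) fun h1 => ?_)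
    (by simp only [BExp.size, NExp.size]; omega)
  all_goals simp only [BExp.eval_nle, NExp.eval_lit, NExp.eval_get, NExp.eval_reg, h31] at h1
  · have hl := (hc (σ.narr 30 e - 1)).1 (by omega)
    refine (stepCmd_runs D hord hp rfl (by decide) rfl rfl (.right e _ _ h32 hl) ?_ ?_ ?_ ?_ ?_ ?_ ?_ ?_
      hS).imp fun τ _ h => ⟨⟨h.1, h.2.1⟩, fun a b a' b' w c p q hR hX => ?_⟩
    · simp
    · simp [h30]
    · simp
    · simp [h31, hp.solved.ready.inp.head, hp.solved.ready.dist.ord]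
    · simp [h31]
    · simp
    · simp [h31]
    · simp [h31, hp.solved.ready.inp.cost]
    · cases hR with
      | right _ _ hb hl' =>
        obtain ⟨-, rfl⟩ := hX
        rw [hl'.unique hl]
        exact h.2.2
      | left => omega
      | both => omega
  · refine ⟨(SameTable.setN _ _).advance hS, fun a b a' b' w c p q hR hX => ?_⟩
    cases hR with
    | right _ _ hb hl' =>
      have := (hc w).2 hl'
      omega
    | left => omega
    | both => omega

theorem bothStepCmd_runs {e' : Fin m} (h33 : σ.nreg 33 = e') (ht : G.tail e' = G.tail e)
    (hc : ∀ w, σ.nreg 12 = w + 1 ↔ IsLeast (G.pairSet (bound G b₂) δ k b₁ b₂ e e') w) :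
    Runs bothStepCmd σ (120 * k + 330) fun τ => Advance G b₁ b₂ k ord δ (ord (G.tail e)) σ τ ∧
      Handled G b₁ b₂ k ord δ e (fun _ _ p q => p ≠ 0 ∧ q = e' + 1) τ := by
  refine Runs.le (Runs.when (t := 120 * k + 320) (fun h1 => ?_) fun h1 => ?_)
    (by simp only [BExp.size, NExp.size]; omega)
  all_goals simp only [BExp.eval_nle, NExp.eval_lit, NExp.eval_reg] at h1
  · have hl := (hc (σ.nreg 12 - 1)).1 (by omega)
    refine (stepCmd_runs D hord hp rfl (by decide) rfl rfl (.both e e' _ ht hl) ?_ ?_ ?_ ?_ ?_ ?_ ?_ ?_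
      hS).imp fun τ _ h => ⟨⟨h.1, h.2.1⟩, fun a b a' b' w c p q hR hX => ?_⟩
    · simp [h30]
    · simp [h30]
    · simp [h31, hp.solved.ready.inp.head, hp.solved.ready.dist.ord]
    · simp [h33, hp.solved.ready.inp.head, hp.solved.ready.dist.ord]
    · simp
    · simp [h31]
    · simp [h33]
    · simp [h31, h33, hp.solved.ready.inp.cost]
    · cases hR with
      | both f _ ht' hl' =>
        obtain rfl : f = e' := by
          have := hX.2
          exact Fin.ext (by omega)
        rw [hl'.unique hl]
        exact h.2.2
      | left => omega
      | right => omega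
  · refine ⟨(SameTable.setN _ _).advance hS, fun a b a' b' w c p q hR hX => ?_⟩
    cases hR with
    | both f _ ht' hl' =>
      obtain rfl : f = e' := by
        have := hX.2
        exact Fin.ext (by omega)
      have := (hc w).2 hl'
      omega
    | left => omega
    | right => omega

end

end PresentBias

/-! ### All moves along an edge, the order of the levels, and the initial table. -/

namespace PresentBias

open TaskGraph Cmd

variable {n m : ℕ} {G : TaskGraph n m} {b₁ b₂ : ℝ} {k : ℕ} {ord : Fin n → ℕ} {δ : Fin n → ℝ}

/-- Account for all ways to proceed along the edge at register 31. -/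
def edgeCmd : Cmd :=
  upTo 32 (nr 30) (leftCmd ;; rightCmd) ;;
  upTo 33 (nr 1) (when (.neq (na 0 (nr 33)) (na 0 (nr 31)))
    (nset 10 (nr 31) ;; nset 11 (nr 33) ;; planCmd ;; bothStepCmd))

/-- A move of one agent has to be accounted for with every lower position of the other one, in time
of order `k` each. A joint move has to be accounted for with every edge that has the same tail:
order `k²` for finding the plan and `k` for the table. -/
theorem edgeCmd_runs (D : Layout G b₂ (bound G b₂) ord δ) (hord : ∀ v, ord v ≤ m + 1)
    (hb : 1 < b₁) (hbb : b₁ < b₂) {e : Fin m} {σ : Mem} (hp : Prepared G b₁ b₂ k ord δ σ)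
    (h30 : σ.nreg 30 = ord (G.tail e)) (h31 : σ.nreg 31 = e)
    (hS : Sound G b₁ b₂ k ord δ (ord (G.tail e)) σ) :
    Runs edgeCmd σ ((m + 1) * (2000 * k * k + 400 * k + 2600)) fun τ =>
      Advance G b₁ b₂ k ord δ (ord (G.tail e)) σ τ ∧
        Handled G b₁ b₂ k ord δ e (fun _ _ _ _ => True) τ := by
  have ho := hord (G.tail e)
  refine Runs.le (s := ((m + 1) * (240 * k + 720) + 9) + (m * (2000 * k * k + 120 * k + 1400) + 9)) ?_
    (by nlinarith [Nat.zero_le (m * k), Nat.zero_le (m * k * k)])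
  refine Runs.seq' (R := fun τ => Advance G b₁ b₂ k ord δ (ord (G.tail e)) σ τ ∧
      Handled G b₁ b₂ k ord δ e (fun _ _ p q => p = 0 ∨ q = 0 ∨ q < 0 + 1) τ) ?_ fun ρ hρ h1 => ?_
  · refine Runs.upTo' (fun j μ => Advance G b₁ b₂ k ord δ (ord (G.tail e)) σ μ ∧
        Handled G b₁ b₂ k ord δ e (fun a b p q => q = 0 ∧ b < j ∨ p = 0 ∧ a < j) μ)
      (t := (120 * k + 330) + (120 * k + 330)) (N := ord (G.tail e)) rfl (fun τ hτ => ?_)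
      ⟨(SameTable.setN _ _).advance hS, fun a b _ _ _ _ p q _ hX => ?_⟩
      (fun j hj μ hμ hμj hJ => ?_) ?_ fun μ hμ hJ => ⟨hJ.1, fun a b _ _ _ _ p q hR hX => ?_⟩
    · simp [hτ.n 30 rfl, h30]
    · omega
    · have p1 := hp.keep hμ rfl
      refine Runs.seq' (leftCmd_runs D hord p1 (by rw [hμ.n 30 rfl, h30]) (by rw [hμ.n 31 rfl, h31])
        hJ.1.sound (by omega)) fun ν hν h2 => ?_
      refine (rightCmd_runs D hord (p1.keep hν rfl) (by rw [hν.n 30 rfl, hμ.n 30 rfl, h30])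
        (by rw [hν.n 31 rfl, hμ.n 31 rfl, h31]) h2.1.sound (by rw [hν.n 32 rfl]; omega)).imp
        fun ξ _ h3 => ?_
      rw [hν.n 32 rfl, hμj] at h3
      rw [hμj] at h2
      have s1 := SameTable.setN (σ := ξ) 32 (j + 1)
      refine ⟨hJ.1.trans (h2.1.trans (h3.1.trans (s1.advance h3.1.sound))), s1.handled ?_⟩
      have q1 := hJ.2.progress D hord (h2.1.trans h3.1).progress le_rfl
      have q2 := h2.2.progress D hord h3.1.progress le_rfl
      intro a b a' b' w c p q hR hX
      by_cases hX1 : q = 0 ∧ b < j ∨ p = 0 ∧ a < j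
      · exact q1 _ _ _ _ _ _ _ _ hR hX1
      by_cases hX2 : q = 0 ∧ b = j
      · exact q2 _ _ _ _ _ _ _ _ hR hX2
      · exact h3.2 _ _ _ _ _ _ _ _ hR (by omega)
    · simp only [NExp.size]
      have : ord (G.tail e) * (120 * k + 330 + (120 * k + 330) + (1 + 8)) ≤
          (m + 1) * (120 * k + 330 + (120 * k + 330) + (1 + 8)) := Nat.mul_le_mul_right _ ho
      nlinarith
    · refine hJ.2 _ _ _ _ _ _ _ _ hR ?_
      cases hR with
      | left => exact Or.inl ⟨rfl, by assumption⟩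
      | right => exact Or.inr ⟨rfl, by assumption⟩
      | both => omega
  · refine Runs.upTo' (fun j μ => Advance G b₁ b₂ k ord δ (ord (G.tail e)) σ μ ∧
        Handled G b₁ b₂ k ord δ e (fun _ _ p q => p = 0 ∨ q = 0 ∨ q < j + 1) μ)
      (t := 2000 * k * k + 120 * k + 1350) (N := m) rfl (fun τ hτ => ?_)
      ⟨h1.1.trans ((SameTable.setN _ _).advance h1.1.sound), (SameTable.setN _ _).handled h1.2⟩
      (fun j hj μ hμ hμj hJ => ?_) (by simp only [NExp.size]; nlinarith)
      fun μ hμ hJ => ⟨hJ.1, fun a b _ _ _ _ p q hR _ => ?_⟩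
    · exact ((hp.keep hρ rfl).keep hτ rfl).solved.ready.inp.regM
    · have p1 := (hp.keep hρ rfl).keep hμ rfl
      have i1 := p1.solved.ready.inp
      obtain ⟨e', rfl⟩ : ∃ e' : Fin m, (e' : ℕ) = j := ⟨⟨j, hj⟩, rfl⟩
      have g31 : μ.nreg 31 = e := by rw [hμ.n 31 rfl, hρ.n 31 rfl, h31]
      have g30 : μ.nreg 30 = ord (G.tail e) := by rw [hμ.n 30 rfl, hρ.n 30 rfl, h30]
      have fin : ∀ {ξ : Mem}, Advance G b₁ b₂ k ord δ (ord (G.tail e)) μ ξ →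
          Handled G b₁ b₂ k ord δ e (fun _ _ p q => p ≠ 0 ∧ q = e' + 1) ξ →
          Advance G b₁ b₂ k ord δ (ord (G.tail e)) σ (ξ.setN 33 (e' + 1)) ∧
          Handled G b₁ b₂ k ord δ e (fun _ _ p q => p = 0 ∨ q = 0 ∨ q < e' + 1 + 1)
            (ξ.setN 33 (e' + 1)) := by
        intro ξ k1 k2
        have s1 := SameTable.setN (σ := ξ) 33 (e' + 1)
        refine ⟨hJ.1.trans (k1.trans (s1.advance k1.sound)), s1.handled ?_⟩
        intro a b a' b' w c p q hR hX
        by_cases hX1 : p = 0 ∨ q = 0 ∨ q < e' + 1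
        · exact hJ.2.progress D hord k1.progress le_rfl _ _ _ _ _ _ _ _ hR hX1
        · exact k2 _ _ _ _ _ _ _ _ hR (by omega)
      refine Runs.le (Runs.when (t := 2000 * k * k + 120 * k + 1300) (fun hc => ?_) fun hc => ?_)
        (by simp only [BExp.neq, BExp.size, NExp.size]; omega)
      all_goals simp only [BExp.eval_neq, NExp.eval_get, NExp.eval_reg, hμj, g31, i1.tail,
        Fin.val_inj] at hc
      · refine Runs.le (s := 2 + (2 + ((2000 * k * k + 910) + (120 * k + 330)))) ?_ (by omega)
        refine Runs.seq' (R := fun ν => ν.nreg 10 = e) (.flat rfl (by decide) fun _ => by simp [g31])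
          fun ν hν f10 => ?_
        refine Runs.seq' (R := fun ν => ν.nreg 11 = e') (.flat rfl (by decide) fun _ => by
          simp [hν.n 33 rfl, hμj]) fun ξ hξ f11 => ?_
        have p2 := (p1.keep hν rfl).keep hξ rfl
        have s2 : SameTable μ ξ := (hν.sameTable rfl).trans (hξ.sameTable rfl)
        refine Runs.seq' (planCmd_runs hb hbb hc (p2.atPair (by rw [hξ.n 10 rfl, f10]) f11))
          fun ζ hζ hpl => ?_
        have s3 := s2.trans (hζ.sameTable rfl)
        refine (bothStepCmd_runs D hord (p2.keep hζ rfl) ?_ ?_ (s3.sound hJ.1.sound) ?_ hc hpl.2).imp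
          fun η _ h => fin ((s3.advance hJ.1.sound).trans h.1) h.2
        · rw [hζ.n 30 rfl, hξ.n 30 rfl, hν.n 30 rfl, g30]
        · rw [hζ.n 31 rfl, hξ.n 31 rfl, hν.n 31 rfl, g31]
        · rw [hζ.n 33 rfl, hξ.n 33 rfl, hν.n 33 rfl, hμj]
      · refine fin ((SameTable.setN _ _).advance hJ.1.sound) fun a b a' b' w c p q hR hX => ?_
        cases hR with
        | both f _ ht' hl' =>
          obtain rfl : f = e' := by
            have := hX.2
            exact Fin.ext (by omega)
          exact absurd ht' hc
        | left => omega
        | right => omega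
    · refine hJ.2 _ _ _ _ _ _ _ _ hR ?_
      cases hR with
      | both f => exact Or.inr (Or.inr (by omega))
      | left => exact Or.inr (Or.inl rfl)
      | right => exact Or.inl rfl

/-- The table contains the entries for the sink. -/
def Based (m k s : ℕ) (σ : Mem) : Prop := ∀ j < k + 1, tF m k σ s s j ∧ tV m k σ s s j ≤ 0

theorem Based.progress {s t : ℕ} {σ τ : Mem} (h : Based m k s σ) (hs : s < m + 2)
    (hP : Progress m k t σ τ) : Based m k s τ := by
  intro j hj
  have h1 := hP.grow s s j hs hs hj (h j hj).1
  exact ⟨h1.1, h1.2.trans (h j hj).2⟩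

theorem Sound.mono {s t : ℕ} {σ : Mem} (h : Sound G b₁ b₂ k ord δ s σ) (hst : s ≤ t) :
    Sound G b₁ b₂ k ord δ t σ :=
  fun a b j ha hb hj hF => (h a b j ha hb hj hF).imp_right fun ⟨h1, h2⟩ => ⟨h1.trans hst, h2⟩

/-- The invariant for the table when the edges that satisfy `X` are done. -/
structure Filled (G : TaskGraph n m) (b₁ b₂ : ℝ) (k : ℕ) (ord : Fin n → ℕ) (δ : Fin n → ℝ) (s : ℕ)
    (X : Fin m → Prop) (σ : Mem) : Prop where
  sound : Sound G b₁ b₂ k ord δ s σ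
  base : Based m k (ord G.sink) σ
  handled : ∀ e, X e → Handled G b₁ b₂ k ord δ e (fun _ _ _ _ => True) σ

theorem Filled.same {s : ℕ} {X : Fin m → Prop} {σ τ : Mem} (h : Filled G b₁ b₂ k ord δ s X σ)
    (hs : SameTable σ τ) (hord : ∀ v, ord v ≤ m + 1) : Filled G b₁ b₂ k ord δ s X τ :=
  ⟨hs.sound h.sound, h.base.progress (Nat.lt_succ_of_le (hord _)) (hs.progress 0),
    fun e he => hs.handled (h.handled e he)⟩

theorem Filled.complete {s : ℕ} {σ : Mem} (h : Filled G b₁ b₂ k ord δ s (fun _ => True) σ) :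
    Complete G (bound G b₂) ord δ k b₁ b₂ (tF m k σ) (tV m k σ) where
  base j hj := h.base j (by omega)
  left e v j w hv hw hwj hj hF :=
    h.handled e trivial _ _ _ _ _ _ _ _ (.left e (ord v) w hv hw) trivial j (by omega) hwj hF
  right e v j w hv hw hwj hj hF :=
    h.handled e trivial _ _ _ _ _ _ _ _ (.right e (ord v) w hv hw) trivial j (by omega) hwj hF
  both e e' j w ht hw hwj hj hF :=
    h.handled e trivial _ _ _ _ _ _ _ _ (.both e e' w ht hw) trivial j (by omega) hwj hF

/-- Fill the table. -/
def dpCmd : Cmd :=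
  upTo 30 (.add (nr 1) (nl 2)) (upTo 31 (nr 1)
    (when (.neq (na 6 (na 0 (nr 31))) (nr 30)) edgeCmd))

/-- At level `a` the edges whose tail has the number `a` are treated. All entries that a move leads
to are of lower level, hence complete, and `Progress` guarantees that they stay as they are. -/
theorem dpCmd_runs (D : Layout G b₂ (bound G b₂) ord δ) (hord : ∀ v, ord v ≤ m + 1)
    (hb : 1 < b₁) (hbb : b₁ < b₂) {σ : Mem} (hp : Prepared G b₁ b₂ k ord δ σ)
    (hF : Filled G b₁ b₂ k ord δ 0 (fun _ => False) σ) :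
    Runs dpCmd σ (m * ((m + 1) * (2000 * k * k + 400 * k + 2600)) + (m + 2) * (m * 30 + 30) + 20)
      fun τ => Filled G b₁ b₂ k ord δ (m + 2) (fun _ => True) τ := by
  classical
  set E := (m + 1) * (2000 * k * k + 400 * k + 2600) with hE
  -- The time `E` for an edge is charged only to the level of its tail. Exchanging the two sums
  -- shows that it is spent once for each edge, although every level scans all edges.
  let f : ℕ → ℕ → ℕ := fun a j =>
    if h : j < m then if ord (G.tail ⟨j, h⟩) = a then E else 0 else 0
  have hsum : ∑ a ∈ Finset.range (m + 2), ∑ j ∈ Finset.range m, f a j ≤ m * E := by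
    rw [Finset.sum_comm, ← smul_eq_mul, ← Finset.card_range m, ← Finset.sum_const, Finset.card_range]
    refine Finset.sum_le_sum fun j hj => ?_
    simp only [Finset.mem_range] at hj
    simp only [f, hj, dif_pos]
    rw [Finset.sum_ite_eq]
    split_ifs <;> omega
  refine Runs.le (Runs.upTo (J := fun a μ => Filled G b₁ b₂ k ord δ a (fun e => ord (G.tail e) < a) μ)
    (N := m + 2) (t := fun a => ∑ j ∈ Finset.range m, (f a j + 14 + (1 + 8)) + (1 + 8)) rfl
    (fun τ hτ => ?_) ?_ (fun a ha μ hμ hμa hJ => ?_) fun τ _ hJ => ?_) ?_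
  · simp [(hp.keep hτ rfl).solved.ready.inp.regM]
  · have h1 := hF.same (SameTable.setN 30 0) hord
    exact ⟨h1.sound, h1.base, fun e he => by omega⟩
  · refine Runs.upTo (J := fun j ν => Filled G b₁ b₂ k ord δ a
      (fun e => ord (G.tail e) < a ∨ ord (G.tail e) = a ∧ (e : ℕ) < j) ν) (N := m)
      (t := fun j => f a j + 14) rfl (fun τ hτ => ?_) ?_ (fun j hj ν hν hνj hJ' => ?_) fun τ _ hJ' => ?_
    · simp [((hp.keep hμ rfl).keep hτ rfl).solved.ready.inp.regM]
    · have h1 := hJ.same (SameTable.setN 31 0) hord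
      exact ⟨h1.sound, h1.base, fun e he => h1.handled e (by omega)⟩
    · have p1 := (hp.keep hμ rfl).keep hν rfl
      obtain ⟨e, rfl⟩ : ∃ e : Fin m, (e : ℕ) = j := ⟨⟨j, hj⟩, rfl⟩
      have hev : (BExp.neq (na 6 (na 0 (nr 31))) (nr 30)).eval ν ↔ ord (G.tail e) = a := by
        simp [hνj, p1.solved.ready.inp.tail, p1.solved.ready.dist.ord, hν.n 30 rfl, hμa]
      have hf : f a e = if ord (G.tail e) = a then E else 0 := by simp [f]
      by_cases hea : ord (G.tail e) = a
      · rw [if_pos hea] at hf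
        have hE2 : 2600 ≤ E := by
          rw [hE]
          nlinarith [Nat.zero_le (m * (2000 * k * k + 400 * k + 2600))]
        refine Runs.le (Runs.when (t := E) (fun _ => (edgeCmd_runs D hord hb hbb p1 (e := e) ?_ hνj ?_).imp
          fun ξ _ h => ?_) fun hc => absurd (hev.2 hea) hc) ?_
        · rw [hν.n 30 rfl, hμa, hea]
        · rw [hea]; exact hJ'.sound
        · rw [hea] at h
          have h1 : Filled G b₁ b₂ k ord δ a
              (fun e' => ord (G.tail e') < a ∨ ord (G.tail e') = a ∧ (e' : ℕ) < e + 1) ξ := by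
            refine ⟨h.1.sound, hJ'.base.progress (Nat.lt_succ_of_le (hord _)) h.1.progress,
              fun e' he' => ?_⟩
            by_cases hee : e' = e
            · subst hee; exact h.2
            · refine (hJ'.handled e' ?_).progress D hord h.1.progress (by omega)
              have : (e' : ℕ) ≠ e := fun h => hee (Fin.ext h)
              omega
          exact h1.same (SameTable.setN _ _) hord
        · simp only [BExp.neq, BExp.size, NExp.size]
          omega
      · refine Runs.le (Runs.when (t := 2) (fun hc => absurd (hev.1 hc) hea) fun _ => ?_) ?_
        · have h1 := (hJ'.same (SameTable.setN 999 0) hord).same (SameTable.setN 31 (e + 1)) hord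
          refine ⟨h1.sound, h1.base, fun e' he' => h1.handled e' ?_⟩
          have : (e' : ℕ) = e → ord (G.tail e') = ord (G.tail e) := fun h => by rw [Fin.ext h]
          omega
        · simp only [BExp.neq, BExp.size, NExp.size]
          omega
    · have h1 := hJ'.same (SameTable.setN 30 (a + 1)) hord
      exact ⟨h1.sound.mono (by omega), h1.base, fun e he => h1.handled e (by omega)⟩
  · exact ⟨hJ.sound, hJ.base, fun e _ => hJ.handled e (by have := hord (G.tail e); omega)⟩
  · simp only [Finset.sum_add_distrib, Finset.sum_const, Finset.card_range, smul_eq_mul, NExp.size]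
    nlinarith [hsum]

/-- Prepare the table. -/
def tableCmd : Cmd :=
  upTo 5 (.add (nr 1) (nl 2))
    (nput 14 (.add (nr 5) (nl 1)) (.add (na 14 (nr 5)) (.add (nr 4) (nl 1)))) ;;
  upTo 5 (.add (nr 1) (nl 2))
    (nput 15 (.add (nr 5) (nl 1)) (.add (na 15 (nr 5)) (na 14 (.add (nr 1) (nl 2))))) ;;
  nset 22 (.add (na 15 (na 6 (nr 3))) (na 14 (na 6 (nr 3)))) ;;
  upTo 27 (.add (nr 4) (nl 1)) (nput 18 (.add (nr 22) (nr 27)) (nl 1))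

/-- The machine cannot multiply natural numbers, so the multiples needed for addressing the table
are tabulated by repeated addition. Only the entries for the sink are written; their value 0 and the
missing edges are already in the zero memory. -/
theorem tableCmd_runs (hord : ∀ v, ord v ≤ m + 1) {σ : Mem} (hi : HasInput G b₁ b₂ k σ)
    (hd : HasDist G b₂ ord δ σ) (h14 : σ.narr 14 0 = 0) (h15 : σ.narr 15 0 = 0)
    (h16 : ∀ i, σ.narr 16 i = 0) (h17 : ∀ i, σ.narr 17 i = 0) (h18 : ∀ i, σ.narr 18 i = 0)
    (h7 : ∀ i, σ.rarr 7 i = 0) :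
    Runs tableCmd σ (100 * (m + k + 3)) fun τ => (∀ b < m + 2, τ.narr 14 b = b * (k + 1)) ∧
      (∀ a < m + 2, τ.narr 15 a = a * ((m + 2) * (k + 1))) ∧
      Filled G b₁ b₂ k ord δ 0 (fun _ => False) τ := by
  have hs := hord G.sink
  refine Runs.le (s := ((m + 2) * 30 + 15) + (((m + 2) * 30 + 15) + (10 + ((k + 1) * 30 + 15)))) ?_ (by omega)
  refine Runs.seq' (R := fun τ => ∀ b ≤ m + 2, τ.narr 14 b = b * (k + 1)) ?_ fun τ hτ col => ?_
  · refine Runs.upTo' (fun j τ => ∀ b ≤ j, τ.narr 14 b = b * (k + 1)) (N := m + 2) (t := 10) rfl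
      (fun τ hτ => by simp [(hi.keep hτ rfl).regM]) (fun b hb => ?_) (fun j hj τ hτ hj' hJ => ?_)
      (by simp only [NExp.size]; omega) fun τ _ h => h
    · obtain rfl : b = 0 := by omega
      simp [h14]
    · refine .flat rfl (by decide) fun hK b hb => ?_
      rcases Nat.lt_or_ge j b with h | h
      · obtain rfl : b = j + 1 := by omega
        simp [hj', hJ j le_rfl, (hi.keep hτ rfl).regK]
        ring
      · simp [hj', hJ b h, show ¬ b = j + 1 by omega]
  have i1 := hi.keep hτ rfl
  refine Runs.seq' (R := fun τ => ∀ a ≤ m + 2, τ.narr 15 a = a * ((m + 2) * (k + 1))) ?_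
    fun ρ hρ row => ?_
  · refine Runs.upTo' (fun j τ => ∀ a ≤ j, τ.narr 15 a = a * ((m + 2) * (k + 1))) (N := m + 2) (t := 12)
      rfl (fun ρ hρ => by simp [(i1.keep hρ rfl).regM]) (fun b hb => ?_) (fun j hj ρ hρ hj' hJ => ?_)
      (by simp only [NExp.size]; omega) fun τ _ h => h
    · obtain rfl : b = 0 := by omega
      simp [hτ.na 15 rfl, h15]
    · refine .flat rfl (by decide) fun hK b hb => ?_
      rcases Nat.lt_or_ge j b with h | h
      · obtain rfl : b = j + 1 := by omega
        simp [hj', hJ j le_rfl, (i1.keep hρ rfl).regM, hρ.na 14 rfl, col (m + 2) le_rfl]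
        ring
      · simp [hj', hJ b h, show ¬ b = j + 1 by omega]
  have i2 := i1.keep hρ rfl
  have d2 := (hd.keep hτ rfl).keep hρ rfl
  have c2 : ∀ b ≤ m + 2, ρ.narr 14 b = b * (k + 1) := by rw [hρ.na 14 rfl]; exact col
  refine Runs.seq' (R := fun ν => ν.nreg 22 = idx m k (ord G.sink) (ord G.sink) 0)
    (.flat rfl (by decide) fun _ => ?_) fun ν hν h22 => ?_
  · simp [i2.sink, d2.ord, c2 _ (show ord G.sink ≤ m + 2 by omega),
      row _ (show ord G.sink ≤ m + 2 by omega), idx]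
  have i3 := i2.keep hν rfl
  have hadd : ∀ a b j, idx m k a b 0 + j = idx m k a b j := fun a b j => by simp [idx]
  refine Runs.upTo' (fun j μ => ∀ i, (μ.narr 18 i ≠ 0 ↔ ∃ j' < j, i = idx m k (ord G.sink) (ord G.sink) j'))
    (N := k + 1) (t := 10) rfl (fun μ hμ => by simp [(i3.keep hμ rfl).regK]) (fun i => ?_)
    (fun j hj μ hμ hj' hJ => ?_) (by simp only [NExp.size]; omega) fun μ hμ hJ => ?_
  · simp [hν.na 18 rfl, hρ.na 18 rfl, hτ.na 18 rfl, h18]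
  · refine .flat rfl (by decide) fun _ i => ?_
    simp only [run_nput, NExp.eval_add, NExp.eval_reg, NExp.eval_lit, Mem.setN_narr,
      Mem.putN_narr_apply, hμ.n 22 rfl, h22, hj', hadd, true_and]
    split_ifs with h
    · simpa using ⟨j, by omega, h⟩
    · rw [hJ]
      refine ⟨fun ⟨j', h1, h2⟩ => ⟨j', by omega, h2⟩, fun ⟨j', h1, h2⟩ => ⟨j', ?_, h2⟩⟩
      rcases Nat.lt_or_ge j' j with h3 | h3
      · exact h3
      · obtain rfl : j' = j := by omega
        exact absurd h2 h
  · have g7 : ∀ i, μ.rarr 7 i = 0 := fun i => by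
      rw [hμ.ra 7 rfl, hν.ra 7 rfl, hρ.ra 7 rfl, hτ.ra 7 rfl, h7]
    refine ⟨fun b hb => ?_, fun a ha => ?_, fun a b j ha hb hj h => Or.inl ?_, fun j hj => ⟨?_, ?_⟩,
      fun _ h => h.elim⟩
    · rw [hμ.na 14 rfl, hν.na 14 rfl, c2 b (by omega)]
    · rw [hμ.na 15 rfl, hν.na 15 rfl, row a (by omega)]
    · obtain ⟨j', h1, h2⟩ := (hJ _).1 h
      obtain ⟨h3, h4, -⟩ := idx_inj hb hj (by omega) h1 h2
      refine ⟨h3, h4, by simp [tV, g7], ?_, ?_⟩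
      · simp [tP, hμ.na 16 rfl, hν.na 16 rfl, hρ.na 16 rfl, hτ.na 16 rfl, h16]
      · simp [tQ, hμ.na 17 rfl, hν.na 17 rfl, hρ.na 17 rfl, hτ.na 17 rfl, h17]
    · exact (hJ _).2 ⟨j, hj, rfl⟩
    · simp [tV, g7]

end PresentBias

namespace PresentBias

open TaskGraph Cmd

variable {n m : ℕ} {G : TaskGraph n m} {b₁ b₂ : ℝ} {k : ℕ} {ord : Fin n → ℕ} {δ : Fin n → ℝ}

/-! ### The program: writing the chunking -/

/-- The memory holds the chunking `C`, and it is free from the position in register 38 on. -/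
structure Allocated (C : Chunking m) (σ : Mem) : Prop where
  out : output m σ = C
  free : ∀ e : Fin m, σ.narr 3 e + σ.narr 2 e ≤ σ.nreg 38

/-- New pieces are written to fresh space from the position in register 38 on. The old pieces of `e`
are abandoned, and those of other edges lie below that position. -/
theorem Allocated.update {C : Chunking m} {σ τ : Mem} (h : Allocated C σ) {e : Fin m} {L : List ℝ}
    (h2 : τ.narr 2 e = L.length) (h3 : τ.narr 3 e = σ.nreg 38)
    (h38 : τ.nreg 38 = σ.nreg 38 + L.length)
    (h2' : ∀ f : ℕ, f ≠ e → τ.narr 2 f = σ.narr 2 f) (h3' : ∀ f : ℕ, f ≠ e → τ.narr 3 f = σ.narr 3 f)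
    (h1' : ∀ p < σ.nreg 38, τ.rarr 1 p = σ.rarr 1 p)
    (h1 : ∀ i (hi : i < L.length), τ.rarr 1 (σ.nreg 38 + i) = L[i]) :
    Allocated (Function.update C e L) τ := by
  constructor
  · ext1 f
    by_cases hf : f = e
    · subst hf
      rw [Function.update_self, output, h2, h3]
      refine List.ext_getElem (by simp) fun i hi hi' => ?_
      simp [h1 i hi']
    · have hf' : (f : ℕ) ≠ e := fun h => hf (Fin.ext h)
      rw [Function.update_of_ne hf, ← h.out, output, output, h2' _ hf', h3' _ hf']
      refine List.map_congr_left fun i hi => h1' _ ?_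
      have := h.free f
      rw [List.mem_range] at hi
      omega
  · intro f
    by_cases hf : f = e
    · subst hf
      omega
    · have hf' : (f : ℕ) ≠ e := fun h => hf (Fin.ext h)
      rw [h2' _ hf', h3' _ hf', h38]
      have := h.free f
      omega

def Cmd.keepsOutput (c : Cmd) : Bool := c.keepsNA 2 && c.keepsNA 3 && c.keepsRA 1 && c.keepsN 38

theorem Allocated.keep {C : Chunking m} {c : Cmd} {σ τ : Mem} (h : Allocated C σ) (hk : Keep c σ τ)
    (hc : c.keepsOutput = true) : Allocated C τ := by
  simp only [Cmd.keepsOutput, Bool.and_eq_true] at hc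
  obtain ⟨⟨⟨h2, h3⟩, h1⟩, h38⟩ := hc
  refine ⟨?_, by rw [hk.na _ h2, hk.na _ h3, hk.n _ h38]; exact h.free⟩
  rw [← h.out]
  ext1 e
  simp only [output, hk.na _ h2, hk.na _ h3, hk.ra _ h1]

/-- Write every edge in one piece. -/
def plainCmd : Cmd :=
  upTo 5 (nr 1) (nput 2 (nr 5) (nl 1) ;; nput 3 (nr 5) (nr 5) ;; rput 1 (nr 5) (ra 0 (nr 5))) ;;
  nset 38 (nr 1)

theorem plainCmd_runs {σ : Mem} (h : HasInput G b₁ b₂ k σ) :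
    Runs plainCmd σ (m * 30 + 20) (Allocated fun e => [G.cost e]) := by
  refine Runs.le (s := (m * 30 + 10) + 2) ?_ (by omega)
  refine Runs.seq' (R := fun τ => ∀ j < m, τ.narr 2 j = 1 ∧ τ.narr 3 j = j ∧ τ.rarr 1 j = σ.rarr 0 j) ?_
    fun τ hτ h1 => ?_
  · refine Runs.forEach (fun j τ => τ.narr 2 j = 1 ∧ τ.narr 3 j = j ∧ τ.rarr 1 j = σ.rarr 0 j) (N := m)
      (t := 12) rfl (fun τ hτ => by simp [(h.keep hτ rfl).regM]) (fun _ _ _ h => h)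
      (fun j hj τ hτ hi => .flat rfl (by decide) fun _ => ?_) (by simp only [NExp.size]; omega)
      fun τ _ h => h
    refine ⟨by simp [hi, hτ.ra 0 rfl], fun l hl h => ?_⟩
    simpa [hi, hl] using h
  · have i1 := h.keep hτ rfl
    refine .flat rfl (by decide) fun _ => ⟨?_, fun e => ?_⟩
    · ext1 e
      simp [output, (h1 e e.2).1, (h1 e e.2).2.1, (h1 e e.2).2.2, h.cost]
    · simp [(h1 e e.2).1, (h1 e e.2).2.1, i1.regM]

def loadBoth (a a' : ℕ) : Cmd :=
  rset 71 (ra (10 + a) (nr 31)) ;; rset 72 (ra (10 + a') (nr 31)) ;; rset 73 (ra 12 (nr 31)) ;;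
  rset 74 (ra 2 (na 1 (nr 31))) ;; thrInit 70 (biasX a) (biasX a')

/-- Write the edge at register 31 in the number of pieces at register 40, starting with the piece at
register 66. -/
def writeCmd (a a' : ℕ) : Cmd :=
  (loadBoth a a' ;; rset 67 (rl 0)) ;;
  upTo 41 (.sub (nr 40) (nl 1)) ((rmin 68 (.sub (ra 0 (nr 31)) (rr 66)) (rr 70) ;;
    rput 1 (.add (nr 38) (.sub (.sub (nr 40) (nl 1)) (nr 41))) (.sub (rr 68) (rr 67)) ;;
    rset 67 (rr 68)) ;; thrStep 70 (biasX a) (biasX a')) ;;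
  rput 1 (nr 38) (.sub (ra 0 (nr 31)) (rr 67)) ;; nput 3 (nr 31) (nr 38) ;; nput 2 (nr 31) (nr 40) ;;
  nset 38 (.add (nr 38) (nr 40))

theorem Ready.run_loadBoth {σ : Mem} (h : Ready G b₁ b₂ k ord δ σ) {a a' : ℕ} (ha : a < 3) (ha' : a' < 3)
    {e : Fin m} (h31 : σ.nreg 31 = e) : ThrAt 70 (biasX a) (biasX a') (bias b₁ b₂ a)
      (G.altMin (bound G b₂) δ (bias b₁ b₂ a) e) (bias b₁ b₂ a')
      (G.altMin (bound G b₂) δ (bias b₁ b₂ a') e) (G.altMin (bound G b₂) δ 1 e) (δ (G.head e)) 0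
      ((loadBoth a a').run σ) := by
  have hX : ∀ (a : ℕ) (w : ℝ) (r' : ℕ) (σ : Mem), 2 ≤ r' →
      (biasX a).eval (σ.setR r' w) = (biasX a).eval σ := by
    intro a w r' σ hr'
    rcases a with _ | _ | _ <;> simp [biasX] <;> omega
  refine ThrAt.init (by omega) ?_ ?_ ?_ ?_ ?_ ?_
  any_goals simp [h31, (h.alts a ha).min, (h.alts a' ha').min, h.altOne, h.inp.head, h.dist.dist]
  all_goals
    rw [hX _ _ _ _ (by omega), hX _ _ _ _ (by omega), hX _ _ _ _ (by omega), hX _ _ _ _ (by omega)]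
    exact h.inp.eval_biasX _

/-- The values of `reach` are produced by increasing index, which belongs to decreasing position in
the edge. So the pieces are written from the last to the second, register 67 holding the cost that
remains after the current piece, and the first piece is what is left. With `l = 1` the loop is empty
and the whole cost is written. -/
theorem writeCmd_runs {a a' : ℕ} (ha : a < 2) (ha' : a' < 2) {σ : Mem} (h : Ready G b₁ b₂ k ord δ σ)
    {C : Chunking m} (hA : Allocated C σ) {e : Fin m} {l : ℕ} {x : ℝ} (h31 : σ.nreg 31 = e)
    (h40 : σ.nreg 40 = l) (hl : 1 ≤ l) (h66 : σ.rreg 66 = x) :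
    Runs (writeCmd a a') σ (120 * l + 120) (Allocated (Function.update C e
      (pieces (G.cost e) x (G.reach (bound G b₂) δ (bias b₁ b₂ a) (bias b₁ b₂ a') e) l))) := by
  set t := G.reach (bound G b₂) δ (bias b₁ b₂ a) (bias b₁ b₂ a') e with ht
  set rem := remain (G.cost e) x t l with hrem
  have hfl : (loadBoth a a' ;; rset 67 (rl 0)).flat = true := by
    interval_cases a <;> interval_cases a' <;> rfl
  have hcost : (loadBoth a a' ;; rset 67 (rl 0)).cost ≤ 50 := by
    interval_cases a <;> interval_cases a' <;> decide
  have hkO : (loadBoth a a' ;; rset 67 (rl 0)).keepsOutput = true := by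
    interval_cases a <;> interval_cases a' <;> rfl
  have hkP : (loadBoth a a' ;; rset 67 (rl 0)).keepsReady = true := by
    interval_cases a <;> interval_cases a' <;> rfl
  have hk31 : ∀ r ∈ [31, 40, 38], (loadBoth a a' ;; rset 67 (rl 0)).keepsN r = true := by
    interval_cases a <;> interval_cases a' <;> decide
  have hk66 : (loadBoth a a' ;; rset 67 (rl 0)).keepsR 66 = true := by
    interval_cases a <;> interval_cases a' <;> rfl
  have hk0 : (rset 67 (rl 0)).keepsR 0 = true ∧ (rset 67 (rl 0)).keepsR 1 = true := ⟨rfl, rfl⟩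
  refine Runs.le (s := 50 + ((l * 90 + 30) + 30)) ?_ (by omega)
  refine Runs.seq' (R := fun τ => ThrAt 70 (biasX a) (biasX a') (bias b₁ b₂ a)
      (G.altMin (bound G b₂) δ (bias b₁ b₂ a) e) (bias b₁ b₂ a')
      (G.altMin (bound G b₂) δ (bias b₁ b₂ a') e) (G.altMin (bound G b₂) δ 1 e) (δ (G.head e)) 0 τ ∧
      τ.rreg 67 = 0) (.flat hfl hcost fun _ => ?_) fun τ hτ h1 => ?_
  · refine ⟨?_, by simp⟩
    have h1 := h.run_loadBoth (a := a) (a' := a') (by omega) (by omega) h31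
    rw [run_seq]
    have hK : Keep (rset 67 (rl 0)) ((loadBoth a a').run σ)
        ((rset 67 (rl 0)).run ((loadBoth a a').run σ)) :=
      (Exec.rset 67 (rl 0) _).keep
    exact h1.keep hK rfl rfl rfl rfl rfl rfl rfl
  have r1 := h.keep hτ hkP
  have A1 := hA.keep hτ hkO
  have g31 : τ.nreg 31 = e := by rw [hτ.n 31 (hk31 31 (by simp)), h31]
  have g40 : τ.nreg 40 = l := by rw [hτ.n 40 (hk31 40 (by simp)), h40]
  have g66 : τ.rreg 66 = x := by rw [hτ.r 66 hk66, h66]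
  set p := τ.nreg 38 with hp
  refine Runs.seq' (R := fun ρ => ρ.rreg 67 = (if l = 1 then 0 else rem 1) ∧
      (∀ i, 1 ≤ i → i < l → ρ.rarr 1 (p + i) = rem i - rem (i + 1)) ∧
      ∀ q < p, ρ.rarr 1 q = τ.rarr 1 q) ?_ fun ρ hρ h2 => ?_
  · refine Runs.upTo' (fun j ρ => ThrAt 70 (biasX a) (biasX a') (bias b₁ b₂ a)
      (G.altMin (bound G b₂) δ (bias b₁ b₂ a) e) (bias b₁ b₂ a')
      (G.altMin (bound G b₂) δ (bias b₁ b₂ a') e) (G.altMin (bound G b₂) δ 1 e) (δ (G.head e)) j ρ ∧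
      ρ.rreg 67 = rem (l - j) ∧ (∀ i, l - j ≤ i → i < l → ρ.rarr 1 (p + i) = rem i - rem (i + 1)) ∧
      ∀ q < p, ρ.rarr 1 q = τ.rarr 1 q) (N := l - 1) (t := 74) ?_ (fun ρ hρ => ?_) ?_
      (fun j hj ρ hρ hρj hJ => ?_) ?_ fun ρ hρ hJ => ?_
    · interval_cases a <;> interval_cases a' <;> rfl
    · have : ρ.nreg 40 = l := by
        rw [hρ.n 40 (by interval_cases a <;> interval_cases a' <;> rfl), g40]
      simp [this]
    · refine ⟨h1.1.setN _ _, ?_, fun i hi hi' => by omega, fun _ _ => rfl⟩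
      simp [h1.2, hrem, remain, show l ≠ 0 by omega]
    · obtain ⟨J1, J2, J3, J4⟩ := hJ
      have f40 : ρ.nreg 40 = l := by
        rw [hρ.n 40 (by interval_cases a <;> interval_cases a' <;> rfl), g40]
      have f31 : ρ.nreg 31 = e := by
        rw [hρ.n 31 (by interval_cases a <;> interval_cases a' <;> rfl), g31]
      have f38 : ρ.nreg 38 = p := by
        rw [hρ.n 38 (by interval_cases a <;> interval_cases a' <;> rfl)]
      have f66 : ρ.rreg 66 = x := by
        rw [hρ.r 66 (by interval_cases a <;> interval_cases a' <;> rfl), g66]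
      have fr := r1.keep hρ (by interval_cases a <;> interval_cases a' <;> rfl)
      have hr : rem (l - 1 - j) = min (G.cost e - x) (t j) := by
        rw [hrem, remain, if_neg (by omega), if_pos (by omega), show l - 1 - (l - 1 - j) = j by omega]
      have hv : ρ.rreg 70 = t j := J1.val
      refine Runs.le (Runs.seq' (s := 30) (t := 44)
        (R := fun ν => ν.rreg 67 = rem (l - 1 - j) ∧
          ν.rarr 1 (p + (l - 1 - j)) = rem (l - 1 - j) - rem (l - j) ∧
          ∀ q, q ≠ p + (l - 1 - j) → ν.rarr 1 q = ρ.rarr 1 q) (.flat rfl (by decide) fun _ => ?_)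
        fun ν hν h3 => ?_) (by omega)
      · refine ⟨?_, ?_, fun q hq => ?_⟩
        · simp [f31, fr.inp.cost, f66, hv, hr]
        · simp [f31, fr.inp.cost, f66, hv, hr, f38, f40, hρj, J2]
        · simp [f31, fr.inp.cost, f66, hv, f38, f40, hρj, J2, hq]
      · have T1 := J1.keep hν rfl rfl rfl rfl rfl rfl rfl
        have T2 := T1.step (by omega)
        refine Runs.flat (by interval_cases a <;> interval_cases a' <;> rfl)
          (by interval_cases a <;> interval_cases a' <;> decide) fun hK => ⟨T2.setN _ _, ?_, ?_, ?_⟩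
        · rw [Mem.setN_rreg, hK.r 67 (by interval_cases a <;> interval_cases a' <;> rfl), h3.1]
          congr 1
          omega
        · intro i hi hi'
          rw [Mem.setN_rarr, hK.ra 1 (by interval_cases a <;> interval_cases a' <;> rfl)]
          by_cases hij : i = l - 1 - j
          · rw [hij, h3.2.1, show l - 1 - j + 1 = l - j by omega]
          · rw [h3.2.2 _ (by omega), J3 i (by omega) hi']
        · intro q hq
          rw [Mem.setN_rarr, hK.ra 1 (by interval_cases a <;> interval_cases a' <;> rfl),
            h3.2.2 _ (by omega), J4 q hq]
    · simp only [NExp.size]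
      have : (l - 1) * (74 + (1 + 1 + 1 + 8)) ≤ l * (74 + (1 + 1 + 1 + 8)) :=
        Nat.mul_le_mul_right _ (by omega)
      omega
    · obtain ⟨-, J2, J3, J4⟩ := hJ
      refine ⟨?_, fun i hi hi' => J3 i (by omega) hi', J4⟩
      rw [J2, show l - (l - 1) = 1 by omega]
      split_ifs with h
      · simp [hrem, remain, h]
      · rfl
  have hkL : ∀ r ∈ [31, 40, 38], (upTo 41 (.sub (nr 40) (nl 1))
      ((rmin 68 (.sub (ra 0 (nr 31)) (rr 66)) (rr 70) ;;
    rput 1 (.add (nr 38) (.sub (.sub (nr 40) (nl 1)) (nr 41))) (.sub (rr 68) (rr 67)) ;;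
    rset 67 (rr 68)) ;; thrStep 70 (biasX a) (biasX a'))).keepsN r = true := by
    interval_cases a <;> interval_cases a' <;> decide
  have f40 : ρ.nreg 40 = l := by rw [hρ.n 40 (hkL 40 (by simp)), g40]
  have f31 : ρ.nreg 31 = e := by rw [hρ.n 31 (hkL 31 (by simp)), g31]
  have f38 : ρ.nreg 38 = p := by rw [hρ.n 38 (hkL 38 (by simp))]
  have fr := r1.keep hρ (by interval_cases a <;> interval_cases a' <;> rfl)
  have e2 : ρ.narr 2 = τ.narr 2 := hρ.na 2 (by interval_cases a <;> interval_cases a' <;> rfl)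
  have e3 : ρ.narr 3 = τ.narr 3 := hρ.na 3 (by interval_cases a <;> interval_cases a' <;> rfl)
  obtain ⟨k1, k2, k3⟩ := h2
  refine Runs.flat rfl (by decide) fun _ => A1.update ?_ ?_ ?_ ?_ ?_ ?_ ?_
  · simp [f31, f40]
  · simp [f31, f38, ← hp]
  · simp [f38, f40, ← hp]
  · intro f hf
    simp [f31, e2, hf]
  · intro f hf
    simp [f31, e3, hf]
  · intro q hq
    simp [f38, show q ≠ p by omega, k3 q hq]
  · intro i hi
    rw [length_pieces] at hi
    have : (pieces (G.cost e) x t l)[i]'(by simpa using hi) = rem i - rem (i + 1) := by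
      simp [pieces, hrem]
    rw [this, ← hp]
    by_cases hi0 : i = 0
    · subst hi0
      have h0 : rem 0 = G.cost e := by simp [hrem, remain]
      have h1 : (if l = 1 then 0 else rem 1) = rem 1 := by
        split_ifs with h
        · simp [hrem, remain, h]
        · rfl
      simp [f38, k1, f31, fr.inp.cost, h0, h1]
    · simp [f38, k2 i (by omega) hi, hi0]

/-- Write the edge with index one less than register 15 in two pieces. -/
def halfCmd : Cmd :=
  nset 31 (.sub (nr 15) (nl 1)) ;; rput 1 (nr 38) (rr 22) ;;
  rput 1 (.add (nr 38) (nl 1)) (.sub (ra 0 (nr 31)) (rr 22)) ;;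
  nput 3 (nr 31) (nr 38) ;; nput 2 (nr 31) (nl 2) ;; nset 38 (.add (nr 38) (nl 2))

theorem halfCmd_runs {σ : Mem} (h : HasInput G b₁ b₂ k σ) {C : Chunking m} (hA : Allocated C σ)
    {g : Fin m} (h15 : σ.nreg 15 = g + 1) :
    Runs halfCmd σ 60 (Allocated (Function.update C g [σ.rreg 22, G.cost g - σ.rreg 22])) := by
  refine Runs.flat rfl (by decide) fun _ => hA.update ?_ ?_ ?_ ?_ ?_ ?_ ?_
  · simp [halfCmd, h15]
  · simp [halfCmd, h15]
  · simp [halfCmd, h15]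
  · intro f hf
    simp [halfCmd, h15, hf]
  · intro f hf
    simp [halfCmd, h15, hf]
  · intro q hq
    simp [halfCmd, h15, show q ≠ σ.nreg 38 by omega, show q ≠ σ.nreg 38 + 1 by omega]
  · intro i hi
    have : i = 0 ∨ i = 1 := by simp at hi; omega
    rcases this with rfl | rfl <;> simp [halfCmd, h15, h.cost]

end PresentBias

namespace PresentBias

open TaskGraph Cmd

variable {n m : ℕ} {G : TaskGraph n m} {b₁ b₂ : ℝ} {k : ℕ} {ord : Fin n → ℕ} {δ : Fin n → ℝ}

/-! ### Following the table -/

/-- Paths from `u` and `v` that the agents take under `C`, of total cost `c`. -/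
def Carries (G : TaskGraph n m) (b₁ b₂ : ℝ) (C : Chunking m) (u v : Fin n) (c : ℝ) : Prop :=
  ∃ P Q, G.IsPath u P ∧ G.IsPath v Q ∧ (∀ e ∈ P, G.Travels C b₁ e) ∧ (∀ e ∈ Q, G.Travels C b₂ e) ∧
    G.pathCost P + G.pathCost Q = c

/-- The chunking `C` brings the agents from the source to `u` and `v`, and `j` chunks are left. -/
structure Trace (G : TaskGraph n m) (b₁ b₂ : ℝ) (k : ℕ) (ord : Fin n → ℕ)
    (F : ℕ → ℕ → ℕ → Prop) (V : ℕ → ℕ → ℕ → ℝ) (u v : Fin n) (j : ℕ) (C : Chunking m) : Prop where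
  mem : F (ord u) (ord v) j
  chunking : G.IsChunking C
  used : chunksUsed C + j ≤ k
  plain : ∀ e, ord (G.tail e) ≤ max (ord u) (ord v) → C e = [G.cost e]
  extend : ∀ C' c, G.IsChunking C' → (∀ e, max (ord u) (ord v) < ord (G.tail e) → C' e = C e) →
    Carries G b₁ b₂ C' u v c → Carries G b₁ b₂ C' G.source G.source
      (V (ord G.source) (ord G.source) k - V (ord u) (ord v) j + c)

variable {F : ℕ → ℕ → ℕ → Prop} {V : ℕ → ℕ → ℕ → ℝ}

theorem Trace.start (hF : F (ord G.source) (ord G.source) k) :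
    Trace G b₁ b₂ k ord F V G.source G.source k fun e => [G.cost e] where
  mem := hF
  chunking e := by simp [G.cost_nonneg e]
  used := by simp [chunksUsed]
  plain _ _ := rfl
  extend C' c _ _ h := by simpa using h

/-- The edges out of `x` have been undivided so far, and later steps touch only edges whose tails
have smaller numbers. So the agents' behavior at `x` is the same in every final chunking. This is
why `extend` speaks of all chunkings that agree with the present one above the current level. -/
theorem Trace.step {u v u' v' x : Fin n} {j w : ℕ} {c : ℝ} {C C₂ : Chunking m}
    (h : Trace G b₁ b₂ k ord F V u v j C) (hx : ord x = max (ord u) (ord v))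
    (hlt : max (ord u') (ord v') < ord x) (hF : F (ord u') (ord v') (j - w)) (hw : w ≤ j)
    (hV : V (ord u) (ord v) j = c + V (ord u') (ord v') (j - w))
    (hC : ∀ e, G.tail e ≠ x → C₂ e = C e)
    (hC₂ : ∀ e, G.tail e = x → C₂ e ≠ [] ∧ (∀ y ∈ C₂ e, 0 ≤ y) ∧ (C₂ e).sum = G.cost e)
    (hu : G.IsChunking C₂ → G.use C₂ x ≤ w)
    (hcar : ∀ C' c', G.IsChunking C' → (∀ e, G.tail e = x → C' e = C₂ e) →
      Carries G b₁ b₂ C' u' v' c' → Carries G b₁ b₂ C' u v (c + c')) :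
    Trace G b₁ b₂ k ord F V u' v' (j - w) C₂ := by
  have hch : G.IsChunking C₂ := fun e => by
    by_cases he : G.tail e = x
    · exact hC₂ e he
    · rw [hC e he]
      exact h.chunking e
  refine ⟨hF, hch, ?_, fun e he => ?_, fun C' c' hC' hag hc => ?_⟩
  · have h1 := chunksUsed_le (G := G) hC
    have h2 := hu hch
    have h3 := h.used
    omega
  · have hne : G.tail e ≠ x := fun h => by rw [h] at he; omega
    rw [hC e hne]
    exact h.plain e (by omega)
  · have h1 := hcar C' c' hC' (fun e he => hag e (by rw [he]; omega)) hc
    have h2 := h.extend C' _ hC' (fun e he => ?_) h1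
    · rw [hV] at h2
      convert h2 using 1
      ring
    · have hne : G.tail e ≠ x := fun h => by rw [h] at he; omega
      rw [hag e (by omega), hC e hne]

theorem TaskGraph.Layout.optimal_of_trace {β B : ℝ} (D : Layout G β B ord δ) (hb : 1 < b₁) (hbβ : b₁ ≤ β)
    (hb' : 1 < b₂) (hbβ' : b₂ ≤ β) (hT : Complete G B ord δ k b₁ b₂ F V) {j : ℕ} {C : Chunking m}
    (h : Trace G b₁ b₂ k ord F V G.sink G.sink j C) (hV : V (ord G.sink) (ord G.sink) j = 0) :
    G.IsOptimal C b₁ b₂ k := by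
  obtain ⟨P, Q, hP, hQ, tP, tQ, hc⟩ := h.extend C 0 h.chunking (fun _ _ => rfl)
    ⟨[], [], rfl, rfl, by simp, by simp, by simp [pathCost]⟩
  refine D.isOptimal hb hbβ hb' hbβ' hT h.chunking hP hQ tP tQ ?_ ?_
  · have := h.used
    omega
  · rw [hc, hV]
    ring

/-- There are paths from the vertices of an entry of the table. -/
theorem Sound.exists_path (D : Layout G b₂ (bound G b₂) ord δ) {s : ℕ} {σ : Mem}
    (hS : Sound G b₁ b₂ k ord δ s σ) {a b j : ℕ} (ha : a < m + 2) (hb : b < m + 2) (hj : j < k + 1)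
    (hF : tF m k σ a b j) : (∃ u P, ord u = a ∧ G.IsPath u P) ∧ ∃ v Q, ord v = b ∧ G.IsPath v Q := by
  have key : ∀ {e : Fin m}, (∃ u P, ord u = ord (G.head e) ∧ G.IsPath u P) →
      ∃ u P, ord u = ord (G.tail e) ∧ G.IsPath u P := by
    rintro e ⟨u, P, hu, hP⟩
    obtain rfl := D.inj _ _ hu (by
      rcases P with _ | ⟨f, P⟩
      · exact Or.inl hP
      · exact Or.inr ⟨f, hP.1⟩)
    exact ⟨_, e :: P, rfl, rfl, hP⟩
  induction hs : max a b using Nat.strong_induction_on generalizing a b j with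
  | _ s ih =>
    subst hs
    rcases hS a b j ha hb hj hF with ⟨rfl, rfl, -⟩ | ⟨-, e, a', b', w, c, hR, hw, hF', -⟩
    · exact ⟨⟨_, [], rfl, rfl⟩, ⟨_, [], rfl, rfl⟩⟩
    · obtain ⟨h1, h2⟩ := hR.level D
      have h3 := ih _ h2 (by omega) (by omega) (by omega) hF' rfl
      generalize tP m k σ a b j = p at hR
      generalize tQ m k σ a b j = q at hR
      cases hR with
      | left => exact ⟨key h3.1, h3.2⟩
      | right => exact ⟨h3.1, key h3.2⟩
      | both f _ ht _ =>
        have h4 := key h3.2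
        rw [ht] at h4
        exact ⟨key h3.1, h4⟩

/-- The description of the agents' choices assumes that the sink can be reached; the existence of a
table entry guarantees it. -/
theorem Sound.alive (D : Layout G b₂ (bound G b₂) ord δ) {s : ℕ} {σ : Mem}
    (hS : Sound G b₁ b₂ k ord δ s σ) {a b j : ℕ} (ha : a < m + 2) (hb : b < m + 2) (hj : j < k + 1)
    (hF : tF m k σ a b j) {e : Fin m} (he : ord (G.head e) = a ∨ ord (G.head e) = b) :
    Alive G (bound G b₂) δ (G.tail e) := by
  obtain ⟨⟨u, P, hu, hP⟩, v, Q, hv, hQ⟩ := hS.exists_path D ha hb hj hF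
  have key : ∀ {u : Fin n} {P : List (Fin m)}, ord u = ord (G.head e) → G.IsPath u P →
      Alive G (bound G b₂) δ (G.tail e) := by
    intro u P hu hP
    obtain rfl := D.inj _ _ hu (by
      rcases P with _ | ⟨f, P⟩
      · exact Or.inl hP
      · exact Or.inr ⟨f, hP.1⟩)
    exact D.alive_of_isPath hP
  rcases he with he | he
  · exact key (by omega) hP
  · exact key (by omega) hQ

section

variable {B : ℝ} (D : Layout G b₂ B ord δ) (hb : 1 < b₁) (hbb : b₁ < b₂) {u v : Fin n} {j w : ℕ}
  {c : ℝ} {C C₂ : Chunking m} (h : Trace G b₁ b₂ k ord F V u v j C) (hw : w ≤ j)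
include D hb hbb h hw

theorem Trace.left {e : Fin m} (hu : G.tail e = u) (hlt : ord v < ord u)
    (hF : F (ord (G.head e)) (ord v) (j - w)) (hal : Alive G B δ u)
    (hV : V (ord u) (ord v) j = G.cost e + V (ord (G.head e)) (ord v) (j - w)) {l : ℕ}
    (hp : SoloPlan G B δ k b₁ b₁ e l w) (hC : ∀ f, f ≠ e → C₂ f = C f)
    (hW : Written G B δ C₂ b₁ b₁ e l (G.maxFirst B δ b₁ b₁ e)) :
    Trace G b₁ b₂ k ord F V (G.head e) v (j - w) C₂ := by
  subst hu
  have D' := D.toIsDist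
  have ho := D'.ord_lt e
  have hl : ∀ f, f ≠ e → G.tail f = G.tail e → C₂ f = [G.cost f] := fun f hf ht => by
    rw [hC f hf]
    exact h.plain f (by rw [ht]; omega)
  refine h.step (x := G.tail e) (by omega) (by omega) hF hw hV
    (fun f hf => hC f fun h => hf (by rw [h])) (fun f hf => ?_) (fun hch => ?_)
    fun C' c' hC' hag hc => ?_
  · by_cases hfe : f = e
    · subst hfe
      exact IsDist.soloPlan_isChunking hb hb hp hW
    · rw [hl f hfe hf]
      simp [G.cost_nonneg f]
  · exact (D'.travels_of_soloPlan hb hbb.le hb hbb.le hch hal hp hW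
      fun f hf ht => by rw [hl f hf ht]; rfl).2.2
  · obtain ⟨P, Q, hP, hQ, tP, tQ, rfl⟩ := hc
    have ht := D'.travels_of_soloPlan hb hbb.le hb hbb.le hC' hal hp
      (by rw [Written, hag e rfl]; exact hW) fun f hf ht => by rw [hag f ht, hl f hf ht]; rfl
    refine ⟨e :: P, Q, ⟨rfl, hP⟩, hQ, ?_, tQ, by simp [pathCost]; ring⟩
    simpa using ⟨ht.1, tP⟩

theorem Trace.right {e : Fin m} (hv : G.tail e = v) (hlt : ord u < ord v)
    (hF : F (ord u) (ord (G.head e)) (j - w)) (hal : Alive G B δ v)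
    (hV : V (ord u) (ord v) j = G.cost e + V (ord u) (ord (G.head e)) (j - w)) {l : ℕ}
    (hp : SoloPlan G B δ k b₂ b₂ e l w) (hC : ∀ f, f ≠ e → C₂ f = C f)
    (hW : Written G B δ C₂ b₂ b₂ e l (G.maxFirst B δ b₂ b₂ e)) :
    Trace G b₁ b₂ k ord F V u (G.head e) (j - w) C₂ := by
  subst hv
  have D' := D.toIsDist
  have ho := D'.ord_lt e
  have hb' := hb.trans hbb
  have hl : ∀ f, f ≠ e → G.tail f = G.tail e → C₂ f = [G.cost f] := fun f hf ht => by
    rw [hC f hf]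
    exact h.plain f (by rw [ht]; omega)
  refine h.step (x := G.tail e) (by omega) (by omega) hF hw hV
    (fun f hf => hC f fun h => hf (by rw [h])) (fun f hf => ?_) (fun hch => ?_)
    fun C' c' hC' hag hc => ?_
  · by_cases hfe : f = e
    · subst hfe
      exact IsDist.soloPlan_isChunking hb' hb' hp hW
    · rw [hl f hfe hf]
      simp [G.cost_nonneg f]
  · exact (D'.travels_of_soloPlan hb' le_rfl hb' le_rfl hch hal hp hW
      fun f hf ht => by rw [hl f hf ht]; rfl).2.2
  · obtain ⟨P, Q, hP, hQ, tP, tQ, rfl⟩ := hc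
    have ht := D'.travels_of_soloPlan hb' le_rfl hb' le_rfl hC' hal hp
      (by rw [Written, hag e rfl]; exact hW) fun f hf ht => by rw [hag f ht, hl f hf ht]; rfl
    refine ⟨P, e :: Q, hP, ⟨rfl, hQ⟩, tP, ?_, by simp [pathCost]; ring⟩
    simpa using ⟨ht.1, tQ⟩

theorem Trace.same {e : Fin m} (hu : G.tail e = u) (hv : v = u)
    (hF : F (ord (G.head e)) (ord (G.head e)) (j - w)) (hal : Alive G B δ u)
    (hV : V (ord u) (ord v) j =
      G.cost e + G.cost e + V (ord (G.head e)) (ord (G.head e)) (j - w)) {l : ℕ}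
    (hp : SoloPlan G B δ k b₁ b₂ e l w) (hC : ∀ f, f ≠ e → C₂ f = C f)
    (hW : Written G B δ C₂ b₁ b₂ e l (G.maxFirst B δ b₁ b₂ e)) :
    Trace G b₁ b₂ k ord F V (G.head e) (G.head e) (j - w) C₂ := by
  subst hu hv
  have D' := D.toIsDist
  have ho := D'.ord_lt e
  have hb' := hb.trans hbb
  have hl : ∀ f, f ≠ e → G.tail f = G.tail e → C₂ f = [G.cost f] := fun f hf ht => by
    rw [hC f hf]
    exact h.plain f (by rw [ht]; omega)
  refine h.step (x := G.tail e) (by omega) (by omega) hF hw hV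
    (fun f hf => hC f fun h => hf (by rw [h])) (fun f hf => ?_) (fun hch => ?_)
    fun C' c' hC' hag hc => ?_
  · by_cases hfe : f = e
    · subst hfe
      exact IsDist.soloPlan_isChunking hb hb' hp hW
    · rw [hl f hfe hf]
      simp [G.cost_nonneg f]
  · exact (D'.travels_of_soloPlan hb hbb.le hb' le_rfl hch hal hp hW
      fun f hf ht => by rw [hl f hf ht]; rfl).2.2
  · obtain ⟨P, Q, hP, hQ, tP, tQ, rfl⟩ := hc
    have ht := D'.travels_of_soloPlan hb hbb.le hb' le_rfl hC' hal hp
      (by rw [Written, hag e rfl]; exact hW) fun f hf ht => by rw [hag f ht, hl f hf ht]; rfl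
    refine ⟨e :: P, e :: Q, ⟨rfl, hP⟩, ⟨rfl, hQ⟩, ?_, ?_, by simp [pathCost]; ring⟩
    · simpa using ⟨ht.1, tP⟩
    · simpa using ⟨ht.2.1, tQ⟩

theorem Trace.both {e e' : Fin m} (hu : G.tail e = u) (hv : v = u) (hne : e' ≠ e)
    (ht : G.tail e' = G.tail e)
    (hF : F (ord (G.head e)) (ord (G.head e')) (j - w)) (hal : Alive G B δ u)
    (hV : V (ord u) (ord v) j =
      G.cost e + G.cost e' + V (ord (G.head e)) (ord (G.head e')) (j - w)) {l l' f : ℕ} {x y z : ℝ}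
    (hp : PairPlan G B δ k b₁ b₂ e e' l x l' y f z w)
    (hC : ∀ g : Fin m, g ≠ e → g ≠ e' → f ≠ g + 1 → C₂ g = C g)
    (hft : ∀ g : Fin m, f = g + 1 → G.tail g = G.tail e)
    (hW : Written G B δ C₂ b₁ b₁ e l x) (hW' : Written G B δ C₂ b₂ b₂ e' l' y)
    (hf : ∀ g : Fin m, f = g + 1 → Halved G C₂ g z) :
    Trace G b₁ b₂ k ord F V (G.head e) (G.head e') (j - w) C₂ := by
  subst hu hv
  have D' := D.toIsDist
  have ho := D'.ord_lt e
  have ho' := D'.ord_lt e'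
  rw [ht] at ho'
  have hb' := hb.trans hbb
  have hl : ∀ g : Fin m, g ≠ e → g ≠ e' → f ≠ g + 1 → G.tail g = G.tail e → C₂ g = [G.cost g] := by
    intro g h1 h2 h3 h4
    rw [hC g h1 h2 h3]
    exact h.plain g (by rw [h4]; omega)
  refine h.step (x := G.tail e) (by omega) (by omega) hF hw hV
    (fun g hg => hC g ?_ ?_ ?_) (fun g hg => ?_) (fun hch => ?_) fun C' c' hC' hag hc => ?_
  · rintro rfl; exact hg rfl
  · rintro rfl; exact hg ht
  · exact fun h => hg (hft g h)
  · have h1 := IsDist.pairPlan_isChunking hb hb' hp hW hW' hf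
    by_cases hge : g = e
    · rw [hge]; exact h1.1
    by_cases hge' : g = e'
    · rw [hge']; exact h1.2.1
    by_cases hgf : f = g + 1
    · exact h1.2.2 g hgf
    · rw [hl g hge hge' hgf hg]
      simp [G.cost_nonneg g]
  · exact (D'.travels_of_pairPlan hb hbb.le hb' le_rfl hch hne ht hal hp hW hW' hf
      fun g h1 h2 h3 h4 => by rw [hl g h1 h2 h3 h4]; rfl).2.2
  · obtain ⟨P, Q, hP, hQ, tP, tQ, rfl⟩ := hc
    have ht' := D'.travels_of_pairPlan hb hbb.le hb' le_rfl hC' hne ht hal hp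
      (by rw [Written, hag e rfl]; exact hW) (by rw [Written, hag e' ht]; exact hW')
      (fun g hg => by rw [Halved, hag g (hft g hg)]; exact hf g hg)
      fun g h1 h2 h3 h4 => by rw [hag g h4, hl g h1 h2 h3 h4]; rfl
    refine ⟨e :: P, e' :: Q, ⟨rfl, hP⟩, ⟨ht, hQ⟩, ?_, ?_, by simp [pathCost]; ring⟩
    · simpa using ⟨ht'.1, tP⟩
    · simpa using ⟨ht'.2.1, tQ⟩

end

end PresentBias

namespace PresentBias

open TaskGraph Cmd

variable {n m : ℕ} {G : TaskGraph n m} {b₁ b₂ : ℝ} {k : ℕ} {ord : Fin n → ℕ} {δ : Fin n → ℝ}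

/-! ### The program: following the table -/

/-- With equations instead of indices the rules can be applied where the numbers are of the form
`ord u` and `ord v`, on which a case distinction would not unify. -/
theorem Rule.elim {e : Fin m} {a b a' b' w p q : ℕ} {c : ℝ}
    (h : Rule G b₁ b₂ k ord δ e a b a' b' w c p q) :
    (a = ord (G.tail e) ∧ b < ord (G.tail e) ∧ a' = ord (G.head e) ∧ b' = b ∧ c = G.cost e ∧
      p = e + 1 ∧ q = 0 ∧ IsLeast (G.soloSet (bound G b₂) δ k b₁ b₁ e) w) ∨
    (b = ord (G.tail e) ∧ a < ord (G.tail e) ∧ a' = a ∧ b' = ord (G.head e) ∧ c = G.cost e ∧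
      p = 0 ∧ q = e + 1 ∧ IsLeast (G.soloSet (bound G b₂) δ k b₂ b₂ e) w) ∨
    ∃ e', G.tail e' = G.tail e ∧ a = ord (G.tail e) ∧ b = ord (G.tail e) ∧ a' = ord (G.head e) ∧
      b' = ord (G.head e') ∧ c = G.cost e + G.cost e' ∧ p = e + 1 ∧ q = e' + 1 ∧
      IsLeast (G.pairSet (bound G b₂) δ k b₁ b₂ e e') w := by
  cases h with
  | left _ _ hb hl => exact Or.inl ⟨rfl, hb, rfl, rfl, rfl, rfl, rfl, hl⟩
  | right _ _ hb hl => exact Or.inr (Or.inl ⟨rfl, hb, rfl, rfl, rfl, rfl, rfl, hl⟩)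
  | both e' _ ht hl => exact Or.inr (Or.inr ⟨e', ht, rfl, rfl, rfl, rfl, rfl, rfl, rfl, hl⟩)

/-- Write the edge at register 31 such that agents take it, for as few chunks as possible. -/
def soloWriteCmd (a a' s : ℕ) : Cmd :=
  (nset 24 (.sub (na (29 + s) (nr 31)) (nl 1)) ;;
    ite (.nle (nl 1) (nr 24)) (nset 40 (nr 24)) (nset 40 (nl 1)) ;;
    rset 66 (ra (13 + s) (nr 31))) ;; writeCmd a a'

/-- The number of pieces is recovered from the number `w` of chunks: one piece if `w = 0`, otherwise
`w` pieces. -/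
theorem soloWriteCmd_runs {a a' s : ℕ} (ha : a < 2) (ha' : a' < 2) (hs : s < 3) {σ : Mem}
    (h : Ready G b₁ b₂ k ord δ σ) {C : Chunking m} (hA : Allocated C σ) {e : Fin m}
    (h31 : σ.nreg 31 = e) (hS : SoloAt G b₁ b₂ k δ a a' s e σ) {w : ℕ}
    (hw : IsLeast (G.soloSet (bound G b₂) δ k (bias b₁ b₂ a) (bias b₁ b₂ a') e) w) :
    Runs (soloWriteCmd a a' s) σ (120 * k + 300) fun τ => τ.nreg 24 = w ∧ ∃ l C₂,
      SoloPlan G (bound G b₂) δ k (bias b₁ b₂ a) (bias b₁ b₂ a') e l w ∧ Allocated C₂ τ ∧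
      (∀ f, f ≠ e → C₂ f = C f) ∧
      Written G (bound G b₂) δ C₂ (bias b₁ b₂ a) (bias b₁ b₂ a') e l
        (G.maxFirst (bound G b₂) δ (bias b₁ b₂ a) (bias b₁ b₂ a') e) := by
  have hplan : ∃ l, SoloPlan G (bound G b₂) δ k (bias b₁ b₂ a) (bias b₁ b₂ a') e l w ∧
      l = (if 1 ≤ w then w else 1) ∧ l ≤ k + 1 ∧ 1 ≤ l := by
    obtain ⟨l, hl⟩ := hw.1
    refine ⟨l, hl, ?_⟩
    rcases hl with ⟨rfl, rfl, -⟩ | ⟨h1, h2, rfl⟩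
    · simp
    · have := h1.1
      rw [if_pos (by omega)]
      omega
  obtain ⟨l, hl, hlw, hlk, hl1⟩ := hplan
  have hc := (hS.code w).2 hw
  refine Runs.le (s := 25 + (120 * l + 120)) ?_ (by omega)
  refine Runs.seq' (R := fun τ => τ.nreg 24 = w ∧ τ.nreg 40 = l ∧
      τ.rreg 66 = G.maxFirst (bound G b₂) δ (bias b₁ b₂ a) (bias b₁ b₂ a') e)
    (.flat rfl (by interval_cases s <;> decide) fun _ => ?_) fun τ hτ h1 => ?_
  · simp only [run_seq, run_nset, run_ite, run_rset, NExp.eval_sub, NExp.eval_get, NExp.eval_reg,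
      NExp.eval_lit, BExp.eval_nle, RExp.eval_get, h31, hc, Nat.add_sub_cancel, Mem.setN_nreg, if_true]
    rw [← hS.first, hlw]
    split_ifs <;> simp [h31]
  · have hkO : ((nset 24 (.sub (na (29 + s) (nr 31)) (nl 1)) ;;
      ite (.nle (nl 1) (nr 24)) (nset 40 (nr 24)) (nset 40 (nl 1)) ;;
      rset 66 (ra (13 + s) (nr 31)))).keepsOutput = true := rfl
    refine (writeCmd_runs ha ha' (h.keep hτ rfl) (hA.keep hτ hkO) (by rw [hτ.n 31 rfl, h31]) h1.2.1 hl1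
      h1.2.2).imp fun ρ hρ h2 => ⟨?_, l, _, hl, h2, fun f hf => Function.update_of_ne hf _ _, ?_⟩
    · rw [hρ.n 24 (by interval_cases a <;> interval_cases a' <;> rfl), h1.1]
    · refine ⟨fun h => ?_, fun h => ?_⟩
      · rw [Function.update_self, h]
        simp [pieces, remain]
      · rw [Function.update_self]

theorem TaskGraph.PairPlan.facts {B : ℝ} {e e' : Fin m} (ht : G.tail e' = G.tail e) {l l' f w : ℕ} {x y z : ℝ}
    (h : PairPlan G B δ k b₁ b₂ e e' l x l' y f z w) :
    (1 ≤ l ∧ l ≤ k + 1) ∧ (1 ≤ l' ∧ l' ≤ k + 1) ∧ (f = 0 ∨ ∃ g : Fin m, f = g + 1 ∧ g ≠ e ∧ g ≠ e' ∧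
      G.tail g = G.tail e ∧ 0 ≤ z ∧ z ≤ G.cost g) := by
  rcases h with ⟨rfl, rfl, rfl, -⟩ | ⟨rfl, -, h⟩ | ⟨rfl, -, h⟩ | ⟨rfl, -, h⟩
  · exact ⟨by omega, by omega, Or.inl rfl⟩
  · have h1 := h.1
    have h2 := h.2.1
    exact ⟨by omega, by omega, Or.inl rfl⟩
  · obtain ⟨-, h1, h2, h3⟩ := h
    have := h1.1
    refine ⟨by omega, by omega, h3.imp And.left ?_⟩
    rintro ⟨g, hg, -, -, -, h4, h5, h6, h7, -⟩
    exact ⟨g, hg, h4, h5, h6.trans ht, h7⟩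
  · obtain ⟨-, h1, h2, h3⟩ := h
    have := h1.1
    refine ⟨by omega, by omega, h3.imp And.left ?_⟩
    rintro ⟨g, hg, -, -, -, h4, h5, h6, h7, -⟩
    exact ⟨g, hg, h5, h4, h6, h7⟩

/-- Write the edges according to the plan in registers 10 to 15. -/
def pairWriteCmd : Cmd :=
  (nset 31 (nr 10) ;; nset 40 (nr 13) ;; rset 66 (rr 20)) ;; writeCmd 0 0 ;;
  (nset 31 (nr 11) ;; nset 40 (nr 14) ;; rset 66 (rr 21)) ;; writeCmd 1 1 ;;
  when (.nle (nl 1) (nr 15)) halfCmd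

theorem written_update {B b : ℝ} {C : Chunking m} {e : Fin m} {l : ℕ} {x : ℝ} :
    Written G B δ (Function.update C e (pieces (G.cost e) x (G.reach B δ b b e) l)) b b e l x := by
  refine ⟨fun h => ?_, fun _ => by rw [Function.update_self]⟩
  rw [Function.update_self, h]
  simp [pieces, remain]

theorem TaskGraph.Written.of_eq {B b b' : ℝ} {C C' : Chunking m} {e : Fin m} {l : ℕ} {x : ℝ}
    (h : Written G B δ C b b' e l x) (he : C' e = C e) : Written G B δ C' b b' e l x := by
  rw [Written, he]
  exact h

theorem pairWriteCmd_runs {σ : Mem} (h : Ready G b₁ b₂ k ord δ σ) {C : Chunking m}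
    (hA : Allocated C σ) {e e' : Fin m} (hne : e' ≠ e) (ht : G.tail e' = G.tail e)
    (h10 : σ.nreg 10 = e) (h11 : σ.nreg 11 = e') {l l' f w : ℕ} {x y z : ℝ}
    (h13 : σ.nreg 13 = l) (h14 : σ.nreg 14 = l') (h15 : σ.nreg 15 = f) (h20 : σ.rreg 20 = x)
    (h21 : σ.rreg 21 = y) (h22 : σ.rreg 22 = z)
    (hp : PairPlan G (bound G b₂) δ k b₁ b₂ e e' l x l' y f z w) :
    Runs pairWriteCmd σ (240 * k + 700) fun τ => ∃ C₂, Allocated C₂ τ ∧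
      (∀ g : Fin m, g ≠ e → g ≠ e' → f ≠ g + 1 → C₂ g = C g) ∧
      Written G (bound G b₂) δ C₂ b₁ b₁ e l x ∧ Written G (bound G b₂) δ C₂ b₂ b₂ e' l' y ∧
      ∀ g : Fin m, f = g + 1 → Halved G C₂ g z := by
  obtain ⟨⟨hl, hlk⟩, ⟨hl', hlk'⟩, hf⟩ := hp.facts ht
  refine Runs.le (s := 8 + ((120 * l + 120) + (8 + ((120 * l' + 120) + 64)))) ?_ (by omega)
  refine Runs.seq' (R := fun τ => τ.nreg 31 = e ∧ τ.nreg 40 = l ∧ τ.rreg 66 = x)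
    (.flat rfl (by decide) fun _ => by simp [h10, h13, h20]) fun τ hτ h1 => ?_
  refine Runs.seq' (writeCmd_runs (a := 0) (a' := 0) (by omega) (by omega) (h.keep hτ rfl)
    (hA.keep hτ rfl) h1.1 h1.2.1 hl h1.2.2) fun ρ hρ A1 => ?_
  simp only [bias_zero] at A1
  set C₁ := Function.update C e (pieces (G.cost e) x (G.reach (bound G b₂) δ b₁ b₁ e) l) with hC₁
  have W1 : Written G (bound G b₂) δ C₁ b₁ b₁ e l x := written_update
  refine Runs.seq' (R := fun τ => τ.nreg 31 = e' ∧ τ.nreg 40 = l' ∧ τ.rreg 66 = y)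
    (.flat rfl (by decide) fun _ => by
      simp [hρ.n 11 rfl, hτ.n 11 rfl, h11, hρ.n 14 rfl, hτ.n 14 rfl, h14, hρ.r 21 rfl, hτ.r 21 rfl, h21])
    fun ν hν h2 => ?_
  have r3 := ((h.keep hτ rfl).keep hρ rfl).keep hν rfl
  refine Runs.seq' (writeCmd_runs (a := 1) (a' := 1) (by omega) (by omega) r3
    (A1.keep hν rfl) h2.1 h2.2.1 hl' h2.2.2) fun ξ hξ A2 => ?_
  simp only [bias_one] at A2
  set C₂ := Function.update C₁ e' (pieces (G.cost e') y (G.reach (bound G b₂) δ b₂ b₂ e') l') with hC₂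
  have W2 : Written G (bound G b₂) δ C₂ b₂ b₂ e' l' y := written_update
  have W1' : Written G (bound G b₂) δ C₂ b₁ b₁ e l x := W1.of_eq (Function.update_of_ne hne.symm _ _)
  have g15 : ξ.nreg 15 = f := by rw [hξ.n 15 rfl, hν.n 15 rfl, hρ.n 15 rfl, hτ.n 15 rfl, h15]
  have g22 : ξ.rreg 22 = z := by rw [hξ.r 22 rfl, hν.r 22 rfl, hρ.r 22 rfl, hτ.r 22 rfl, h22]
  have hC : ∀ g : Fin m, g ≠ e → g ≠ e' → C₂ g = C g := fun g h1 h2 => by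
    rw [hC₂, Function.update_of_ne h2, hC₁, Function.update_of_ne h1]
  refine Runs.le (Runs.when (t := 60) (fun hc => ?_) fun hc => ?_) (by decide)
  all_goals simp only [BExp.eval_nle, NExp.eval_lit, NExp.eval_reg, g15] at hc
  · obtain ⟨g, hg, h3, h4, -, h5, h6⟩ := hf.resolve_left (by omega)
    refine (halfCmd_runs (r3.keep hξ rfl).inp A2 (g15.trans hg)).imp fun μ _ A3 => ?_
    rw [g22] at A3
    refine ⟨_, A3, fun g' h7 h8 h9 => ?_, W1'.of_eq (Function.update_of_ne h3.symm _ _),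
      W2.of_eq (Function.update_of_ne h4.symm _ _), fun g' hg' => ?_⟩
    · rw [Function.update_of_ne, hC g' h7 h8]
      rintro rfl
      exact h9 hg
    · obtain rfl : g' = g := Fin.ext (by omega)
      -- Any monotone bound that never takes effect would do; with the constant `cost g'` the pieces
      -- are `z` and the rest.
      refine ⟨fun _ => G.cost g', fun _ _ _ => le_rfl, le_rfl, ?_⟩
      rw [Function.update_self]
      simp [pieces, remain, List.range_succ, h5]
  · exact ⟨C₂, A2.keep (Exec.nset 999 (nl 0) _).keep rfl, fun g h1 h2 _ => hC g h1 h2, W1', W2,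
      fun g hg => by omega⟩

/-- The state while the table is being followed. -/
structure Following (G : TaskGraph n m) (b₁ b₂ : ℝ) (k : ℕ) (ord : Fin n → ℕ) (δ : Fin n → ℝ)
    (σ₀ : Mem) (u v : Fin n) (j : ℕ) (C : Chunking m) (σ : Mem) : Prop where
  prep : Prepared G b₁ b₂ k ord δ σ
  table : SameTable σ₀ σ
  alloc : Allocated C σ
  fst : σ.nreg 30 = ord u
  snd : σ.nreg 32 = ord v
  left : σ.nreg 28 = j
  trace : Trace G b₁ b₂ k ord (tF m k σ₀) (tV m k σ₀) u v j C

def followLeft : Cmd :=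
  nset 31 (.sub (nr 25) (nl 1)) ;; soloWriteCmd 0 0 0 ;; nset 30 (na 6 (na 1 (nr 31))) ;;
  nset 28 (.sub (nr 28) (nr 24))

def followRight : Cmd :=
  nset 31 (.sub (nr 26) (nl 1)) ;; soloWriteCmd 1 1 1 ;; nset 32 (na 6 (na 1 (nr 31))) ;;
  nset 28 (.sub (nr 28) (nr 24))

/-- The table stores only the edges. The plan for a pair is computed a second time when it is
needed, which happens at most once in each of the `m + 2` passes. -/
def followBoth : Cmd :=
  (nset 10 (.sub (nr 25) (nl 1)) ;; nset 11 (.sub (nr 26) (nl 1))) ;; planCmd ;;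
  ite (.neq (nr 10) (nr 11)) (nset 31 (nr 10) ;; soloWriteCmd 0 1 2)
    (nset 24 (.sub (nr 12) (nl 1)) ;; pairWriteCmd) ;;
  nset 30 (na 6 (na 1 (nr 10))) ;; nset 32 (na 6 (na 1 (nr 11))) ;; nset 28 (.sub (nr 28) (nr 24))

section

variable (D : Layout G b₂ (bound G b₂) ord δ) (hb : 1 < b₁) (hbb : b₁ < b₂) {σ₀ σ : Mem} {u v : Fin n}
  {j w : ℕ} {C : Chunking m} (h : Following G b₁ b₂ k ord δ σ₀ u v j C σ) (hw : w ≤ j)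
include D hb hbb h hw

theorem followLeft_runs {e : Fin m} (hu : G.tail e = u) (hlt : ord v < ord u)
    (h25 : σ.nreg 25 = e + 1) (hF : tF m k σ₀ (ord (G.head e)) (ord v) (j - w))
    (hal : Alive G (bound G b₂) δ u)
    (hV : tV m k σ₀ (ord u) (ord v) j = G.cost e + tV m k σ₀ (ord (G.head e)) (ord v) (j - w))
    (hl : IsLeast (G.soloSet (bound G b₂) δ k b₁ b₁ e) w) :
    Runs followLeft σ (120 * k + 330) fun τ => ∃ C₂, Following G b₁ b₂ k ord δ σ₀ (G.head e) v (j - w) C₂ τ := by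
  refine Runs.le (s := 4 + ((120 * k + 300) + 10)) ?_ (by omega)
  refine Runs.seq' (R := fun τ => τ.nreg 31 = e) (.flat rfl (by decide) fun _ => by simp [h25])
    fun τ hτ h31 => ?_
  have p1 := h.prep.keep hτ rfl
  refine Runs.seq' (soloWriteCmd_runs (a := 0) (a' := 0) (s := 0) (by omega) (by omega) (by omega)
    p1.solved.ready (h.alloc.keep hτ rfl) h31 (p1.solved.fst e) hl) fun ρ hρ h2 => ?_
  obtain ⟨h24, l, C₂, hp, A, hC, hW⟩ := h2
  have p2 := p1.keep hρ rfl
  have g31 : ρ.nreg 31 = e := by rw [hρ.n 31 rfl, h31]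
  refine .flat rfl (by decide) fun hK => ⟨C₂, p2.keep hK rfl,
    ((h.table.trans (hτ.sameTable rfl)).trans (hρ.sameTable rfl)).trans (hK.sameTable rfl),
    A.keep hK rfl, ?_, ?_, ?_, h.trace.left D hb hbb hw hu hlt hF hal hV hp hC hW⟩
  · simp [g31, p2.solved.ready.inp.head, p2.solved.ready.dist.ord]
  · rw [hK.n 32 rfl, hρ.n 32 rfl, hτ.n 32 rfl, h.snd]
  · simp [h24, hρ.n 28 rfl, hτ.n 28 rfl, h.left]

theorem followRight_runs {e : Fin m} (hv : G.tail e = v) (hlt : ord u < ord v)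
    (h26 : σ.nreg 26 = e + 1) (hF : tF m k σ₀ (ord u) (ord (G.head e)) (j - w))
    (hal : Alive G (bound G b₂) δ v)
    (hV : tV m k σ₀ (ord u) (ord v) j = G.cost e + tV m k σ₀ (ord u) (ord (G.head e)) (j - w))
    (hl : IsLeast (G.soloSet (bound G b₂) δ k b₂ b₂ e) w) :
    Runs followRight σ (120 * k + 330) fun τ => ∃ C₂, Following G b₁ b₂ k ord δ σ₀ u (G.head e) (j - w) C₂ τ := by
  refine Runs.le (s := 4 + ((120 * k + 300) + 10)) ?_ (by omega)
  refine Runs.seq' (R := fun τ => τ.nreg 31 = e) (.flat rfl (by decide) fun _ => by simp [h26])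
    fun τ hτ h31 => ?_
  have p1 := h.prep.keep hτ rfl
  refine Runs.seq' (soloWriteCmd_runs (a := 1) (a' := 1) (s := 1) (by omega) (by omega) (by omega)
    p1.solved.ready (h.alloc.keep hτ rfl) h31 (p1.solved.snd e) hl) fun ρ hρ h2 => ?_
  obtain ⟨h24, l, C₂, hp, A, hC, hW⟩ := h2
  have p2 := p1.keep hρ rfl
  have g31 : ρ.nreg 31 = e := by rw [hρ.n 31 rfl, h31]
  refine .flat rfl (by decide) fun hK => ⟨C₂, p2.keep hK rfl,
    ((h.table.trans (hτ.sameTable rfl)).trans (hρ.sameTable rfl)).trans (hK.sameTable rfl),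
    A.keep hK rfl, ?_, ?_, ?_, h.trace.right D hb hbb hw hv hlt hF hal hV hp hC hW⟩
  · rw [hK.n 30 rfl, hρ.n 30 rfl, hτ.n 30 rfl, h.fst]
  · simp [g31, p2.solved.ready.inp.head, p2.solved.ready.dist.ord]
  · simp [h24, hρ.n 28 rfl, hτ.n 28 rfl, h.left]

theorem followBoth_runs {e e' : Fin m} (hu : G.tail e = u) (hv : v = u) (ht : G.tail e' = G.tail e)
    (h25 : σ.nreg 25 = e + 1) (h26 : σ.nreg 26 = e' + 1)
    (hF : tF m k σ₀ (ord (G.head e)) (ord (G.head e')) (j - w)) (hal : Alive G (bound G b₂) δ u)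
    (hV : tV m k σ₀ (ord u) (ord v) j =
      G.cost e + G.cost e' + tV m k σ₀ (ord (G.head e)) (ord (G.head e')) (j - w))
    (hl : IsLeast (G.pairSet (bound G b₂) δ k b₁ b₂ e e') w) :
    Runs followBoth σ (2000 * k * k + 240 * k + 1700) fun τ =>
      ∃ C₂, Following G b₁ b₂ k ord δ σ₀ (G.head e) (G.head e') (j - w) C₂ τ := by
  refine Runs.le (s := 8 + ((2000 * k * k + 910) + ((240 * k + 720) + 15))) ?_ (by omega)
  refine Runs.seq' (R := fun τ => τ.nreg 10 = e ∧ τ.nreg 11 = e')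
    (.flat rfl (by decide) fun _ => by simp [h25, h26]) fun τ hτ h1 => ?_
  have p1 := h.prep.keep hτ rfl
  refine Runs.seq' (planCmd_runs hb hbb ht (p1.atPair h1.1 h1.2)) fun ρ hρ h2 => ?_
  obtain ⟨hpl, hcode⟩ := h2
  have p2 := p1.keep hρ rfl
  have A2 := (h.alloc.keep hτ rfl).keep hρ rfl
  have g10 : ρ.nreg 10 = e := by rw [hρ.n 10 rfl, h1.1]
  have g11 : ρ.nreg 11 = e' := by rw [hρ.n 11 rfl, h1.2]
  have g12 := (hcode w).2 hl
  refine Runs.seq' (R := fun ν => ν.nreg 24 = w ∧ ∃ C₂, Allocated C₂ ν ∧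
      Trace G b₁ b₂ k ord (tF m k σ₀) (tV m k σ₀) (G.head e) (G.head e') (j - w) C₂) ?_
    fun ν hν h3 => ?_
  · refine Runs.le (Runs.ite (s := 240 * k + 702) (t := 240 * k + 704) (fun hc => ?_) fun hc => ?_)
      (by simp only [BExp.neq, BExp.size, NExp.size]; omega)
    all_goals simp only [BExp.eval_neq, NExp.eval_reg, g10, g11, Fin.val_inj] at hc
    · subst hc
      have hl' : IsLeast (G.soloSet (bound G b₂) δ k b₁ b₂ e) w := by
        have h1 : G.pairSet (bound G b₂) δ k b₁ b₂ e e = G.soloSet (bound G b₂) δ k b₁ b₂ e := by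
          ext w; simp [pairSet, soloSet]
        rwa [h1] at hl
      refine Runs.le (s := 2 + (120 * k + 300)) ?_ (by omega)
      refine Runs.seq' (R := fun ν => ν.nreg 31 = e) (.flat rfl (by decide) fun _ => by simp [g10])
        fun ν hν h31 => ?_
      have p3 := p2.keep hν rfl
      refine (soloWriteCmd_runs (a := 0) (a' := 1) (s := 2) (by omega) (by omega) (by omega)
        p3.solved.ready (A2.keep hν rfl) h31 (p3.solved.two e) hl').imp fun ξ hξ h4 => ?_
      obtain ⟨h24, l, C₂, hp, A, hC, hW⟩ := h4
      refine ⟨h24, C₂, A, h.trace.same D hb hbb hw hu hv hF hal hV hp hC hW⟩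
    · have hne : e' ≠ e := fun h => hc h.symm
      have hp := hpl hne (by omega)
      rw [g12, Nat.add_sub_cancel] at hp
      refine Runs.le (s := 4 + (240 * k + 700)) ?_ (by omega)
      refine Runs.seq' (R := fun ν => ν.nreg 24 = w) (.flat rfl (by decide) fun _ => by simp [g12])
        fun ν hν h24 => ?_
      have p3 := p2.keep hν rfl
      refine (pairWriteCmd_runs p3.solved.ready (A2.keep hν rfl) hne ht (by rw [hν.n 10 rfl, g10])
        (by rw [hν.n 11 rfl, g11]) (hν.n 13 rfl) (hν.n 14 rfl) (hν.n 15 rfl) (hν.r 20 rfl)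
        (hν.r 21 rfl) (hν.r 22 rfl) hp).imp fun ξ hξ h4 => ?_
      obtain ⟨C₂, A, hC, hW, hW', hH⟩ := h4
      refine ⟨by rw [hξ.n 24 rfl, h24], C₂, A, h.trace.both D hb hbb hw hu hv hne ht hF hal hV hp hC
        (fun g hg => ?_) hW hW' hH⟩
      rcases (hp.facts ht).2.2 with h5 | ⟨g', h5, -, -, h6, -⟩
      · omega
      · obtain rfl : g' = g := Fin.ext (by omega)
        exact h6
  · obtain ⟨h24, C₂, A, T⟩ := h3
    have p3 := p2.keep hν rfl
    have f10 : ν.nreg 10 = e := by rw [hν.n 10 rfl, g10]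
    have f11 : ν.nreg 11 = e' := by rw [hν.n 11 rfl, g11]
    refine .flat rfl (by decide) fun hK => ⟨C₂, p3.keep hK rfl,
      (((h.table.trans (hτ.sameTable rfl)).trans (hρ.sameTable rfl)).trans (hν.sameTable rfl)).trans
        (hK.sameTable rfl), A.keep hK rfl, ?_, ?_, ?_, T⟩
    · simp [f10, p3.solved.ready.inp.head, p3.solved.ready.dist.ord]
    · simp [f11, p3.solved.ready.inp.head, p3.solved.ready.dist.ord]
    · simp [h24, hν.n 28 rfl, hρ.n 28 rfl, hτ.n 28 rfl, h.left]

end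

/-- Follow the table for one step. -/
def followCmd : Cmd :=
  (nset 22 (.add (.add (na 15 (nr 30)) (na 14 (nr 32))) (nr 28)) ;; nset 25 (na 16 (nr 22)) ;;
    nset 26 (na 17 (nr 22))) ;;
  ite (.nle (nl 1) (nr 25)) (ite (.nle (nl 1) (nr 26)) followBoth followLeft)
    (when (.nle (nl 1) (nr 26)) followRight)

theorem followCmd_runs (D : Layout G b₂ (bound G b₂) ord δ) (hord : ∀ v, ord v ≤ m + 1) (hb : 1 < b₁)
    (hbb : b₁ < b₂) {σ₀ σ : Mem} {u v : Fin n} {j : ℕ} {C : Chunking m} {s : ℕ}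
    (hS : Sound G b₁ b₂ k ord δ s σ₀) (h : Following G b₁ b₂ k ord δ σ₀ u v j C σ) :
    Runs followCmd σ (2000 * k * k + 240 * k + 1760) fun τ =>
      (u = G.sink ∧ v = G.sink ∧ tV m k σ₀ (ord u) (ord v) j = 0 ∧
        Following G b₁ b₂ k ord δ σ₀ u v j C τ) ∨
      ∃ u' v' j' C', max (ord u') (ord v') < max (ord u) (ord v) ∧
        Following G b₁ b₂ k ord δ σ₀ u' v' j' C' τ := by
  have ou : ord u < m + 2 := Nat.lt_succ_of_le (hord u)
  have ov : ord v < m + 2 := Nat.lt_succ_of_le (hord v)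
  have hj : j < k + 1 := by
    have := h.trace.used
    omega
  refine Runs.le (s := 30 + (2000 * k * k + 240 * k + 1720)) ?_ (by omega)
  refine Runs.seq' (R := fun τ => τ.nreg 25 = tP m k σ₀ (ord u) (ord v) j ∧
    τ.nreg 26 = tQ m k σ₀ (ord u) (ord v) j) (.flat rfl (by decide) fun _ => ?_) fun τ hτ h1 => ?_
  · simp [h.fst, h.snd, h.left, h.prep.row _ ou, h.prep.col _ ov, h.table.p, h.table.q, tP, tQ, idx]
  have h2 : Following G b₁ b₂ k ord δ σ₀ u v j C τ := ⟨h.prep.keep hτ rfl,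
    h.table.trans (hτ.sameTable rfl), h.alloc.keep hτ rfl, by rw [hτ.n 30 rfl, h.fst],
    by rw [hτ.n 32 rfl, h.snd], by rw [hτ.n 28 rfl, h.left], h.trace⟩
  obtain ⟨h25, h26⟩ := h1
  refine Runs.le (Runs.ite (s := 2000 * k * k + 240 * k + 1710) (t := 120 * k + 340) (fun hc => ?_)
    fun hc => ?_) (by simp only [BExp.size, NExp.size]; omega)
  all_goals simp only [BExp.eval_nle, NExp.eval_lit, NExp.eval_reg, h25] at hc
  · refine Runs.le (Runs.ite (s := 2000 * k * k + 240 * k + 1700) (t := 120 * k + 330) (fun hd => ?_)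
      fun hd => ?_) (by simp only [BExp.size, NExp.size]; omega)
    all_goals simp only [BExp.eval_nle, NExp.eval_lit, NExp.eval_reg, h26] at hd
    all_goals
      obtain ⟨-, -, -, h3, -⟩ | ⟨-, e, a', b', w, c, hR, hw, hF, hV⟩ := hS _ _ _ ou ov hj h.trace.mem
      · omega
      have hlev := hR.level D
      obtain ⟨hu, hlt, rfl, rfl, rfl, hp, hq, hl⟩ | ⟨-, -, -, -, -, hp, -⟩ |
        ⟨e', ht, hu, hv, rfl, rfl, rfl, hp, hq, hl⟩ := hR.elim
    any_goals omega
    · have hu' := (D.inj _ _ hu.symm (Or.inr ⟨e, rfl⟩))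
      have hv' : v = u := (D.inj _ _ (hu.trans hv.symm) (Or.inr ⟨e, hu'⟩)).symm
      have hal := hS.alive D (by omega) (by omega) (by omega) hF (Or.inl rfl)
      exact (followBoth_runs D hb hbb h2 hw hu' hv' ht (h25.trans hp) (h26.trans hq) hF (hu' ▸ hal) hV
        hl).imp fun ρ _ ⟨C₂, h⟩ => Or.inr ⟨_, _, _, C₂, hlev.2, h⟩
    · have hu' := (D.inj _ _ hu.symm (Or.inr ⟨e, rfl⟩))
      have hal := hS.alive D (by omega) (by omega) (by omega) hF (Or.inl rfl)
      exact (followLeft_runs D hb hbb h2 hw hu' (by omega) (h25.trans hp) hF (hu' ▸ hal) hV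
        hl).imp fun ρ _ ⟨C₂, h⟩ => Or.inr ⟨_, _, _, C₂, hlev.2, h⟩
  · refine Runs.le (Runs.when (t := 120 * k + 330) (fun hd => ?_) fun hd => ?_)
      (by simp only [BExp.size, NExp.size]; omega)
    all_goals simp only [BExp.eval_nle, NExp.eval_lit, NExp.eval_reg, h26] at hd
    all_goals
      obtain ⟨hu, hv, hV, h3, h4⟩ | ⟨-, e, a', b', w, c, hR, hw, hF, hV⟩ :=
        hS _ _ _ ou ov hj h.trace.mem
    · omega
    · have hlev := hR.level D
      obtain ⟨-, -, -, -, -, hp, -⟩ | ⟨hv, hlt, rfl, rfl, rfl, hp, hq, hl⟩ |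
        ⟨-, -, -, -, -, -, -, hp, -⟩ := hR.elim
      any_goals omega
      have hv' := (D.inj _ _ hv.symm (Or.inr ⟨e, rfl⟩))
      have hal := hS.alive D (by omega) (by omega) (by omega) hF (Or.inr rfl)
      exact (followRight_runs D hb hbb h2 hw hv' (by omega) (h26.trans hq) hF (hv' ▸ hal) hV
        hl).imp fun ρ _ ⟨C₂, h⟩ => Or.inr ⟨_, _, _, C₂, hlev.2, h⟩
    · refine Or.inl ⟨(D.inj _ _ hu.symm (Or.inl rfl)).symm, (D.inj _ _ hv.symm (Or.inl rfl)).symm, hV, ?_⟩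
      have hK : Keep (nset 999 (nl 0)) τ (τ.setN 999 0) := (Exec.nset 999 (nl 0) τ).keep
      exact ⟨h2.prep.keep hK rfl, h2.table.trans ⟨rfl, rfl, rfl, rfl⟩, h2.alloc.keep hK rfl, h2.fst,
        h2.snd, h2.left, h2.trace⟩
    · obtain ⟨-, -, -, -, -, hp, -⟩ | ⟨-, -, -, -, -, -, hq, -⟩ |
        ⟨-, -, -, -, -, -, -, hp, -⟩ := hR.elim
      all_goals omega

/-- Follow the table from the source, and write the chunking. -/
def traceCmd : Cmd :=
  plainCmd ;; (nset 30 (na 6 (nr 2)) ;; nset 32 (na 6 (nr 2)) ;; nset 28 (nr 4)) ;;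
  upTo 29 (.add (nr 1) (nl 2)) followCmd

theorem traceCmd_runs (D : Layout G b₂ (bound G b₂) ord δ) (hord : ∀ v, ord v ≤ m + 1) (hb : 1 < b₁)
    (hbb : b₁ < b₂) {σ : Mem} (hp : Prepared G b₁ b₂ k ord δ σ) {s : ℕ}
    (hF : Filled G b₁ b₂ k ord δ s (fun _ => True) σ) :
    Runs traceCmd σ ((m + 2) * (2000 * k * k + 240 * k + 1900)) fun τ =>
      G.IsOptimal (output m τ) b₁ b₂ k := by
  have hb' := hb.trans hbb
  have hT := hF.complete
  refine Runs.le (s := (m * 30 + 20) + (12 + ((m + 2) * (2000 * k * k + 240 * k + 1780) + 11))) ?_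
    (by nlinarith)
  refine Runs.seq' (plainCmd_runs hp.solved.ready.inp) fun τ hτ hA => ?_
  have p1 := hp.keep hτ rfl
  refine Runs.seq' (R := fun τ => Following G b₁ b₂ k ord δ σ G.source G.source k
    (fun e => [G.cost e]) τ) (.flat rfl (by decide) fun hK => ?_) fun ρ hρ h1 => ?_
  · refine ⟨p1.keep hK rfl, (hτ.sameTable rfl).trans (hK.sameTable rfl), hA.keep hK rfl, ?_, ?_, ?_,
      Trace.start (D.source_mem hb hbb.le hb' le_rfl hT)⟩
    · simp [p1.solved.ready.inp.source, p1.solved.ready.dist.ord]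
    · simp [p1.solved.ready.inp.source, p1.solved.ready.dist.ord]
    · simp [p1.solved.ready.inp.regK]
  have hset : ∀ {u v : Fin n} {j : ℕ} {C : Chunking m} {ν : Mem} (i : ℕ),
      Following G b₁ b₂ k ord δ σ u v j C ν → Following G b₁ b₂ k ord δ σ u v j C (ν.setN 29 i) := by
    intro u v j C ν i h
    have hK : Keep (nset 29 (nl i)) ν (ν.setN 29 i) := (Exec.nset 29 (nl i) ν).keep
    exact ⟨h.prep.keep hK rfl, h.table.trans ⟨rfl, rfl, rfl, rfl⟩, h.alloc.keep hK rfl, h.fst,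
      h.snd, h.left, h.trace⟩
  -- Each pass lowers the level, which is at most `m + 1` initially, until both agents are at the
  -- sink; so `m + 2` passes are enough, and further ones do nothing.
  refine Runs.upTo' (fun i μ => ∃ u v j C, Following G b₁ b₂ k ord δ σ u v j C μ ∧
    ((u = G.sink ∧ v = G.sink ∧ tV m k σ (ord u) (ord v) j = 0) ∨ max (ord u) (ord v) + i ≤ m + 1))
    (N := m + 2) (t := 2000 * k * k + 240 * k + 1760) rfl
    (fun μ hμ => by simp [(h1.prep.keep hμ rfl).solved.ready.inp.regM])
    ⟨_, _, _, _, hset 0 h1, Or.inr ?_⟩ (fun i hi μ hμ hμi hJ => ?_) (by simp only [NExp.size]; nlinarith)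
    fun μ hμ hJ => ?_
  · have := hord G.source
    omega
  · obtain ⟨u, v, j, C, h2, h3⟩ := hJ
    refine (followCmd_runs D hord hb hbb hF.sound h2).imp fun ν _ h4 => ?_
    rcases h4 with ⟨h5, h6, h7, h8⟩ | ⟨u', v', j', C', h5, h6⟩
    · exact ⟨u, v, j, C, hset _ h8, Or.inl ⟨h5, h6, h7⟩⟩
    · refine ⟨u', v', j', C', hset _ h6, Or.inr ?_⟩
      -- Once at the sink there is no further step: by `Sound.exists_path` no entry has a lower
      -- level.
      rcases h3 with ⟨rfl, rfl, -⟩ | h3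
      · obtain ⟨u'', P, hu'', hP⟩ := (hF.sound.exists_path D (Nat.lt_succ_of_le (hord _))
          (Nat.lt_succ_of_le (hord _)) (by have := h6.trace.used; omega) h6.trace.mem).1
        have := (D.ord_sink_le hP).1
        omega
      · omega
  · obtain ⟨u, v, j, C, h2, ⟨rfl, rfl, hV⟩ | h3⟩ := hJ
    · rw [h2.alloc.out]
      exact D.optimal_of_trace hb hbb.le hb' le_rfl hT h2.trace hV
    · omega

end PresentBias

namespace PresentBias

open TaskGraph Cmd

variable {n m : ℕ} {G : TaskGraph n m} {b₁ b₂ : ℝ} {k : ℕ} {ord : Fin n → ℕ} {δ : Fin n → ℝ}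

/-! ### The whole program -/

theorem hasInput_input (G : TaskGraph n m) (b₁ b₂ : ℝ) (k : ℕ) : HasInput G b₁ b₂ k (input G b₁ b₂ k) := by
  constructor <;> simp [input]

/-- Everything that does not depend on the table. -/
def prepareCmd : Cmd :=
  (boundCmd ;; orderCmd) ;; (altRow 0 ;; altRow 1 ;; altRow 2) ;;
  (soloRow 0 0 0 ;; soloRow 1 1 1 ;; soloRow 0 1 2) ;; oneRow 0 1 ;; oneRow 1 0

theorem prepareCmd_runs (hb : 1 < b₁) (hbb : b₁ < b₂) {σ : Mem} (h : HasInput G b₁ b₂ k σ)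
    (h4 : ∀ i, σ.narr 4 i = 0) (h5 : ∀ i, σ.narr 5 i = 0) (h6 : ∀ i, σ.narr 6 i = 0) :
    Runs prepareCmd σ ((100 * (m + 1) + 100 * (m * m + n + 2 * m + 1)) + (3 * (m * (80 * m + 120) + 9) +
      (3 * (m * (100 * k + 300) + 9) + 2 * (m * (300 * m + 400) + 9)))) fun τ =>
      ∃ ord δ, Layout G b₂ (bound G b₂) ord δ ∧ (∀ v, ord v ≤ m + 1) ∧ Solved G b₁ b₂ k ord δ τ ∧
        (∀ e, OneAt G b₁ b₂ k δ 0 1 e τ) ∧ ∀ e, OneAt G b₁ b₂ k δ 1 0 e τ := by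
  refine Runs.seq' (R := fun τ => HasInput G b₁ b₂ k τ ∧ ∃ ord δ, Layout G b₂ (bound G b₂) ord δ ∧
    (∀ v, ord v ≤ m + 1) ∧ HasDist G b₂ ord δ τ) ?_ fun τ hτ h1 => ?_
  · refine Runs.seq' (boundCmd_runs h) fun τ hτ h3 => ?_
    have i1 := h.keep hτ rfl
    refine (orderCmd_runs i1 hb hbb h3 (by rw [hτ.na 4 rfl]; exact h4) (by rw [hτ.na 5 rfl]; exact h5)
      (by rw [hτ.na 6 rfl]; exact h6)).imp fun ρ hρ h7 => ⟨i1.keep hρ rfl, ?_⟩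
    obtain ⟨ord, δ, D, ho, g6, g2⟩ := h7
    exact ⟨ord, δ, D, ho, by rw [hρ.r 3 rfl, h3], g6, g2⟩
  obtain ⟨i1, ord, δ, D, ho, d1⟩ := h1
  refine Runs.seq' (R := Ready G b₁ b₂ k ord δ) ?_ fun τ₁ hτ₁ r1 => ?_
  · refine Runs.le (s := (m * (80 * m + 120) + 9) + ((m * (80 * m + 120) + 9) + (m * (80 * m + 120) + 9)))
      ?_ (by omega)
    refine Runs.seq' (altRow_runs (a := 0) (by omega) i1 d1) fun ρ hρ a0 => ?_
    refine Runs.seq' (altRow_runs (a := 1) (by omega) (i1.keep hρ rfl) (d1.keep hρ rfl))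
      fun ν hν a1 => ?_
    refine (altRow_runs (a := 2) (by omega) ((i1.keep hρ rfl).keep hν rfl)
      ((d1.keep hρ rfl).keep hν rfl)).imp fun ξ hξ a2 => ⟨((i1.keep hρ rfl).keep hν rfl).keep hξ rfl,
        ((d1.keep hρ rfl).keep hν rfl).keep hξ rfl, fun a ha => ?_⟩
    interval_cases a
    · exact (a0.keep hν rfl rfl rfl).keep hξ rfl rfl rfl
    · exact a1.keep hξ rfl rfl rfl
    · exact a2
  refine Runs.seq' (R := Solved G b₁ b₂ k ord δ) ?_ fun τ₂ hτ₂ s1 => ?_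
  · refine Runs.le (s := (m * (100 * k + 300) + 9) + ((m * (100 * k + 300) + 9) + (m * (100 * k + 300) + 9)))
      ?_ (by omega)
    refine Runs.seq' (soloRow_runs (a := 0) (a' := 0) (s := 0) (by omega) (by omega) (by omega) r1)
      fun ρ hρ s0 => ?_
    have r2 := r1.keep hρ rfl
    refine Runs.seq' (soloRow_runs (a := 1) (a' := 1) (s := 1) (by omega) (by omega) (by omega) r2)
      fun ν hν s1 => ?_
    have r3 := r2.keep hν rfl
    refine (soloRow_runs (a := 0) (a' := 1) (s := 2) (by omega) (by omega) (by omega) r3).imp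
      fun ξ hξ s2 => ⟨r3.keep hξ rfl, fun e => ((s0 e).congr ?_ ?_ ?_ : SoloAt G b₁ b₂ k δ 0 0 0 e ν).congr
        ?_ ?_ ?_, fun e => (s1 e).congr ?_ ?_ ?_, s2⟩
    · rw [hν.na 26 rfl]
    · rw [hν.na 29 rfl]
    · rw [hν.ra 13 rfl]
    · rw [hξ.na 26 rfl]
    · rw [hξ.na 29 rfl]
    · rw [hξ.ra 13 rfl]
    · rw [hξ.na 27 rfl]
    · rw [hξ.na 30 rfl]
    · rw [hξ.ra 14 rfl]
  refine Runs.le (s := (m * (300 * m + 400) + 9) + (m * (300 * m + 400) + 9)) ?_ (by omega)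
  refine Runs.seq' (oneRow_runs (a := 0) (a' := 1) (by omega) (by omega) hb s1) fun ρ hρ o0 => ?_
  refine (oneRow_runs (a := 1) (a' := 0) (by omega) (by omega) (hb.trans hbb) (s1.keep hρ rfl)).imp
    fun ν hν o1 => ⟨ord, δ, D, ho, (s1.keep hρ rfl).keep hν rfl, fun e => (o0 e).congr ?_ ?_ ?_ ?_, o1⟩
  · rw [hν.na 27 rfl]
  · rw [hν.na 32 rfl]
  · rw [hν.na 34 rfl]
  · rw [hν.ra 16 rfl]

/-- Find an optimal chunking of a task graph that has an edge. -/
def solveCmd : Cmd := prepareCmd ;; tableCmd ;; dpCmd ;; traceCmd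

theorem solveCmd_runs (hb : 1 < b₁) (hbb : b₁ < b₂) :
    Runs solveCmd (input G b₁ b₂ k) (((100 * (m + 1) + 100 * (m * m + n + 2 * m + 1)) +
      (3 * (m * (80 * m + 120) + 9) + (3 * (m * (100 * k + 300) + 9) + 2 * (m * (300 * m + 400) + 9)))) +
      (100 * (m + k + 3) + ((m * ((m + 1) * (2000 * k * k + 400 * k + 2600)) + (m + 2) * (m * 30 + 30) + 20)
        + (m + 2) * (2000 * k * k + 240 * k + 1900))))
      fun τ => G.IsOptimal (output m τ) b₁ b₂ k := by
  have hz : ∀ a, 2 ≤ a → ∀ i, (input G b₁ b₂ k).narr a i = 0 := by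
    intro a ha i
    simp [input, show a ≠ 0 by omega, show a ≠ 1 by omega]
  have i0 := hasInput_input G b₁ b₂ k
  refine Runs.seq' (prepareCmd_runs hb hbb i0 (hz 4 (by omega)) (hz 5 (by omega)) (hz 6 (by omega)))
    fun τ hτ h1 => ?_
  obtain ⟨ord, δ, D, ho, s1, o0, o1⟩ := h1
  refine Runs.seq' (tableCmd_runs ho s1.ready.inp s1.ready.dist ?_ ?_ ?_ ?_ ?_ ?_) fun ρ hρ h2 => ?_
  · rw [hτ.na 14 rfl]; exact hz 14 (by omega) 0
  · rw [hτ.na 15 rfl]; exact hz 15 (by omega) 0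
  · rw [hτ.na 16 rfl]; exact hz 16 (by omega)
  · rw [hτ.na 17 rfl]; exact hz 17 (by omega)
  · rw [hτ.na 18 rfl]; exact hz 18 (by omega)
  · rw [hτ.ra 7 rfl]; simp [input]
  obtain ⟨hcol, hrow, hF⟩ := h2
  have p1 : Prepared G b₁ b₂ k ord δ ρ := by
    refine ⟨s1.keep hρ rfl, fun e => (o0 e).congr ?_ ?_ ?_ ?_, fun e => (o1 e).congr ?_ ?_ ?_ ?_, hcol,
      hrow⟩
    · rw [hρ.na 27 rfl]
    · rw [hρ.na 32 rfl]
    · rw [hρ.na 34 rfl]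
    · rw [hρ.ra 16 rfl]
    · rw [hρ.na 26 rfl]
    · rw [hρ.na 33 rfl]
    · rw [hρ.na 35 rfl]
    · rw [hρ.ra 17 rfl]
  refine Runs.seq' (dpCmd_runs D ho hb hbb p1 hF) fun ν hν h3 => ?_
  exact traceCmd_runs D ho hb hbb (p1.keep hν rfl) h3

/-- Without edges the source is the sink, both paths are empty, and there is nothing to divide. -/
theorem isOptimal_of_isEmpty {G : TaskGraph n 0} (C : Chunking 0) : G.IsOptimal C b₁ b₂ k := by
  have hs : G.source = G.sink := by
    rcases G.reachable.cases_head with h | ⟨_, ⟨e, -⟩, -⟩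
    · exact h
    · exact e.elim0
  have hl : ∀ P : List (Fin 0), P = [] := fun P => by
    rcases P with _ | ⟨e, _⟩
    · rfl
    · exact e.elim0
  refine ⟨[], [], ⟨fun e => e.elim0, by simp [chunksUsed], ⟨hs, by simp⟩, ⟨hs, by simp⟩⟩,
    fun C' P' Q' _ => ?_⟩
  rw [hl P', hl Q']

/-- A graph without edges must be treated separately: the claimed bound is then a multiple of `n`
alone, while setting up the table takes time proportional to `k`. -/
def mainCmd : Cmd := ite (.nle (nl 1) (nr 1)) solveCmd skip

/-- Apart from a multiple of `n`, the left side is a polynomial in `m` and `k` of degree at most 2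
in each of them. Each of its monomials is at most `m ^ 2 * k ^ 3`, because `m` and `k` are positive.
-/
theorem time_le {n m k : ℕ} (hm : 1 ≤ m) (hk : 2 ≤ k) :
    ((100 * (m + 1) + 100 * (m * m + n + 2 * m + 1)) +
      (3 * (m * (80 * m + 120) + 9) + (3 * (m * (100 * k + 300) + 9) + 2 * (m * (300 * m + 400) + 9)))) +
      (100 * (m + k + 3) + ((m * ((m + 1) * (2000 * k * k + 400 * k + 2600)) + (m + 2) * (m * 30 + 30) + 20)
        + (m + 2) * (2000 * k * k + 240 * k + 1900))) + 4 ≤ 100000 * (m ^ 2 * k ^ 3 + n) := by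
  have e1 : 1 ≤ m ^ 2 := Nat.one_le_pow _ _ hm
  have e2 : m ≤ m ^ 2 := Nat.le_self_pow (by omega) m
  have k0 : 1 ≤ k ^ 3 := Nat.one_le_pow _ _ (by omega)
  have k1 : k ≤ k ^ 3 := Nat.le_self_pow (by omega) k
  have k2 : k ^ 2 ≤ k ^ 3 := Nat.pow_le_pow_right (by omega) (by omega)
  have h00 := Nat.mul_le_mul e1 k0
  have h01 := Nat.mul_le_mul e1 k1
  have h02 := Nat.mul_le_mul e1 k2
  have h10 := Nat.mul_le_mul e2 k0
  have h11 := Nat.mul_le_mul e2 k1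
  have h12 := Nat.mul_le_mul e2 k2
  have h20 := Nat.mul_le_mul (le_refl (m ^ 2)) k0
  have h21 := Nat.mul_le_mul (le_refl (m ^ 2)) k1
  have h22 := Nat.mul_le_mul (le_refl (m ^ 2)) k2
  linarith

end PresentBias

theorem mainTheorem9 :
    ∃ (prog : PresentBias.Cmd) (A : ℝ),
      ∀ (n m : ℕ) (G : PresentBias.TaskGraph n m) (b₁ b₂ : ℝ) (k : ℕ),
        1 < b₁ → b₁ < b₂ → 2 ≤ k →
        ∃ (σ : PresentBias.Mem) (T : ℕ),
          PresentBias.Exec prog (PresentBias.input G b₁ b₂ k) σ T ∧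
          G.IsOptimal (PresentBias.output m σ) b₁ b₂ k ∧
          (T : ℝ) ≤ A * ((m : ℝ) ^ 2 * (k : ℝ) ^ 3 * Real.log (k : ℝ) + (n : ℝ)) := by
  refine ⟨PresentBias.mainCmd, 200000, fun n m G b₁ b₂ k hb hbb hk => ?_⟩
  -- The logarithm is not needed for the algorithm; it is at least `log 2 > 1 / 2`, which doubles
  -- the constant 100000 of `time_le`.
  have hlog : 1 / 2 ≤ Real.log (k : ℝ) := by
    have h1 : Real.log 2 ≤ Real.log (k : ℝ) := Real.log_le_log (by norm_num) (by exact_mod_cast hk)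
    have h2 := Real.log_two_gt_d9
    linarith
  have hmk : (0 : ℝ) ≤ (m : ℝ) ^ 2 * (k : ℝ) ^ 3 := by positivity
  rcases Nat.eq_zero_or_pos m with rfl | hm
  · refine ⟨_, _, .ite_false ?_ (.nset _ _ _), PresentBias.isOptimal_of_isEmpty _, ?_⟩
    · simp [PresentBias.input]
    · have hn : (1 : ℝ) ≤ n := by exact_mod_cast Nat.one_le_of_lt G.source.2
      simp only [PresentBias.BExp.size, PresentBias.NExp.size]
      push_cast
      nlinarith
  · obtain ⟨σ, T, hE, hT, hO⟩ := PresentBias.solveCmd_runs (G := G) (k := k) hb hbb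
    refine ⟨σ, _, .ite_true ?_ hE, hO, ?_⟩
    · simp only [PresentBias.BExp.eval_nle, PresentBias.NExp.eval_lit, PresentBias.NExp.eval_reg]
      exact hm
    · have h1 := (Nat.add_le_add_right hT 4).trans (PresentBias.time_le (n := n) hm hk)
      have h2 : ((T + 4 : ℕ) : ℝ) ≤ 100000 * ((m : ℝ) ^ 2 * (k : ℝ) ^ 3 + n) := by exact_mod_cast h1
      have hn : (0 : ℝ) ≤ n := n.cast_nonneg
      simp only [PresentBias.BExp.size, PresentBias.NExp.size]
      push_cast at h2 ⊢
      nlinarith [mul_le_mul_of_nonneg_left hlog hmk]
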